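/- Let $0<\beta<\gamma<1$ be fixed, and let $d_C,d_B,w$ be functions of $n\in\mathbb N$ such that $d_C(n)$ and $d_B(n)$ are powers of two, $w(n)>0$ is real, and, as $n\to\infty$, $$d_C=\Theta(\log^{\gamma}n),\qquad d_B=\Theta(\log^{1+\beta}n),\qquad w=\Theta(\log^{\beta/2}n).$$ A filter family $\mathcal G$ for $\mathbb R^{d}$ is a collection of subsets of $\mathbb R^d$ (filters), and $\mathcal G(x)=\{A\in\mathcal G: x\in A\}$. Norms and distances are Euclidean. Algorithms are programs for a randomized unit-cost real RAM (arithmetic, comparison, floor, indirect addressing, independent uniform random reals in $[0,1]$; a filter is output by writing its name, one number). There is one sampling program and one decoding program for all $n$; the sampler is given $n,d_B,d_C,w$, and the decoder is given what the sampler has left in memory, and a point. Then for all sufficiently large $n$ there is a distribution $\mathscr G=\mathscr G_n$ over filter families for $\mathbb R^{d_B}$ with the following properties. 1. A family $\mathcal G$ can be sampled from $\mathscr G$ in expected time $O(\mathrm{poly}(d_B^{d_B/d_C}d_C^{d_C}))$. 2. For almost every sampled $\mathcal G$ and for all $x\in\mathbb R^{d_B}$, $\mathcal G(x)$ can be computed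 from the sampled representation of $\mathcal G$ in expected time $O(\mathrm{poly}(d_B^{d_B/d_C}d_C^{d_C})+|\mathcal G(x)|)$, the expectation being over the coins of the decoder, with constants that do not depend on $n$, $\mathcal G$ or $x$. 3. Every family $\mathcal G$ that the sampler produces satisfies $\mathcal G(x)\cap\mathcal G(y)\ne\emptyset$ for all $x,y\in\mathbb R^{d_B}$ with $\|x-y\|\le 1$. 4. Let $t\ge 0$ be a fixed constant. For all $x,y\in\mathbb R^{d_B}$ with $\|x-y\|\ge t$, $$\mathbb E_{\mathcal G\sim\mathscr G}\,|\mathcal G(x)\cap\mathcal G(y)|\le O\Bigl(\mathrm{poly}(d_B^{d_B/d_C})\exp\Bigl(-\frac{d_B}{2}\cdot\frac{t^2-1-o(1)}{4w^2}\Bigr)\Bigr)$$ as $n\to\infty$, where the $o(1)$ term may depend on $t$ but not on $x,y$. In particular, $\mathbb E\,|\mathcal G(x)|=O\bigl(\mathrm{poly}(d_B^{d_B/d_C})\exp(\frac{d_B}{2}\cdot\frac{1+o(1)}{4w^2})\bigr)$ for all $x$. Moreover, $\mathscr G$ can be chosen of the following form. There are $\varepsilon=\varepsilon(n)=\Theta(\log^{-\gamma/2}n)$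 and a fixed collection $\mathcal Q=\mathcal Q_n$ of $O(\mathrm{poly}(d_B^{d_B/d_C}))$ orthogonal decompositions $P=(P_1,\dots,P_{d_B/d_C})$ of $\mathbb R^{d_B}$ (the $P_i$ are $d_C\times d_B$ matrices whose rows together form an orthonormal basis of $\mathbb R^{d_B}$) that is splitting: for each unit vector $x$ some $P\in\mathcal Q$ satisfies $\bigl|\sqrt{d_B/d_C}\,\|P_ix\|-1\bigr|<\varepsilon$ for all $i$. There is also $N=N(n)=O(\mathrm{poly}(d_C^{d_C}))$ such that for every sampled $\mathcal G$ there are families $\mathcal F_{P,i}$ ($P\in\mathcal Q$, $1\le i\le d_B/d_C$), each consisting of all closed balls of radius $w$ with centres in $\bigcup_{j=1}^N(v_j+3w\mathbb Z^{d_C})$ for some offsets $v_1,\dots,v_N\in[0,3w]^{d_C}$, and $\mathcal G$ consists of the sets $$\Bigl\{x\in\mathbb R^{d_B}:\ \sqrt{d_B/d_C}\;P_i\,\frac{x}{1+\varepsilon}\in B_i\text{ for all }i\Bigr\},\qquad P\in\mathcal Q,\ B_i\in\mathcal F_{P,i}.$$ -/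

import Mathlib

open MeasureTheory Filter Topology Asymptotics
open scoped ENNReal

namespace RealRAM

/-! A randomized real RAM with unit cost arithmetic, indirect addressing and rounding. -/

/-- An infinite tape of coins, each a real number in `[0, 1]`. -/
abbrev Tape : Type := ℕ → unitInterval

/-- The coins are independent and uniform on `[0, 1]`. -/
noncomputable def coinMeasure : Measure Tape :=
  Measure.infinitePi (fun _ : ℕ => (volume : Measure unitInterval))

/-- A machine state: real memory cells, a read-only input array, the list of the numbers that have
been output so far (the latest one first), and the coins that have not been used yet. -/
structure State where
  mem : ℕ → ℝ
  inp : ℕ → ℝ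
  out : List ℝ
  coins : Tape

/-- Write `a` into memory cell `i`. -/
noncomputable def State.write (s : State) (i : ℕ) (a : ℝ) : State :=
  { s with mem := Function.update s.mem i a }

/-- The instructions. Numerical arguments are fixed addresses of memory cells. -/
inductive Instr : Type
  | const (i : ℕ) (z : ℤ)
  | add (i j k : ℕ)
  | sub (i j k : ℕ)
  | mul (i j k : ℕ)
  | div (i j k : ℕ)
  | floor (i j : ℕ)
  | load (i j : ℕ)
  | store (i j : ℕ)
  | read (i j : ℕ)
  | coin (i : ℕ)
  | emit (i : ℕ)

/-- The effect of one instruction. -/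
noncomputable def Instr.apply : Instr → State → State
  | .const i z, s => s.write i z
  | .add i j k, s => s.write i (s.mem j + s.mem k)
  | .sub i j k, s => s.write i (s.mem j - s.mem k)
  | .mul i j k, s => s.write i (s.mem j * s.mem k)
  | .div i j k, s => s.write i (s.mem j / s.mem k)
  | .floor i j, s => s.write i (⌊s.mem j⌋ : ℤ)
  | .load i j, s => s.write i (s.mem ⌊s.mem j⌋₊)
  | .store i j, s => s.write ⌊s.mem i⌋₊ (s.mem j)
  | .read i j, s => s.write i (s.inp ⌊s.mem j⌋₊)
  | .coin i, s => { s.write i (s.coins 0 : ℝ) with coins := fun m => s.coins (m + 1) }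
  | .emit i, s => { s with out := s.mem i :: s.out }

/-- Programs; the tests compare the contents of two memory cells. -/
inductive Program : Type
  | instr (a : Instr)
  | seq (p q : Program)
  | ifLt (i j : ℕ) (p q : Program)
  | whileLt (i j : ℕ) (p : Program)

/-- `Exec p s t s'`: started in state `s`, program `p` halts after `t` steps in state `s'`.
Each instruction and each test is one step. -/
inductive Exec : Program → State → ℕ → State → Prop
  | instr (a : Instr) (s : State) : Exec (.instr a) s 1 (a.apply s)
  | seq {p q : Program} {s s' s'' : State} {t t' : ℕ} :
      Exec p s t s' → Exec q s' t' s'' → Exec (.seq p q) s (t + t') s''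
  | ifTrue {i j : ℕ} {p q : Program} {s s' : State} {t : ℕ} :
      s.mem i < s.mem j → Exec p s t s' → Exec (.ifLt i j p q) s (t + 1) s'
  | ifFalse {i j : ℕ} {p q : Program} {s s' : State} {t : ℕ} :
      ¬ s.mem i < s.mem j → Exec q s t s' → Exec (.ifLt i j p q) s (t + 1) s'
  | whileFalse {i j : ℕ} {p : Program} {s : State} :
      ¬ s.mem i < s.mem j → Exec (.whileLt i j p) s 1 s
  | whileTrue {i j : ℕ} {p : Program} {s s' s'' : State} {t t' : ℕ} :
      s.mem i < s.mem j → Exec p s t s' → Exec (.whileLt i j p) s' t' s'' →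
      Exec (.whileLt i j p) s (t + t' + 1) s''

/-- The running time from state `s`; it is `∞` if the program does not halt. -/
noncomputable def runTime (p : Program) (s : State) : ℝ≥0∞ :=
  ⨅ (t : ℕ) (s' : State) (_ : Exec p s t s'), (t : ℝ≥0∞)

/-- The expected running time over the coins. -/
noncomputable def expectedTime (p : Program) (start : Tape → State) : ℝ≥0∞ :=
  ∫⁻ ω, runTime p (start ω) ∂coinMeasure

end RealRAM

namespace FilterLSF

open RealRAM

/-- Euclidean space of dimension `d`. -/
abbrev E (d : ℕ) : Type := EuclideanSpace ℝ (Fin d)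

/-- A filter family is a collection of subsets of `X`, called filters. -/
abbrev FilterFamily (X : Type) : Type := Set (Set X)

/-- The set `F(x)` of all filters of the family `F` that contain `x`. -/
def FilterFamily.at {X : Type} (F : FilterFamily X) (x : X) : Set (Set X) :=
  {A | A ∈ F ∧ x ∈ A}

/-- The number of filters shared by `x` and `y`. -/
noncomputable def shared {X : Type} (F : FilterFamily X) (x y : X) : ℝ≥0∞ :=
  ((F.at x ∩ F.at y).encard : ℝ≥0∞)

/-- The linear map given by a matrix. -/
noncomputable def applyMat {d' d : ℕ} (A : Matrix (Fin d') (Fin d) ℝ) (x : E d) : E d' :=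
  WithLp.toLp 2 (A.mulVec x.ofLp)

/-- The `d' × d` matrices `P 0, …, P (k - 1)` form an orthogonal decomposition of `ℝ^d`. -/
def IsOrthDecomp {k d' d : ℕ} (P : Fin k → Matrix (Fin d') (Fin d) ℝ) : Prop :=
  let rows : Fin k × Fin d' → E d := fun q => WithLp.toLp 2 (P q.1 q.2)
  k * d' = d ∧ Orthonormal ℝ rows ∧ Submodule.span ℝ (Set.range rows) = ⊤

/-- `Q 0, …, Q (M - 1)` are orthogonal decompositions, and each unit vector `x` is split into pieces
of almost equal length by at least one of them. -/
def IsSplitting {M k d' d : ℕ} (Q : Fin M → Fin k → Matrix (Fin d') (Fin d) ℝ) (ε : ℝ) : Prop :=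
  (∀ m, IsOrthDecomp (Q m)) ∧
  ∀ x : E d, ‖x‖ = 1 → ∃ m, ∀ i, |√((d : ℝ) / d') * ‖applyMat (Q m i) x‖ - 1| < ε

/-- The tensor product of filter families along `P`. A filter of the product is given by a tuple of
filters `B i`, and contains `x` if and only if each `B i` contains `√(d / d') P_i x`. -/
def tensor {k d' d : ℕ} (P : Fin k → Matrix (Fin d') (Fin d) ℝ)
    (F : Fin k → FilterFamily (E d')) : FilterFamily (E d) :=
  {A | ∃ B : Fin k → Set (E d'), (∀ i, B i ∈ F i) ∧
    A = {x | ∀ i, √((d : ℝ) / d') • applyMat (P i) x ∈ B i}}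

/-- The family `G` with `G(x) = F(x / a)`. -/
def rescale {d : ℕ} (a : ℝ) (F : FilterFamily (E d)) : FilterFamily (E d) :=
  {A | ∃ B ∈ F, A = {x | a⁻¹ • x ∈ B}}

/-- All balls of radius `w` with centres in `v j + 3w ℤ^d` for some `j`. -/
def ballLattices {d N : ℕ} (w : ℝ) (v : Fin N → E d) : FilterFamily (E d) :=
  {A | ∃ (j : Fin N) (z : Fin d → ℤ),
    A = Metric.closedBall (v j + WithLp.toLp 2 (fun i => 3 * w * (z i : ℝ))) w}

/-- Start of a sampling run: the input is `(n, dB, dC, w)` and the memory is blank. -/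
noncomputable def sampleStart (n dB dC : ℕ) (w : ℝ) (ω : Tape) : State where
  mem := fun _ => 0
  inp := fun j => if j = 0 then n else if j = 1 then dB else if j = 2 then dC
    else if j = 3 then w else 0
  out := []
  coins := ω

/-- Start of a decoding run: the memory is what the sampler has left, the input is the point `x`,
and the coins are fresh. -/
noncomputable def decodeStart {d : ℕ} (mem : ℕ → ℝ) (x : E d) (ω : Tape) : State where
  mem := mem
  inp := fun j => if h : j < d then x ⟨j, h⟩ else 0
  out := []
  coins := ω

/-- With the memory contents `mem`, the program `p` decodes the family `F`: there are distinct
names for the filters in `F`, not depending on `x`, such that for each point `x` the program lists,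
without repetitions, the names of the filters in `F(x)`, in expected time at most
`C * (T + |F(x)|)`. -/
def Decodes {d : ℕ} (p : Program) (mem : ℕ → ℝ) (F : FilterFamily (E d)) (C T : ℝ) : Prop :=
  ∃ name : Set (E d) → ℝ, Set.InjOn name F ∧ ∀ x : E d,
    (∀ (ω : Tape) (t : ℕ) (s : State), Exec p (decodeStart mem x ω) t s →
      s.out.Nodup ∧ {a | a ∈ s.out} = name '' F.at x) ∧
    expectedTime p (decodeStart mem x) ≤
      ENNReal.ofReal C * (ENNReal.ofReal T + ((F.at x).encard : ℝ≥0∞))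

end FilterLSF

open RealRAM FilterLSF

namespace RealRAM

/-! ### Determinism and running times -/

/-! Write D = d_B, d = d_C and k = D / d.

Splitting. A vector is cut into k pieces of dimension d by a binary tree of plane rotations. At a
node, consecutive coordinates are paired, all pairs are rotated by the same angle, and the first and
the second entries of the rotated pairs go to the two children. Over a quarter turn the excess of
the energy of the first child over its fair share turns into its negative, so a discrete
intermediate value argument finds, among S = D² angles, one that balances the children up to a
relative error O(1/S) (`exists_balanced_split`). Along the tree the errors add up to at most 64k/S
(`exists_balanced_tree`), which is below ε = 1/⌈√d⌉ for large n. The S^(k-1) choices of the angles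
form the splitting collection (`isSplitting_decomp`).

Covering. In units of the period 3w the balls in one piece have radius 1/3 and their centres are
shifted copies of ℤ^d. On a torus grid with K = d³ points per period, N grid points are chosen
greedily such that any two grid points at distance about 1/(3w) or less lie in a common ball around
a chosen point. By Chebyshev's inequality the lens of two balls of radius ρ with centres at distance
s has at least half the volume of a ball whose squared radius is slightly below ρ² - s²/4
(`volume_lens_ge`). So every close pair is covered by a large fraction of all grid points, and the
greedy choice loses only a logarithmic factor against that fraction (`IsGreedy.mul_le`,
`greedy_card_mul_le`). The cover does not involve the coins, and therefore no shift of the lattices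
can separate a close pair (`Scheme.nonempty_common_filter`).

Distant pairs. Each piece of each decomposition has one uniform random shift. The expected number of
common balls in a piece is at most N times the volume of a lens, and a lens at distance t lies in a
ball of squared radius w² - t²/4 (`volume_lens_le`). The ratio of the two volumes is about ((w² -
t²/4)/(w² - 1/4))^(d/2), which is bounded by an exponential. Shifts of different pieces are
independent, so the expectations multiply and the exponents add; by orthogonality of the
decomposition their sum depends on ‖x - y‖ only (`Scheme.lintegral_shared_le_exp`). The number of
decompositions and the k-th power of the logarithmic factor are polynomial in D^(D/d), and the
corrections to the exponent vanish because w = o(√d), which is where β < γ enters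
(`tendsto_ratioSq`).

Algorithms. Both programs are written in a small structured language with a verified compiler
(`Cmd.exec_code`) and a static cost bound (`Cmd.cost_le`). The decoder rounds to find, for each
lattice and each piece, the only ball that can contain the piece. It then builds the list of names
by copying and translating a list that never shrinks, so that this work is paid for by the length of
the output (`Cmd.loop_cost`). The name of a filter is the number of its decomposition plus an
integral linear form in the coins. Almost surely different indices give different names and
different filters (`Scheme.ae_injective_name`, `Scheme.ae_injective_filt`). -/

theorem Exec.det {p : Program} {s s₁ s₂ : State} {t₁ t₂ : ℕ} (h₁ : Exec p s t₁ s₁)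
    (h₂ : Exec p s t₂ s₂) : t₁ = t₂ ∧ s₁ = s₂ := by
  induction h₁ generalizing t₂ s₂ with
  | instr a s => cases h₂; exact ⟨rfl, rfl⟩
  | seq _ _ ih₁ ih₂ =>
    cases h₂ with
    | seq h h' =>
      obtain ⟨rfl, rfl⟩ := ih₁ h
      obtain ⟨rfl, rfl⟩ := ih₂ h'
      exact ⟨rfl, rfl⟩
  | ifTrue hc _ ih =>
    cases h₂ with
    | ifTrue _ h => obtain ⟨rfl, rfl⟩ := ih h; exact ⟨rfl, rfl⟩
    | ifFalse hc' _ => exact absurd hc hc'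
  | ifFalse hc _ ih =>
    cases h₂ with
    | ifTrue hc' _ => exact absurd hc' hc
    | ifFalse _ h => obtain ⟨rfl, rfl⟩ := ih h; exact ⟨rfl, rfl⟩
  | whileFalse hc =>
    cases h₂ with
    | whileFalse _ => exact ⟨rfl, rfl⟩
    | whileTrue hc' _ _ => exact absurd hc' hc
  | whileTrue hc _ _ ih₁ ih₂ =>
    cases h₂ with
    | whileFalse hc' => exact absurd hc hc'
    | whileTrue _ h h' =>
      obtain ⟨rfl, rfl⟩ := ih₁ h
      obtain ⟨rfl, rfl⟩ := ih₂ h'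
      exact ⟨rfl, rfl⟩

theorem runTime_le {p : Program} {s s' : State} {t : ℕ} (h : Exec p s t s') :
    runTime p s ≤ t :=
  iInf_le_of_le t (iInf_le_of_le s' (iInf_le _ h))

/-! ### A structured language on named variables and arrays -/

/-- The state seen by structured commands: variables, eight arrays, input, output and coins. -/
structure Store where
  var : ℕ → ℝ
  arr : Fin 8 → ℕ → ℝ
  inp : ℕ → ℝ
  out : List ℝ
  coins : Tape

/-- Assign `x` to the variable `v`. -/
noncomputable def Store.setVar (H : Store) (v : ℕ) (x : ℝ) : Store :=
  { H with var := Function.update H.var v x }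

/-- Assign `x` to the cell `i` of the array `a`. -/
noncomputable def Store.setArr (H : Store) (a : Fin 8) (i : ℕ) (x : ℝ) : Store :=
  { H with arr := Function.update H.arr a (Function.update (H.arr a) i x) }

/-- Arithmetic expressions. -/
inductive Expr : Type
  | lit (z : ℤ)
  | var (v : ℕ)
  | get (a : Fin 8) (e : Expr)
  | inp (e : Expr)
  | add (e f : Expr)
  | sub (e f : Expr)
  | mul (e f : Expr)
  | div (e f : Expr)
  | floor (e : Expr)

/-- The value of an expression. Negative array indices refer to the variable `0`. -/
noncomputable def Expr.eval (H : Store) : Expr → ℝ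
  | .lit z => z
  | .var v => H.var v
  | .get a e => if 0 ≤ e.eval H then H.arr a ⌊e.eval H⌋₊ else H.var 0
  | .inp e => H.inp ⌊e.eval H⌋₊
  | .add e f => e.eval H + f.eval H
  | .sub e f => e.eval H - f.eval H
  | .mul e f => e.eval H * f.eval H
  | .div e f => e.eval H / f.eval H
  | .floor e => (⌊e.eval H⌋ : ℤ)

instance : Add Expr := ⟨.add⟩
instance : Sub Expr := ⟨.sub⟩
instance : Mul Expr := ⟨.mul⟩
instance : Div Expr := ⟨.div⟩
instance (n : ℕ) : OfNat Expr n := ⟨.lit n⟩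

@[simp] theorem Expr.eval_lit (H : Store) (z : ℤ) : (Expr.lit z).eval H = z := rfl
@[simp] theorem Expr.eval_ofNat (H : Store) (n : ℕ) [n.AtLeastTwo] :
    (ofNat(n) : Expr).eval H = OfNat.ofNat n := by
  change (((OfNat.ofNat n : ℕ) : ℤ) : ℝ) = _
  simp
@[simp] theorem Expr.eval_zero (H : Store) : (0 : Expr).eval H = 0 := by
  change (((0 : ℕ) : ℤ) : ℝ) = _; simp
@[simp] theorem Expr.eval_one (H : Store) : (1 : Expr).eval H = 1 := by
  change (((1 : ℕ) : ℤ) : ℝ) = _; simp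
@[simp] theorem Expr.eval_var (H : Store) (v : ℕ) : (Expr.var v).eval H = H.var v := rfl
@[simp] theorem Expr.eval_add (H : Store) (e f : Expr) :
    (e + f).eval H = e.eval H + f.eval H := rfl
@[simp] theorem Expr.eval_sub (H : Store) (e f : Expr) :
    (e - f).eval H = e.eval H - f.eval H := rfl
@[simp] theorem Expr.eval_mul (H : Store) (e f : Expr) :
    (e * f).eval H = e.eval H * f.eval H := rfl
@[simp] theorem Expr.eval_div (H : Store) (e f : Expr) :
    (e / f).eval H = e.eval H / f.eval H := rfl
@[simp] theorem Expr.eval_floor (H : Store) (e : Expr) :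
    (Expr.floor e).eval H = (⌊e.eval H⌋ : ℤ) := rfl
@[simp] theorem Expr.eval_inp (H : Store) (e : Expr) :
    (Expr.inp e).eval H = H.inp ⌊e.eval H⌋₊ := rfl

theorem Expr.eval_get {H : Store} {a : Fin 8} {e : Expr} {i : ℕ} (h : e.eval H = i) :
    (Expr.get a e).eval H = H.arr a i := by
  simp [Expr.eval, h]

/-- Structured commands. In `loop v b c` the counter `v` runs through all natural numbers below
the value that the variable `b` has at the start. -/
inductive Cmd : Type
  | skip
  | set (v : ℕ) (e : Expr)
  | put (a : Fin 8) (e f : Expr)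
  | coin (v : ℕ)
  | emit (e : Expr)
  | seq (c c' : Cmd)
  | ite (e f : Expr) (c c' : Cmd)
  | loop (v b : ℕ) (c : Cmd)

infixr:60 " ;; " => Cmd.seq

/-- `n` rounds of a loop. -/
def rounds (f : ℕ → Store → Store) : ℕ → Store → Store
  | 0, H => H
  | n + 1, H => f n (rounds f n H)

/-- The effect of a command. -/
noncomputable def Cmd.run : Cmd → Store → Store
  | .skip, H => H
  | .set v e, H => H.setVar v (e.eval H)
  | .put a e f, H =>
      if 0 ≤ e.eval H then H.setArr a ⌊e.eval H⌋₊ (f.eval H) else H.setVar 0 (f.eval H)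
  | .coin v, H => { H.setVar v (H.coins 0 : ℝ) with coins := fun m => H.coins (m + 1) }
  | .emit e, H => { H with out := e.eval H :: H.out }
  | .seq c c', H => c'.run (c.run H)
  | .ite e f c c', H => if e.eval H < f.eval H then c.run H else c'.run H
  | .loop v b c, H => rounds (fun i H => c.run (H.setVar v i)) ⌈H.var b⌉₊ H

theorem Cmd.run_put {a : Fin 8} {e f : Expr} {H : Store} {i : ℕ} (h : e.eval H = i) :
    (Cmd.put a e f).run H = H.setArr a i (f.eval H) := by
  simp [Cmd.run, h]

theorem Cmd.run_loop {v b : ℕ} {c : Cmd} {H : Store} {n : ℕ} (h : H.var b = n) :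
    (Cmd.loop v b c).run H = rounds (fun i H => c.run (H.setVar v i)) n H := by
  simp [Cmd.run, h]

/-- The number of instructions needed to evaluate an expression. -/
def Expr.cost : Expr → ℕ
  | .lit _ => 1
  | .var _ => 2
  | .get _ e => e.cost + 6
  | .inp e => e.cost + 1
  | .add e f => e.cost + f.cost + 1
  | .sub e f => e.cost + f.cost + 1
  | .mul e f => e.cost + f.cost + 1
  | .div e f => e.cost + f.cost + 1
  | .floor e => e.cost + 1

/-- The number of steps that a command takes. -/
noncomputable def Cmd.cost : Cmd → Store → ℕ
  | .skip, _ => 1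
  | .set _ e, _ => e.cost + 2
  | .put _ e f, _ => e.cost + f.cost + 6
  | .coin _, _ => 1
  | .emit e, _ => e.cost + 1
  | .seq c c', H => c.cost H + c'.cost (c.run H)
  | .ite e f c c', H => e.cost + f.cost + (if e.eval H < f.eval H then c.cost H else c'.cost H) + 1
  | .loop v b c, H => 4 + ∑ i ∈ Finset.range ⌈H.var b⌉₊,
      (c.cost ((rounds (fun i H => c.run (H.setVar v i)) i H).setVar v i) + 5)

/-! ### Compilation -/

/-- Cells for intermediate results. -/
def tmp (t : ℕ) : ℕ := 16 * t + 14
/-- Cells for loop counters. -/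
def ctr (t : ℕ) : ℕ := 16 * t + 15

/-- The state `s` represents the store `H`. -/
structure Rep (H : Store) (s : State) : Prop where
  var : ∀ v, s.mem (16 * v) = H.var v
  arr : ∀ (a : Fin 8) i, s.mem (16 * i + a + 1) = H.arr a i
  inp : s.inp = H.inp
  out : s.out = H.out
  coins : s.coins = H.coins

/-- The memory is laid out by residues modulo 16: 0 for variables, 1 to 8 for the arrays, 14 for
temporaries, 15 for counters. A write in one class leaves the others alone, so the represented store
does not see temporaries and counters. -/
theorem Rep.write_tmp {H : Store} {s : State} (h : Rep H s) (t : ℕ) (x : ℝ) :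
    Rep H (s.write (tmp t) x) where
  var v := by
    simp only [State.write, tmp]
    rw [Function.update_of_ne (by omega)]; exact h.var v
  arr a i := by
    simp only [State.write, tmp]
    rw [Function.update_of_ne (by omega)]; exact h.arr a i
  inp := h.inp
  out := h.out
  coins := h.coins

theorem Rep.write_ctr {H : Store} {s : State} (h : Rep H s) (t : ℕ) (x : ℝ) :
    Rep H (s.write (ctr t) x) where
  var v := by
    simp only [State.write, ctr]
    rw [Function.update_of_ne (by omega)]; exact h.var v
  arr a i := by
    simp only [State.write, ctr]
    rw [Function.update_of_ne (by omega)]; exact h.arr a i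
  inp := h.inp
  out := h.out
  coins := h.coins

theorem Rep.write_var {H : Store} {s : State} (h : Rep H s) (v : ℕ) (x : ℝ) :
    Rep (H.setVar v x) (s.write (16 * v) x) where
  var u := by
    simp only [State.write, Store.setVar]
    by_cases huv : u = v
    · subst huv; simp
    · rw [Function.update_of_ne (by omega), Function.update_of_ne huv]; exact h.var u
  arr a i := by
    simp only [State.write, Store.setVar]
    rw [Function.update_of_ne (by omega)]; exact h.arr a i
  inp := h.inp
  out := h.out
  coins := h.coins

theorem Rep.write_arr {H : Store} {s : State} (h : Rep H s) (a : Fin 8) (i : ℕ) (x : ℝ) :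
    Rep (H.setArr a i x) (s.write (16 * i + a + 1) x) where
  var u := by
    simp only [State.write, Store.setArr]
    rw [Function.update_of_ne (by omega)]; exact h.var u
  arr b j := by
    simp only [State.write, Store.setArr]
    by_cases hb : b = a
    · subst hb
      by_cases hj : j = i
      · subst hj; simp
      · rw [Function.update_of_ne (by omega), Function.update_self, Function.update_of_ne hj]
        exact h.arr b j
    · have : (b : ℕ) ≠ a := fun e => hb (Fin.ext e)
      rw [Function.update_of_ne (by omega), Function.update_of_ne hb]; exact h.arr b j
  inp := h.inp
  out := h.out
  coins := h.coins

theorem write_mem_ne {s : State} {i j : ℕ} {x : ℝ} (h : j ≠ i) :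
    (s.write i x).mem j = s.mem j := by
  simp [State.write, Function.update_of_ne h]

@[simp] theorem write_mem_self (s : State) (i : ℕ) (x : ℝ) : (s.write i x).mem i = x := by
  simp [State.write]

theorem Exec.snoc {p : Program} {s s' : State} {t : ℕ} (h : Exec p s t s') (a : Instr) :
    Exec (.seq p (.instr a)) s (t + 1) (a.apply s') :=
  .seq h (.instr a s')

/-- Code that puts the value of an expression into `tmp t`. -/
def Expr.code : Expr → ℕ → Program
  | .lit z, t => .instr (.const (tmp t) z)
  | .var v, t => .seq (.instr (.const (tmp t) 0)) (.instr (.add (tmp t) (tmp t) (16 * v)))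
  | .get a e, t =>
      .seq (.seq (.seq (.seq (.seq (.seq (e.code t) (.instr (.floor (tmp t) (tmp t))))
        (.instr (.const (tmp (t + 1)) 16))) (.instr (.mul (tmp t) (tmp t) (tmp (t + 1)))))
        (.instr (.const (tmp (t + 1)) (a + 1 : ℕ)))) (.instr (.add (tmp t) (tmp t) (tmp (t + 1)))))
        (.instr (.load (tmp t) (tmp t)))
  | .inp e, t => .seq (e.code t) (.instr (.read (tmp t) (tmp t)))
  | .add e f, t => .seq (.seq (e.code t) (f.code (t + 1)))
      (.instr (.add (tmp t) (tmp t) (tmp (t + 1))))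
  | .sub e f, t => .seq (.seq (e.code t) (f.code (t + 1)))
      (.instr (.sub (tmp t) (tmp t) (tmp (t + 1))))
  | .mul e f, t => .seq (.seq (e.code t) (f.code (t + 1)))
      (.instr (.mul (tmp t) (tmp t) (tmp (t + 1))))
  | .div e f, t => .seq (.seq (e.code t) (f.code (t + 1)))
      (.instr (.div (tmp t) (tmp t) (tmp (t + 1))))
  | .floor e, t => .seq (e.code t) (.instr (.floor (tmp t) (tmp t)))

/-- `s'` differs from `s` at most in the data of the represented store and in temporary cells
of index at least `t`. -/
def Keeps (t : ℕ) (s s' : State) : Prop :=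
  (∀ u < t, s'.mem (tmp u) = s.mem (tmp u)) ∧ ∀ u, s'.mem (ctr u) = s.mem (ctr u)

theorem Keeps.refl (t : ℕ) (s : State) : Keeps t s s := ⟨fun _ _ => rfl, fun _ => rfl⟩

theorem Keeps.trans {t : ℕ} {s s' s'' : State} (h : Keeps t s s') (h' : Keeps t s' s'') :
    Keeps t s s'' :=
  ⟨fun u hu => (h'.1 u hu).trans (h.1 u hu), fun u => (h'.2 u).trans (h.2 u)⟩

theorem Keeps.mono {t u : ℕ} {s s' : State} (h : Keeps u s s') (htu : t ≤ u) : Keeps t s s' :=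
  ⟨fun v hv => h.1 v (hv.trans_le htu), h.2⟩

theorem Keeps.write {t u : ℕ} {s s' : State} (h : Keeps t s s') (htu : t ≤ u) (x : ℝ) :
    Keeps t s (s'.write (tmp u) x) := by
  refine h.trans ⟨fun v hv => write_mem_ne ?_, fun v => write_mem_ne ?_⟩ <;>
  simp only [tmp, ctr] <;> omega

/-- For negative `x` the computed address is at most -16 + 8 and is truncated to 0, the cell of the
variable 0. This forces the convention for negative indices in `Expr.eval` and `Cmd.run`. -/
theorem natFloor_address (x : ℝ) (a : ℕ) (ha : a < 8) :
    ⌊(⌊x⌋ : ℝ) * 16 + ((a + 1 : ℕ) : ℝ)⌋₊ = if 0 ≤ x then 16 * ⌊x⌋₊ + a + 1 else 0 := by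
  split_ifs with hx
  · rw [← natCast_floor_eq_intCast_floor hx]
    have : ((⌊x⌋₊ : ℕ) : ℝ) * 16 + ((a + 1 : ℕ) : ℝ) = ((16 * ⌊x⌋₊ + a + 1 : ℕ) : ℝ) := by
      push_cast; ring
    rw [this, Nat.floor_natCast]
  · rw [Nat.floor_eq_zero]
    have h1 : ⌊x⌋ ≤ -1 := by
      have : ⌊x⌋ < 0 := Int.floor_lt.2 (by simpa using hx)
      omega
    have h2 : (⌊x⌋ : ℝ) ≤ -1 := by exact_mod_cast h1
    have h3 : ((a + 1 : ℕ) : ℝ) ≤ 8 := by exact_mod_cast ha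
    linarith

/-- The temporaries form a stack: the second operand is evaluated one level higher, and `Keeps`
guarantees that the value of the first operand survives this. -/
theorem Expr.exec_code (H : Store) (e : Expr) : ∀ (t : ℕ) (s : State), Rep H s →
    ∃ s', Exec (e.code t) s e.cost s' ∧ s'.mem (tmp t) = e.eval H ∧ Rep H s' ∧ Keeps t s s' := by
  -- The four arithmetic operations share this argument.
  have bin : ∀ (e f : Expr) (op : ℕ → ℕ → ℕ → Instr) (o : ℝ → ℝ → ℝ),
      (∀ i j k s, (op i j k).apply s = s.write i (o (s.mem j) (s.mem k))) →
      (∀ (t : ℕ) (s : State), Rep H s →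
        ∃ s', Exec (e.code t) s e.cost s' ∧ s'.mem (tmp t) = e.eval H ∧ Rep H s' ∧ Keeps t s s') →
      (∀ (t : ℕ) (s : State), Rep H s →
        ∃ s', Exec (f.code t) s f.cost s' ∧ s'.mem (tmp t) = f.eval H ∧ Rep H s' ∧ Keeps t s s') →
      ∀ (t : ℕ) (s : State), Rep H s →
        ∃ s', Exec (.seq (.seq (e.code t) (f.code (t + 1)))
          (.instr (op (tmp t) (tmp t) (tmp (t + 1))))) s (e.cost + f.cost + 1) s' ∧
          s'.mem (tmp t) = o (e.eval H) (f.eval H) ∧ Rep H s' ∧ Keeps t s s' := by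
    intro e f op o hop he hf t s hs
    obtain ⟨s₁, x₁, v₁, r₁, k₁⟩ := he t s hs
    obtain ⟨s₂, x₂, v₂, r₂, k₂⟩ := hf (t + 1) s₁ r₁
    refine ⟨_, (x₁.seq x₂).snoc _, ?_, ?_, ?_⟩
    · rw [hop, write_mem_self, v₂, k₂.1 t (by omega), v₁]
    · rw [hop]; exact r₂.write_tmp _ _
    · rw [hop]; exact (k₁.trans (k₂.mono (by omega))).write le_rfl _
  induction e with
  | lit z =>
    intro t s hs
    exact ⟨_, .instr _ _, by simp [Instr.apply], hs.write_tmp _ _, (Keeps.refl t s).write le_rfl _⟩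
  | var v =>
    intro t s hs
    refine ⟨_, (Exec.instr _ _).snoc _, ?_, ?_, ?_⟩
    · simp only [Instr.apply, write_mem_self]
      rw [write_mem_ne (by simp only [tmp]; omega), hs.var]; simp
    · exact (hs.write_tmp _ _).write_tmp _ _
    · exact ((Keeps.refl t s).write le_rfl _).write le_rfl _
  | get a e ih =>
    intro t s hs
    obtain ⟨s₁, x₁, v₁, r₁, k₁⟩ := ih t s hs
    have hne : tmp t ≠ tmp (t + 1) := by simp only [tmp]; omega
    have r₆ : Rep H ((Instr.add (tmp t) (tmp t) (tmp (t + 1))).apply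
        ((Instr.const (tmp (t + 1)) (a + 1 : ℕ)).apply ((Instr.mul (tmp t) (tmp t)
        (tmp (t + 1))).apply ((Instr.const (tmp (t + 1)) 16).apply
        ((Instr.floor (tmp t) (tmp t)).apply s₁))))) :=
      ((((r₁.write_tmp _ _).write_tmp _ _).write_tmp _ _).write_tmp _ _).write_tmp _ _
    refine ⟨_, (((((x₁.snoc _).snoc _).snoc _).snoc _).snoc _).snoc _, ?_, r₆.write_tmp _ _, ?_⟩
    · have hv : ((Instr.add (tmp t) (tmp t) (tmp (t + 1))).apply
          ((Instr.const (tmp (t + 1)) (a + 1 : ℕ)).apply ((Instr.mul (tmp t) (tmp t)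
          (tmp (t + 1))).apply ((Instr.const (tmp (t + 1)) 16).apply
          ((Instr.floor (tmp t) (tmp t)).apply s₁))))).mem (tmp t) =
          (⌊e.eval H⌋ : ℝ) * 16 + ((a + 1 : ℕ) : ℝ) := by
        simp [Instr.apply, write_mem_ne hne, v₁]
      simp only [Instr.apply] at hv r₆ ⊢
      rw [write_mem_self, hv, natFloor_address _ _ a.2]
      simp only [Expr.eval]
      split_ifs with h0
      · rw [r₆.arr a]
      · exact r₆.var 0
    · simp only [Instr.apply]
      exact (((((k₁.write le_rfl _).write (by omega) _).write le_rfl _).write (by omega) _).write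
        le_rfl _).write le_rfl _
  | inp e ih =>
    intro t s hs
    obtain ⟨s₁, x₁, v₁, r₁, k₁⟩ := ih t s hs
    refine ⟨_, x₁.snoc _, ?_, r₁.write_tmp _ _, k₁.write le_rfl _⟩
    simp [Instr.apply, v₁, r₁.inp, Expr.eval]
  | add e f he hf => exact bin e f .add (· + ·) (fun _ _ _ _ => rfl) he hf
  | sub e f he hf => exact bin e f .sub (· - ·) (fun _ _ _ _ => rfl) he hf
  | mul e f he hf => exact bin e f .mul (· * ·) (fun _ _ _ _ => rfl) he hf
  | div e f he hf => exact bin e f .div (· / ·) (fun _ _ _ _ => rfl) he hf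
  | floor e ih =>
    intro t s hs
    obtain ⟨s₁, x₁, v₁, r₁, k₁⟩ := ih t s hs
    refine ⟨_, x₁.snoc _, ?_, r₁.write_tmp _ _, k₁.write le_rfl _⟩
    simp [Instr.apply, v₁, Expr.eval]

/-- Compiled commands; `l` is the number of enclosing loops. -/
def Cmd.code : Cmd → ℕ → Program
  | .skip, _ => .instr (.const (tmp 0) 0)
  | .set v e, _ => .seq (.seq (e.code 0) (.instr (.const (tmp 1) 0)))
      (.instr (.add (16 * v) (tmp 0) (tmp 1)))
  | .put a e f, _ =>
      .seq (.seq (.seq (.seq (.seq (.seq (.seq (e.code 0) (f.code 1))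
        (.instr (.floor (tmp 0) (tmp 0))))
        (.instr (.const (tmp 2) 16))) (.instr (.mul (tmp 0) (tmp 0) (tmp 2))))
        (.instr (.const (tmp 2) (a + 1 : ℕ)))) (.instr (.add (tmp 0) (tmp 0) (tmp 2))))
        (.instr (.store (tmp 0) (tmp 1)))
  | .coin v, _ => .instr (.coin (16 * v))
  | .emit e, _ => .seq (e.code 0) (.instr (.emit (tmp 0)))
  | .seq c c', l => .seq (c.code l) (c'.code l)
  | .ite e f c c', l => .seq (.seq (e.code 0) (f.code 1))
      (.ifLt (tmp 0) (tmp 1) (c.code l) (c'.code l))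
  | .loop v b c, l =>
      .seq (.seq (.seq (.instr (.const (tmp 0) 0)) (.instr (.add (ctr (2 * l)) (tmp 0) (16 * b))))
        (.instr (.const (ctr (2 * l + 1)) 0)))
        (.whileLt (ctr (2 * l + 1)) (ctr (2 * l))
          (.seq (.seq (.seq (.seq (.instr (.const (tmp 0) 0))
            (.instr (.add (16 * v) (tmp 0) (ctr (2 * l + 1))))) (c.code (l + 1)))
            (.instr (.const (tmp 0) 1)))
            (.instr (.add (ctr (2 * l + 1)) (ctr (2 * l + 1)) (tmp 0)))))

/-- A loop inside `l` others keeps its bound in `ctr (2 * l)` and its index in `ctr (2 * l + 1)`, so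
the number of rounds is fixed at the start, whatever the body does to the visible variables. The
last clause protects the counters of the enclosing loops. -/
theorem Cmd.exec_code (c : Cmd) : ∀ (l : ℕ) (H : Store) (s : State), Rep H s →
    ∃ s', Exec (c.code l) s (c.cost H) s' ∧ Rep (c.run H) s' ∧
      ∀ u < 2 * l, s'.mem (ctr u) = s.mem (ctr u) := by
  have hct : ∀ u t, ctr u ≠ tmp t := fun u t => by simp only [ctr, tmp]; omega
  have hcv : ∀ u v, ctr u ≠ 16 * v := fun u v => by simp only [ctr]; omega
  have hca : ∀ u i (a : Fin 8), ctr u ≠ 16 * i + a + 1 := fun u i a => by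
    have := a.2
    simp only [ctr]; omega
  have htt : ∀ t u, t ≠ u → tmp t ≠ tmp u := fun t u h => by simp only [tmp]; omega
  induction c with
  | skip =>
    intro l H s hs
    exact ⟨_, .instr _ _, hs.write_tmp _ _, fun u _ => write_mem_ne (hct _ _)⟩
  | set v e =>
    intro l H s hs
    obtain ⟨s₁, x₁, v₁, r₁, k₁⟩ := e.exec_code H 0 s hs
    refine ⟨_, (x₁.snoc _).snoc _, ?_, ?_⟩
    · have : ((Instr.add (16 * v) (tmp 0) (tmp 1)).apply ((Instr.const (tmp 1) 0).apply s₁)) =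
          (s₁.write (tmp 1) 0).write (16 * v) (e.eval H) := by
        simp [Instr.apply, write_mem_ne (htt 0 1 (by simp)), v₁]
      rw [this]
      exact (r₁.write_tmp _ _).write_var _ _
    · intro u _
      simp only [Instr.apply]
      rw [write_mem_ne (hcv _ _), write_mem_ne (hct _ _), k₁.2]
  | put a e f =>
    intro l H s hs
    obtain ⟨s₁, x₁, v₁, r₁, k₁⟩ := e.exec_code H 0 s hs
    obtain ⟨s₂, x₂, v₂, r₂, k₂⟩ := f.exec_code H 1 s₁ r₁
    have v₁' : s₂.mem (tmp 0) = e.eval H := by rw [k₂.1 0 (by omega), v₁]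
    have h01 := htt 0 1 (by simp)
    have h02 := htt 0 2 (by simp)
    have h12 := htt 1 2 (by simp)
    have h10 := h01.symm
    refine ⟨_, ((((((x₁.seq x₂).snoc _).snoc _).snoc _).snoc _).snoc _).snoc _, ?_, ?_⟩
    · have r₇ := ((((r₂.write_tmp 0 ⌊e.eval H⌋).write_tmp 2 16).write_tmp 0
        (⌊e.eval H⌋ * 16)).write_tmp 2 ((a + 1 : ℕ) : ℝ)).write_tmp 0
        (⌊e.eval H⌋ * 16 + ((a + 1 : ℕ) : ℝ))
      have hfl := natFloor_address (e.eval H) a a.2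
      simp only [Nat.cast_add, Nat.cast_one] at hfl r₇
      simp only [Instr.apply, write_mem_self, write_mem_ne h02, write_mem_ne h12,
        write_mem_ne h10, v₁', v₂, Int.cast_natCast, Int.cast_ofNat, Nat.cast_add, Nat.cast_one,
        hfl, Cmd.run, Int.cast_add, Int.cast_one]
      split_ifs with h0
      · exact r₇.write_arr _ _ _
      · exact r₇.write_var 0 _
    · intro u _
      simp only [Instr.apply, write_mem_self, write_mem_ne h02, write_mem_ne h12,
        write_mem_ne h10, v₁']
      have hfl := natFloor_address (e.eval H) a a.2
      simp only [Nat.cast_add, Nat.cast_one] at hfl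
      have : ctr u ≠ ⌊(⌊e.eval H⌋ : ℝ) * 16 + ((a : ℕ) + 1)⌋₊ := by
        rw [hfl]
        split_ifs
        · exact hca _ _ _
        · exact hcv u 0
      simp only [Int.cast_natCast, Int.cast_ofNat, Nat.cast_add, Nat.cast_one, Int.cast_add,
        Int.cast_one]
      rw [write_mem_ne this, write_mem_ne (hct _ _), write_mem_ne (hct _ _),
        write_mem_ne (hct _ _), write_mem_ne (hct _ _), write_mem_ne (hct _ _), k₂.2, k₁.2]
  | coin v =>
    intro l H s hs
    refine ⟨_, .instr _ _, ?_, fun u _ => ?_⟩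
    · have r := hs.write_var v (s.coins 0)
      have hc := hs.coins
      exact ⟨by simpa [Instr.apply, Cmd.run, hc] using r.var,
        by simpa [Instr.apply, Cmd.run, hc] using r.arr,
        by simpa [Instr.apply, Cmd.run, hc] using r.inp,
        by simpa [Instr.apply, Cmd.run, hc] using r.out, by simp [Instr.apply, Cmd.run, hc]⟩
    · simp only [Instr.apply]
      exact write_mem_ne (hcv _ _)
  | emit e =>
    intro l H s hs
    obtain ⟨s₁, x₁, v₁, r₁, k₁⟩ := e.exec_code H 0 s hs
    exact ⟨_, x₁.snoc _, ⟨r₁.var, r₁.arr, r₁.inp, by simp [Instr.apply, Cmd.run, v₁, r₁.out],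
      r₁.coins⟩, fun u _ => k₁.2 u⟩
  | seq c c' ih ih' =>
    intro l H s hs
    obtain ⟨s₁, x₁, r₁, k₁⟩ := ih l H s hs
    obtain ⟨s₂, x₂, r₂, k₂⟩ := ih' l _ s₁ r₁
    exact ⟨s₂, x₁.seq x₂, r₂, fun u hu => (k₂ u hu).trans (k₁ u hu)⟩
  | ite e f c c' ih ih' =>
    intro l H s hs
    obtain ⟨s₁, x₁, v₁, r₁, k₁⟩ := e.exec_code H 0 s hs
    obtain ⟨s₂, x₂, v₂, r₂, k₂⟩ := f.exec_code H 1 s₁ r₁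
    have v₁' : s₂.mem (tmp 0) = e.eval H := by rw [k₂.1 0 (by omega), v₁]
    by_cases hlt : e.eval H < f.eval H
    · obtain ⟨s₃, x₃, r₃, k₃⟩ := ih l H s₂ r₂
      refine ⟨s₃, ?_, by simpa [Cmd.run, hlt] using r₃,
        fun u hu => by rw [k₃ u hu, k₂.2, k₁.2]⟩
      have := (x₁.seq x₂).seq (Exec.ifTrue (q := c'.code l) (i := tmp 0) (j := tmp 1)
        (by rwa [v₁', v₂]) x₃)
      simpa [Cmd.cost, Cmd.code, hlt, add_assoc] using this
    · obtain ⟨s₃, x₃, r₃, k₃⟩ := ih' l H s₂ r₂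
      refine ⟨s₃, ?_, by simpa [Cmd.run, hlt] using r₃,
        fun u hu => by rw [k₃ u hu, k₂.2, k₁.2]⟩
      have := (x₁.seq x₂).seq (Exec.ifFalse (p := c.code l) (i := tmp 0) (j := tmp 1)
        (by rwa [v₁', v₂]) x₃)
      simpa [Cmd.cost, Cmd.code, hlt, add_assoc] using this
  | loop v b c ih =>
    intro l H s hs
    set F : ℕ → Store → Store := fun i H => c.run (H.setVar v i) with hF
    set n := ⌈H.var b⌉₊ with hn
    set g : ℕ → ℕ := fun i => c.cost ((rounds F i H).setVar v i) + 5 with hg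
    have hcc : ∀ u v, u ≠ v → ctr u ≠ ctr v := fun u v h => by simp only [ctr]; omega
    have hcc' := hcc (2 * l) (2 * l + 1) (by omega)
    -- Induction on the number `m` of remaining rounds; `s` is the state just before the test of
    -- round `i`.
    have key : ∀ (m i : ℕ) (s : State), i + m = n → Rep (rounds F i H) s →
        s.mem (ctr (2 * l)) = H.var b → s.mem (ctr (2 * l + 1)) = i →
        ∃ s', Exec (.whileLt (ctr (2 * l + 1)) (ctr (2 * l))
          (.seq (.seq (.seq (.seq (.instr (.const (tmp 0) 0))
            (.instr (.add (16 * v) (tmp 0) (ctr (2 * l + 1))))) (c.code (l + 1)))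
            (.instr (.const (tmp 0) 1)))
            (.instr (.add (ctr (2 * l + 1)) (ctr (2 * l + 1)) (tmp 0)))))
          s (1 + ∑ j ∈ Finset.Ico i n, g j) s' ∧ Rep (rounds F n H) s' ∧
          ∀ u < 2 * l, s'.mem (ctr u) = s.mem (ctr u) := by
      intro m
      induction m with
      | zero =>
        intro i s hi hr h1 h2
        obtain rfl : i = n := by omega
        refine ⟨s, ?_, hr, fun _ _ => rfl⟩
        simp only [Finset.Ico_self, Finset.sum_empty, add_zero]
        refine .whileFalse ?_
        rw [h1, h2, not_lt]
        exact Nat.le_ceil _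
      | succ m ihm =>
        intro i s hi hr h1 h2
        have hlt : (i : ℝ) < H.var b := Nat.lt_ceil.1 (by omega)
        have e₀ : (Instr.add (16 * v) (tmp 0) (ctr (2 * l + 1))).apply
            ((Instr.const (tmp 0) 0).apply s) = (s.write (tmp 0) 0).write (16 * v) i := by
          simp [Instr.apply, write_mem_ne (hct _ _), h2]
        have r₀ := (hr.write_tmp 0 0).write_var v i
        obtain ⟨s₁, x₁, r₁, k₁⟩ := ih (l + 1) _ _ r₀
        rw [← e₀] at x₁
        have X := ((((Exec.instr (Instr.const (tmp 0) 0) s).snoc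
          (Instr.add (16 * v) (tmp 0) (ctr (2 * l + 1)))).seq x₁).snoc
          (Instr.const (tmp 0) 1)).snoc (Instr.add (ctr (2 * l + 1)) (ctr (2 * l + 1)) (tmp 0))
        have e₁ : (Instr.add (ctr (2 * l + 1)) (ctr (2 * l + 1)) (tmp 0)).apply
            ((Instr.const (tmp 0) 1).apply s₁) =
            (s₁.write (tmp 0) 1).write (ctr (2 * l + 1)) ((i + 1 : ℕ) : ℝ) := by
          have := k₁ (2 * l + 1) (by omega)
          rw [write_mem_ne (hcv _ _), write_mem_ne (hct _ _), h2] at this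
          simp [Instr.apply, write_mem_ne (hct _ _), this]
        rw [e₁] at X
        obtain ⟨s₂, x₂, r₂, k₂⟩ := ihm (i + 1) _ (by omega)
          ((r₁.write_tmp 0 1).write_ctr (2 * l + 1) ((i + 1 : ℕ) : ℝ))
          (by rw [write_mem_ne hcc', write_mem_ne (hct _ _), k₁ _ (by omega),
              write_mem_ne (hcv _ _), write_mem_ne (hct _ _), h1])
          (by simp)
        refine ⟨s₂, ?_, r₂, fun u hu => ?_⟩
        · have := Exec.whileTrue (i := ctr (2 * l + 1)) (j := ctr (2 * l))
            (by rw [h1, h2]; exact hlt) X x₂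
          -- Two instructions copy the index to `v`, two advance it, and the test is one step: the 5
          -- in `Cmd.cost`.
          have ht : 1 + ∑ j ∈ Finset.Ico i n, g j = 1 + 1 + c.cost ((rounds F i H).setVar v i) +
              1 + 1 + (1 + ∑ j ∈ Finset.Ico (i + 1) n, g j) + 1 := by
            rw [Finset.sum_eq_sum_Ico_succ_bot (by omega), hg]
            ring
          rw [ht]
          exact this
        · rw [k₂ u hu, write_mem_ne (hcc _ _ (by omega)), write_mem_ne (hct _ _),
            k₁ u (by omega), write_mem_ne (hcv _ _), write_mem_ne (hct _ _)]
    have e₀ : (Instr.const (ctr (2 * l + 1)) 0).apply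
        ((Instr.add (ctr (2 * l)) (tmp 0) (16 * b)).apply ((Instr.const (tmp 0) 0).apply s)) =
        ((s.write (tmp 0) 0).write (ctr (2 * l)) (H.var b)).write (ctr (2 * l + 1)) 0 := by
      have : (16 * b) ≠ tmp 0 := by simp only [tmp]; omega
      simp [Instr.apply, write_mem_ne this, hs.var]
    have X := ((Exec.instr (Instr.const (tmp 0) 0) s).snoc
      (Instr.add (ctr (2 * l)) (tmp 0) (16 * b))).snoc (Instr.const (ctr (2 * l + 1)) 0)
    rw [e₀] at X
    obtain ⟨s', x', r', k'⟩ := key n 0 _ (by omega)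
      (((hs.write_tmp 0 0).write_ctr (2 * l) (H.var b)).write_ctr (2 * l + 1) 0)
      (by rw [write_mem_ne hcc', write_mem_self]) (by simp)
    refine ⟨s', ?_, r', fun u hu => ?_⟩
    · have := X.seq x'
      have ht : (Cmd.loop v b c).cost H = 1 + 1 + 1 + (1 + ∑ j ∈ Finset.Ico 0 n, g j) := by
        simp only [Cmd.cost, hg, hF, ← hn, Finset.range_eq_Ico]
        ring
      rw [ht]
      exact this
    · rw [k' u hu, write_mem_ne (hcc _ _ (by omega)), write_mem_ne (hcc _ _ (by omega)),
        write_mem_ne (hct _ _)]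

/-! ### Frames, coins and polynomial cost bounds -/

/-- The command does not change the variable `v`. -/
def Cmd.keepsVar (v : ℕ) : Cmd → Bool
  | .skip => true
  | .set u _ => u != v
  -- With a negative index, `put` writes to the variable 0.
  | .put _ _ _ => v != 0
  | .coin u => u != v
  | .emit _ => true
  | .seq c c' => c.keepsVar v && c'.keepsVar v
  | .ite _ _ c c' => c.keepsVar v && c'.keepsVar v
  | .loop u _ c => u != v && c.keepsVar v

/-- The command does not change the array `a`. -/
def Cmd.keepsArr (a : Fin 8) : Cmd → Bool
  | .put b _ _ => b != a
  | .seq c c' => c.keepsArr a && c'.keepsArr a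
  | .ite _ _ c c' => c.keepsArr a && c'.keepsArr a
  | .loop _ _ c => c.keepsArr a
  | _ => true

/-- The command outputs nothing. -/
def Cmd.silent : Cmd → Bool
  | .emit _ => false
  | .seq c c' => c.silent && c'.silent
  | .ite _ _ c c' => c.silent && c'.silent
  | .loop _ _ c => c.silent
  | _ => true

/-- The command uses no coins. -/
def Cmd.coinless : Cmd → Bool
  | .coin _ => false
  | .seq c c' => c.coinless && c'.coinless
  | .ite _ _ c c' => c.coinless && c'.coinless
  | .loop _ _ c => c.coinless
  | _ => true

theorem rounds_induction {P : ℕ → Store → Prop} {f : ℕ → Store → Store} {n : ℕ} {H : Store}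
    (h0 : P 0 H) (hs : ∀ i H, i < n → P i H → P (i + 1) (f i H)) : P n (rounds f n H) := by
  induction n with
  | zero => exact h0
  | succ n ih => exact hs n _ (Nat.lt_succ_self n) (ih fun i H hi => hs i H (by omega))

theorem Cmd.run_var {c : Cmd} {v : ℕ} (hc : c.keepsVar v = true) (H : Store) :
    (c.run H).var v = H.var v := by
  induction c generalizing H with
  | skip => rfl
  | set u e =>
    have : v ≠ u := by rintro rfl; simp [Cmd.keepsVar] at hc
    simp [Cmd.run, Store.setVar, Function.update_of_ne this]
  | put a e f =>
    have : v ≠ 0 := by simpa [Cmd.keepsVar] using hc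
    simp only [Cmd.run]
    split_ifs
    · rfl
    · simp [Store.setVar, Function.update_of_ne this]
  | coin u =>
    have : v ≠ u := by rintro rfl; simp [Cmd.keepsVar] at hc
    simp [Cmd.run, Store.setVar, Function.update_of_ne this]
  | emit e => rfl
  | seq c c' ih ih' =>
    simp only [Cmd.keepsVar, Bool.and_eq_true] at hc
    rw [Cmd.run, ih' hc.2, ih hc.1]
  | ite e f c c' ih ih' =>
    simp only [Cmd.keepsVar, Bool.and_eq_true] at hc
    simp only [Cmd.run]
    split_ifs
    · exact ih hc.1 H
    · exact ih' hc.2 H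
  | loop u b c ih =>
    simp only [Cmd.keepsVar, Bool.and_eq_true, bne_iff_ne, ne_eq] at hc
    exact rounds_induction (P := fun _ G => G.var v = H.var v) rfl fun i G _ hG => by
      rw [ih hc.2, ← hG]
      simp [Store.setVar, Function.update_of_ne (Ne.symm hc.1)]

theorem Cmd.run_arr {c : Cmd} {a : Fin 8} (hc : c.keepsArr a = true) (H : Store) :
    (c.run H).arr a = H.arr a := by
  induction c generalizing H with
  | skip | set | coin | emit => rfl
  | put b e f =>
    have : a ≠ b := by rintro rfl; simp [Cmd.keepsArr] at hc
    simp only [Cmd.run]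
    split_ifs
    · simp [Store.setArr, Function.update_of_ne this]
    · rfl
  | seq c c' ih ih' =>
    simp only [Cmd.keepsArr, Bool.and_eq_true] at hc
    rw [Cmd.run, ih' hc.2, ih hc.1]
  | ite e f c c' ih ih' =>
    simp only [Cmd.keepsArr, Bool.and_eq_true] at hc
    simp only [Cmd.run]
    split_ifs
    · exact ih hc.1 H
    · exact ih' hc.2 H
  | loop u b c ih =>
    exact rounds_induction (P := fun _ G => G.arr a = H.arr a) rfl fun i G _ hG => by
      rw [ih hc, ← hG]; rfl

theorem Cmd.run_inp (c : Cmd) (H : Store) : (c.run H).inp = H.inp := by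
  induction c generalizing H with
  | skip | set | coin | emit => rfl
  | put b e f => simp only [Cmd.run]; split_ifs <;> rfl
  | seq c c' ih ih' => rw [Cmd.run, ih', ih]
  | ite e f c c' ih ih' => simp only [Cmd.run]; split_ifs; exacts [ih H, ih' H]
  | loop u b c ih =>
    exact rounds_induction (P := fun _ G => G.inp = H.inp) rfl fun i G _ hG => by
      rw [ih, ← hG]; rfl

theorem Cmd.run_out {c : Cmd} (hc : c.silent = true) (H : Store) : (c.run H).out = H.out := by
  induction c generalizing H with
  | skip | set | coin => rfl
  | emit => simp [Cmd.silent] at hc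
  | put b e f => simp only [Cmd.run]; split_ifs <;> rfl
  | seq c c' ih ih' =>
    simp only [Cmd.silent, Bool.and_eq_true] at hc
    rw [Cmd.run, ih' hc.2, ih hc.1]
  | ite e f c c' ih ih' =>
    simp only [Cmd.silent, Bool.and_eq_true] at hc
    simp only [Cmd.run]; split_ifs; exacts [ih hc.1 H, ih' hc.2 H]
  | loop u b c ih =>
    exact rounds_induction (P := fun _ G => G.out = H.out) rfl fun i G _ hG => by
      rw [ih hc, ← hG]; rfl

/-- The same store with other coins. -/
def Store.withCoins (H : Store) (ω : Tape) : Store := { H with coins := ω }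

theorem Expr.eval_withCoins (e : Expr) (H : Store) (ω : Tape) :
    e.eval (H.withCoins ω) = e.eval H := by
  induction e with
  | lit | var => rfl
  | get a e ih => simp only [Expr.eval, ih]; rfl
  | inp e ih => simp only [Expr.eval, ih]; rfl
  | add e f he hf | sub e f he hf | mul e f he hf | div e f he hf => simp only [Expr.eval, he, hf]
  | floor e ih => simp only [Expr.eval, ih]

/-- This makes the result of the first phase of the sampler, in particular the greedy cover,
independent of the tape. -/
theorem Cmd.run_withCoins {c : Cmd} (hc : c.coinless = true) (H : Store) (ω : Tape) :
    c.run (H.withCoins ω) = (c.run H).withCoins ω := by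
  induction c generalizing H with
  | skip => rfl
  | coin => simp [Cmd.coinless] at hc
  | set v e => simp only [Cmd.run, Expr.eval_withCoins]; rfl
  | emit e => simp only [Cmd.run, Expr.eval_withCoins]; rfl
  | put b e f => simp only [Cmd.run, Expr.eval_withCoins]; split_ifs <;> rfl
  | seq c c' ih ih' =>
    simp only [Cmd.coinless, Bool.and_eq_true] at hc
    rw [Cmd.run, Cmd.run, ih hc.1, ih' hc.2]
  | ite e f c c' ih ih' =>
    simp only [Cmd.coinless, Bool.and_eq_true] at hc
    simp only [Cmd.run, Expr.eval_withCoins]; split_ifs; exacts [ih hc.1 H, ih' hc.2 H]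
  | loop u b c ih =>
    simp only [Cmd.run]
    change rounds _ ⌈H.var b⌉₊ _ = _
    generalize ⌈H.var b⌉₊ = n
    induction n with
    | zero => rfl
    | succ n ihn =>
      simp only [rounds, ihn]
      exact ih hc ((rounds (fun i H => c.run (H.setVar u i)) n H).setVar u n)

/-- The loop bounds of a command. -/
def Cmd.bounds : Cmd → List ℕ
  | .seq c c' => c.bounds ++ c'.bounds
  | .ite _ _ c c' => c.bounds ++ c'.bounds
  | .loop _ b c => b :: c.bounds
  | _ => []

/-- The size of a command. -/
def Cmd.size : Cmd → ℕ
  | .skip => 1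
  | .set _ e => e.cost + 2
  | .put _ e f => e.cost + f.cost + 6
  | .coin _ => 1
  | .emit e => e.cost + 1
  | .seq c c' => c.size + c'.size
  | .ite e f c c' => e.cost + f.cost + c.size + c'.size + 1
  | .loop _ _ c => c.size + 9

/-- The nesting depth of the loops. -/
def Cmd.depth : Cmd → ℕ
  | .seq c c' => max c.depth c'.depth
  | .ite _ _ c c' => max c.depth c'.depth
  | .loop _ _ c => c.depth + 1
  | _ => 0

/-- If the loop bounds never change, each loop has at most `B` rounds at any time, and each level of
nesting costs a factor `B + 1`. The list `l` stays fixed in the induction because a subcommand has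
to preserve the bounds of the whole command and not only its own. -/
theorem Cmd.cost_le_of_subset {B : ℕ} (c : Cmd) (l : List ℕ) (hl : ∀ b ∈ l, c.keepsVar b = true)
    (hc : ∀ b ∈ c.bounds, b ∈ l) (H : Store) (hB : ∀ b ∈ l, H.var b ≤ B) :
    c.cost H ≤ c.size * (B + 1) ^ c.depth := by
  have hone : ∀ n, 1 ≤ (B + 1) ^ n := fun n => Nat.one_le_pow _ _ (by omega)
  induction c generalizing H with
  | skip | set | put | coin | emit => simp [Cmd.cost, Cmd.size, Cmd.depth]
  | seq c c' ih ih' =>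
    simp only [Cmd.keepsVar, Bool.and_eq_true, Cmd.bounds, List.mem_append] at hl hc
    have h1 := ih (fun b hb => (hl b hb).1) (fun b hb => hc b (.inl hb)) H hB
    have h2 := ih' (fun b hb => (hl b hb).2) (fun b hb => hc b (.inr hb)) (c.run H)
      (fun b hb => by rw [Cmd.run_var (hl b hb).1]; exact hB b hb)
    simp only [Cmd.cost, Cmd.size, Cmd.depth]
    calc _ ≤ c.size * (B + 1) ^ c.depth + c'.size * (B + 1) ^ c'.depth := add_le_add h1 h2
      _ ≤ c.size * (B + 1) ^ max c.depth c'.depth + c'.size * (B + 1) ^ max c.depth c'.depth := by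
        gcongr <;> omega
      _ = _ := by ring
  | ite e f c c' ih ih' =>
    simp only [Cmd.keepsVar, Bool.and_eq_true, Cmd.bounds, List.mem_append] at hl hc
    have h1 := ih (fun b hb => (hl b hb).1) (fun b hb => hc b (.inl hb)) H hB
    have h2 := ih' (fun b hb => (hl b hb).2) (fun b hb => hc b (.inr hb)) H hB
    simp only [Cmd.cost, Cmd.size, Cmd.depth]
    have h1' : c.size * (B + 1) ^ c.depth ≤ c.size * (B + 1) ^ max c.depth c'.depth := by
      gcongr <;> omega
    have h2' : c'.size * (B + 1) ^ c'.depth ≤ c'.size * (B + 1) ^ max c.depth c'.depth := by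
      gcongr <;> omega
    have h3 := hone (max c.depth c'.depth)
    have h4 : e.cost + f.cost + 1 ≤ (e.cost + f.cost + 1) * (B + 1) ^ max c.depth c'.depth :=
      Nat.le_mul_of_pos_right _ h3
    have : (if e.eval H < f.eval H then c.cost H else c'.cost H) ≤
        c.size * (B + 1) ^ max c.depth c'.depth + c'.size * (B + 1) ^ max c.depth c'.depth := by
      split_ifs <;> omega
    calc _ ≤ (e.cost + f.cost + 1) * (B + 1) ^ max c.depth c'.depth +
        (c.size * (B + 1) ^ max c.depth c'.depth +
          c'.size * (B + 1) ^ max c.depth c'.depth) := by omega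
      _ = _ := by ring
  | loop v b c ih =>
    simp only [Cmd.keepsVar, Bool.and_eq_true, Cmd.bounds, List.mem_cons, bne_iff_ne, ne_eq]
      at hl hc
    have hn : ⌈H.var b⌉₊ ≤ B := Nat.ceil_le.2 (hB b (hc b (.inl rfl)))
    simp only [Cmd.cost, Cmd.size, Cmd.depth]
    set F : ℕ → Store → Store := fun i H => c.run (H.setVar v i) with hF
    have hpow := hone c.depth
    have hb : ∀ i ∈ Finset.range ⌈H.var b⌉₊,
        c.cost ((rounds F i H).setVar v i) + 5 ≤ (c.size + 5) * (B + 1) ^ c.depth := by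
      intro i _
      have hrec : ∀ u ∈ l, (rounds F i H).var u = H.var u := fun u hu =>
        rounds_induction (P := fun _ G => G.var u = H.var u) rfl fun j G _ hG => by
          rw [hF, Cmd.run_var (hl u hu).2, ← hG]
          simp [Store.setVar, Function.update_of_ne (Ne.symm (hl u hu).1)]
      have h1 := ih (fun u hu => (hl u hu).2) (fun u hu => hc u (.inr hu))
        ((rounds F i H).setVar v i) (fun u hu => by
          have : u ≠ v := Ne.symm (hl u hu).1
          simp only [Store.setVar, Function.update_of_ne this, hrec u hu]
          exact hB u hu)
      have h5 : 5 ≤ 5 * (B + 1) ^ c.depth := Nat.le_mul_of_pos_right _ hpow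
      rw [add_mul]
      omega
    have h1 := Finset.sum_le_card_nsmul _ _ _ hb
    rw [Finset.card_range, smul_eq_mul] at h1
    have h2 : ⌈H.var b⌉₊ * ((c.size + 5) * (B + 1) ^ c.depth) ≤
        B * ((c.size + 5) * (B + 1) ^ c.depth) := by gcongr
    calc _ ≤ 4 * (B + 1) ^ (c.depth + 1) + B * ((c.size + 5) * (B + 1) ^ c.depth) := by
          have := Nat.le_mul_of_pos_right 4 (hone (c.depth + 1))
          omega
      _ ≤ 4 * (B + 1) ^ (c.depth + 1) + (B + 1) * ((c.size + 5) * (B + 1) ^ c.depth) := by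
          gcongr; omega
      _ = _ := by ring

theorem Cmd.cost_le {B : ℕ} (c : Cmd) (hc : c.bounds.all (fun b => c.keepsVar b) = true)
    (H : Store) (hB : ∀ b ∈ c.bounds, H.var b ≤ B) : c.cost H ≤ c.size * (B + 1) ^ c.depth :=
  c.cost_le_of_subset c.bounds (by simpa using hc) (fun _ h => h) H hB

end RealRAM

namespace FilterLSF

/-! ### Splitting a vector along a binary tree of plane rotations -/

/-- Rational parametrization of `√2 cos` on a quarter of the circle. -/
noncomputable def cosPar (s : ℝ) : ℝ := (1 + 2 * s - s * s) / (1 + s * s)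

/-- Rational parametrization of `√2 sin` on a quarter of the circle. -/
noncomputable def sinPar (s : ℝ) : ℝ := (s * s + 2 * s - 1) / (1 + s * s)

/-- The parameters 0 and 1 give (1, -1) and (1, 1), a quarter turn apart. A rational parametrization
with radius √2 instead of 1 keeps the tree within the arithmetic of the machine, which has no roots.
-/
theorem cosPar_sq_add_sinPar_sq (s : ℝ) : cosPar s ^ 2 + sinPar s ^ 2 = 2 := by
  have : 1 + s * s ≠ 0 := by nlinarith [mul_self_nonneg s]
  simp only [cosPar, sinPar]
  field_simp
  ring

theorem abs_cosPar_le (s : ℝ) : |cosPar s| ≤ 2 :=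
  abs_le_of_sq_le_sq (by nlinarith [cosPar_sq_add_sinPar_sq s, sq_nonneg (sinPar s)]) (by norm_num)

theorem abs_sinPar_le (s : ℝ) : |sinPar s| ≤ 2 :=
  abs_le_of_sq_le_sq (by nlinarith [cosPar_sq_add_sinPar_sq s, sq_nonneg (cosPar s)]) (by norm_num)

theorem abs_div_le_of_den {a D c : ℝ} (hD : 0 < D) (h1 : a ≤ c * D) (h2 : -(c * D) ≤ a) :
    |a / D| ≤ c := by
  rw [abs_le]
  constructor
  · rw [le_div_iff₀ hD]; linarith
  · rw [div_le_iff₀ hD]; exact h1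

/-- The difference quotient is a rational function with denominator (1 + s²)(1 + r²), and its
numerator is at most four times as large. -/
theorem abs_cosPar_sub_le (s r : ℝ) : |cosPar s - cosPar r| ≤ 4 * |s - r| := by
  have hs : 0 < 1 + s * s := by nlinarith [mul_self_nonneg s]
  have hr : 0 < 1 + r * r := by nlinarith [mul_self_nonneg r]
  have : cosPar s - cosPar r =
      (s - r) * ((2 * (1 - s * r) - 2 * (s + r)) / ((1 + s * s) * (1 + r * r))) := by
    simp only [cosPar]
    field_simp
    ring
  rw [this, abs_mul, mul_comm]
  gcongr
  refine abs_div_le_of_den (by positivity) ?_ ?_ <;>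
  nlinarith [sq_nonneg (s + r), sq_nonneg (s - r), sq_nonneg (s * r - 1), sq_nonneg (s * r + 1),
    sq_nonneg (1 - s), sq_nonneg (1 - r), sq_nonneg (1 + s), sq_nonneg (1 + r)]

theorem abs_sinPar_sub_le (s r : ℝ) : |sinPar s - sinPar r| ≤ 4 * |s - r| := by
  have hs : 0 < 1 + s * s := by nlinarith [mul_self_nonneg s]
  have hr : 0 < 1 + r * r := by nlinarith [mul_self_nonneg r]
  have : sinPar s - sinPar r =
      (s - r) * ((2 * (1 - s * r) + 2 * (s + r)) / ((1 + s * s) * (1 + r * r))) := by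
    simp only [sinPar]
    field_simp
    ring
  rw [this, abs_mul, mul_comm]
  gcongr
  refine abs_div_le_of_den (by positivity) ?_ ?_ <;>
  nlinarith [sq_nonneg (s + r), sq_nonneg (s - r), sq_nonneg (s * r - 1), sq_nonneg (s * r + 1),
    sq_nonneg (1 - s), sq_nonneg (1 - r), sq_nonneg (1 + s), sq_nonneg (1 + r)]

/-- A discrete intermediate value theorem: values larger than `δ` in modulus cannot change their
sign in steps of size at most `δ`, but `f S = -f 0` requires a change. -/
theorem exists_abs_le_of_antisymm {f : ℕ → ℝ} {S : ℕ} {δ : ℝ} (hS : 0 < S) (hf : f S = -f 0)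
    (hδ : ∀ j < S, |f (j + 1) - f j| ≤ δ) : ∃ j < S, |f j| ≤ δ := by
  have main : ∀ g : ℕ → ℝ, g S = -g 0 → (∀ j < S, |g (j + 1) - g j| ≤ δ) →
      (∀ j < S, δ < |g j|) → g 0 ≤ 0 := by
    intro g h1 h2 h3
    by_contra! h0
    have : ∀ j ≤ S, 0 < g j := by
      intro j
      induction j with
      | zero => intro _; exact h0
      | succ j ih =>
        intro hj
        have h4 := ih (by omega)
        have h5 := h3 j (by omega)
        rw [abs_of_pos h4] at h5
        have h6 := (abs_le.1 (h2 j (by omega))).1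
        linarith
    linarith [this S le_rfl]
  by_contra! h
  have h1 := main f hf hδ h
  have h2 := main (fun j => -f j) (by simp [hf])
    (fun j hj => by rw [← abs_neg]; convert hδ j hj using 2; ring)
    (fun j hj => by rw [abs_neg]; exact h j hj)
  have h0 : f 0 = 0 := by linarith
  have h3 := h 0 hS
  rw [h0, abs_zero] at h3
  exact absurd ((abs_nonneg _).trans (hδ 0 hS)) (not_le.2 h3)

/-- The vectors in a binary tree of rotations: the vector at the node `p` is split between the
nodes `2 p` and `2 p + 1` by the rotation with parameter `σ p`. -/
noncomputable def node (σ : ℕ → ℝ) (x : ℕ → ℝ) (q : ℕ) : ℕ → ℝ :=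
  if _h : q ≤ 1 then x
  else fun j =>
    if q % 2 = 0 then
      cosPar (σ (q / 2)) * node σ x (q / 2) (2 * j) +
        sinPar (σ (q / 2)) * node σ x (q / 2) (2 * j + 1)
    else
      cosPar (σ (q / 2)) * node σ x (q / 2) (2 * j + 1) -
        sinPar (σ (q / 2)) * node σ x (q / 2) (2 * j)
termination_by q
decreasing_by all_goals omega

theorem node_one (σ x : ℕ → ℝ) : node σ x 1 = x := by
  rw [node]; simp

theorem node_even (σ x : ℕ → ℝ) {p : ℕ} (hp : 1 ≤ p) (j : ℕ) :
    node σ x (2 * p) j =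
      cosPar (σ p) * node σ x p (2 * j) + sinPar (σ p) * node σ x p (2 * j + 1) := by
  rw [node, dif_neg (by omega)]
  simp

theorem node_odd (σ x : ℕ → ℝ) {p : ℕ} (hp : 1 ≤ p) (j : ℕ) :
    node σ x (2 * p + 1) j =
      cosPar (σ p) * node σ x p (2 * j + 1) - sinPar (σ p) * node σ x p (2 * j) := by
  rw [node, dif_neg (by omega)]
  have h1 : (2 * p + 1) / 2 = p := by omega
  have h2 : (2 * p + 1) % 2 ≠ 0 := by omega
  simp [h1]

theorem node_induction {P : ℕ → Prop} (h1 : P 1) (h : ∀ p, 1 ≤ p → P p → P (2 * p) ∧ P (2 * p + 1))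
    {q : ℕ} (hq : 1 ≤ q) : P q := by
  induction q using Nat.strong_induction_on with
  | _ q ih =>
    rcases Nat.lt_or_ge 1 q with hq1 | hq1
    · have h2 := h (q / 2) (by omega) (ih (q / 2) (by omega) (by omega))
      rcases Nat.mod_two_eq_zero_or_one q with h3 | h3
      · have : 2 * (q / 2) = q := by omega
        rw [this] at h2; exact h2.1
      · have : 2 * (q / 2) + 1 = q := by omega
        rw [this] at h2; exact h2.2
    · obtain rfl : q = 1 := by omega
      exact h1

/-- The ancestors of a node have smaller numbers, so the parameters can be chosen one after the
other in the order of the nodes. -/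
theorem node_congr {σ τ x : ℕ → ℝ} {q : ℕ} (hq : 1 ≤ q) (h : ∀ p, 1 ≤ p → p < q → σ p = τ p) :
    node σ x q = node τ x q := by
  revert h
  refine node_induction (P := fun q => (∀ p, 1 ≤ p → p < q → σ p = τ p) →
    node σ x q = node τ x q) (fun _ => by rw [node_one, node_one]) (fun p hp ih => ?_) hq
  constructor <;> intro h <;> funext j
  · rw [node_even _ _ hp, node_even _ _ hp, ih fun r h1 h2 => h r h1 (by omega),
      h p hp (by omega)]
  · rw [node_odd _ _ hp, node_odd _ _ hp, ih fun r h1 h2 => h r h1 (by omega),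
      h p hp (by omega)]

theorem node_add (σ x y : ℕ → ℝ) {q : ℕ} (hq : 1 ≤ q) :
    node σ (x + y) q = node σ x q + node σ y q := by
  refine node_induction (P := fun q => node σ (x + y) q = node σ x q + node σ y q)
    (by simp [node_one]) (fun p hp ih => ?_) hq
  constructor <;> funext j
  · simp only [node_even _ _ hp, ih, Pi.add_apply]; ring
  · simp only [node_odd _ _ hp, ih, Pi.add_apply]; ring

theorem node_smul (σ x : ℕ → ℝ) (a : ℝ) {q : ℕ} (hq : 1 ≤ q) :
    node σ (a • x) q = a • node σ x q := by
  refine node_induction (P := fun q => node σ (a • x) q = a • node σ x q)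
    (by simp [node_one]) (fun p hp ih => ?_) hq
  constructor <;> funext j
  · simp only [node_even _ _ hp, ih, Pi.smul_apply, smul_eq_mul]; ring
  · simp only [node_odd _ _ hp, ih, Pi.smul_apply, smul_eq_mul]; ring

/-- The vector at a node as a linear function of the vector at the root. -/
noncomputable def nodeLin (σ : ℕ → ℝ) {q : ℕ} (hq : 1 ≤ q) : (ℕ → ℝ) →ₗ[ℝ] (ℕ → ℝ) where
  toFun x := node σ x q
  map_add' x y := node_add σ x y hq
  map_smul' a x := node_smul σ x a hq

theorem node_eq_zero {σ x : ℕ → ℝ} {q D : ℕ} (hq : 1 ≤ q) (hx : ∀ j, D ≤ j → x j = 0) :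
    ∀ j, D ≤ j → node σ x q j = 0 := by
  refine node_induction (P := fun q => ∀ j, D ≤ j → node σ x q j = 0)
    (by simpa [node_one] using hx) (fun p hp ih => ?_) hq
  constructor <;> intro j hj
  · rw [node_even _ _ hp, ih _ (by omega), ih _ (by omega)]; simp
  · rw [node_odd _ _ hp, ih _ (by omega), ih _ (by omega)]; simp

/-- Each split uses up two entries of the parent for one entry of a child, so the support halves
from level to level. -/
theorem node_eq_zero_of_level {σ x : ℕ → ℝ} {r q D : ℕ} (h1 : 2 ^ r ≤ q) (h2 : q < 2 ^ (r + 1))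
    (hx : ∀ j, 2 ^ r * D ≤ j → x j = 0) : ∀ j, D ≤ j → node σ x q j = 0 := by
  induction r generalizing q D with
  | zero =>
    obtain rfl : q = 1 := by simp at h1 h2; omega
    simpa [node_one] using hx
  | succ r ih =>
    intro j hj
    have h3 : 2 ^ r ≤ q / 2 := by rw [pow_succ] at h1; omega
    have h4 : q / 2 < 2 ^ (r + 1) := by rw [pow_succ] at h2; omega
    have h5 : 1 ≤ q / 2 := le_trans Nat.one_le_two_pow h3
    have h6 := ih (D := 2 * D) h3 h4 (fun j hj => hx j (by rw [pow_succ]; linarith))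
    rcases Nat.mod_two_eq_zero_or_one q with h7 | h7
    · have : q = 2 * (q / 2) := by omega
      rw [this, node_even _ _ h5, h6 _ (by omega), h6 _ (by omega)]; simp
    · have : q = 2 * (q / 2) + 1 := by omega
      rw [this, node_odd _ _ h5, h6 _ (by omega), h6 _ (by omega)]; simp

/-- The sum of the squares of the first `D` entries. -/
def energy (D : ℕ) (u : ℕ → ℝ) : ℝ := ∑ j ∈ Finset.range D, u j ^ 2

theorem energy_nonneg (D : ℕ) (u : ℕ → ℝ) : 0 ≤ energy D u :=
  Finset.sum_nonneg fun _ _ => sq_nonneg _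

theorem sum_range_two_mul (D : ℕ) (f : ℕ → ℝ) :
    ∑ j ∈ Finset.range (2 * D), f j = ∑ j ∈ Finset.range D, (f (2 * j) + f (2 * j + 1)) := by
  induction D with
  | zero => simp
  | succ D ih =>
    rw [Nat.mul_succ, Finset.sum_range_succ, Finset.sum_range_succ, ih, Finset.sum_range_succ]
    ring

theorem energy_eq_of_le {D D' : ℕ} {u : ℕ → ℝ} (h : D ≤ D') (hu : ∀ j, D ≤ j → u j = 0) :
    energy D' u = energy D u := by
  refine (Finset.sum_subset (by simpa using h) fun j _ hj => ?_).symm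
  rw [hu j (by simpa using hj)]; simp

/-- A rotation scaled by √2 doubles the squared length of every pair. Since the entries beyond the
support vanish, the same `D` serves for all levels of the tree. -/
theorem energy_node_add {σ x : ℕ → ℝ} {p D : ℕ} (hp : 1 ≤ p) (hx : ∀ j, D ≤ j → x j = 0) :
    energy D (node σ x (2 * p)) + energy D (node σ x (2 * p + 1)) = 2 * energy D (node σ x p) := by
  have h1 : energy D (node σ x p) = energy (2 * D) (node σ x p) :=
    (energy_eq_of_le (by omega) (node_eq_zero hp hx)).symm
  rw [h1]
  simp only [energy]
  rw [sum_range_two_mul, ← Finset.sum_add_distrib, Finset.mul_sum]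
  refine Finset.sum_congr rfl fun j _ => ?_
  rw [node_even _ _ hp, node_odd _ _ hp]
  have := cosPar_sq_add_sinPar_sq (σ p)
  linear_combination (node σ x p (2 * j) ^ 2 + node σ x p (2 * j + 1) ^ 2) * this

theorem sum_energy_node {σ x : ℕ → ℝ} {D : ℕ} (hx : ∀ j, D ≤ j → x j = 0) (r : ℕ) :
    ∑ i ∈ Finset.range (2 ^ r), energy D (node σ x (2 ^ r + i)) = 2 ^ r * energy D x := by
  induction r with
  | zero => simp [node_one]
  | succ r ih =>
    have : 2 ^ (r + 1) = 2 * 2 ^ r := by ring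
    rw [this, sum_range_two_mul]
    have h : ∀ i, energy D (node σ x (2 * 2 ^ r + 2 * i)) +
        energy D (node σ x (2 * 2 ^ r + (2 * i + 1))) = 2 * energy D (node σ x (2 ^ r + i)) := by
      intro i
      have h1 := energy_node_add (σ := σ) (p := 2 ^ r + i)
        (le_trans Nat.one_le_two_pow (Nat.le_add_right _ _)) hx
      rw [← h1]
      congr 3 <;> ring
    rw [Finset.sum_congr rfl fun i _ => h i, ← Finset.mul_sum, ih]
    ring

/-- The energy of the first child is a quadratic form a²A + b²B + 2abP in the entries of the
rotation. At the two ends of the quarter turn it deviates from A + B by -2P and by 2P, so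
`exists_abs_le_of_antisymm` applies. Neighbouring parameters change it by at most (16/S)(|A - B| +
|2P|), and both moduli are at most A + B. -/
theorem exists_balanced_split {S D : ℕ} (hS : 0 < S) {u : ℕ → ℝ} (hu : ∀ j, D ≤ j → u j = 0) :
    ∃ j < S, |energy D (fun i => cosPar (j / S) * u (2 * i) + sinPar (j / S) * u (2 * i + 1)) -
      energy D u| ≤ 32 / S * energy D u := by
  have hS' : (0 : ℝ) < S := by exact_mod_cast hS
  set A := ∑ i ∈ Finset.range D, u (2 * i) ^ 2 with hA
  set B := ∑ i ∈ Finset.range D, u (2 * i + 1) ^ 2 with hB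
  set P := ∑ i ∈ Finset.range D, u (2 * i) * u (2 * i + 1) with hP
  have hE : energy D u = A + B := by
    rw [← energy_eq_of_le (D' := 2 * D) (by omega) hu, energy, sum_range_two_mul,
      Finset.sum_add_distrib]
  have hf : ∀ a b : ℝ, energy D (fun i => a * u (2 * i) + b * u (2 * i + 1)) =
      a ^ 2 * A + b ^ 2 * B + 2 * (a * b) * P := by
    intro a b
    simp only [energy, hA, hB, hP, Finset.mul_sum, ← Finset.sum_add_distrib]
    refine Finset.sum_congr rfl fun i _ => by ring
  have hA0 : 0 ≤ A := Finset.sum_nonneg fun _ _ => sq_nonneg _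
  have hB0 : 0 ≤ B := Finset.sum_nonneg fun _ _ => sq_nonneg _
  have hP1 : |2 * P| ≤ A + B := by
    have h1 : 0 ≤ A + B - 2 * P := by
      have : A + B - 2 * P = ∑ i ∈ Finset.range D, (u (2 * i) - u (2 * i + 1)) ^ 2 := by
        simp only [hA, hB, hP, Finset.mul_sum, ← Finset.sum_add_distrib, ← Finset.sum_sub_distrib]
        refine Finset.sum_congr rfl fun i _ => by ring
      rw [this]; exact Finset.sum_nonneg fun _ _ => sq_nonneg _
    have h2 : 0 ≤ A + B + 2 * P := by
      have : A + B + 2 * P = ∑ i ∈ Finset.range D, (u (2 * i) + u (2 * i + 1)) ^ 2 := by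
        simp only [hA, hB, hP, Finset.mul_sum, ← Finset.sum_add_distrib]
        refine Finset.sum_congr rfl fun i _ => by ring
      rw [this]; exact Finset.sum_nonneg fun _ _ => sq_nonneg _
    rw [abs_le]; constructor <;> linarith
  refine exists_abs_le_of_antisymm (f := fun j : ℕ => energy D
    (fun i => cosPar (j / S) * u (2 * i) + sinPar (j / S) * u (2 * i + 1)) - energy D u) hS ?_ ?_
  · have h1 : ((S : ℕ) : ℝ) / S = 1 := div_self hS'.ne'
    simp only [hf, hE, h1, Nat.cast_zero, zero_div]
    norm_num [cosPar, sinPar]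
  · intro j _
    simp only [hf, hE]
    set s : ℝ := ((j + 1 : ℕ) : ℝ) / S
    set r : ℝ := (j : ℝ) / S
    have hsr : |s - r| = 1 / S := by
      have : s - r = 1 / S := by simp only [s, r]; push_cast; ring
      rw [this, abs_of_pos (by positivity)]
    have h1 := abs_cosPar_sub_le s r
    have h2 := abs_sinPar_sub_le s r
    rw [hsr] at h1 h2
    have hs := cosPar_sq_add_sinPar_sq s
    have hr := cosPar_sq_add_sinPar_sq r
    have key : cosPar s ^ 2 * A + sinPar s ^ 2 * B + 2 * (cosPar s * sinPar s) * P - (A + B) -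
        (cosPar r ^ 2 * A + sinPar r ^ 2 * B + 2 * (cosPar r * sinPar r) * P - (A + B)) =
        (cosPar s ^ 2 - cosPar r ^ 2) * (A - B) +
          (cosPar s * sinPar s - cosPar r * sinPar r) * (2 * P) := by
      linear_combination B * hs - B * hr
    rw [key]
    have h3 : |cosPar s ^ 2 - cosPar r ^ 2| ≤ 16 / S := by
      have : cosPar s ^ 2 - cosPar r ^ 2 = (cosPar s - cosPar r) * (cosPar s + cosPar r) := by ring
      rw [this, abs_mul]
      have h4 : |cosPar s + cosPar r| ≤ 4 := (abs_add_le _ _).trans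
        (by linarith [abs_cosPar_le s, abs_cosPar_le r])
      calc _ ≤ 4 * (1 / (S : ℝ)) * 4 := by gcongr
        _ = _ := by ring
    have h5 : |cosPar s * sinPar s - cosPar r * sinPar r| ≤ 16 / S := by
      have : cosPar s * sinPar s - cosPar r * sinPar r =
          cosPar s * (sinPar s - sinPar r) + (cosPar s - cosPar r) * sinPar r := by ring
      rw [this]
      refine (abs_add_le _ _).trans ?_
      rw [abs_mul, abs_mul]
      calc _ ≤ 2 * (4 * (1 / (S : ℝ))) + 4 * (1 / (S : ℝ)) * 2 := by
            gcongr
            exacts [abs_cosPar_le s, abs_sinPar_le r]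
        _ = _ := by ring
    have h6 : |A - B| ≤ A + B := by rw [abs_le]; constructor <;> linarith
    refine (abs_add_le _ _).trans ?_
    rw [abs_mul, abs_mul]
    calc _ ≤ 16 / (S : ℝ) * (A + B) + 16 / (S : ℝ) * (A + B) := by gcongr
      _ = _ := by ring

/-- The step from `n` to `n + 1` fixes the angle at the node `n` and thereby its two children. The
crude bound `q` for the energy of the node `q` turns the relative error 32/S of the new split into
32n/S, and together with the error 32n/S of the parent this is at most 32/S times the number of a
child. -/
theorem exists_balanced_tree {S D : ℕ} (hS : 0 < S) {x : ℕ → ℝ} (hx : ∀ j, D ≤ j → x j = 0)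
    (hx1 : energy D x = 1) (n : ℕ) : ∃ f : ℕ → ℕ, (∀ p, f p < S) ∧
      ∀ q, 1 ≤ q → q < 2 * n → energy D (node (fun p => (f p : ℝ) / S) x q) ≤ q ∧
        |energy D (node (fun p => (f p : ℝ) / S) x q) - 1| ≤ 32 / S * q := by
  induction n with
  | zero => exact ⟨fun _ => 0, fun _ => hS, fun q _ h => by omega⟩
  | succ n ih =>
    obtain ⟨f, hf, h⟩ := ih
    have hSr : (0 : ℝ) < S := by exact_mod_cast hS
    rcases Nat.eq_zero_or_pos n with rfl | hn
    · refine ⟨f, hf, fun q h1 h2 => ?_⟩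
      obtain rfl : q = 1 := by omega
      rw [node_one, hx1]
      simp only [Nat.cast_one, sub_self, abs_zero, mul_one, le_refl, true_and]
      positivity
    obtain ⟨j, hj, hb⟩ := exists_balanced_split hS
      (node_eq_zero (σ := fun p => (f p : ℝ) / S) (x := x) hn hx)
    set g := Function.update f n j with hg
    have hgq : ∀ q, 1 ≤ q → q ≤ n → node (fun p => (g p : ℝ) / S) x q =
        node (fun p => (f p : ℝ) / S) x q := fun q h1 h2 =>
      node_congr h1 fun p _ hp => by
        rw [hg, Function.update_of_ne (by omega)]
    -- The parent of such a node has a number below `n`, so the new parameter at `n` affects none of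
    -- them.
    have hgq' : ∀ q, 1 ≤ q → q < 2 * n → node (fun p => (g p : ℝ) / S) x q =
        node (fun p => (f p : ℝ) / S) x q := by
      intro q h1 h2
      rcases Nat.lt_or_ge 1 q with hq1 | hq1
      · have h3 := hgq (q / 2) (by omega) (by omega)
        have h4 : g (q / 2) = f (q / 2) := by rw [hg, Function.update_of_ne (by omega)]
        funext i
        rcases Nat.mod_two_eq_zero_or_one q with h5 | h5
        · have : q = 2 * (q / 2) := by omega
          rw [this, node_even _ _ (by omega), node_even _ _ (by omega), h3, h4]
        · have : q = 2 * (q / 2) + 1 := by omega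
          rw [this, node_odd _ _ (by omega), node_odd _ _ (by omega), h3, h4]
      · obtain rfl : q = 1 := by omega
        rw [node_one, node_one]
    have hgn : g n = j := by simp [hg]
    refine ⟨g, fun p => ?_, fun q h1 h2 => ?_⟩
    · by_cases hp : p = n
      · rw [hp, hgn]; exact hj
      · rw [hg, Function.update_of_ne hp]; exact hf p
    rcases Nat.lt_or_ge q (2 * n) with h3 | h3
    · rw [hgq' q h1 h3]; exact h q h1 h3
    have hn' := h n hn (by omega)
    have hadd := energy_node_add (σ := fun p => (g p : ℝ) / S) hn hx
    have hev : energy D (node (fun p => (g p : ℝ) / S) x (2 * n)) = energy D (fun i =>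
        cosPar (j / S) * node (fun p => (f p : ℝ) / S) x n (2 * i) +
        sinPar (j / S) * node (fun p => (f p : ℝ) / S) x n (2 * i + 1)) := by
      congr 1
      funext i
      rw [node_even _ _ hn, hgn, hgq n hn le_rfl]
    rw [hgq n hn le_rfl] at hadd
    rw [← hev] at hb
    set e := energy D (node (fun p => (f p : ℝ) / S) x n)
    set e₀ := energy D (node (fun p => (g p : ℝ) / S) x (2 * n))
    set e₁ := energy D (node (fun p => (g p : ℝ) / S) x (2 * n + 1))
    have he : 32 / (S : ℝ) * e ≤ 32 / (S : ℝ) * n := by gcongr; exact hn'.1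
    have hb' := abs_le.1 hb
    have hc' := abs_le.1 hn'.2
    have h0 : 0 ≤ e₀ := energy_nonneg _ _
    have h1 : 0 ≤ e₁ := energy_nonneg _ _
    have hpos : 0 ≤ 32 / (S : ℝ) := by positivity
    obtain rfl | rfl : q = 2 * n ∨ q = 2 * n + 1 := by omega
    · push_cast
      refine ⟨by linarith [hn'.1], abs_le.2 ⟨by linarith, by linarith⟩⟩
    · push_cast
      refine ⟨by linarith [hn'.1], abs_le.2 ⟨by linarith, by linarith⟩⟩

end FilterLSF

namespace FilterLSF

/-! ### Orthogonal decompositions -/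

theorem applyMat_apply {d' d : ℕ} (A : Matrix (Fin d') (Fin d) ℝ) (x : E d) (l : Fin d') :
    applyMat A x l = ∑ b, A l b * x b := rfl

/-- An isometry between spaces of equal dimension is onto, and the rows are the preimages of the
standard basis. So conservation of energy in the tree replaces any computation with inner products
of rows. -/
theorem isOrthDecomp_of_isometry {k d' d : ℕ} {P : Fin k → Matrix (Fin d') (Fin d) ℝ}
    (hd : k * d' = d) (h : ∀ x : E d, ∑ i, ‖applyMat (P i) x‖ ^ 2 = ‖x‖ ^ 2) :
    IsOrthDecomp P := by
  let T₀ : E d →ₗ[ℝ] EuclideanSpace ℝ (Fin k × Fin d') :=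
    { toFun := fun x => WithLp.toLp 2 fun q => ∑ b, P q.1 q.2 b * x b
      map_add' := fun x y => by
        ext q; simp [mul_add, Finset.sum_add_distrib]
      map_smul' := fun a x => by
        ext q
        simp only [PiLp.smul_apply, smul_eq_mul, RingHom.id_apply, Finset.mul_sum]
        exact Finset.sum_congr rfl fun b _ => by ring }
  let T : E d →ₗᵢ[ℝ] EuclideanSpace ℝ (Fin k × Fin d') :=
    { T₀ with
      norm_map' := fun x => by
        have h1 := h x
        simp only [EuclideanSpace.norm_sq_eq, Real.norm_eq_abs, sq_abs, applyMat_apply] at h1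
        rw [← sq_eq_sq₀ (norm_nonneg _) (norm_nonneg _), EuclideanSpace.norm_sq_eq,
          EuclideanSpace.norm_sq_eq, Fintype.sum_prod_type]
        simpa [T₀] using h1 }
  let e : E d ≃ₗᵢ[ℝ] EuclideanSpace ℝ (Fin k × Fin d') :=
    T.toLinearIsometryEquiv (by simp [hd])
  let b := (EuclideanSpace.basisFun (Fin k × Fin d') ℝ).map e.symm
  have hb : (fun q : Fin k × Fin d' => (WithLp.toLp 2 (P q.1 q.2) : E d)) = b := by
    funext q
    refine ext_inner_right ℝ fun x => ?_
    have h1 : inner ℝ (b q) x = (e x) q := by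
      simp only [b, OrthonormalBasis.map_apply, EuclideanSpace.basisFun_apply]
      rw [← e.inner_map_map, e.apply_symm_apply, EuclideanSpace.inner_single_left]
      simp
    rw [h1]
    change _ = ∑ b, P q.1 q.2 b * x b
    simp [PiLp.inner_apply, mul_comm]
  refine ⟨hd, ?_, ?_⟩
  · rw [hb]; exact b.orthonormal
  · rw [hb, ← b.coe_toBasis]; exact b.toBasis.span_eq

theorem IsOrthDecomp.sum_norm_sq {k d' d : ℕ} {P : Fin k → Matrix (Fin d') (Fin d) ℝ}
    (h : IsOrthDecomp P) (x : E d) : ∑ i, ‖applyMat (P i) x‖ ^ 2 = ‖x‖ ^ 2 := by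
  obtain ⟨_, h1, h2⟩ := h
  have := (OrthonormalBasis.mk h1 h2.ge).sum_sq_norm_inner_right x
  rw [← this, Fintype.sum_prod_type]
  refine Finset.sum_congr rfl fun i _ => ?_
  rw [EuclideanSpace.norm_sq_eq]
  refine Finset.sum_congr rfl fun l _ => ?_
  congr 2
  simp [applyMat_apply, PiLp.inner_apply, mul_comm]

/-- The vector whose components along the decomposition are `c`. -/
noncomputable def assemble {k d' d : ℕ} (P : Fin k → Matrix (Fin d') (Fin d) ℝ)
    (c : Fin k → E d') : E d :=
  ∑ i, ∑ l, c i l • (WithLp.toLp 2 (P i l) : E d)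

theorem IsOrthDecomp.applyMat_assemble {k d' d : ℕ} {P : Fin k → Matrix (Fin d') (Fin d) ℝ}
    (h : IsOrthDecomp P) (c : Fin k → E d') (i : Fin k) :
    applyMat (P i) (assemble P c) = c i := by
  obtain ⟨_, h1, _⟩ := h
  ext l
  have h2 : applyMat (P i) (assemble P c) l =
      inner ℝ (WithLp.toLp 2 (P i l) : E d) (assemble P c) := by
    simp [applyMat_apply, PiLp.inner_apply, mul_comm]
  rw [h2, assemble, ← Fintype.sum_prod_type'
    (f := fun i l => c i l • (WithLp.toLp 2 (P i l) : E d))]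
  have := h1.inner_right_fintype (fun q : Fin k × Fin d' => c q.1 q.2) (i, l)
  simpa using this

/-- The entries of a vector, followed by zeros. -/
noncomputable def entries {d : ℕ} (x : E d) (j : ℕ) : ℝ := if h : j < d then x ⟨j, h⟩ else 0

theorem entries_eq_zero {d : ℕ} (x : E d) (j : ℕ) (h : d ≤ j) : entries x j = 0 :=
  dif_neg (by omega)

theorem energy_entries {d : ℕ} (x : E d) : energy d (entries x) = ‖x‖ ^ 2 := by
  rw [energy, EuclideanSpace.norm_sq_eq, ← Fin.sum_univ_eq_sum_range (fun j => entries x j ^ 2)]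
  simp [entries]

/-- The parameter at the node `p` of the tree with index `m`: a digit of `m` in base `S`. -/
noncomputable def angle (S m p : ℕ) : ℝ := ((m / S ^ (p - 1) % S : ℕ) : ℝ) / S

/-- The part of `x` at the leaf `i` of the tree with index `m`. -/
noncomputable def leaf (S k d m : ℕ) (x : ℕ → ℝ) (i : ℕ) : E d :=
  WithLp.toLp 2 fun l => node (angle S m) x (k + i) l

/-- The decomposition with index `m`. -/
noncomputable def decomp (S k d D m : ℕ) (i : Fin k) : Matrix (Fin d) (Fin D) ℝ :=
  fun l b => node (angle S m) (Pi.single (b : ℕ) 1) (k + i) l / √k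

/-- A leaf is a linear function of the root, so it is determined by its values on the unit vectors,
which are the columns of `decomp` up to the factor √k. -/
theorem applyMat_decomp {S k d D m : ℕ} (hk : 0 < k) (i : Fin k) (x : E D) :
    applyMat (decomp S k d D m i) x = (√(k : ℝ))⁻¹ • leaf S k d m (entries x) i := by
  have hx : entries x = ∑ b : Fin D, x b • (Pi.single (b : ℕ) (1 : ℝ) : ℕ → ℝ) := by
    funext j
    simp only [Finset.sum_apply, Pi.smul_apply, smul_eq_mul, Pi.single_apply, mul_ite, mul_one,
      mul_zero, entries]
    split_ifs with hj
    · rw [Finset.sum_eq_single ⟨j, hj⟩]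
      · simp
      · intro b _ hb
        rw [if_neg]
        intro h; exact hb (Fin.ext h.symm)
      · simp
    · rw [Finset.sum_eq_zero]
      intro b _
      rw [if_neg]
      intro h; exact hj (h ▸ b.2)
  ext l
  have h1 := congrFun (congrArg (nodeLin (angle S m) (q := k + i) (by omega)) hx) l
  rw [map_sum] at h1
  simp only [map_smul, Finset.sum_apply, Pi.smul_apply, smul_eq_mul] at h1
  simp only [nodeLin, LinearMap.coe_mk, AddHom.coe_mk] at h1
  simp only [applyMat_apply, decomp, leaf, PiLp.smul_apply, smul_eq_mul, h1, Finset.mul_sum]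
  refine Finset.sum_congr rfl fun b _ => by ring

/-- Since D / d = k, the two roots cancel: the pieces that enter the filters are exactly the leaves
of the tree, which can be computed without roots. -/
theorem sqrt_smul_applyMat_decomp {S k d D m : ℕ} (hk : 0 < k) (hd : 0 < d) (hD : k * d = D)
    (i : Fin k) (x : E D) :
    √((D : ℝ) / d) • applyMat (decomp S k d D m i) x = leaf S k d m (entries x) i := by
  have : (D : ℝ) / d = k := by
    rw [← hD]; push_cast; field_simp
  rw [applyMat_decomp hk, this, smul_smul, mul_inv_cancel₀ (by positivity), one_smul]

theorem norm_leaf_sq {S d D m r : ℕ} (hD : 2 ^ r * d = D) {x : ℕ → ℝ}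
    (hx : ∀ j, D ≤ j → x j = 0) {i : ℕ} (hi : i < 2 ^ r) :
    ‖leaf S (2 ^ r) d m x i‖ ^ 2 = energy D (node (angle S m) x (2 ^ r + i)) := by
  have h1 : d ≤ D := by
    rw [← hD]; exact Nat.le_mul_of_pos_left _ (by positivity)
  rw [energy_eq_of_le h1 (node_eq_zero_of_level (r := r) (by omega) (by rw [pow_succ]; omega)
    (by rwa [hD])), energy, EuclideanSpace.norm_sq_eq, ← Fin.sum_univ_eq_sum_range
    (fun j => node (angle S m) x (2 ^ r + i) j ^ 2)]
  simp [leaf]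

theorem isOrthDecomp_decomp {S d D m r : ℕ} (hD : 2 ^ r * d = D) :
    IsOrthDecomp (decomp S (2 ^ r) d D m) := by
  refine isOrthDecomp_of_isometry hD fun x => ?_
  have hk : (0 : ℝ) < ((2 ^ r : ℕ) : ℝ) := by positivity
  have h1 : ∀ i : Fin (2 ^ r), ‖applyMat (decomp S (2 ^ r) d D m i) x‖ ^ 2 =
      (((2 ^ r : ℕ) : ℝ))⁻¹ * energy D (node (angle S m) (entries x) (2 ^ r + i)) := by
    intro i
    rw [applyMat_decomp (by positivity), norm_smul, mul_pow,
      norm_leaf_sq hD (entries_eq_zero x) i.2, norm_inv, inv_pow, Real.norm_eq_abs, sq_abs,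
      Real.sq_sqrt hk.le]
  rw [Finset.sum_congr rfl fun i _ => h1 i, ← Finset.mul_sum, Fin.sum_univ_eq_sum_range
    (fun i => energy D (node (angle S m) (entries x) (2 ^ r + i))),
    sum_energy_node (entries_eq_zero x), energy_entries, ← mul_assoc]
  push_cast at hk ⊢
  rw [inv_mul_cancel₀ hk.ne', one_mul]

theorem exists_index_of_digits {S n : ℕ} (f : ℕ → ℕ) (hf : ∀ p, f p < S) :
    ∃ m < S ^ n, ∀ p < n, m / S ^ p % S = f p := by
  refine ⟨finFunctionFinEquiv (fun p : Fin n => (⟨f p, hf p⟩ : Fin S)), Fin.is_lt _,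
    fun p hp => ?_⟩
  have := congrFun (finFunctionFinEquiv.symm_apply_apply
    (fun p : Fin n => (⟨f p, hf p⟩ : Fin S))) ⟨p, hp⟩
  exact congrArg Fin.val this

/-- The angles at the 2^r - 1 inner nodes are the base `S` digits of the index `m`. Leaves have
numbers below 2 · 2^r, whence the constant 64. -/
theorem exists_balanced_decomp {S d D r : ℕ} (hS : 0 < S) (hD : 2 ^ r * d = D) {x : E D}
    (hx : ‖x‖ = 1) : ∃ m < S ^ (2 ^ r - 1), ∀ i < 2 ^ r,
      |‖leaf S (2 ^ r) d m (entries x) i‖ - 1| ≤ 64 * 2 ^ r / S := by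
  obtain ⟨f, hf, h⟩ := exists_balanced_tree hS (entries_eq_zero x)
    (by rw [energy_entries, hx, one_pow]) (2 ^ r)
  obtain ⟨m, hm, hmf⟩ := exists_index_of_digits (n := 2 ^ r - 1) (fun p => f (p + 1))
    (fun p => hf _)
  refine ⟨m, hm, fun i hi => ?_⟩
  have hpos := Nat.one_le_two_pow (n := r)
  have hnode : node (angle S m) (entries x) (2 ^ r + i) =
      node (fun p => (f p : ℝ) / S) (entries x) (2 ^ r + i) := by
    have aux : ∀ q, 1 ≤ q → q < 2 * 2 ^ r → node (angle S m) (entries x) q =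
        node (fun p => (f p : ℝ) / S) (entries x) q := by
      intro q hq
      refine node_induction (P := fun q => q < 2 * 2 ^ r → node (angle S m) (entries x) q =
        node (fun p => (f p : ℝ) / S) (entries x) q) (fun _ => by rw [node_one, node_one])
        (fun p hp ih => ?_) hq
      have hang : p < 2 ^ r → angle S m p = (f p : ℝ) / S := fun hp' => by
        rw [angle, hmf (p - 1) (by omega)]
        congr 3; omega
      constructor <;> intro hlt <;> funext j
      · rw [node_even _ _ hp, node_even _ _ hp, ih (by omega), hang (by omega)]
      · rw [node_odd _ _ hp, node_odd _ _ hp, ih (by omega), hang (by omega)]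
    exact aux _ (by omega) (by omega)
  have h1 := (h (2 ^ r + i) (by omega) (by omega)).2
  rw [← hnode, ← norm_leaf_sq hD (entries_eq_zero x) hi] at h1
  set a := ‖leaf S (2 ^ r) d m (entries x) i‖ with ha
  have h2 : |a ^ 2 - 1| = |a - 1| * (a + 1) := by
    have h0 : 0 ≤ a := norm_nonneg _
    rw [show a ^ 2 - 1 = (a - 1) * (a + 1) by ring, abs_mul, abs_of_nonneg (by linarith : 0 ≤ a + 1)]
  -- The tree controls squared norms; as a + 1 ≥ 1, the error of the norm itself is no larger.
  have h3 : |a - 1| ≤ |a ^ 2 - 1| := by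
    rw [h2]
    exact le_mul_of_one_le_right (abs_nonneg _) (by linarith [(norm_nonneg
      (leaf S (2 ^ r) d m (entries x) i) : 0 ≤ a)])
  refine h3.trans (h1.trans ?_)
  have h4 : ((2 ^ r + i : ℕ) : ℝ) ≤ 2 * 2 ^ r := by
    have : ((2 ^ r + i : ℕ) : ℝ) ≤ ((2 * 2 ^ r : ℕ) : ℝ) := by exact_mod_cast (by omega)
    simpa using this
  calc 32 / (S : ℝ) * ((2 ^ r + i : ℕ) : ℝ) ≤ 32 / (S : ℝ) * (2 * 2 ^ r) := by gcongr
    _ = _ := by ring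

theorem isSplitting_decomp {S d D r : ℕ} {ε : ℝ} (hS : 0 < S) (hd : 0 < d) (hD : 2 ^ r * d = D)
    (hε : 64 * 2 ^ r / S < ε) :
    IsSplitting (fun m : Fin (S ^ (2 ^ r - 1)) => decomp S (2 ^ r) d D m) ε := by
  refine ⟨fun m => isOrthDecomp_decomp hD, fun x hx => ?_⟩
  obtain ⟨m, hm, h⟩ := exists_balanced_decomp hS hD hx
  refine ⟨⟨m, hm⟩, fun i => lt_of_le_of_lt ?_ hε⟩
  have h1 := h i i.2
  rw [← sqrt_smul_applyMat_decomp (by positivity) hd hD, norm_smul, Real.norm_eq_abs,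
    abs_of_nonneg (Real.sqrt_nonneg _)] at h1
  exact h1

end FilterLSF

namespace FilterLSF

/-! ### Volumes of intersections of balls -/

/-- The reflection that exchanges `e` and `e'` preserves the ball and the volume. -/
theorem setLIntegral_inner_sq_eq {d : ℕ} {e e' : E d} (h : ‖e‖ = ‖e'‖) (r : ℝ) :
    ∫⁻ u in Metric.closedBall (0 : E d) r, ENNReal.ofReal (inner ℝ u e ^ 2) =
      ∫⁻ u in Metric.closedBall (0 : E d) r, ENNReal.ofReal (inner ℝ u e' ^ 2) := by
  let R : E d ≃ₗᵢ[ℝ] E d := (ℝ ∙ (e - e'))ᗮ.reflection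
  have hR : R e = e' := Submodule.reflection_sub h
  have hpre : R ⁻¹' Metric.closedBall (0 : E d) r = Metric.closedBall (0 : E d) r := by
    ext u; simp
  have := R.measurePreserving.setLIntegral_comp_preimage
    (Metric.isClosed_closedBall.measurableSet : MeasurableSet (Metric.closedBall (0 : E d) r))
    (f := fun u => ENNReal.ofReal (inner ℝ u e' ^ 2)) (by fun_prop)
  rw [← this, hpre]
  refine lintegral_congr fun u => ?_
  rw [← hR, R.inner_map_map]

/-- By symmetry the second moment is the same in all directions of equal length, and over the
coordinate directions the moments add up to that of the norm, which is at most r². -/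
theorem setLIntegral_inner_sq_le {d : ℕ} (e : E d) (r : ℝ) :
    d * ∫⁻ u in Metric.closedBall (0 : E d) r, ENNReal.ofReal (inner ℝ u e ^ 2) ≤
      ENNReal.ofReal (‖e‖ ^ 2 * r ^ 2) * volume (Metric.closedBall (0 : E d) r) := by
  have h1 : ∀ i : Fin d, ∫⁻ u in Metric.closedBall (0 : E d) r, ENNReal.ofReal (inner ℝ u e ^ 2) =
      ∫⁻ u in Metric.closedBall (0 : E d) r, ENNReal.ofReal (‖e‖ ^ 2 * u i ^ 2) := by
    intro i
    rw [setLIntegral_inner_sq_eq (e' := EuclideanSpace.single i ‖e‖) (by simp)]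
    refine lintegral_congr fun u => ?_
    congr 1
    rw [EuclideanSpace.inner_single_right]
    simp [mul_pow]
  have h2 : d * ∫⁻ u in Metric.closedBall (0 : E d) r, ENNReal.ofReal (inner ℝ u e ^ 2) =
      ∑ i : Fin d, ∫⁻ u in Metric.closedBall (0 : E d) r, ENNReal.ofReal (‖e‖ ^ 2 * u i ^ 2) := by
    rw [← Finset.sum_congr rfl fun i _ => h1 i]
    simp
  rw [h2, ← lintegral_finsetSum _ (fun i _ => by fun_prop)]
  calc ∫⁻ u in Metric.closedBall (0 : E d) r, ∑ i : Fin d, ENNReal.ofReal (‖e‖ ^ 2 * u i ^ 2)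
      ≤ ∫⁻ u in Metric.closedBall (0 : E d) r, ENNReal.ofReal (‖e‖ ^ 2 * r ^ 2) := by
        refine setLIntegral_mono measurable_const fun u hu => ?_
        rw [← ENNReal.ofReal_sum_of_nonneg fun i _ => by positivity, ← Finset.mul_sum]
        refine ENNReal.ofReal_le_ofReal ?_
        have : ∑ i, u i ^ 2 = ‖u‖ ^ 2 := by simp [EuclideanSpace.norm_sq_eq]
        rw [this]
        have hu' : ‖u‖ ≤ r := by simpa using hu
        gcongr
    _ = _ := by rw [setLIntegral_const]

/-- Chebyshev's inequality: the mean of ⟨u, e⟩² over the ball is at most ‖e‖²r²/d, which the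
hypothesis bounds by η²/2, so at most half of the ball lies outside the slab. -/
theorem half_volume_le_slab {d : ℕ} (hd : 0 < d) (e : E d) {r η : ℝ} (hη : 0 < η)
    (h : 2 * (‖e‖ ^ 2 * r ^ 2) ≤ d * η ^ 2) :
    volume (Metric.closedBall (0 : E d) r) ≤
      2 * volume {u ∈ Metric.closedBall (0 : E d) r | |inner ℝ u e| ≤ η} := by
  set B := Metric.closedBall (0 : E d) r with hB
  have hBm : MeasurableSet B := Metric.isClosed_closedBall.measurableSet
  set A := {u ∈ B | |inner ℝ u e| ≤ η} with hA
  have hAm : MeasurableSet A := hBm.inter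
    (measurableSet_le (f := fun u : E d => |inner ℝ u e|) (g := fun _ => η)
      (by fun_prop) measurable_const)
  have hBt : volume B ≠ ∞ := (isCompact_closedBall (0 : E d) r).measure_lt_top.ne
  have hd' : (d : ℝ≥0∞) ≠ 0 := by exact_mod_cast hd.ne'
  have hdt : (d : ℝ≥0∞) ≠ ∞ := ENNReal.natCast_ne_top d
  have hη2 : 0 < η ^ 2 := by positivity
  have h1 : 2 * volume (B \ A) ≤ volume B := by
    have h2 : ENNReal.ofReal (η ^ 2) * volume (B \ A) ≤
        ∫⁻ u in B, ENNReal.ofReal (inner ℝ u e ^ 2) := by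
      have h3 := mul_meas_ge_le_lintegral₀ (μ := volume.restrict B)
        (f := fun u : E d => ENNReal.ofReal (inner ℝ u e ^ 2)) (by fun_prop) (ENNReal.ofReal (η ^ 2))
      refine le_trans ?_ h3
      refine mul_le_mul_right ?_ _
      rw [Measure.restrict_apply (measurableSet_le (g := fun u : E d =>
        ENNReal.ofReal (inner ℝ u e ^ 2)) measurable_const (by fun_prop))]
      refine measure_mono fun u hu => ⟨?_, hu.1⟩
      have h4 : η < |inner ℝ u e| := by
        by_contra! h5
        exact hu.2 ⟨hu.1, h5⟩
      refine ENNReal.ofReal_le_ofReal ?_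
      rw [← sq_abs (inner ℝ u e)]
      gcongr
    have h4 : 2 * (d : ℝ≥0∞) * ENNReal.ofReal (η ^ 2) * volume (B \ A) ≤
        (d : ℝ≥0∞) * ENNReal.ofReal (η ^ 2) * volume B := by
      calc 2 * (d : ℝ≥0∞) * ENNReal.ofReal (η ^ 2) * volume (B \ A)
          = 2 * (d * (ENNReal.ofReal (η ^ 2) * volume (B \ A))) := by ring
        _ ≤ 2 * (ENNReal.ofReal (‖e‖ ^ 2 * r ^ 2) * volume B) := by
            exact mul_le_mul_right
              ((mul_le_mul_right h2 _).trans (setLIntegral_inner_sq_le e r)) 2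
        _ = ENNReal.ofReal (2 * (‖e‖ ^ 2 * r ^ 2)) * volume B := by
            rw [ENNReal.ofReal_mul (by norm_num : (0 : ℝ) ≤ 2)]; simp [mul_assoc]
        _ ≤ ENNReal.ofReal (d * η ^ 2) * volume B := by gcongr
        _ = _ := by rw [ENNReal.ofReal_mul (by positivity)]; simp
    have h5 : (d : ℝ≥0∞) * ENNReal.ofReal (η ^ 2) ≠ 0 :=
      mul_ne_zero hd' (ENNReal.ofReal_pos.2 hη2).ne'
    have h6 : (d : ℝ≥0∞) * ENNReal.ofReal (η ^ 2) ≠ ∞ := ENNReal.mul_ne_top hdt ENNReal.ofReal_ne_top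
    rw [show 2 * (d : ℝ≥0∞) * ENNReal.ofReal (η ^ 2) * volume (B \ A) =
      (d : ℝ≥0∞) * ENNReal.ofReal (η ^ 2) * (2 * volume (B \ A)) by ring] at h4
    exact (ENNReal.mul_le_mul_iff_right h5 h6).1 h4
  have h7 : volume B = volume A + volume (B \ A) := by
    rw [← measure_inter_add_sdiff B hAm, Set.inter_eq_self_of_subset_right fun u hu => hu.1]
  have hAt : volume A ≠ ∞ := measure_ne_top_of_subset (fun u hu => hu.1) hBt
  have hDt : volume (B \ A) ≠ ∞ := measure_ne_top_of_subset Set.sdiff_subset hBt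
  lift volume B to NNReal using hBt with b
  lift volume A to NNReal using hAt with a
  lift volume (B \ A) to NNReal using hDt with c
  norm_cast at *
  have h8 : (b : ℝ) = a + c := by exact_mod_cast h7
  have h9 : (2 : ℝ) * c ≤ b := by exact_mod_cast h1
  have : (b : ℝ) ≤ 2 * a := by linarith
  exact_mod_cast this

theorem midpoint_identities {d : ℕ} (x y c : E d) :
    ‖c - x‖ ^ 2 = ‖c - (2⁻¹ : ℝ) • (x + y)‖ ^ 2 + ‖x - y‖ ^ 2 / 4 -
      inner ℝ (c - (2⁻¹ : ℝ) • (x + y)) (x - y) := by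
  have h : c - x = (c - (2⁻¹ : ℝ) • (x + y)) - (2⁻¹ : ℝ) • (x - y) := by module
  rw [h, norm_sub_sq_real, inner_smul_right, norm_smul, mul_pow]
  norm_num
  ring

/-- Seen from the midpoint of `x` and `y`, the squared distances to the two centres are ‖u‖² + ‖x -
y‖²/4 ∓ ⟨u, x - y⟩. In high dimension the inner product is small for most of the ball around the
midpoint, so at least half of that ball lies in the lens; `η` is the slack left for the inner
product. -/
theorem volume_lens_ge {d : ℕ} (hd : 0 < d) (x y : E d) {ρ r η s : ℝ} (hη : 0 < η)
    (hxy : ‖x - y‖ ≤ s) (hρ : 0 ≤ ρ) (hs : r ^ 2 + s ^ 2 / 4 + η ≤ ρ ^ 2)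
    (h : 2 * (s ^ 2 * r ^ 2) ≤ d * η ^ 2) :
    volume (Metric.closedBall (0 : E d) r) ≤
      2 * volume (Metric.closedBall x ρ ∩ Metric.closedBall y ρ) := by
  have hs2 : ‖x - y‖ ^ 2 ≤ s ^ 2 := by gcongr
  refine (half_volume_le_slab hd (x - y) hη (le_trans (by gcongr) h)).trans ?_
  refine mul_le_mul_right ?_ 2
  rw [← measure_preimage_add_right volume (-((2⁻¹ : ℝ) • (x + y)))]
  refine measure_mono fun c hc => ?_
  obtain ⟨h1, h2⟩ := hc
  simp only [← sub_eq_add_neg] at h1 h2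
  rw [mem_closedBall_zero_iff] at h1
  have h3 := abs_le.1 h2
  have h1' : ‖c - (2⁻¹ : ℝ) • (x + y)‖ ^ 2 ≤ r ^ 2 := by gcongr
  constructor <;> rw [mem_closedBall_iff_norm] <;> refine le_of_sq_le_sq ?_ hρ
  · rw [midpoint_identities x y c]; linarith
  · have h5 := midpoint_identities y x c
    rw [add_comm y x, norm_sub_rev y x, show y - x = -(x - y) by abel, inner_neg_right] at h5
    rw [h5]; linarith

/-- Averaging the midpoint identities for `x` and `y` cancels the inner products. So lenses are
compared with balls from both sides, here without any loss in `η`. -/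
theorem lens_subset {d : ℕ} {x y : E d} {t w : ℝ} (ht : 0 ≤ t) (hxy : t ≤ ‖x - y‖) :
    Metric.closedBall x w ∩ Metric.closedBall y w ⊆
      {c | ‖c - (2⁻¹ : ℝ) • (x + y)‖ ^ 2 ≤ w ^ 2 - t ^ 2 / 4} := by
  rintro c ⟨h1, h2⟩
  rw [mem_closedBall_iff_norm] at h1 h2
  have h3 := midpoint_identities x y c
  have h5 := midpoint_identities y x c
  rw [add_comm y x, norm_sub_rev y x, show y - x = -(x - y) by abel, inner_neg_right] at h5
  have h1' : ‖c - x‖ ^ 2 ≤ w ^ 2 := by gcongr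
  have h2' : ‖c - y‖ ^ 2 ≤ w ^ 2 := by gcongr
  have h6 : t ^ 2 ≤ ‖x - y‖ ^ 2 := by gcongr
  simp only [Set.mem_ofPred_eq]
  linarith

theorem volume_closedBall_scale {d : ℕ} (x : E d) {r : ℝ} (hr : 0 ≤ r) :
    volume (Metric.closedBall x r) =
      ENNReal.ofReal (r ^ d) * volume (Metric.closedBall (0 : E d) 1) := by
  rw [Measure.addHaar_closedBall' _ x hr]
  simp

theorem volume_lens_le {d : ℕ} {x y : E d} {t w : ℝ} (ht : 0 ≤ t)
    (hxy : t ≤ ‖x - y‖) :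
    volume (Metric.closedBall x w ∩ Metric.closedBall y w) ≤
      ENNReal.ofReal (√(w ^ 2 - t ^ 2 / 4) ^ d) * volume (Metric.closedBall (0 : E d) 1) := by
  rw [← volume_closedBall_scale ((2⁻¹ : ℝ) • (x + y)) (Real.sqrt_nonneg _)]
  refine measure_mono fun c hc => ?_
  rw [mem_closedBall_iff_norm]
  exact Real.le_sqrt_of_sq_le (lens_subset ht hxy hc)

end FilterLSF

namespace FilterLSF

/-! ### Greedy covering of pairs -/

section Greedy

variable (n : ℕ) (near cov : ℕ → ℕ → Prop)

open Classical in
/-- The pairs that none of `u 0, …, u (t - 1)` covers. -/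
noncomputable def uncov (u : ℕ → ℕ) (t : ℕ) : Finset (ℕ × ℕ) :=
  (Finset.range n ×ˢ Finset.range n).filter fun p =>
    near p.1 p.2 ∧ ∀ j < t, ¬ (cov (u j) p.1 ∧ cov (u j) p.2)

open Classical in
/-- The number of pairs in `S` that `v` covers. -/
noncomputable def gain (S : Finset (ℕ × ℕ)) (v : ℕ) : ℕ :=
  (S.filter fun p => cov v p.1 ∧ cov v p.2).card

/-- `u 0, …, u (N - 1)` are chosen greedily. -/
structure IsGreedy (u : ℕ → ℕ) (N : ℕ) : Prop where
  lt : ∀ t < N, u t < n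
  max : ∀ t < N, ∀ v < n, gain cov (uncov n near cov u t) v ≤ gain cov (uncov n near cov u t) (u t)
  pos : ∀ t < N, 0 < gain cov (uncov n near cov u t) (u t)

variable {n near cov}

theorem mem_uncov {u : ℕ → ℕ} {t : ℕ} {p : ℕ × ℕ} : p ∈ uncov n near cov u t ↔
    (p.1 < n ∧ p.2 < n) ∧ near p.1 p.2 ∧ ∀ j < t, ¬ (cov (u j) p.1 ∧ cov (u j) p.2) := by
  simp [uncov]

theorem gain_pos_iff {S : Finset (ℕ × ℕ)} {v : ℕ} :
    0 < gain cov S v ↔ ∃ p ∈ S, cov v p.1 ∧ cov v p.2 := by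
  simp only [gain, Finset.card_pos, Finset.filter_nonempty_iff]

theorem card_uncov_succ (u : ℕ → ℕ) (t : ℕ) : (uncov n near cov u (t + 1)).card +
    gain cov (uncov n near cov u t) (u t) = (uncov n near cov u t).card := by
  classical
  rw [add_comm, gain, ← Finset.card_filter_add_card_filter_not
    (s := uncov n near cov u t) (fun p => cov (u t) p.1 ∧ cov (u t) p.2)]
  congr 2
  ext p
  simp only [mem_uncov, Finset.mem_filter]
  constructor
  · rintro ⟨h1, h2, h3⟩
    exact ⟨⟨h1, h2, fun j hj => h3 j (by omega)⟩, h3 t (by omega)⟩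
  · rintro ⟨⟨h1, h2, h3⟩, h4⟩
    refine ⟨h1, h2, fun j hj => ?_⟩
    rcases Nat.lt_succ_iff_lt_or_eq.1 hj with h | rfl
    exacts [h3 j h, h4]

theorem IsGreedy.ne {u : ℕ → ℕ} {N : ℕ} (h : IsGreedy n near cov u N) {s t : ℕ} (hst : s < t)
    (ht : t < N) : u s ≠ u t := by
  intro he
  obtain ⟨p, hp, hc⟩ := gain_pos_iff.1 (h.pos t ht)
  exact (mem_uncov.1 hp).2.2 s hst (by rwa [he])

theorem IsGreedy.injOn {u : ℕ → ℕ} {N : ℕ} (h : IsGreedy n near cov u N) :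
    Set.InjOn u (Finset.range N : Finset ℕ) := by
  intro s hs t ht he
  simp only [Finset.coe_range, Set.mem_Iio] at hs ht
  rcases lt_trichotomy s t with h1 | h1 | h1
  · exact absurd he (h.ne h1 ht)
  · exact h1
  · exact absurd he.symm (h.ne h1 hs)

theorem IsGreedy.le {u : ℕ → ℕ} {N : ℕ} (h : IsGreedy n near cov u N) : N ≤ n := by
  have := Finset.card_le_card_of_injOn u (s := Finset.range N) (t := Finset.range n)
    (fun t ht => by simpa using h.lt t (by simpa using ht)) h.injOn
  simpa using this

/-- A step with positive gain picks a point not picked before, so after `n` steps all points are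
picked and nothing is left to gain. Hence `n` rounds of the greedy loop suffice. -/
theorem IsGreedy.gain_eq_zero {u : ℕ → ℕ} (h : IsGreedy n near cov u n) {v : ℕ} (hv : v < n) :
    gain cov (uncov n near cov u n) v = 0 := by
  have hsurj := Finset.surj_on_of_inj_on_of_card_le (s := Finset.range n) (t := Finset.range n)
    (fun t _ => u t) (fun t ht => by simpa using h.lt t (by simpa using ht))
    (fun a b ha hb he => h.injOn (by simpa using ha) (by simpa using hb) he) le_rfl v (by simpa)
  obtain ⟨t, ht, rfl⟩ := hsurj
  by_contra h0
  obtain ⟨p, hp, hc⟩ := gain_pos_iff.1 (Nat.pos_of_ne_zero h0)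
  exact (mem_uncov.1 hp).2.2 t (by simpa using ht) hc

open Classical in
-- By double counting, the best point covers at least a fraction c/n of the open pairs. There are at
-- most n² pairs at first and at least one is open before the last step, so 1 ≤ n² exp(-c(N - 1)/n).
-- Taking logarithms gives c(N - 1) ≤ 2n log n, and `c ≤ n` pays for the missing step.
theorem IsGreedy.mul_le {u : ℕ → ℕ} {N : ℕ} (h : IsGreedy n near cov u N) {c : ℝ} (hn : 0 < n)
    (hcn : c ≤ n)
    (hc : ∀ a < n, ∀ b < n, near a b →
      c ≤ ((Finset.range n).filter fun v => cov v a ∧ cov v b).card) :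
    N * c ≤ n * (1 + 2 * Real.log n) := by
  have hn' : (0 : ℝ) < n := by exact_mod_cast hn
  have hlog : 0 ≤ Real.log n := Real.log_nonneg (by exact_mod_cast hn)
  have hstep : ∀ t < N, ((uncov n near cov u (t + 1)).card : ℝ) ≤
      (uncov n near cov u t).card * (1 - c / n) := by
    intro t ht
    set S := uncov n near cov u t with hS
    have h1 : c * S.card ≤ ∑ v ∈ Finset.range n, (gain cov S v : ℝ) := by
      have h2 : ∑ v ∈ Finset.range n, (gain cov S v : ℝ) =
          ∑ p ∈ S, (((Finset.range n).filter fun v => cov v p.1 ∧ cov v p.2).card : ℝ) := by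
        simp only [gain, Finset.card_filter, Nat.cast_sum]
        exact Finset.sum_comm
      rw [h2]
      calc c * S.card = ∑ p ∈ S, c := by simp [mul_comm]
        _ ≤ _ := Finset.sum_le_sum fun p hp => by
          have := mem_uncov.1 hp
          exact hc _ this.1.1 _ this.1.2 this.2.1
    have h3 : ∑ v ∈ Finset.range n, (gain cov S v : ℝ) ≤ n * gain cov S (u t) := by
      calc _ ≤ ∑ v ∈ Finset.range n, (gain cov S (u t) : ℝ) := Finset.sum_le_sum fun v hv => by
            exact_mod_cast h.max t ht v (by simpa using hv)
        _ = _ := by simp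
    have h4 : ((uncov n near cov u (t + 1)).card : ℝ) + gain cov S (u t) = S.card := by
      exact_mod_cast card_uncov_succ u t
    have h5 : c / n * S.card ≤ gain cov S (u t) := by
      rw [div_mul_eq_mul_div, div_le_iff₀ hn', mul_comm (gain cov S (u t) : ℝ)]
      exact h1.trans h3
    linarith
  have h0 : ((uncov n near cov u 0).card : ℝ) ≤ n ^ 2 := by
    have : (uncov n near cov u 0).card ≤ n ^ 2 := by
      refine (Finset.card_filter_le _ _).trans ?_
      simp [sq]
    exact_mod_cast this
  have hq : 0 ≤ 1 - c / n := by
    rw [sub_nonneg, div_le_one hn']; exact hcn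
  have hpow : ∀ t ≤ N, ((uncov n near cov u t).card : ℝ) ≤ n ^ 2 * (1 - c / n) ^ t := by
    intro t
    induction t with
    | zero => intro _; simpa using h0
    | succ t ih =>
      intro ht
      refine (hstep t (by omega)).trans ?_
      rw [pow_succ (1 - c / (n : ℝ)), ← mul_assoc]
      gcongr
      exact ih (by omega)
  rcases Nat.eq_zero_or_pos N with rfl | hN
  · simp; positivity
  obtain ⟨p, hp, _⟩ := gain_pos_iff.1 (h.pos (N - 1) (by omega))
  have h6 : (1 : ℝ) ≤ (uncov n near cov u (N - 1)).card := by
    exact_mod_cast Finset.card_pos.2 ⟨p, hp⟩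
  have h7 := h6.trans (hpow (N - 1) (by omega))
  have h8 : (1 : ℝ) ≤ n ^ 2 * Real.exp (-(c / n) * (N - 1 : ℕ)) := by
    refine h7.trans ?_
    rw [mul_comm (-(c / n)), Real.exp_nat_mul]
    gcongr
    linarith [Real.add_one_le_exp (-(c / n))]
  have h9 := Real.log_le_log one_pos h8
  rw [Real.log_one, Real.log_mul (by positivity) (by positivity), Real.log_exp, Real.log_pow] at h9
  have hN1 : ((N - 1 : ℕ) : ℝ) = N - 1 := by push_cast [Nat.cast_sub hN]; ring
  rw [hN1] at h9
  push_cast at h9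
  have h10 : c / n * (N - 1) ≤ 2 * Real.log n := by linarith
  rw [div_mul_eq_mul_div, div_le_iff₀ hn'] at h10
  linarith

end Greedy

/-! ### The grid on the torus -/

/-- The digit `l` of `a` in base `K`. -/
def digit (K a l : ℕ) : ℕ := a / K ^ l % K

/-- The representative of `x` modulo `K` of least absolute value. -/
noncomputable def wrap (K : ℕ) (x : ℤ) : ℤ := x - K * ⌊(x : ℝ) / K + 1 / 2⌋

/-- The squared distance of two grid points on the torus. -/
noncomputable def torSq (K d a b : ℕ) : ℝ :=
  ∑ l ∈ Finset.range d, (wrap K ((digit K a l : ℤ) - digit K b l) : ℝ) ^ 2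

theorem two_mul_abs_wrap_le {K : ℕ} (hK : 0 < K) (x : ℤ) : 2 * |wrap K x| ≤ K := by
  have hK' : (0 : ℝ) < K := by exact_mod_cast hK
  have h1 := Int.floor_le ((x : ℝ) / K + 1 / 2)
  have h2 := Int.lt_floor_add_one ((x : ℝ) / K + 1 / 2)
  have h3 : (wrap K x : ℝ) = K * ((x : ℝ) / K - ⌊(x : ℝ) / K + 1 / 2⌋) := by
    simp only [wrap]; push_cast; field_simp
  have h4 : |(wrap K x : ℝ)| ≤ K * (1 / 2) := by
    rw [h3, abs_mul, abs_of_pos hK']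
    gcongr
    rw [abs_le]; constructor <;> linarith
  have : 2 * |(wrap K x : ℝ)| ≤ K := by linarith
  exact_mod_cast this

theorem exists_wrap_eq (K : ℕ) (x : ℤ) : ∃ z : ℤ, wrap K x = x + K * z :=
  ⟨-⌊(x : ℝ) / K + 1 / 2⌋, by simp [wrap]; ring⟩

/-- Other representatives differ from `wrap K x` by at least `K`, while `|wrap K x| ≤ K / 2`. -/
theorem abs_wrap_le {K : ℕ} (hK : 0 < K) {x y z : ℤ} (h : y = x + K * z) :
    |wrap K x| ≤ |y| := by
  obtain ⟨z', hz'⟩ := exists_wrap_eq K x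
  have h1 := two_mul_abs_wrap_le hK x
  have h2 : y = wrap K x + K * (z - z') := by rw [hz', h]; ring
  by_cases h0 : z - z' = 0
  · rw [h2, h0]; simp
  · have h3 : (K : ℤ) ≤ |(K : ℤ) * (z - z')| := by
      rw [abs_mul, Nat.abs_cast]
      exact le_mul_of_one_le_right (by positivity) (Int.one_le_abs h0)
    have h4 : |(K : ℤ) * (z - z')| ≤ |y| + |wrap K x| := by
      have : (K : ℤ) * (z - z') = y - wrap K x := by rw [h2]; ring
      rw [this]; exact abs_sub _ _
    omega

theorem wrap_eq_of_abs_lt {K : ℕ} (hK : 0 < K) {x y z : ℤ} (h : y = x + K * z)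
    (hy : 2 * |y| < K) : wrap K x = y := by
  obtain ⟨z', hz'⟩ := exists_wrap_eq K x
  have h1 := two_mul_abs_wrap_le hK x
  have h2 : wrap K x - y = K * (z' - z) := by rw [hz', h]; ring
  have h3 : |wrap K x - y| < K := by
    have := abs_sub (wrap K x) y
    omega
  have h4 : wrap K x - y = 0 := Int.eq_zero_of_abs_lt_dvd ⟨_, h2⟩ h3
  omega

/-- The integer vector `v` as a point of Euclidean space. -/
noncomputable def intVec {d : ℕ} (v : Fin d → ℤ) : E d := WithLp.toLp 2 fun l => (v l : ℝ)

theorem norm_intVec_sub_sq {d : ℕ} (v u : Fin d → ℤ) :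
    ‖intVec v - intVec u‖ ^ 2 = ∑ l, ((v l - u l : ℤ) : ℝ) ^ 2 := by
  simp [EuclideanSpace.norm_sq_eq, intVec]

theorem exists_digits {K d : ℕ} (hK : 0 < K) (v : Fin d → ℤ) :
    ∃ a < K ^ d, ∀ l : Fin d, ∃ z : ℤ, (digit K a l : ℤ) = v l + K * z := by
  have hK' : (K : ℤ) ≠ 0 := by exact_mod_cast hK.ne'
  obtain ⟨a, ha, h⟩ := exists_index_of_digits (S := K) (n := d)
    (fun l => if h : l < d then (v ⟨l, h⟩ % K).toNat else 0) (fun l => by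
      split_ifs with h
      · have h1 := Int.emod_nonneg (v ⟨l, h⟩) hK'
        have h2 := Int.emod_lt_of_pos (v ⟨l, h⟩) (by exact_mod_cast hK : (0 : ℤ) < K)
        omega
      · exact hK)
  refine ⟨a, ha, fun l => ⟨-(v l / K), ?_⟩⟩
  rw [digit, h l l.2, dif_pos l.2, Int.toNat_of_nonneg (Int.emod_nonneg _ hK')]
  have := Int.emod_add_mul_ediv (v l) K
  simp only [Fin.eta]
  linarith

/-- The true bound is √d. The weaker bound avoids roots in the radii that the sampler computes, and
relative to K = d³ it is negligible. -/
theorem norm_intVec_floor_sub_le {d : ℕ} (X : E d) :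
    ‖intVec (fun l => ⌊X l⌋) - X‖ ≤ d := by
  refine le_of_sq_le_sq ?_ (Nat.cast_nonneg d)
  have h1 : ‖intVec (fun l => ⌊X l⌋) - X‖ ^ 2 ≤ ∑ _l : Fin d, (1 : ℝ) := by
    rw [EuclideanSpace.norm_sq_eq]
    refine Finset.sum_le_sum fun l _ => ?_
    have h2 := Int.floor_le (X l)
    have h3 := Int.lt_floor_add_one (X l)
    simp only [intVec, PiLp.sub_apply, Real.norm_eq_abs, sq_abs]
    nlinarith
  refine h1.trans ?_
  have h4 : (d : ℝ) ≤ d ^ 2 := by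
    have : d ≤ d ^ 2 := by nlinarith [Nat.zero_le d, Nat.le_mul_self d]
    exact_mod_cast this
  simpa using h4

theorem torSq_le {K d : ℕ} (hK : 0 < K) {a b : ℕ} {v u : Fin d → ℤ}
    (ha : ∀ l : Fin d, ∃ z : ℤ, (digit K a l : ℤ) = v l + K * z)
    (hb : ∀ l : Fin d, ∃ z : ℤ, (digit K b l : ℤ) = u l + K * z) :
    torSq K d a b ≤ ‖intVec v - intVec u‖ ^ 2 := by
  rw [norm_intVec_sub_sq, torSq, ← Fin.sum_univ_eq_sum_range
    (fun l => (wrap K ((digit K a l : ℤ) - digit K b l) : ℝ) ^ 2)]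
  refine Finset.sum_le_sum fun l _ => ?_
  obtain ⟨z, hz⟩ := ha l
  obtain ⟨z', hz'⟩ := hb l
  have := abs_wrap_le hK (x := (digit K a l : ℤ) - digit K b l) (y := v l - u l)
    (z := z' - z) (by rw [hz, hz']; ring)
  have h2 : |(wrap K ((digit K a l : ℤ) - digit K b l) : ℝ)| ≤ |((v l - u l : ℤ) : ℝ)| := by
    exact_mod_cast this
  exact sq_le_sq.2 h2

/-- The point of the class of `u` that is nearest to `v`, where `v` is in the class of `a`. -/
noncomputable def nearest {d : ℕ} (K u a : ℕ) (v : Fin d → ℤ) (l : Fin d) : ℤ :=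
  v l + wrap K ((digit K u l : ℤ) - digit K a l)

theorem norm_nearest_sub_sq {K d u a : ℕ} (v : Fin d → ℤ) :
    ‖intVec (nearest K u a v) - intVec v‖ ^ 2 = torSq K d u a := by
  rw [norm_intVec_sub_sq, torSq, ← Fin.sum_univ_eq_sum_range
    (fun l => (wrap K ((digit K u l : ℤ) - digit K a l) : ℝ) ^ 2)]
  simp [nearest]

theorem exists_nearest_eq {K d u a : ℕ} {v : Fin d → ℤ}
    (ha : ∀ l : Fin d, ∃ z : ℤ, (digit K a l : ℤ) = v l + K * z) (l : Fin d) :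
    ∃ z : ℤ, nearest K u a v l = digit K u l + K * z := by
  obtain ⟨z, hz⟩ := ha l
  obtain ⟨z', hz'⟩ := exists_wrap_eq K ((digit K u l : ℤ) - digit K a l)
  refine ⟨z' - z, ?_⟩
  rw [nearest, hz', hz]; ring

theorem abs_sub_le_norm {d : ℕ} (v u : Fin d → ℤ) (l : Fin d) :
    |((v l - u l : ℤ) : ℝ)| ≤ ‖intVec v - intVec u‖ := by
  have := EuclideanSpace.norm_eq (intVec v - intVec u)
  have h := PiLp.norm_apply_le (intVec v - intVec u) l
  simpa [intVec] using h

/-- Rounding moves `X` and `Y` by at most `d` each, which accounts for the 2d in `hr₁` and the `d`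
in the conclusion. The chosen class `u` has a representative near the rounded `X` and one near the
rounded `Y`. In every coordinate these differ by a multiple of `K` and, by `hsmall`, by less than
`K`, so they are the same point. -/
theorem exists_common_center {K d : ℕ} (hK : 0 < K) {r₁ r₂ σ : ℝ} (hr₂ : 0 ≤ r₂)
    (hr₁ : σ + 2 * d ≤ r₁) (hsmall : 2 * r₂ + r₁ < K) {U : Set ℕ}
    (hU : ∀ a < K ^ d, ∀ b < K ^ d, torSq K d a b ≤ r₁ ^ 2 →
      ∃ u ∈ U, torSq K d u a ≤ r₂ ^ 2 ∧ torSq K d u b ≤ r₂ ^ 2)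
    {X Y : E d} (hXY : ‖X - Y‖ ≤ σ) : ∃ u ∈ U, ∃ v : Fin d → ℤ,
      (∀ l, ∃ z : ℤ, v l = digit K u l + K * z) ∧
      ‖intVec v - X‖ ≤ r₂ + d ∧ ‖intVec v - Y‖ ≤ r₂ + d := by
  set p : Fin d → ℤ := fun l => ⌊X l⌋ with hp
  set q : Fin d → ℤ := fun l => ⌊Y l⌋ with hq
  obtain ⟨a, ha, hap⟩ := exists_digits hK p
  obtain ⟨b, hb, hbq⟩ := exists_digits hK q
  have h1 := norm_intVec_floor_sub_le X
  have h2 := norm_intVec_floor_sub_le Y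
  have hr0 : 0 ≤ r₁ := le_trans (add_nonneg ((norm_nonneg _).trans hXY) (by positivity)) hr₁
  have hpq : ‖intVec p - intVec q‖ ≤ r₁ := by
    have : intVec p - intVec q = (intVec p - X) + (X - Y) - (intVec q - Y) := by abel
    rw [this]
    refine (norm_sub_le _ _).trans ?_
    have := norm_add_le (intVec p - X) (X - Y)
    linarith
  have htor : torSq K d a b ≤ r₁ ^ 2 :=
    (torSq_le hK hap hbq).trans (by gcongr)
  obtain ⟨u, hu, hua, hub⟩ := hU a ha b hb htor
  have hn1 : ‖intVec (nearest K u a p) - intVec p‖ ≤ r₂ :=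
    le_of_sq_le_sq (by rwa [norm_nearest_sub_sq]) hr₂
  have hn2 : ‖intVec (nearest K u b q) - intVec q‖ ≤ r₂ :=
    le_of_sq_le_sq (by rwa [norm_nearest_sub_sq]) hr₂
  have heq : nearest K u a p = nearest K u b q := by
    funext l
    obtain ⟨z, hz⟩ := exists_nearest_eq (u := u) hap l
    obtain ⟨z', hz'⟩ := exists_nearest_eq (u := u) hbq l
    have h3 : nearest K u a p l - nearest K u b q l = K * (z - z') := by rw [hz, hz']; ring
    have h4 : |((nearest K u a p l - nearest K u b q l : ℤ) : ℝ)| < K := by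
      have e : ((nearest K u a p l - nearest K u b q l : ℤ) : ℝ) =
          ((nearest K u a p l - p l : ℤ) : ℝ) + ((p l - q l : ℤ) : ℝ) -
            ((nearest K u b q l - q l : ℤ) : ℝ) := by push_cast; ring
      rw [e]
      have h5 := abs_sub_le_norm (nearest K u a p) p l
      have h6 := abs_sub_le_norm p q l
      have h7 := abs_sub_le_norm (nearest K u b q) q l
      refine (abs_sub _ _).trans_lt ?_
      have h8 := abs_add_le ((nearest K u a p l - p l : ℤ) : ℝ) ((p l - q l : ℤ) : ℝ)
      linarith
    have h9 := Int.eq_zero_of_abs_lt_dvd ⟨_, h3⟩ (by exact_mod_cast h4)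
    omega
  refine ⟨u, hu, nearest K u a p, fun l => exists_nearest_eq hap l, ?_, ?_⟩
  · have : intVec (nearest K u a p) - X =
      (intVec (nearest K u a p) - intVec p) + (intVec p - X) := by abel
    rw [this]
    exact (norm_add_le _ _).trans (add_le_add hn1 h1)
  · have : intVec (nearest K u a p) - Y =
      (intVec (nearest K u b q) - intVec q) + (intVec q - Y) := by rw [heq]; abel
    rw [this]
    exact (norm_add_le _ _).trans (add_le_add hn2 h2)

theorem volume_unitCube {d : ℕ} (v : Fin d → ℤ) :
    volume {s : E d | ∀ l, (v l : ℝ) ≤ s l ∧ s l < v l + 1} = 1 := by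
  have h := (EuclideanSpace.volume_preserving_symm_measurableEquiv_toLp (Fin d)).symm
  have h1 : {s : E d | ∀ l, (v l : ℝ) ≤ s l ∧ s l < v l + 1} =
      (MeasurableEquiv.toLp 2 (Fin d → ℝ)).symm ⁻¹'
        (Set.univ.pi fun l => Set.Ico (v l : ℝ) (v l + 1)) := by
    ext s; simp
  rw [h1, (EuclideanSpace.volume_preserving_symm_measurableEquiv_toLp (Fin d)).measure_preimage
    (MeasurableSet.univ_pi fun _ => measurableSet_Ico).nullMeasurableSet, Real.volume_pi_Ico]
  simp

open Classical in
-- The unit cubes at the grid points cover the lens, and a cube that meets it belongs to a grid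
-- point within `r₂` of both centres. Since `2 * r₂ < K`, each class has only one representative
-- that close, so volume is bounded by a number of classes. `X` and `Y` are representatives of `a`
-- and `b` that realize the torus distance.
theorem volume_lens_le_card {K d : ℕ} (hK : 0 < K) {r₂ : ℝ}
    (hsmall : 2 * r₂ < K) (a b : ℕ) :
    ∃ X Y : E d, ‖X - Y‖ ^ 2 = torSq K d a b ∧
      volume (Metric.closedBall X (r₂ - d) ∩ Metric.closedBall Y (r₂ - d)) ≤
      ((Finset.range (K ^ d)).filter
        fun u => torSq K d u a ≤ r₂ ^ 2 ∧ torSq K d u b ≤ r₂ ^ 2).card := by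
  set p : Fin d → ℤ := fun l => digit K a l with hp
  set q : Fin d → ℤ := fun l => p l - wrap K ((digit K a l : ℤ) - digit K b l) with hq
  have hap : ∀ l : Fin d, ∃ z : ℤ, (digit K a l : ℤ) = p l + K * z := fun l => ⟨0, by simp [hp]⟩
  have hbq : ∀ l : Fin d, ∃ z : ℤ, (digit K b l : ℤ) = q l + K * z := by
    intro l
    obtain ⟨z, hz⟩ := exists_wrap_eq K ((digit K a l : ℤ) - digit K b l)
    exact ⟨z, by simp only [hq, hp, hz]; ring⟩
  refine ⟨intVec p, intVec q, ?_, ?_⟩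
  · rw [norm_intVec_sub_sq, torSq, ← Fin.sum_univ_eq_sum_range
      (fun l => (wrap K ((digit K a l : ℤ) - digit K b l) : ℝ) ^ 2)]
    simp [hq]
  set S := (Finset.range (K ^ d)).filter
    fun u => torSq K d u a ≤ r₂ ^ 2 ∧ torSq K d u b ≤ r₂ ^ 2 with hS
  have hsub : Metric.closedBall (intVec p) (r₂ - d) ∩ Metric.closedBall (intVec q) (r₂ - d) ⊆
      ⋃ u ∈ S, {s : E d | ∀ l, (nearest K u a p l : ℝ) ≤ s l ∧ s l < nearest K u a p l + 1} := by
    rintro s ⟨h1, h2⟩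
    rw [mem_closedBall_iff_norm] at h1 h2
    set v : Fin d → ℤ := fun l => ⌊s l⌋ with hv
    have h3 := norm_intVec_floor_sub_le s
    have hvp : ‖intVec v - intVec p‖ ≤ r₂ := by
      have : intVec v - intVec p = (intVec v - s) + (s - intVec p) := by abel
      rw [this]
      exact (norm_add_le _ _).trans (by linarith)
    have hvq : ‖intVec v - intVec q‖ ≤ r₂ := by
      have : intVec v - intVec q = (intVec v - s) + (s - intVec q) := by abel
      rw [this]
      exact (norm_add_le _ _).trans (by linarith)
    obtain ⟨u, hu, huv⟩ := exists_digits hK v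
    have hmem : u ∈ S := by
      rw [hS, Finset.mem_filter, Finset.mem_range]
      exact ⟨hu, (torSq_le hK huv hap).trans (by gcongr), (torSq_le hK huv hbq).trans (by gcongr)⟩
    have hn : ∀ l, nearest K u a p l = v l := by
      intro l
      obtain ⟨z, hz⟩ := huv l
      have h4 := abs_sub_le_norm v p l
      have h5 : 2 * |v l - p l| < K := by
        have : (2 * |((v l - p l : ℤ) : ℝ)|) < K := by linarith
        exact_mod_cast this
      have h6 := wrap_eq_of_abs_lt hK (x := (digit K u l : ℤ) - digit K a l) (y := v l - p l)
        (z := -z) (by rw [hz]; simp only [hp]; ring) h5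
      rw [nearest, h6]; ring
    simp only [Set.mem_iUnion]
    refine ⟨u, hmem, fun l => ?_⟩
    rw [hn l]
    exact ⟨Int.floor_le _, Int.lt_floor_add_one _⟩
  refine (measure_mono hsub).trans ((measure_biUnion_finset_le _ _).trans ?_)
  simp [volume_unitCube]

end FilterLSF

namespace FilterLSF
open RealRAM

/-! ### Independent coins -/

instance : IsProbabilityMeasure coinMeasure := by
  unfold coinMeasure; infer_instance

theorem map_coinMeasure_comp {κ : Type*} {pos : κ → ℕ} (hpos : Function.Injective pos) :
    coinMeasure.map (fun ω q => ω (pos q)) =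
      Measure.infinitePi (fun _ : κ => (volume : Measure unitInterval)) := by
  classical
  refine Measure.eq_infinitePi _ fun s t ht => ?_
  have hm : Measurable fun (ω : Tape) (q : κ) => ω (pos q) := by fun_prop
  rw [Measure.map_apply hm (.pi s.countable_toSet fun _ _ => ht _)]
  set t' : ℕ → Set unitInterval := Function.extend pos t fun _ => Set.univ with ht'
  have he : ∀ q, t' (pos q) = t q := fun q => hpos.extend_apply _ _ _
  have h1 : (fun (ω : Tape) (q : κ) => ω (pos q)) ⁻¹' ((s : Set κ).pi t) =
      ((s.map ⟨pos, hpos⟩ : Finset ℕ) : Set ℕ).pi t' := by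
    ext ω; simp [Set.mem_pi, he]
  rw [h1, coinMeasure, Measure.infinitePi_pi]
  · simp [he]
  · intro n hn
    obtain ⟨q, _, rfl⟩ := Finset.mem_map.1 hn
    simpa [he] using ht q

theorem measurable_update_coin (p : ℕ) :
    Measurable fun z : Tape × unitInterval => Function.update z.1 p z.2 := by
  rw [measurable_pi_iff]
  intro n
  by_cases h : n = p
  · subst h; simpa using measurable_snd
  · simp only [Function.update_of_ne h]
    exact (measurable_pi_apply (X := fun _ => unitInterval) n).comp measurable_fst

theorem map_coinMeasure_update (p : ℕ) :
    (coinMeasure.prod (volume : Measure unitInterval)).map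
      (fun z => Function.update z.1 p z.2) = coinMeasure := by
  refine Measure.eq_infinitePi _ fun s t ht => ?_
  have hm := measurable_update_coin p
  rw [Measure.map_apply hm (.pi s.countable_toSet fun _ _ => ht _)]
  by_cases hp : p ∈ s
  · have h1 : (fun z : Tape × unitInterval => Function.update z.1 p z.2) ⁻¹' ((s : Set ℕ).pi t) =
        (((s.erase p : Finset ℕ) : Set ℕ).pi t) ×ˢ t p := by
      ext ⟨ω, r⟩
      simp only [Set.mem_preimage, Set.mem_pi, Finset.mem_coe, Finset.mem_erase, Set.mem_prod]
      constructor
      · intro h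
        refine ⟨fun i hi => ?_, by simpa using h p hp⟩
        simpa [Function.update_of_ne hi.1] using h i hi.2
      · rintro ⟨h, h'⟩ i hi
        by_cases hip : i = p
        · subst hip; simpa using h'
        · simpa [Function.update_of_ne hip] using h i ⟨hip, hi⟩
    rw [h1, Measure.prod_prod, coinMeasure, Measure.infinitePi_pi _ fun i _ => ht i, mul_comm,
      Finset.mul_prod_erase s (fun i => volume (t i)) hp]
  · have h1 : (fun z : Tape × unitInterval => Function.update z.1 p z.2) ⁻¹' ((s : Set ℕ).pi t) =
        ((s : Set ℕ).pi t) ×ˢ Set.univ := by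
      ext ⟨ω, r⟩
      simp only [Set.mem_preimage, Set.mem_pi, Finset.mem_coe, Set.mem_prod, Set.mem_univ,
        and_true]
      refine forall₂_congr fun i hi => ?_
      rw [Function.update_of_ne (by rintro rfl; exact hp hi)]
    rw [h1, Measure.prod_prod, coinMeasure, Measure.infinitePi_pi _ fun i _ => ht i]
    simp

/-- Resampling the coin `p` preserves the law of the tape. Given the other coins, `f` is a fixed
number, and the new coin hits it with probability zero. -/
theorem ae_coin_ne {f : Tape → ℝ} (hf : Measurable f) (p : ℕ)
    (h : ∀ ω r, f (Function.update ω p r) = f ω) :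
    ∀ᵐ ω ∂coinMeasure, (ω p : ℝ) ≠ f ω := by
  have hm := measurable_update_coin p
  have hset : MeasurableSet {ω : Tape | (ω p : ℝ) ≠ f ω} :=
    (measurableSet_eq_fun (f := fun ω : Tape => (ω p : ℝ)) (by fun_prop) hf).compl
  rw [← map_coinMeasure_update p, ae_map_iff hm.aemeasurable hset]
  have hset' : MeasurableSet {z : Tape × unitInterval |
      ((Function.update z.1 p z.2 p : unitInterval) : ℝ) ≠ f (Function.update z.1 p z.2)} :=
    hm hset
  change ∀ᵐ z ∂_, z ∈ {z : Tape × unitInterval |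
      ((Function.update z.1 p z.2 p : unitInterval) : ℝ) ≠ f (Function.update z.1 p z.2)}
  rw [Measure.ae_prod_mem_iff_ae_ae_mem hset']
  refine ae_of_all _ fun ω => ?_
  simp only [Set.mem_ofPred_eq, Function.update_self, h]
  have : ({r : unitInterval | (r : ℝ) = f ω}).Subsingleton := fun a ha b hb =>
    Subtype.ext (ha.trans hb.symm)
  have h0 := this.measure_zero (volume : Measure unitInterval)
  rw [ae_iff]
  simpa using h0

/-- If some coefficient is not zero, the equation can be solved for its coin, and `ae_coin_ne`
applies. -/
theorem ae_affine_ne_zero {κ : Type*} [Fintype κ] [DecidableEq κ] {pos : κ → ℕ}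
    (hpos : Function.Injective pos) (a : κ → ℝ) (c : ℝ) (h : a ≠ 0 ∨ c ≠ 0) :
    ∀ᵐ ω ∂coinMeasure, c + ∑ q, a q * (ω (pos q) : ℝ) ≠ 0 := by
  by_cases ha : a = 0
  · refine ae_of_all _ fun ω => ?_
    simpa [ha] using h
  obtain ⟨q, hq⟩ := Function.ne_iff.1 ha
  have hq' : a q ≠ 0 := hq
  filter_upwards [ae_coin_ne (p := pos q)
    (f := fun ω => -(c + ∑ r ∈ Finset.univ.erase q, a r * (ω (pos r) : ℝ)) / a q) (by fun_prop)
    (fun ω r => by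
      congr 3
      refine Finset.sum_congr rfl fun r' hr' => ?_
      rw [Function.update_of_ne]
      exact fun he => (Finset.mem_erase.1 hr').1 (hpos he))] with ω hω
  intro h0
  apply hω
  rw [← Finset.add_sum_erase _ _ (Finset.mem_univ q)] at h0
  field_simp
  linarith

/-- The half-open unit cube. -/
def unitCube (d : ℕ) : Set (E d) := {s | ∀ l, 0 ≤ s l ∧ s l < 1}

/-- The coins take the value 1 with probability zero. Passing to the half-open interval makes the
integer translates of the cube disjoint. -/
theorem map_coe_unitInterval :
    (volume : Measure unitInterval).map (Subtype.val : unitInterval → ℝ) =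
      volume.restrict (Set.Ico (0 : ℝ) 1) := by
  have h1 := (MeasurePreserving.map_eq (measurePreserving_subtype_coe
    (μa := (volume : Measure ℝ)) (measurableSet_Icc (a := (0 : ℝ)) (b := 1))))
  rw [Measure.restrict_congr_set Ico_ae_eq_Icc]
  exact h1

theorem map_toLp_coins (d : ℕ) :
    (Measure.infinitePi (fun _ : Fin d => (volume : Measure unitInterval))).map
      (fun y => (WithLp.toLp 2 fun l => (y l : ℝ) : E d)) = volume.restrict (unitCube d) := by
  have h1 : (Measure.infinitePi (fun _ : Fin d => (volume : Measure unitInterval))).map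
      (fun (y : Fin d → unitInterval) l => (y l : ℝ)) =
      (volume : Measure (Fin d → ℝ)).restrict (Set.univ.pi fun _ => Set.Ico (0 : ℝ) 1) := by
    rw [Measure.infinitePi_map_pi (μ := fun _ : Fin d => (volume : Measure unitInterval))
      (f := fun _ => (Subtype.val : unitInterval → ℝ)) (fun _ => measurable_subtype_coe)]
    have h2 : IsProbabilityMeasure
        ((volume : Measure unitInterval).map (Subtype.val : unitInterval → ℝ)) :=
      Measure.isProbabilityMeasure_map measurable_subtype_coe.aemeasurable
    have h3 := Measure.infinitePi_eq_pi
      (μ := fun _ : Fin d => (volume : Measure unitInterval).map (Subtype.val : unitInterval → ℝ))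
    rw [volume_pi, Measure.restrict_pi_pi]
    simp only [map_coe_unitInterval] at h3 ⊢
    exact h3
  have h2 := EuclideanSpace.volume_preserving_symm_measurableEquiv_toLp (Fin d)
  have h3 := (h2.symm).restrict_preimage
    (s := unitCube d) (by
      have : unitCube d = (MeasurableEquiv.toLp 2 (Fin d → ℝ)).symm ⁻¹'
          (Set.univ.pi fun _ => Set.Ico (0 : ℝ) 1) := by
        ext s; simp [unitCube]
      rw [this]
      exact (MeasurableEquiv.toLp 2 (Fin d → ℝ)).symm.measurable
        (MeasurableSet.univ_pi fun _ => measurableSet_Ico))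
  have h4 : (MeasurableEquiv.toLp 2 (Fin d → ℝ)).symm.symm ⁻¹' unitCube d =
      Set.univ.pi fun _ => Set.Ico (0 : ℝ) 1 := by
    ext s; simp [unitCube]
  rw [h4, ← h1] at h3
  rw [← h3.map_eq, Measure.map_map h3.measurable (by fun_prop)]
  rfl

/-- Different pieces read disjoint sets of coins, so the blocks are independent and each of them is
uniform on the cube. -/
theorem lintegral_prod_blocks {k d : ℕ} {pos : Fin k × Fin d → ℕ} (hpos : Function.Injective pos)
    {g : Fin k → E d → ℝ≥0∞} (hg : ∀ i, Measurable (g i)) :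
    ∫⁻ ω, ∏ i, g i (WithLp.toLp 2 fun l => (ω (pos (i, l)) : ℝ)) ∂coinMeasure =
      ∏ i, ∫⁻ s in unitCube d, g i s := by
  set ν := Measure.infinitePi (fun _ : Fin d => (volume : Measure unitInterval)) with hν
  have hm : Measurable fun (y : Fin d → unitInterval) => (WithLp.toLp 2 fun l => (y l : ℝ) : E d) := by
    fun_prop
  set g' : Fin k → (Fin d → unitInterval) → ℝ≥0∞ := fun i y =>
    g i (WithLp.toLp 2 fun l => (y l : ℝ)) with hg'
  have hg'm : ∀ i, Measurable (g' i) := fun i => (hg i).comp hm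
  have h1 : coinMeasure.map (fun ω (i : Fin k) (l : Fin d) => ω (pos (i, l))) =
      Measure.infinitePi fun _ : Fin k => ν := by
    rw [hν, ← Measure.infinitePi_map_curry
      (μ := fun (_ : Fin k) (_ : Fin d) => (volume : Measure unitInterval)),
      ← map_coinMeasure_comp hpos, Measure.map_map (by fun_prop) (by fun_prop)]
    rfl
  have h2 : ∫⁻ ω, ∏ i, g i (WithLp.toLp 2 fun l => (ω (pos (i, l)) : ℝ)) ∂coinMeasure =
      ∫⁻ z, ∏ i, g' i (z i) ∂(Measure.infinitePi fun _ : Fin k => ν) := by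
    rw [← h1, lintegral_map (f := fun z : Fin k → Fin d → unitInterval => ∏ i, g' i (z i))
      (Finset.measurable_fun_prod _ fun i _ => (hg'm i).comp (measurable_pi_apply i))
      (by fun_prop)]
  rw [h2, ProbabilityTheory.lintegral_prod_eq_prod_lintegral_of_indepFun Finset.univ
    (fun i (z : Fin k → Fin d → unitInterval) => g' i (z i))
    (ProbabilityTheory.iIndepFun_infinitePi hg'm)
    (fun i => (hg'm i).comp (measurable_pi_apply i))]
  refine Finset.prod_congr rfl fun i _ => ?_
  rw [← map_toLp_coins, lintegral_map (hg i) hm]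
  exact (measurePreserving_eval_infinitePi (fun _ : Fin k => ν) i).lintegral_comp (hg'm i)

/-- The integer translates of the half-open cube are disjoint, so the parts of `L` that they cut out
have total volume at most that of `L`. This says that a uniformly shifted lattice has on average at
most `volume L` points in `L`. -/
theorem tsum_setLIntegral_le {d : ℕ} {L : Set (E d)} (hL : MeasurableSet L) (c : E d) :
    ∑' z : Fin d → ℤ, volume (unitCube d ∩ {s | c + intVec z + s ∈ L}) ≤ volume L := by
  have hc : MeasurableSet (unitCube d) := by
    have : unitCube d = ⋂ l, {s : E d | 0 ≤ s l} ∩ {s : E d | s l < 1} := by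
      ext s; simp [unitCube]
    rw [this]
    exact MeasurableSet.iInter fun l => (measurableSet_le measurable_const (by fun_prop)).inter
      (measurableSet_lt (by fun_prop) measurable_const)
  have hmeas : ∀ z : Fin d → ℤ, MeasurableSet (unitCube d ∩ {s | c + intVec z + s ∈ L}) :=
    fun z => hc.inter (hL.preimage (f := fun s => c + intVec z + s) (by fun_prop))
  set A : (Fin d → ℤ) → Set (E d) := fun z =>
    (fun s => -(c + intVec z) + s) ⁻¹' (unitCube d ∩ {s | c + intVec z + s ∈ L}) with hA
  have h1 : ∀ z, volume (unitCube d ∩ {s | c + intVec z + s ∈ L}) = volume (A z) := fun z =>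
    (measure_preimage_add volume _ _).symm
  simp only [h1]
  rw [← measure_iUnion]
  · refine measure_mono (Set.iUnion_subset fun z s hs => ?_)
    have := hs.2
    simpa only [Set.mem_ofPred_eq, add_neg_cancel_left] using this
  · intro z z' hzz
    refine Set.disjoint_left.2 fun s hs hs' => hzz ?_
    funext l
    have h2 := hs.1 l
    have h3 := hs'.1 l
    simp only [PiLp.add_apply, PiLp.neg_apply, intVec] at h2 h3
    have h4 : (z l : ℝ) < z' l + 1 := by linarith
    have h5 : (z' l : ℝ) < z l + 1 := by linarith
    have h6 : z l < z' l + 1 := by exact_mod_cast h4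
    have h7 : z' l < z l + 1 := by exact_mod_cast h5
    omega
  · intro z
    exact (hmeas z).preimage (by fun_prop)

end FilterLSF

namespace FilterLSF
open RealRAM

/-! ### The random filter family -/

/-- The parameters of a filter family for `ℝ^D`: a base `S` for the angles, `2 ^ r` pieces of
dimension `d`, a grid with `K` points per period, and `N` chosen grid points `u j`. -/
structure Scheme (D : ℕ) where
  S : ℕ
  r : ℕ
  d : ℕ
  K : ℕ
  N : ℕ
  u : ℕ → ℕ
  w : ℝ
  ε : ℝ
  hD : 2 ^ r * d = D
  d_pos : 0 < d
  K_pos : 0 < K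
  S_pos : 0 < S
  w_pos : 0 < w
  ε_pos : 0 < ε
  u_lt : ∀ j < N, u j < K ^ d
  u_inj : ∀ i < N, ∀ j < N, u i = u j → i = j

theorem digit_injective {K d a b : ℕ} (ha : a < K ^ d) (hb : b < K ^ d)
    (h : ∀ l < d, digit K a l = digit K b l) : a = b := by
  have h1 : finFunctionFinEquiv.symm (⟨a, ha⟩ : Fin (K ^ d)) =
      finFunctionFinEquiv.symm ⟨b, hb⟩ := by
    funext l
    refine Fin.ext ?_
    exact h l l.2
  exact congrArg Fin.val (finFunctionFinEquiv.symm.injective h1)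

theorem applyMat_add {d' d : ℕ} (A : Matrix (Fin d') (Fin d) ℝ) (x y : E d) :
    applyMat A (x + y) = applyMat A x + applyMat A y := by
  ext l; simp [applyMat_apply, mul_add, Finset.sum_add_distrib]

theorem applyMat_smul {d' d : ℕ} (A : Matrix (Fin d') (Fin d) ℝ) (a : ℝ) (x : E d) :
    applyMat A (a • x) = a • applyMat A x := by
  ext l
  simp only [applyMat_apply, PiLp.smul_apply, smul_eq_mul, Finset.mul_sum]
  exact Finset.sum_congr rfl fun b _ => by ring

namespace Scheme

variable {D : ℕ} (s : Scheme D)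

/-- The number of pieces. -/
abbrev k : ℕ := 2 ^ s.r

/-- The number of decompositions. -/
abbrev M : ℕ := s.S ^ (s.k - 1)

/-- The decomposition with index `m`. -/
noncomputable abbrev mat (m : ℕ) : Fin s.k → Matrix (Fin s.d) (Fin D) ℝ :=
  decomp s.S s.k s.d D m

/-- The number of the coin that shifts the coordinate `l` of the lattices for the piece `i`. -/
def pos (m i l : ℕ) : ℕ := m * D + i * s.d + l

/-- The piece `i` of `x`, in units of the period of the lattices. -/
noncomputable def pt (m : ℕ) (x : E D) (i : ℕ) : E s.d :=
  ((1 + s.ε) * (3 * s.w))⁻¹ • leaf s.S s.k s.d m (entries x) i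

/-- The random shift of the lattices for the piece `i`. -/
noncomputable def shift (ω : Tape) (m i : ℕ) : E s.d :=
  WithLp.toLp 2 fun l => (ω (s.pos m i l) : ℝ)

/-- The grid point with number `j`. -/
noncomputable def base (j : ℕ) : E s.d :=
  WithLp.toLp 2 fun l => (digit s.K (s.u j) l : ℝ) / s.K

/-- The centre of a ball, in units of the period. -/
noncomputable def center (ω : Tape) (m i j : ℕ) (z : Fin s.d → ℤ) : E s.d :=
  s.base j + intVec z + s.shift ω m i

/-- The offset of a lattice, reduced to the first period. -/
noncomputable def offset (ω : Tape) (m i j : ℕ) : E s.d :=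
  WithLp.toLp 2 fun l => 3 * s.w * Int.fract (s.base j l + s.shift ω m i l)

/-- The filter family. -/
noncomputable def fam (ω : Tape) : FilterFamily (E D) :=
  rescale (1 + s.ε) (⋃ m : Fin s.M, tensor (s.mat m)
    (fun i => ballLattices s.w (fun j : Fin s.N => s.offset ω m i j)))

/-- Indices of filters. -/
abbrev Idx : Type := Fin s.M × (Fin s.k → Fin s.N × (Fin s.d → ℤ))

/-- The filter with a given index. -/
def filt (ω : Tape) (q : s.Idx) : Set (E D) :=
  {x | ∀ i : Fin s.k, ‖s.pt q.1 x i - s.center ω q.1 i (q.2 i).1 (q.2 i).2‖ ≤ 1 / 3}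

theorem k_pos : 0 < s.k := by positivity

theorem scale_pos : 0 < (1 + s.ε) * (3 * s.w) := by
  have := s.w_pos; have := s.ε_pos; positivity

theorem coef_pos : 0 < ((1 + s.ε) * (3 * s.w))⁻¹ * √((D : ℝ) / s.d) := by
  have h1 := s.scale_pos
  have h2 : (0 : ℝ) < D := by
    have : 0 < D := by rw [← s.hD]; exact Nat.mul_pos (by positivity) s.d_pos
    exact_mod_cast this
  have h3 : (0 : ℝ) < s.d := by exact_mod_cast s.d_pos
  positivity

theorem pt_eq (m : ℕ) (x : E D) (i : Fin s.k) :
    s.pt m x i = (((1 + s.ε) * (3 * s.w))⁻¹ * √((D : ℝ) / s.d)) • applyMat (s.mat m i) x := by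
  rw [pt, ← sqrt_smul_applyMat_decomp s.k_pos s.d_pos s.hD, smul_smul]

theorem pt_sub (m : ℕ) (x y : E D) (i : Fin s.k) :
    s.pt m (x - y) i = s.pt m x i - s.pt m y i := by
  have h : x - y = x + (-1 : ℝ) • y := by module
  rw [h]
  simp only [pt_eq, applyMat_add, applyMat_smul]
  module

theorem pt_smul (m : ℕ) (a : ℝ) (x : E D) (i : Fin s.k) :
    s.pt m (a • x) i = a • s.pt m x i := by
  simp only [pt_eq, applyMat_smul]
  rw [smul_comm]

/-- This is the only trace of orthogonality in the estimate for distant pairs: the total over the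
pieces depends neither on `m` nor on the direction of `x`. -/
theorem sum_norm_pt_sq (m : ℕ) (x : E D) :
    ∑ i : Fin s.k, ‖s.pt m x i‖ ^ 2 = s.k * (((1 + s.ε) * (3 * s.w))⁻¹ * ‖x‖) ^ 2 := by
  have h1 := (isOrthDecomp_decomp (S := s.S) (m := m) s.hD).sum_norm_sq x
  have h3 : (0 : ℝ) < s.d := by exact_mod_cast s.d_pos
  have h2 : (D : ℝ) / s.d = s.k := by
    have h : ((s.k * s.d : ℕ) : ℝ) = D := congrArg Nat.cast s.hD
    rw [div_eq_iff h3.ne', ← h, Nat.cast_mul]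
  simp only [pt_eq, norm_smul, mul_pow, ← Finset.mul_sum]
  rw [h1, norm_mul, Real.norm_eq_abs, Real.norm_eq_abs, mul_pow, sq_abs, sq_abs, h2,
    Real.sq_sqrt (by positivity)]
  ring

theorem eq_zero_of_pt {m : ℕ} {x : E D} (h : ∀ i : Fin s.k, s.pt m x i = 0) : x = 0 := by
  have h1 := s.sum_norm_pt_sq m x
  simp only [h, norm_zero] at h1
  have h2 : (0 : ℝ) < s.k := by exact_mod_cast s.k_pos
  have h3 := s.scale_pos
  have h4 : ((1 + s.ε) * (3 * s.w))⁻¹ * ‖x‖ = 0 := by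
    by_contra h0
    have : 0 < s.k * (((1 + s.ε) * (3 * s.w))⁻¹ * ‖x‖) ^ 2 := by positivity
    simp only [ne_eq, OfNat.ofNat_ne_zero, not_false_eq_true, zero_pow,
      Finset.sum_const_zero] at h1
    linarith
  rcases mul_eq_zero.1 h4 with h5 | h5
  · exact absurd h5 (inv_pos.2 h3).ne'
  · exact norm_eq_zero.1 h5

/-- The point whose pieces are `c`. -/
noncomputable def glue (m : ℕ) (c : Fin s.k → E s.d) : E D :=
  assemble (s.mat m) fun i => (((1 + s.ε) * (3 * s.w))⁻¹ * √((D : ℝ) / s.d))⁻¹ • c i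

theorem pt_glue (m : ℕ) (c : Fin s.k → E s.d) (i : Fin s.k) : s.pt m (s.glue m c) i = c i := by
  rw [pt_eq, glue, (isOrthDecomp_decomp (S := s.S) (m := m) s.hD).applyMat_assemble, smul_smul,
    mul_inv_cancel₀ s.coef_pos.ne', one_smul]

theorem pos_injective : Function.Injective
    (fun q : Fin s.M × Fin s.k × Fin s.d => s.pos q.1 q.2.1 q.2.2) := by
  rintro ⟨m, i, l⟩ ⟨m', i', l'⟩ h
  simp only [pos] at h
  have e : ∀ (m : Fin s.M) (i : Fin s.k) (l : Fin s.d),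
      (m : ℕ) * D + i * s.d + l = l + s.d * (i + s.k * m) := by
    intro m i l
    have h : (m : ℕ) * D = m * (s.k * s.d) := congrArg ((m : ℕ) * ·) s.hD.symm
    rw [h]; ring
  rw [e, e] at h
  have h1 := congrArg (· % s.d) h
  have h2 := congrArg (· / s.d) h
  simp only [Nat.add_mul_mod_self_left, Nat.mod_eq_of_lt l.2, Nat.mod_eq_of_lt l'.2] at h1
  simp only [Nat.add_mul_div_left _ _ s.d_pos, Nat.div_eq_of_lt l.2, Nat.div_eq_of_lt l'.2,
    zero_add] at h2
  have h3 := congrArg (· % s.k) h2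
  have h4 := congrArg (· / s.k) h2
  simp only [Nat.add_mul_mod_self_left, Nat.mod_eq_of_lt i.2, Nat.mod_eq_of_lt i'.2] at h3
  simp only [Nat.add_mul_div_left _ _ s.k_pos, Nat.div_eq_of_lt i.2, Nat.div_eq_of_lt i'.2,
    zero_add] at h4
  simp only [Prod.mk.injEq]
  exact ⟨Fin.ext h4, Fin.ext h3, Fin.ext h1⟩

/-! #### Membership -/

/-- Reducing an offset to the first period changes the label of a lattice vector by an integer
vector but leaves the lattice as it is. -/
theorem mem_closedBall_offset_iff (ω : Tape) (m i j : ℕ) (z : Fin s.d → ℤ) (y : E s.d) :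
    y ∈ Metric.closedBall (s.offset ω m i j + WithLp.toLp 2 fun l => 3 * s.w * (z l : ℝ)) s.w ↔
      ‖(3 * s.w)⁻¹ • y - s.center ω m i j
        (fun l => z l - ⌊s.base j l + s.shift ω m i l⌋)‖ ≤ 1 / 3 := by
  have hw := s.w_pos
  have h : (3 * s.w)⁻¹ • y - s.center ω m i j
      (fun l => z l - ⌊s.base j l + s.shift ω m i l⌋) = (3 * s.w)⁻¹ •
        (y - (s.offset ω m i j + WithLp.toLp 2 fun l => 3 * s.w * (z l : ℝ))) := by
    ext l
    simp only [center, offset, intVec, PiLp.sub_apply, PiLp.add_apply, PiLp.smul_apply,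
      smul_eq_mul, Int.fract]
    push_cast
    field_simp
    ring
  rw [h, norm_smul, mem_closedBall_iff_norm, Real.norm_eq_abs, abs_of_pos (by positivity),
    inv_mul_le_iff₀ (by positivity)]
  constructor <;> intro h <;> linarith

theorem smul_leaf (m i : ℕ) (x : E D) :
    leaf s.S s.k s.d m (entries ((1 + s.ε)⁻¹ • x)) i =
      (1 + s.ε)⁻¹ • leaf s.S s.k s.d m (entries x) i := by
  have h : entries ((1 + s.ε)⁻¹ • x) = (1 + s.ε)⁻¹ • entries x := by
    funext j
    simp only [entries, Pi.smul_apply, smul_eq_mul]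
    split_ifs <;> simp
  ext l
  rw [h]
  simp only [leaf, PiLp.smul_apply]
  rw [node_smul _ _ _ (le_trans s.k_pos (Nat.le_add_right _ _))]
  rfl

theorem scaled_piece (m : ℕ) (i : Fin s.k) (x : E D) :
    (3 * s.w)⁻¹ • √((D : ℝ) / s.d) • applyMat (s.mat m i) ((1 + s.ε)⁻¹ • x) = s.pt m x i := by
  rw [sqrt_smul_applyMat_decomp s.k_pos s.d_pos s.hD, smul_leaf, smul_smul, pt]
  congr 1
  exact (mul_inv_rev _ _).symm

theorem mem_fam {ω : Tape} {A : Set (E D)} : A ∈ s.fam ω ↔ ∃ q : s.Idx, A = s.filt ω q := by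
  simp only [fam, rescale, tensor, ballLattices, Set.mem_iUnion, Set.mem_ofPred_eq]
  constructor
  · rintro ⟨B, ⟨m, C, hC, rfl⟩, rfl⟩
    choose j z hz using hC
    refine ⟨(m, fun i => (j i, fun l => z i l - ⌊s.base (j i) l + s.shift ω m i l⌋)), ?_⟩
    ext x
    simp only [Set.mem_ofPred_eq, filt]
    refine forall_congr' fun i => ?_
    rw [hz i, mem_closedBall_offset_iff, scaled_piece]
  · rintro ⟨⟨m, f⟩, rfl⟩
    refine ⟨_, ⟨m, fun i => Metric.closedBall (s.offset ω m i (f i).1 + WithLp.toLp 2 fun l =>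
      3 * s.w * (((f i).2 l + ⌊s.base (f i).1 l + s.shift ω m i l⌋ : ℤ) : ℝ)) s.w,
      fun i => ⟨(f i).1, _, rfl⟩, rfl⟩, ?_⟩
    ext x
    simp only [Set.mem_ofPred_eq, filt]
    refine forall_congr' fun i => ?_
    rw [mem_closedBall_offset_iff, scaled_piece]
    simp

theorem at_inter_at (ω : Tape) (x y : E D) : (s.fam ω).at x ∩ (s.fam ω).at y =
    s.filt ω '' {q | x ∈ s.filt ω q ∧ y ∈ s.filt ω q} := by
  ext A
  simp only [FilterFamily.at, Set.mem_inter_iff, Set.mem_ofPred_eq, mem_fam, Set.mem_image]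
  constructor
  · rintro ⟨⟨⟨q, rfl⟩, hx⟩, _, hy⟩
    exact ⟨q, ⟨hx, hy⟩, rfl⟩
  · rintro ⟨q, ⟨hx, hy⟩, rfl⟩
    exact ⟨⟨⟨q, rfl⟩, hx⟩, ⟨q, rfl⟩, hy⟩

/-! #### Almost surely, different indices give different filters -/

/-- The integer vector that identifies a ball. -/
def code (j : ℕ) (z : Fin s.d → ℤ) (l : Fin s.d) : ℤ := digit s.K (s.u j) l + s.K * z l

theorem code_injective {j j' : Fin s.N} {z z' : Fin s.d → ℤ}
    (h : ∀ l, s.code j z l = s.code j' z' l) : j = j' ∧ z = z' := by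
  have hK : (0 : ℤ) < s.K := by exact_mod_cast s.K_pos
  have hlt : ∀ a l, (digit s.K a l : ℤ) < s.K := fun a l => by
    exact_mod_cast Nat.mod_lt _ s.K_pos
  have h1 : ∀ l : Fin s.d, digit s.K (s.u j) l = digit s.K (s.u j') l := by
    intro l
    have h2 := congrArg (· % (s.K : ℤ)) (h l)
    simp only [code, Int.add_mul_emod_self_left] at h2
    rw [Int.emod_eq_of_lt (by positivity) (hlt _ _),
      Int.emod_eq_of_lt (by positivity) (hlt _ _)] at h2
    exact_mod_cast h2
  constructor
  · refine Fin.ext (s.u_inj _ j.2 _ j'.2 (digit_injective (s.u_lt _ j.2) (s.u_lt _ j'.2)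
      fun l hl => h1 ⟨l, hl⟩))
  · funext l
    have h2 := h l
    simp only [code, h1 l] at h2
    exact mul_left_cancel₀ hK.ne' (add_left_cancel h2)

theorem center_apply (ω : Tape) (m i j : ℕ) (z : Fin s.d → ℤ) (l : Fin s.d) :
    s.center ω m i j z l = (s.code j z l : ℝ) / s.K + ω (s.pos m i l) := by
  have hK : (s.K : ℝ) ≠ 0 := by exact_mod_cast s.K_pos.ne'
  simp only [center, base, intVec, shift, code, PiLp.add_apply]
  push_cast
  field_simp

/-- A filter is symmetric about its centre. If it were symmetric about two points `x ≠ x'`, it would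
be invariant under the product of the two point reflections, the translation by 2(x - x'), and so it
would be unbounded in some piece. -/
theorem eq_of_filt_eq {ω : Tape} {q q' : s.Idx} (h : s.filt ω q = s.filt ω q') :
    s.glue q.1 (fun i => s.center ω q.1 i (q.2 i).1 (q.2 i).2) =
      s.glue q'.1 (fun i => s.center ω q'.1 i (q'.2 i).1 (q'.2 i).2) := by
  set x := s.glue q.1 (fun i => s.center ω q.1 i (q.2 i).1 (q.2 i).2) with hx
  set x' := s.glue q'.1 (fun i => s.center ω q'.1 i (q'.2 i).1 (q'.2 i).2) with hx'
  have hm : ∀ y, y ∈ s.filt ω q ↔ ∀ i : Fin s.k, ‖s.pt q.1 (y - x) i‖ ≤ 1 / 3 := by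
    intro y
    refine forall_congr' fun i => ?_
    rw [pt_sub, hx, pt_glue]
  have hm' : ∀ y, y ∈ s.filt ω q' ↔ ∀ i : Fin s.k, ‖s.pt q'.1 (y - x') i‖ ≤ 1 / 3 := by
    intro y
    refine forall_congr' fun i => ?_
    rw [pt_sub, hx', pt_glue]
  have hneg : ∀ (m : ℕ) (y : E D) (i : Fin s.k), ‖s.pt m (-y) i‖ = ‖s.pt m y i‖ := by
    intro m y i
    have := s.pt_smul m (-1) y i
    rw [neg_one_smul] at this
    rw [this, norm_smul]; simp
  have hr : ∀ y, y ∈ s.filt ω q → (2 : ℝ) • x - y ∈ s.filt ω q := by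
    intro y hy
    rw [hm] at hy ⊢
    intro i
    have : (2 : ℝ) • x - y - x = -(y - x) := by module
    rw [this, hneg]; exact hy i
  have hr' : ∀ y, y ∈ s.filt ω q → (2 : ℝ) • x' - y ∈ s.filt ω q := by
    intro y hy
    rw [h, hm'] at hy ⊢
    intro i
    have : (2 : ℝ) • x' - y - x' = -(y - x') := by module
    rw [this, hneg]; exact hy i
  have hn : ∀ n : ℕ, x + (n : ℝ) • (2 : ℝ) • (x - x') ∈ s.filt ω q := by
    intro n
    induction n with
    | zero =>
      rw [hm]
      intro i
      have h0 := s.pt_smul q.1 0 0 i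
      simp only [zero_smul] at h0
      simp [h0]
    | succ n ih =>
      have := hr _ (hr' _ ih)
      have e : (2 : ℝ) • x - ((2 : ℝ) • x' - (x + (n : ℝ) • (2 : ℝ) • (x - x'))) =
          x + ((n + 1 : ℕ) : ℝ) • (2 : ℝ) • (x - x') := by push_cast; module
      rwa [e] at this
  have h0 : x - x' = 0 := by
    refine s.eq_zero_of_pt (m := q.1) fun i => ?_
    by_contra hne
    have hpos : 0 < ‖s.pt q.1 (x - x') i‖ := norm_pos_iff.2 hne
    obtain ⟨n, hn'⟩ := exists_nat_gt (1 / ‖s.pt q.1 (x - x') i‖)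
    have h1 := (hm _).1 (hn n) i
    rw [add_sub_cancel_left, pt_smul, pt_smul, norm_smul, norm_smul] at h1
    rw [div_lt_iff₀ hpos] at hn'
    simp only [Real.norm_eq_abs, Nat.abs_cast, Nat.abs_ofNat] at h1
    linarith
  exact sub_eq_zero.1 h0

theorem continuous_applyMat {d' d : ℕ} (A : Matrix (Fin d') (Fin d) ℝ) :
    Continuous (applyMat A) := by
  unfold applyMat
  fun_prop

/-- Equal filters have equal centres. Within one decomposition the centres determine the balls,
piece by piece. For two different decompositions, equal centres would make a coin of the second
equal to a function of the coins of the first, which has probability zero; and there are countably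
many pairs of indices. -/
theorem ae_injective_filt : ∀ᵐ ω ∂coinMeasure, Function.Injective (s.filt ω) := by
  obtain ⟨i₀⟩ : Nonempty (Fin s.k) := ⟨⟨0, s.k_pos⟩⟩
  obtain ⟨l₀⟩ : Nonempty (Fin s.d) := ⟨⟨0, s.d_pos⟩⟩
  have key : ∀ p : s.Idx × s.Idx, ∀ᵐ ω ∂coinMeasure, p.1.1 ≠ p.2.1 →
      (ω (s.pos p.2.1 i₀ l₀) : ℝ) ≠
      s.pt p.2.1 (s.glue p.1.1 (fun i => s.center ω p.1.1 i (p.1.2 i).1 (p.1.2 i).2))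
        i₀ l₀ -
        s.code (p.2.2 i₀).1 (p.2.2 i₀).2 l₀ / s.K := by
    rintro ⟨q, q'⟩
    by_cases hq : q.1 = q'.1
    · exact ae_of_all _ fun ω h => absurd hq h
    have hc : ∀ i : Fin s.k, Continuous
        fun ω : Tape => s.center ω q.1 i (q.2 i).1 (q.2 i).2 := by
      intro i
      unfold center shift
      fun_prop
    have hg : Continuous fun ω : Tape =>
        s.glue q.1 (fun i => s.center ω q.1 i (q.2 i).1 (q.2 i).2) := by
      unfold glue assemble
      fun_prop
    have hF : Continuous fun ω : Tape =>
        s.pt q'.1 (s.glue q.1 (fun i => s.center ω q.1 i (q.2 i).1 (q.2 i).2))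
          i₀ := by
      simp only [pt_eq]
      exact Continuous.const_smul ((continuous_applyMat _).comp hg)
        (((1 + s.ε) * (3 * s.w))⁻¹ * √((D : ℝ) / s.d))
    have hF0 := (EuclideanSpace.proj (𝕜 := ℝ) l₀).continuous.comp hF
    have := ae_coin_ne (p := s.pos q'.1 i₀ l₀)
      (f := fun ω => s.pt q'.1 (s.glue q.1 (fun i => s.center ω q.1 i (q.2 i).1 (q.2 i).2))
        i₀ l₀ -
        s.code (q'.2 i₀).1 (q'.2 i₀).2 l₀ / s.K)
      (hF0.measurable.sub_const _) (fun ω r => by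
        have : ∀ i : Fin s.k, s.center (Function.update ω
            (s.pos q'.1 i₀ l₀) r) q.1 i (q.2 i).1 (q.2 i).2 =
            s.center ω q.1 i (q.2 i).1 (q.2 i).2 := by
          intro i
          ext l
          rw [center_apply, center_apply, Function.update_of_ne]
          intro he
          have h2 := congrArg Prod.fst
            (s.pos_injective (a₁ := (q.1, i, l)) (a₂ := (q'.1, i₀, l₀)) he)
          exact hq h2
        simp only [this])
    filter_upwards [this] with ω hω _
    exact hω
  have hall := ae_all_iff.2 key
  filter_upwards [hall] with ω hω q q' he
  have hgl := s.eq_of_filt_eq he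
  by_cases hq : q.1 = q'.1
  · obtain ⟨m, f⟩ := q
    obtain ⟨m', f'⟩ := q'
    obtain rfl : m = m' := hq
    have : f = f' := by
      funext i
      have h1 := congrArg (fun x => s.pt m x i) hgl
      simp only [pt_glue] at h1
      have hK : (s.K : ℝ) ≠ 0 := by exact_mod_cast s.K_pos.ne'
      obtain ⟨h2, h3⟩ := s.code_injective (j := (f i).1) (j' := (f' i).1) (z := (f i).2)
        (z' := (f' i).2) fun l => by
          have h4 := congrArg (fun v : E s.d => v l) h1
          simp only [center_apply] at h4
          have h5 := add_right_cancel h4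
          rw [div_left_inj' hK] at h5
          exact_mod_cast h5
      exact Prod.ext h2 h3
    rw [this]
  · exfalso
    refine hω (q, q') hq ?_
    simp only
    rw [hgl, pt_glue, center_apply]
    ring

/-- The name of a filter. -/
noncomputable def name (ω : Tape) (q : s.Idx) : ℝ :=
  (q.1 : ℕ) + ∑ i : Fin s.k, ∑ l : Fin s.d,
    (s.code (q.2 i).1 (q.2 i).2 l : ℝ) * ω (s.pos q.1 i l)

/-- A name is an affine form in the coins: its constant term is `m`, and its coefficients are the
integer vectors of the balls, placed in the block of `m`. Different indices have different forms,
and two such forms agree with probability zero. -/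
theorem ae_injective_name : ∀ᵐ ω ∂coinMeasure, Function.Injective (s.name ω) := by
  classical
  let a : s.Idx → Fin s.M × Fin s.k × Fin s.d → ℝ := fun q p =>
    if p.1 = q.1 then (s.code (q.2 p.2.1).1 (q.2 p.2.1).2 p.2.2 : ℝ) else 0
  have hname : ∀ ω q, s.name ω q = (q.1 : ℕ) + ∑ p, a q p * (ω (s.pos p.1 p.2.1 p.2.2) : ℝ) := by
    intro ω q
    rw [name, Fintype.sum_prod_type, Finset.sum_eq_single q.1]
    · rw [Fintype.sum_prod_type]
      simp [a]
    · intro m _ hm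
      simp [a, hm]
    · simp
  have key : ∀ p : s.Idx × s.Idx, ∀ᵐ ω ∂coinMeasure, p.1 ≠ p.2 →
      (((p.1.1 : ℕ) : ℝ) - ((p.2.1 : ℕ) : ℝ)) +
        ∑ q, (a p.1 q - a p.2 q) * (ω (s.pos q.1 q.2.1 q.2.2) : ℝ) ≠ 0 := by
    rintro ⟨q, q'⟩
    by_cases hq : q = q'
    · exact ae_of_all _ fun ω h => absurd hq h
    have := ae_affine_ne_zero (pos := fun q : Fin s.M × Fin s.k × Fin s.d => s.pos q.1 q.2.1 q.2.2)
      s.pos_injective (fun p => a q p - a q' p) (((q.1 : ℕ) : ℝ) - ((q'.1 : ℕ) : ℝ)) (by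
        by_contra! hcon
        obtain ⟨h1, h2⟩ := hcon
        have hm : q.1 = q'.1 := by
          have h3 : ((q.1 : ℕ) : ℝ) = ((q'.1 : ℕ) : ℝ) := by linarith
          exact Fin.ext (by exact_mod_cast h3)
        apply hq
        refine Prod.ext hm (funext fun i => ?_)
        obtain ⟨h3, h4⟩ := s.code_injective (j := (q.2 i).1) (j' := (q'.2 i).1) (z := (q.2 i).2)
          (z' := (q'.2 i).2) fun l => by
            have h5 := congrFun h1 (q.1, i, l)
            simp only [a, if_true, hm, Pi.zero_apply] at h5
            have h6 := sub_eq_zero.1 h5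
            exact_mod_cast h6
        exact Prod.ext h3 h4)
    filter_upwards [this] with ω hω _
    exact hω
  have hall := ae_all_iff.2 key
  filter_upwards [hall] with ω hω q q' he
  by_contra hne
  apply hω (q, q') hne
  rw [hname, hname] at he
  simp only [sub_mul, Finset.sum_sub_distrib]
  linarith

/-! #### The number of shared filters -/

/-- Some ball of the lattice with number `j` contains the pieces `i` of `x` and of `y`. -/
def Hit (ω : Tape) (m i j : ℕ) (x y : E D) : Prop :=
  ∃ z : Fin s.d → ℤ, ‖s.pt m x i - s.center ω m i j z‖ ≤ 1 / 3 ∧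
    ‖s.pt m y i - s.center ω m i j z‖ ≤ 1 / 3

open Classical in
/-- The lattices that have a ball which contains the pieces `i` of `x` and of `y`. -/
noncomputable def hits (ω : Tape) (m i : ℕ) (x y : E D) : Finset (Fin s.N) :=
  Finset.univ.filter fun j => s.Hit ω m i j x y

/-- The radius 1/3 is less than half of the period, so the balls of one lattice are disjoint. -/
theorem center_unique {ω : Tape} {m i j : ℕ} {p : E s.d} {z z' : Fin s.d → ℤ}
    (h : ‖p - s.center ω m i j z‖ ≤ 1 / 3) (h' : ‖p - s.center ω m i j z'‖ ≤ 1 / 3) : z = z' := by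
  funext l
  have h1 := (PiLp.norm_apply_le (p - s.center ω m i j z) l).trans h
  have h2 := (PiLp.norm_apply_le (p - s.center ω m i j z') l).trans h'
  simp only [center, PiLp.sub_apply, PiLp.add_apply, intVec, Real.norm_eq_abs] at h1 h2
  have h3 := abs_le.1 h1
  have h4 := abs_le.1 h2
  have h5 : (z l : ℝ) < z' l + 1 := by linarith
  have h6 : (z' l : ℝ) < z l + 1 := by linarith
  have h7 : z l < z' l + 1 := by exact_mod_cast h5
  have h8 : z' l < z l + 1 := by exact_mod_cast h6
  omega

/-- By `center_unique` the choice of a lattice in each piece determines the balls, so for each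
decomposition the indices form a product of finite sets. -/
theorem encard_index (ω : Tape) (x y : E D) :
    {q : s.Idx | x ∈ s.filt ω q ∧ y ∈ s.filt ω q}.encard =
      ((∑ m : Fin s.M, ∏ i : Fin s.k, (s.hits ω m i x y).card : ℕ) : ℕ∞) := by
  classical
  let φ : s.Idx → (_ : Fin s.M) × (Fin s.k → Fin s.N) := fun q => ⟨q.1, fun i => (q.2 i).1⟩
  set I := {q : s.Idx | x ∈ s.filt ω q ∧ y ∈ s.filt ω q} with hI
  have hinj : Set.InjOn φ I := by
    rintro ⟨m, f⟩ hq ⟨m', f'⟩ hq' he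
    simp only [φ, Sigma.mk.injEq] at he
    obtain ⟨rfl, he⟩ := he
    have he := eq_of_heq he
    refine Prod.ext rfl (funext fun i => ?_)
    have h1 : (f i).1 = (f' i).1 := congrFun he i
    have h2 := hq.1 i
    have h3 := hq'.1 i
    simp only at h2 h3
    rw [← h1] at h3
    exact Prod.ext h1 (s.center_unique h2 h3)
  have himg : φ '' I = ((Finset.univ.sigma fun m : Fin s.M =>
      Fintype.piFinset fun i : Fin s.k => s.hits ω m i x y : Finset _) : Set _) := by
    ext ⟨m, J⟩
    simp only [Set.mem_image, Finset.coe_sigma, Set.mem_sigma_iff, Finset.coe_univ, Set.mem_univ,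
      Finset.mem_coe, Fintype.mem_piFinset, true_and, hits, Finset.mem_filter, Finset.mem_univ]
    constructor
    · rintro ⟨⟨m', f⟩, hq, he⟩ i
      simp only [φ, Sigma.mk.injEq] at he
      obtain ⟨rfl, he⟩ := he
      obtain rfl := eq_of_heq he
      exact ⟨(f i).2, hq.1 i, hq.2 i⟩
    · intro h
      choose z hz using h
      exact ⟨(m, fun i => (J i, z i)), ⟨fun i => (hz i).1, fun i => (hz i).2⟩, rfl⟩
  rw [← hinj.encard_image, himg, Set.encard_coe_eq_coe_finsetCard, Finset.card_sigma]
  simp only [Fintype.card_piFinset]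

theorem shared_le (ω : Tape) (x y : E D) : shared (s.fam ω) x y ≤
    ∑ m : Fin s.M, ∏ i : Fin s.k, ((s.hits ω m i x y).card : ℝ≥0∞) := by
  rw [shared, at_inter_at]
  have h := (Set.encard_image_le (s.filt ω) _).trans_eq (s.encard_index ω x y)
  have h2 := ENat.toENNReal_le.2 h
  refine h2.trans_eq ?_
  rw [ENat.toENNReal_coe]
  push_cast
  rfl

/-- The inequality `shared_le` holds on every tape and suffices for the expectation; the equality
almost surely is needed for measurability. -/
theorem shared_eq {ω : Tape} (hω : Function.Injective (s.filt ω)) (x y : E D) :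
    shared (s.fam ω) x y =
      ∑ m : Fin s.M, ∏ i : Fin s.k, ((s.hits ω m i x y).card : ℝ≥0∞) := by
  rw [shared, at_inter_at, hω.encard_image, s.encard_index ω x y, ENat.toENNReal_coe]
  push_cast
  rfl

theorem measurableSet_hit (m i j : ℕ) (x y : E D) : MeasurableSet
    {v : E s.d | ∃ z : Fin s.d → ℤ, ‖s.pt m x i - (s.base j + intVec z + v)‖ ≤ 1 / 3 ∧
      ‖s.pt m y i - (s.base j + intVec z + v)‖ ≤ 1 / 3} := by
  have : {v : E s.d | ∃ z : Fin s.d → ℤ, ‖s.pt m x i - (s.base j + intVec z + v)‖ ≤ 1 / 3 ∧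
      ‖s.pt m y i - (s.base j + intVec z + v)‖ ≤ 1 / 3} =
      ⋃ z : Fin s.d → ℤ, {v : E s.d | ‖s.pt m x i - (s.base j + intVec z + v)‖ ≤ 1 / 3} ∩
        {v : E s.d | ‖s.pt m y i - (s.base j + intVec z + v)‖ ≤ 1 / 3} := by
    ext v; simp
  rw [this]
  exact MeasurableSet.iUnion fun z => (measurableSet_le (by fun_prop) measurable_const).inter
    (measurableSet_le (by fun_prop) measurable_const)

/-- The number of lattices with a suitable ball, as a function of the shift. -/
noncomputable def hitCount (m i : ℕ) (x y : E D) (v : E s.d) : ℝ≥0∞ :=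
  ∑ j : Fin s.N, Set.indicator {v : E s.d | ∃ z : Fin s.d → ℤ,
    ‖s.pt m x i - (s.base j + intVec z + v)‖ ≤ 1 / 3 ∧
      ‖s.pt m y i - (s.base j + intVec z + v)‖ ≤ 1 / 3} 1 v

theorem measurable_hitCount (m i : ℕ) (x y : E D) : Measurable (s.hitCount m i x y) :=
  Finset.measurable_fun_sum _ fun _ _ => measurable_one.indicator (s.measurableSet_hit _ _ _ _ _)

theorem card_hits (ω : Tape) (m i : ℕ) (x y : E D) :
    ((s.hits ω m i x y).card : ℝ≥0∞) = s.hitCount m i x y (s.shift ω m i) := by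
  classical
  rw [hits, Finset.card_filter, hitCount]
  push_cast
  refine Finset.sum_congr rfl fun j _ => ?_
  simp only [Set.indicator_apply, Set.mem_ofPred_eq, Hit, center, Pi.one_apply]
  exact if_congr Iff.rfl rfl rfl

theorem aemeasurable_shared (x y : E D) :
    AEMeasurable (fun ω => shared (s.fam ω) x y) coinMeasure := by
  refine ⟨fun ω => ∑ m : Fin s.M, ∏ i : Fin s.k, s.hitCount m i x y (s.shift ω m i), ?_, ?_⟩
  · refine Finset.measurable_fun_sum _ fun m _ => Finset.measurable_fun_prod _ fun i _ =>
      (s.measurable_hitCount _ _ _ _).comp ?_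
    unfold shift
    fun_prop
  · filter_upwards [s.ae_injective_filt] with ω hω
    rw [s.shared_eq hω]
    simp only [card_hits]

theorem setLIntegral_hitCount_le (m i : ℕ) (x y : E D) :
    ∫⁻ v in unitCube s.d, s.hitCount m i x y v ≤ s.N *
      volume (Metric.closedBall (s.pt m x i) (1 / 3) ∩ Metric.closedBall (s.pt m y i) (1 / 3)) := by
  unfold hitCount
  rw [lintegral_finsetSum _ fun j _ => measurable_one.indicator (s.measurableSet_hit _ _ _ _ _)]
  set L := Metric.closedBall (s.pt m x i) (1 / 3) ∩ Metric.closedBall (s.pt m y i) (1 / 3) with hL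
  calc _ ≤ ∑ j : Fin s.N, volume L := Finset.sum_le_sum fun j _ => by
        rw [lintegral_indicator_one (s.measurableSet_hit _ _ _ _ _),
          Measure.restrict_apply (s.measurableSet_hit _ _ _ _ _)]
        refine le_trans ?_ (tsum_setLIntegral_le (L := L)
          (Metric.isClosed_closedBall.inter Metric.isClosed_closedBall).measurableSet (s.base j))
        refine le_trans (measure_mono ?_) (measure_iUnion_le _)
        rintro v ⟨⟨z, h1, h2⟩, h3⟩
        refine Set.mem_iUnion.2 ⟨z, h3, ?_⟩
        simp only [Set.mem_ofPred_eq, hL, Set.mem_inter_iff, mem_closedBall_iff_norm']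
        exact ⟨h1, h2⟩
    _ = _ := by simp

/-- The lattices of one piece share a shift, but only linearity of the expectation is used for them.
Independence is used between the pieces of one decomposition, and the sum over decompositions is
again linear. -/
theorem lintegral_shared_le (x y : E D) : ∫⁻ ω, shared (s.fam ω) x y ∂coinMeasure ≤
    ∑ m : Fin s.M, ∏ i : Fin s.k, (s.N * volume (Metric.closedBall (s.pt m x i) (1 / 3) ∩
      Metric.closedBall (s.pt m y i) (1 / 3))) := by
  have hmeas : ∀ (m : Fin s.M), Measurable fun ω : Tape =>
      ∏ i : Fin s.k, s.hitCount m i x y (s.shift ω m i) := fun m =>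
    Finset.measurable_fun_prod _ fun i _ =>
      (s.measurable_hitCount _ _ _ _).comp (by unfold shift; fun_prop)
  calc _ ≤ ∫⁻ ω, ∑ m : Fin s.M, ∏ i : Fin s.k, s.hitCount m i x y (s.shift ω m i) ∂coinMeasure := by
        refine lintegral_mono fun ω => ?_
        refine (s.shared_le ω x y).trans_eq ?_
        simp only [card_hits]
    _ = ∑ m : Fin s.M, ∫⁻ ω, ∏ i : Fin s.k, s.hitCount m i x y (s.shift ω m i) ∂coinMeasure :=
        lintegral_finsetSum _ fun m _ => hmeas m
    _ ≤ _ := Finset.sum_le_sum fun m _ => by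
        have hinj : Function.Injective fun q : Fin s.k × Fin s.d => s.pos m q.1 q.2 := by
          intro q q' h
          have := s.pos_injective (a₁ := (m, q)) (a₂ := (m, q')) h
          exact (Prod.ext_iff.1 this).2
        have h1 := lintegral_prod_blocks hinj
          (g := fun i => s.hitCount m i x y) (fun i => s.measurable_hitCount _ _ _ _)
        refine (le_of_eq h1).trans (Finset.prod_le_prod' fun i _ => ?_)
        exact s.setLIntegral_hitCount_le m i x y

end Scheme

end FilterLSF

namespace FilterLSF
open RealRAM

/-! ### The parameters of the grid cover -/

/-- Pairs of grid points at this distance have to be covered. -/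
noncomputable def nearRadius (K d : ℕ) (w : ℝ) : ℝ := K / (3 * w) + 2 * d

/-- A grid point covers the grid points up to this distance. -/
noncomputable def coverRadius (K d : ℕ) : ℝ := K / 3 - d

/-- The square of the relative radius of a ball that has at most twice the volume of each lens. -/
noncomputable def ratioSq (K d : ℕ) (w : ℝ) : ℝ :=
  (1 - 6 * d / K) ^ 2 - (1 / w + 6 * d / K) ^ 2 / 4 - 4 / (w * √d)

/-- The volume of the unit ball. -/
noncomputable def unitBallVol (d : ℕ) : ℝ := (volume (Metric.closedBall (0 : E d) 1)).toReal

theorem ofReal_unitBallVol (d : ℕ) :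
    ENNReal.ofReal (unitBallVol d) = volume (Metric.closedBall (0 : E d) 1) :=
  ENNReal.ofReal_toReal measure_closedBall_lt_top.ne

theorem unitBallVol_pos (d : ℕ) : 0 < unitBallVol d :=
  ENNReal.toReal_pos (Metric.measure_closedBall_pos _ _ one_pos).ne' measure_closedBall_lt_top.ne

theorem ratioSq_le_one {K d : ℕ} {w : ℝ} (hK : 0 < K) (hw : 1 < w)
    (h6 : 6 * d * w ≤ K) : ratioSq K d w ≤ 1 := by
  have hK' : (0 : ℝ) < K := by exact_mod_cast hK
  have h1 : (6 * d / K : ℝ) ≤ 1 := by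
    rw [div_le_one hK']
    nlinarith [Nat.cast_nonneg (α := ℝ) d]
  have h2 : (0 : ℝ) ≤ 6 * d / K := by positivity
  have h3 : (0 : ℝ) ≤ 4 / (w * √d) := by positivity
  have h4 : (0 : ℝ) ≤ (1 / w + 6 * d / K) ^ 2 / 4 := by positivity
  unfold ratioSq
  nlinarith

/-- In units of K/3 the radius left for the lens after rounding is 1 - 6d/K, and the distance of the
centres is at most 1/w + 6d/K ≤ 2/w. The Chebyshev condition then allows the slack 4/(w√d), with a
factor 2 to spare, and `ratioSq` is what remains of the squared radius. -/
theorem le_card_common_cover {K d : ℕ} {w : ℝ} (hK : 0 < K) (hd : 0 < d) (hw : 1 < w)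
    (h6 : 6 * d * w ≤ K) (hq : 0 < ratioSq K d w) {a b : ℕ}
    (hab : torSq K d a b ≤ nearRadius K d w ^ 2) :
    (K / 3 * √(ratioSq K d w)) ^ d * unitBallVol d / 2 ≤
      (((Finset.range (K ^ d)).filter fun u => torSq K d u a ≤ coverRadius K d ^ 2 ∧
        torSq K d u b ≤ coverRadius K d ^ 2).card : ℝ) := by
  classical
  have hK' : (0 : ℝ) < K := by exact_mod_cast hK
  have hd' : (0 : ℝ) < d := by exact_mod_cast hd
  have hw0 : 0 < w := by linarith
  set r := K / 3 * √(ratioSq K d w) with hr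
  have hr0 : 0 ≤ r := by positivity
  have hr2 : r ^ 2 = K ^ 2 / 9 * ratioSq K d w := by
    rw [hr, mul_pow, Real.sq_sqrt hq.le]; ring
  obtain ⟨X, Y, h1, h2⟩ := volume_lens_le_card (d := d) hK (r₂ := coverRadius K d)
    (by unfold coverRadius; linarith) a b
  have hs0 : 0 ≤ nearRadius K d w := by unfold nearRadius; positivity
  have hXY : ‖X - Y‖ ≤ nearRadius K d w := by
    rw [← h1] at hab
    exact le_of_sq_le_sq hab hs0
  have h6' : (6 * d / K : ℝ) ≤ 1 / w := by
    rw [div_le_div_iff₀ hK' hw0]; linarith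
  have hη : (0 : ℝ) < K ^ 2 / 9 * (4 / (w * √d)) := by positivity
  have hs : nearRadius K d w = K / 3 * (1 / w + 6 * d / K) := by
    unfold nearRadius; field_simp; ring
  have hρ : coverRadius K d - d = K / 3 * (1 - 6 * d / K) := by
    unfold coverRadius; field_simp; ring
  have h1w : 1 / w ≤ 1 := by rw [div_le_one hw0]; exact hw.le
  have hv := volume_lens_ge hd X Y (ρ := coverRadius K d - d) (r := r)
    (η := K ^ 2 / 9 * (4 / (w * √d))) (s := nearRadius K d w) hη hXY
    (by rw [hρ]; exact mul_nonneg (by positivity) (by linarith))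
    (by
      rw [hρ, hs, hr2, ratioSq]
      exact le_of_eq (by ring))
    (by
      rw [hs, hr2]
      have e1 : (1 / w + 6 * d / K) ^ 2 ≤ (2 / w) ^ 2 := by
        gcongr
        have : 2 / w = 1 / w + 1 / w := by ring
        linarith
      have e2 := ratioSq_le_one hK hw h6
      calc 2 * ((K / 3 * (1 / w + 6 * d / K)) ^ 2 * (K ^ 2 / 9 * ratioSq K d w))
          = 2 * (K ^ 2 / 9) ^ 2 * ((1 / w + 6 * d / K) ^ 2 * ratioSq K d w) := by ring
        _ ≤ 2 * (K ^ 2 / 9) ^ 2 * ((2 / w) ^ 2 * 1) := by gcongr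
        _ ≤ 4 * (K ^ 2 / 9) ^ 2 * ((2 / w) ^ 2 * 1) := by gcongr; norm_num
        _ = d * (K ^ 2 / 9 * (4 / (w * √d))) ^ 2 := by
            have hsd : √(d : ℝ) ^ 2 = d := Real.sq_sqrt hd'.le
            have hsd0 : 0 < √(d : ℝ) := Real.sqrt_pos.2 hd'
            field_simp
            rw [hsd]; ring)
  have h3 := hv.trans (mul_le_mul_right h2 2)
  rw [volume_closedBall_scale _ hr0, ← ofReal_unitBallVol, ← ENNReal.ofReal_mul (by positivity)] at h3
  have h4 : ENNReal.ofReal (r ^ d * unitBallVol d) ≤ ENNReal.ofReal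
      (2 * (((Finset.range (K ^ d)).filter fun u => torSq K d u a ≤ coverRadius K d ^ 2 ∧
        torSq K d u b ≤ coverRadius K d ^ 2).card : ℝ)) := by
    rw [ENNReal.ofReal_mul (p := 2) (by norm_num), ENNReal.ofReal_natCast]
    simpa using h3
  have h5 := (ENNReal.ofReal_le_ofReal_iff (by positivity)).1 h4
  have : r ^ d * unitBallVol d / 2 ≤ (((Finset.range (K ^ d)).filter fun u =>
      torSq K d u a ≤ coverRadius K d ^ 2 ∧ torSq K d u b ≤ coverRadius K d ^ 2).card : ℝ) := by
    linarith
  convert this using 4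

/-- The pairs of grid points that have to be covered. -/
def IsNear (K d : ℕ) (w : ℝ) (a b : ℕ) : Prop := torSq K d a b ≤ nearRadius K d w ^ 2

/-- The grid point `u` covers the grid point `a`. -/
def Covers (K d : ℕ) (u a : ℕ) : Prop := torSq K d u a ≤ coverRadius K d ^ 2

theorem torSq_self (K d a : ℕ) : torSq K d a a = 0 := by
  have h : ⌊(1 / 2 : ℝ)⌋ = 0 := by norm_num
  refine Finset.sum_eq_zero fun l _ => ?_
  simp only [sub_self, wrap, Int.cast_zero, zero_div, zero_add, h]
  simp

theorem greedy_card_mul_le {K d N : ℕ} {w : ℝ} {u : ℕ → ℕ} (hK : 0 < K) (hd : 0 < d) (hw : 1 < w)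
    (h6 : 6 * d * w ≤ K) (hq : 0 < ratioSq K d w)
    (hg : IsGreedy (K ^ d) (IsNear K d w) (Covers K d) u N) :
    N * unitBallVol d * (K / 3 * √(ratioSq K d w)) ^ d ≤
      2 * (1 + 2 * (d * Real.log K)) * (K : ℝ) ^ d := by
  have hn : 0 < K ^ d := by positivity
  have h := hg.mul_le (c := (K / 3 * √(ratioSq K d w)) ^ d * unitBallVol d / 2) hn (by
    -- The pair (0, 0) is near, so the lower bound for the number of common covers is itself at most
    -- the number of all grid points.
    have h1 := le_card_common_cover hK hd hw h6 hq (a := 0) (b := 0)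
      (by rw [torSq_self]; positivity)
    refine h1.trans ?_
    exact_mod_cast (Finset.card_filter_le _ _).trans (Finset.card_range _).le)
    (fun a _ b _ hab => by
      have := le_card_common_cover hK hd hw h6 hq hab
      convert this using 4
      exact Iff.rfl)
  push_cast at h
  rw [Real.log_pow] at h
  nlinarith

theorem exists_cover_of_near {K d : ℕ} {w : ℝ} (hK : 0 < K) (hd : 0 < d) (hw : 1 < w)
    (h6 : 6 * d * w ≤ K) (hq : 0 < ratioSq K d w) {a b : ℕ} (hab : IsNear K d w a b) :
    ∃ u < K ^ d, Covers K d u a ∧ Covers K d u b := by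
  classical
  have h1 := le_card_common_cover hK hd hw h6 hq hab
  have hK' : (0 : ℝ) < K := by exact_mod_cast hK
  have h2 : 0 < (K / 3 * √(ratioSq K d w)) ^ d * unitBallVol d / 2 := by
    have := Real.sqrt_pos.2 hq
    have := unitBallVol_pos d
    positivity
  have h3 := h2.trans_le h1
  obtain ⟨u, hu⟩ := Finset.card_pos.1 (by exact_mod_cast h3)
  simp only [Finset.mem_filter, Finset.mem_range] at hu
  exact ⟨u, hu.1, hu.2⟩

/-- This is z/q ≤ exp(z/q - 1). It makes the bound for a piece log-linear in the squared distance,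
so that the product over the pieces only sees the sum of these squares. For `z < 0` the balls are
disjoint, and the left side is zero as it should be unless `d = 0`. -/
theorem sqrt_pow_le_exp {z q : ℝ} (hq : 0 < q) (d : ℕ) :
    √z ^ d ≤ √q ^ d * Real.exp (d / 2 * (z / q - 1)) := by
  have h1 : √z ≤ √q * Real.exp ((z / q - 1) / 2) := by
    rw [Real.sqrt_le_left (by positivity), mul_pow, Real.sq_sqrt hq.le, ← Real.exp_nat_mul]
    have h2 := Real.add_one_le_exp (z / q - 1)
    have h3 : ((2 : ℕ) : ℝ) * ((z / q - 1) / 2) = z / q - 1 := by push_cast; ring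
    rw [h3]
    calc z = q * (z / q - 1 + 1) := by field_simp; ring
      _ ≤ _ := by gcongr
  calc √z ^ d ≤ (√q * Real.exp ((z / q - 1) / 2)) ^ d := by gcongr
    _ = _ := by
      rw [mul_pow, ← Real.exp_nat_mul]
      congr 2; ring

namespace Scheme

variable {D : ℕ} (s : Scheme D)

/-! #### Close pairs -/

/-- The division by 1 + ε in `pt` absorbs the error of the splitting. -/
theorem exists_balanced_pieces (hε : 64 * 2 ^ s.r / s.S < s.ε) {x : E D} (hx : ‖x‖ ≤ 1) :
    ∃ m : Fin s.M, ∀ i : Fin s.k, ‖s.pt m x i‖ ≤ 1 / (3 * s.w) := by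
  have hw := s.w_pos
  have hS := s.S_pos
  have he := s.ε_pos
  rcases eq_or_ne x 0 with rfl | hx0
  · refine ⟨⟨0, by positivity⟩, fun i => ?_⟩
    have := s.pt_smul 0 0 0 i
    rw [zero_smul, zero_smul] at this
    simp only
    rw [this, norm_zero]
    positivity
  · have hn : 0 < ‖x‖ := norm_pos_iff.2 hx0
    obtain ⟨m, hm⟩ := (isSplitting_decomp s.S_pos s.d_pos s.hD hε).2 (‖x‖⁻¹ • x)
      (by rw [norm_smul, norm_inv, norm_norm, inv_mul_cancel₀ hn.ne'])
    refine ⟨m, fun i => ?_⟩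
    have h1 := (abs_lt.1 (hm i)).2
    rw [applyMat_smul, norm_smul, norm_inv, norm_norm] at h1
    have h2 : √((D : ℝ) / s.d) * ‖applyMat (s.mat m i) x‖ ≤ 1 + s.ε := by
      have h3 : √((D : ℝ) / s.d) * ‖applyMat (s.mat m i) x‖ =
          ‖x‖ * (√((D : ℝ) / s.d) * (‖x‖⁻¹ * ‖applyMat (s.mat m i) x‖)) := by
        field_simp
      rw [h3]
      calc _ ≤ 1 * (√((D : ℝ) / s.d) * (‖x‖⁻¹ * ‖applyMat (s.mat m i) x‖)) := by gcongr
        _ ≤ _ := by linarith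
    rw [pt_eq, norm_smul, Real.norm_eq_abs, abs_of_pos s.coef_pos, mul_assoc]
    calc _ ≤ ((1 + s.ε) * (3 * s.w))⁻¹ * (1 + s.ε) := by
          have := s.scale_pos; gcongr
      _ = _ := by field_simp

/-- After subtracting the shift and scaling by `K`, a pair of pieces has distance at most K/(3w),
and the cover gives a grid point within `coverRadius + d = K / 3` of both. Nothing depends on the
value of the shift, so the conclusion holds for every tape. -/
theorem nonempty_common_filter (hε : 64 * 2 ^ s.r / s.S < s.ε) (hw : 1 < s.w)
    (hd : 3 * s.d ≤ s.K)
    (hcov : ∀ a < s.K ^ s.d, ∀ b < s.K ^ s.d, IsNear s.K s.d s.w a b →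
      ∃ j < s.N, Covers s.K s.d (s.u j) a ∧ Covers s.K s.d (s.u j) b)
    (ω : Tape) {x y : E D} (hxy : dist x y ≤ 1) :
    ((s.fam ω).at x ∩ (s.fam ω).at y).Nonempty := by
  rw [at_inter_at, Set.image_nonempty]
  rw [dist_eq_norm] at hxy
  have hw0 := s.w_pos
  have hK : (0 : ℝ) < s.K := by exact_mod_cast s.K_pos
  have hd' : (3 : ℝ) * s.d ≤ s.K := by exact_mod_cast hd
  obtain ⟨m, hm⟩ := s.exists_balanced_pieces hε hxy
  have key : ∀ i : Fin s.k, ∃ (j : Fin s.N) (z : Fin s.d → ℤ),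
      ‖s.pt m x i - s.center ω m i j z‖ ≤ 1 / 3 ∧ ‖s.pt m y i - s.center ω m i j z‖ ≤ 1 / 3 := by
    intro i
    obtain ⟨u, ⟨j, hj, rfl⟩, v, hv, h1, h2⟩ := exists_common_center s.K_pos
      (r₁ := nearRadius s.K s.d s.w) (r₂ := coverRadius s.K s.d) (σ := s.K / (3 * s.w))
      (U := s.u '' {j | j < s.N}) (by unfold coverRadius; linarith) le_rfl (by
        unfold coverRadius nearRadius
        have : (s.K : ℝ) / (3 * s.w) < s.K / 3 := by
          apply div_lt_div_of_pos_left hK (by norm_num) (by linarith)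
        linarith)
      (fun a ha b hb hab => by
        obtain ⟨j, hj, hc⟩ := hcov a ha b hb hab
        exact ⟨s.u j, ⟨j, hj, rfl⟩, hc⟩)
      (X := (s.K : ℝ) • (s.pt m x i - s.shift ω m i))
      (Y := (s.K : ℝ) • (s.pt m y i - s.shift ω m i)) (by
        rw [← smul_sub, sub_sub_sub_cancel_right, ← pt_sub, norm_smul, Real.norm_eq_abs,
          abs_of_pos hK, div_eq_mul_one_div]
        gcongr
        exact hm i)
    choose z hz using hv
    refine ⟨⟨j, hj⟩, z, ?_⟩
    have aux : ∀ p : E s.d, ‖intVec v - (s.K : ℝ) • (p - s.shift ω m i)‖ ≤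
        coverRadius s.K s.d + s.d → ‖p - s.center ω m i j z‖ ≤ 1 / 3 := by
      intro p hp
      have e : intVec v - (s.K : ℝ) • (p - s.shift ω m i) =
          (-(s.K : ℝ)) • (p - s.center ω m i j z) := by
        ext l
        simp only [PiLp.sub_apply, PiLp.smul_apply, smul_eq_mul, center_apply, intVec, hz, code,
          shift]
        push_cast
        field_simp
        ring
      rw [e, norm_smul, norm_neg, Real.norm_eq_abs, abs_of_pos hK, coverRadius] at hp
      have : (s.K : ℝ) * ‖p - s.center ω m i j z‖ ≤ s.K * (1 / 3) := by linarith
      exact le_of_mul_le_mul_left this hK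
    exact ⟨aux _ h1, aux _ h2⟩
  choose j z hjz using key
  exact ⟨(m, fun i => (j i, z i)), fun i => (hjz i).1, fun i => (hjz i).2⟩

/-! #### Distant pairs -/

/-- The lens lies in a ball of radius √z/3, while `hN` says that `N` balls of radius √q/3 have total
volume at most `A`. The ratio of the two volumes is left to `sqrt_pow_le_exp`. -/
theorem card_mul_volume_le {A q : ℝ} (hq : 0 < q)
    (hN : s.N * unitBallVol s.d * (s.K / 3 * √q) ^ s.d ≤ A * (s.K : ℝ) ^ s.d) (p p' : E s.d) :
    s.N * volume (Metric.closedBall p (1 / 3) ∩ Metric.closedBall p' (1 / 3)) ≤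
      ENNReal.ofReal (A * Real.exp (s.d / 2 * ((1 - 9 * ‖p - p'‖ ^ 2 / 4) / q - 1))) := by
  have hK : (0 : ℝ) < s.K := by exact_mod_cast s.K_pos
  have hV := unitBallVol_pos s.d
  set z := 1 - 9 * ‖p - p'‖ ^ 2 / 4 with hz
  have h1 := volume_lens_le (x := p) (y := p') (w := 1 / 3) (norm_nonneg _) le_rfl
  have h2 : √((1 / 3) ^ 2 - ‖p - p'‖ ^ 2 / 4) = √z / 3 := by
    have : (1 / 3 : ℝ) ^ 2 - ‖p - p'‖ ^ 2 / 4 = z / 3 ^ 2 := by rw [hz]; ring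
    rw [this, Real.sqrt_div' _ (by norm_num), Real.sqrt_sq (by norm_num)]
  rw [h2, ← ofReal_unitBallVol, ← ENNReal.ofReal_mul (by positivity)] at h1
  calc _ ≤ (s.N : ℝ≥0∞) * ENNReal.ofReal ((√z / 3) ^ s.d * unitBallVol s.d) := by gcongr
    _ = ENNReal.ofReal (s.N * ((√z / 3) ^ s.d * unitBallVol s.d)) := by
        rw [ENNReal.ofReal_mul (p := s.N) (by positivity), ENNReal.ofReal_natCast]
    _ ≤ _ := by
      refine ENNReal.ofReal_le_ofReal ?_
      have h3 := sqrt_pow_le_exp (z := z) hq s.d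
      have hsq : 0 < √q := Real.sqrt_pos.2 hq
      have h4 : (s.K : ℝ) ^ s.d * (s.N * unitBallVol s.d * (√q ^ s.d / 3 ^ s.d)) ≤
          (s.K : ℝ) ^ s.d * A := by
        calc _ = s.N * unitBallVol s.d * (s.K / 3 * √q) ^ s.d := by
              rw [mul_pow, div_pow]; ring
          _ ≤ _ := by linarith
      have h5 := le_of_mul_le_mul_left h4 (by positivity)
      calc s.N * ((√z / 3) ^ s.d * unitBallVol s.d)
          = s.N * unitBallVol s.d / 3 ^ s.d * √z ^ s.d := by rw [div_pow]; ring
        _ ≤ s.N * unitBallVol s.d / 3 ^ s.d * (√q ^ s.d * Real.exp (s.d / 2 * (z / q - 1))) := by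
            gcongr
        _ = s.N * unitBallVol s.d * (√q ^ s.d / 3 ^ s.d) * Real.exp (s.d / 2 * (z / q - 1)) := by
            ring
        _ ≤ _ := by gcongr

theorem lintegral_shared_le_exp {A q : ℝ} (hq : 0 < q) (hA : 0 ≤ A)
    (hN : s.N * unitBallVol s.d * (s.K / 3 * √q) ^ s.d ≤ A * (s.K : ℝ) ^ s.d)
    {t : ℝ} (ht : 0 ≤ t) {x y : E D} (hxy : t ≤ dist x y) :
    ∫⁻ ω, shared (s.fam ω) x y ∂coinMeasure ≤ ENNReal.ofReal (s.M * A ^ s.k *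
      Real.exp (-(D / 2 * (((t / (1 + s.ε)) ^ 2 - 4 * s.w ^ 2 * (1 - q)) / q / (4 * s.w ^ 2))))) := by
  refine (s.lintegral_shared_le x y).trans ?_
  have hw := s.w_pos
  have he := s.ε_pos
  set B := A ^ s.k * Real.exp (-(D / 2 *
    (((t / (1 + s.ε)) ^ 2 - 4 * s.w ^ 2 * (1 - q)) / q / (4 * s.w ^ 2)))) with hB
  have key : ∀ m : Fin s.M, ∏ i : Fin s.k, (s.N * volume (Metric.closedBall (s.pt m x i) (1 / 3) ∩
      Metric.closedBall (s.pt m y i) (1 / 3))) ≤ ENNReal.ofReal B := by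
    intro m
    calc _ ≤ ∏ i : Fin s.k, ENNReal.ofReal (A * Real.exp (s.d / 2 *
          ((1 - 9 * ‖s.pt m x i - s.pt m y i‖ ^ 2 / 4) / q - 1))) :=
          Finset.prod_le_prod' fun i _ => s.card_mul_volume_le hq hN _ _
      _ = ENNReal.ofReal (A ^ s.k * Real.exp (∑ i : Fin s.k, s.d / 2 *
          ((1 - 9 * ‖s.pt m x i - s.pt m y i‖ ^ 2 / 4) / q - 1))) := by
          rw [← ENNReal.ofReal_prod_of_nonneg fun i _ => by positivity, Finset.prod_mul_distrib,
            Finset.prod_const, Finset.card_univ, Fintype.card_fin, Real.exp_sum]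
      _ ≤ _ := by
          refine ENNReal.ofReal_le_ofReal ?_
          rw [hB]
          gcongr
          -- The exponents are affine in the squared distances of the pieces, so their sum depends
          -- on ‖x - y‖ only and is the same for all `m`.
          have h1 := s.sum_norm_pt_sq m (x - y)
          simp only [pt_sub] at h1
          have hD : (D : ℝ) = s.k * s.d := by
            have h : ((s.k * s.d : ℕ) : ℝ) = D := congrArg Nat.cast s.hD
            rw [← h, Nat.cast_mul]
          have h2 : ∑ i : Fin s.k, (s.d : ℝ) / 2 *
              ((1 - 9 * ‖s.pt m x i - s.pt m y i‖ ^ 2 / 4) / q - 1) =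
              s.d / 2 * ((s.k - 9 / 4 * ∑ i : Fin s.k, ‖s.pt m x i - s.pt m y i‖ ^ 2) / q - s.k) := by
            rw [← Finset.mul_sum, Finset.sum_sub_distrib, ← Finset.sum_div,
              Finset.sum_sub_distrib, ← Finset.sum_div, ← Finset.mul_sum]
            simp
            left
            ring
          rw [h2, h1]
          rw [dist_eq_norm] at hxy
          have h3 : (t / (1 + s.ε)) ^ 2 ≤ (‖x - y‖ / (1 + s.ε)) ^ 2 := by gcongr
          have h4 : s.d / 2 * ((s.k - 9 / 4 * (s.k * (((1 + s.ε) * (3 * s.w))⁻¹ * ‖x - y‖) ^ 2)) / q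
              - s.k) = -(D / 2 * (((‖x - y‖ / (1 + s.ε)) ^ 2 - 4 * s.w ^ 2 * (1 - q)) / q /
                (4 * s.w ^ 2))) := by
            rw [hD]
            field_simp
            ring
          rw [h4]
          gcongr
  calc _ ≤ ∑ m : Fin s.M, ENNReal.ofReal B := Finset.sum_le_sum fun m _ => key m
    _ = _ := by
      rw [Finset.sum_const, Finset.card_univ, Fintype.card_fin, nsmul_eq_mul,
        ← ENNReal.ofReal_natCast, ← ENNReal.ofReal_mul (by positivity), hB]
      congr 1
      push_cast
      ring

theorem encard_at_eq_shared {X : Type} (F : FilterFamily X) (x : X) :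
    ((F.at x).encard : ℝ≥0∞) = shared F x x := by
  rw [shared, Set.inter_self]

/-! #### The shape of the family -/

theorem offset_mem (ω : Tape) (m i j : ℕ) (l : Fin s.d) :
    s.offset ω m i j l ∈ Set.Icc 0 (3 * s.w) := by
  have hw := s.w_pos
  simp only [offset]
  have h1 := Int.fract_nonneg (s.base j l + s.shift ω m i l)
  have h2 := (Int.fract_lt_one (s.base j l + s.shift ω m i l)).le
  constructor
  · positivity
  · exact mul_le_of_le_one_right (by positivity) h2

end Scheme

end FilterLSF

namespace RealRAM

/-! ### Reasoning about loops -/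

section Store

variable (H : Store) (u v : ℕ) (a b : Fin 8) (i : ℕ) (x : ℝ)

@[simp] theorem Store.setVar_var : (H.setVar v x).var u = if u = v then x else H.var u :=
  Function.update_apply _ _ _ _

@[simp] theorem Store.setVar_arr : (H.setVar v x).arr = H.arr := rfl

@[simp] theorem Store.setVar_inp : (H.setVar v x).inp = H.inp := rfl

@[simp] theorem Store.setVar_out : (H.setVar v x).out = H.out := rfl

@[simp] theorem Store.setArr_var : (H.setArr a i x).var = H.var := rfl

@[simp] theorem Store.setArr_arr : (H.setArr a i x).arr b =
    if b = a then Function.update (H.arr a) i x else H.arr b := by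
  by_cases h : b = a
  · subst h; simp [Store.setArr]
  · simp [Store.setArr, h]

end Store

/-- `G` arises from `H` by some rounds of a loop with counter `v` and body `c`, as far as the
constant parts of the store are concerned. -/
structure Frame (v : ℕ) (c : Cmd) (H G : Store) : Prop where
  var : ∀ u : ℕ, u ≠ v → c.keepsVar u = true → G.var u = H.var u
  arr : ∀ a : Fin 8, c.keepsArr a = true → G.arr a = H.arr a
  inp : G.inp = H.inp

theorem Frame.refl (v : ℕ) (c : Cmd) (H : Store) : Frame v c H H :=
  ⟨fun _ _ _ => rfl, fun _ _ => rfl, rfl⟩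

theorem Frame.setVar {v : ℕ} {c : Cmd} {H G : Store} (h : Frame v c H G) (x : ℝ) :
    Frame v c H (G.setVar v x) :=
  ⟨fun u hu hc => by simp [hu, h.var u hu hc], fun a ha => h.arr a ha, h.inp⟩

theorem Frame.run {v : ℕ} {c : Cmd} {H G : Store} (h : Frame v c H G) : Frame v c H (c.run G) :=
  ⟨fun u hu hc => by rw [Cmd.run_var hc, h.var u hu hc],
    fun a ha => by rw [Cmd.run_arr ha, h.arr a ha], by rw [Cmd.run_inp, h.inp]⟩

/-- Amortized analysis: `Φ` is a potential such as a multiple of the length of the output. A round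
may cost `A` plus the growth of `Φ`, and the growth telescopes. In this way the decoder is charged
for the filters it lists. -/
theorem Cmd.loop_cost {v b : ℕ} {c : Cmd} {H : Store} {n A : ℕ} (Φ : Store → ℕ)
    {P : ℕ → Store → Prop} (h : H.var b = n) (h0 : P 0 H)
    (hset : ∀ i G x, P i G → P i (G.setVar v x))
    (hΦ : ∀ G x, Φ (G.setVar v x) = Φ G)
    (hs : ∀ i : ℕ, i < n → ∀ G : Store, G.var v = (i : ℝ) → Frame v c H G → P i G →
      P (i + 1) (c.run G) ∧ c.cost G + Φ G ≤ A + Φ (c.run G)) :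
    P n ((Cmd.loop v b c).run H) ∧
      (Cmd.loop v b c).cost H + Φ H ≤ 4 + n * (A + 5) + Φ ((Cmd.loop v b c).run H) := by
  rw [Cmd.run_loop h]
  have key : ∀ m ≤ n, Frame v c H (rounds (fun i H => c.run (H.setVar v i)) m H) ∧
      P m (rounds (fun i H => c.run (H.setVar v i)) m H) ∧
      ∑ i ∈ Finset.range m, (c.cost ((rounds (fun i H => c.run (H.setVar v i)) i H).setVar v i) + 5)
        + Φ H ≤ m * (A + 5) + Φ (rounds (fun i H => c.run (H.setVar v i)) m H) := by
    intro m
    induction m with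
    | zero => intro _; exact ⟨Frame.refl _ _ _, h0, by simp [rounds]⟩
    | succ m ih =>
      intro hm
      obtain ⟨h1, h2, h3⟩ := ih (by omega)
      obtain ⟨h4, h5⟩ := hs m (by omega) _ (by simp) (h1.setVar (m : ℝ)) (hset m _ (m : ℝ) h2)
      refine ⟨(h1.setVar _).run, h4, ?_⟩
      rw [hΦ] at h5
      rw [Finset.sum_range_succ, Nat.add_mul, one_mul]
      simp only [rounds]
      omega
  obtain ⟨_, h2, h3⟩ := key n le_rfl
  refine ⟨h2, ?_⟩
  simp only [Cmd.cost, h, Nat.ceil_natCast]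
  omega

theorem Cmd.loop_spec {v b : ℕ} {c : Cmd} {H : Store} {n : ℕ} {P : ℕ → Store → Prop}
    (h : H.var b = n) (h0 : P 0 H) (hset : ∀ i G x, P i G → P i (G.setVar v x))
    (hs : ∀ i : ℕ, i < n → ∀ G : Store, G.var v = (i : ℝ) → Frame v c H G → P i G → P (i + 1) (c.run G)) :
    P n ((Cmd.loop v b c).run H) := by
  rw [Cmd.run_loop h]
  have key : ∀ m ≤ n, Frame v c H (rounds (fun i H => c.run (H.setVar v i)) m H) ∧
      P m (rounds (fun i H => c.run (H.setVar v i)) m H) := by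
    intro m
    induction m with
    | zero => intro _; exact ⟨Frame.refl _ _ _, h0⟩
    | succ m ih =>
      intro hm
      obtain ⟨h1, h2⟩ := ih (by omega)
      exact ⟨(h1.setVar _).run,
        hs m (by omega) _ (by simp) (h1.setVar (m : ℝ)) (hset m _ (m : ℝ) h2)⟩
  exact (key n le_rfl).2

theorem Cmd.run_seq (c c' : Cmd) (H : Store) : (c ;; c').run H = c'.run (c.run H) := rfl

theorem Cmd.run_ite_pos {e f : Expr} {c c' : Cmd} {H : Store} (h : e.eval H < f.eval H) :
    (Cmd.ite e f c c').run H = c.run H := if_pos h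

theorem Cmd.run_ite_neg {e f : Expr} {c c' : Cmd} {H : Store} (h : ¬ e.eval H < f.eval H) :
    (Cmd.ite e f c c').run H = c'.run H := if_neg h

theorem floor_natCast_div (a b : ℕ) : ((⌊(a : ℝ) / b⌋ : ℤ) : ℝ) = ((a / b : ℕ) : ℝ) := by
  rw [← natCast_floor_eq_intCast_floor (by positivity), Nat.floor_div_eq_div]

theorem natCast_mod (a b : ℕ) : (a : ℝ) - b * ((a / b : ℕ) : ℝ) = ((a % b : ℕ) : ℝ) := by
  rw [sub_eq_iff_eq_add]
  exact_mod_cast (Nat.mod_add_div a b).symm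

local prefix:max "§" => Expr.var

/-- Raise the variable `b` to the power given by the variable `e`. -/
def powerLoop (v b e : ℕ) : Cmd := .loop 20 e (.set v (§v * §b))

theorem powerLoop_run {v b e : ℕ} {H : Store} {x : ℝ} {n : ℕ} (hvb : v ≠ b) (hb : b ≠ 20)
    (hv : v ≠ 20) (he : H.var e = n) (h1 : H.var v = 1) (hx : H.var b = x) :
    ((powerLoop v b e).run H).var v = x ^ n :=
  Cmd.loop_spec (P := fun i G => G.var v = x ^ i) he (by simpa using h1)
    (fun i G x h => by simpa [hv] using h) fun i _ G _ hF hG => by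
      have := hF.var b hb (by simpa [Cmd.keepsVar] using hvb)
      simp [Cmd.run, hG, this, hx, pow_succ]

end RealRAM

namespace FilterLSF
open RealRAM

local prefix:max "§" => Expr.var

/-! ### The sampler -/

/-- Read the input and compute the simple parameters. -/
def readParams : Cmd :=
  .set 1 (.inp 1) ;; .set 2 (.inp 2) ;; .set 3 (.inp 3) ;; .set 4 (§1 / §2) ;; .set 5 (§4 - 1) ;;
  .set 6 (§2 * §2 * §2) ;; .set 7 1 ;; .set 8 (§1 * §1) ;; .set 9 1 ;; .set 10 0 ;;
  .set 12 ((§6 / (3 * §3) + 2 * §2) * (§6 / (3 * §3) + 2 * §2)) ;;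
  .set 13 ((§6 / 3 - §2) * (§6 / 3 - §2)) ;; .set 14 0 ;; .set 15 (2 * §1)

/-- Count the numbers below `§2` whose square is less than `§2`. -/
def rootLoop : Cmd := .loop 20 2 (.ite (§20 * §20) §2 (.set 10 (§10 + 1)) .skip)

/-- Compute the powers that occur in the parameters, and a root. -/
def powers : Cmd := powerLoop 7 6 2 ;; powerLoop 9 8 5 ;; rootLoop

/-- Compute the number of coins and the size of the tables. -/
def sizes : Cmd := .set 11 (§9 * §1) ;; .set 16 (§7 * §7)

/-- Add to `§25` the squared torus distance of the grid points `§23` and `§24`. -/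
def torLoop : Cmd := .loop 20 2
  (.set 26 (.floor (§23 / §6)) ;; .set 27 (.floor (§24 / §6)) ;;
   .set 28 ((§23 - §6 * §26) - (§24 - §6 * §27)) ;;
   .set 28 (§28 - §6 * .floor (§28 / §6 + 1 / 2)) ;;
   .set 25 (§25 + §28 * §28) ;; .set 23 §26 ;; .set 24 §27)

/-- Tabulate which grid points cover each other, and which pairs have to be covered. -/
def tables : Cmd := .loop 21 16
  (.set 23 (.floor (§21 / §7)) ;; .set 24 (§21 - §7 * §23) ;; .set 25 0 ;; torLoop ;;
   .ite §13 §25 (.put 0 §21 0) (.put 0 §21 1) ;; .ite §12 §25 (.put 1 §21 0) (.put 1 §21 1))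

/-- Add to `§31` the number of open pairs that the grid point `§21` covers. -/
def gainLoop : Cmd := .loop 22 16
  (.set 23 (.floor (§22 / §7)) ;; .set 24 (§22 - §7 * §23) ;;
   .set 31 (§31 + .get 0 (§21 * §7 + §23) * .get 0 (§21 * §7 + §24) * .get 1 §22))

/-- Find a grid point that covers as many open pairs as possible. -/
def bestLoop : Cmd := .loop 21 7
  (.set 31 0 ;; gainLoop ;; .ite §29 §31 (.set 29 §31 ;; .set 30 §21) .skip)

/-- Close the pairs that the grid point `§30` covers. -/
def updateLoop : Cmd := .loop 22 16
  (.set 23 (.floor (§22 / §7)) ;; .set 24 (§22 - §7 * §23) ;;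
   .put 1 §22 (.get 1 §22 * (1 - .get 0 (§30 * §7 + §23) * .get 0 (§30 * §7 + §24))))

/-- One greedy step. -/
def greedyStep : Cmd :=
  .set 29 0 ;; .set 30 0 ;; bestLoop ;;
  .ite 0 §29 (.put 2 §14 §30 ;; .set 14 (§14 + 1) ;; updateLoop) .skip

/-- The greedy cover. -/
def greedyLoop : Cmd := .loop 20 7 greedyStep

/-- Draw the coins. -/
def coinLoop : Cmd := .loop 20 11 (.coin 21 ;; .put 3 §20 §21)

/-- The part of the sampler that does not use coins. -/
def prepare : Cmd := readParams ;; powers ;; sizes ;; tables ;; greedyLoop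

/-- The sampler. -/
def samplerCmd : Cmd := prepare ;; coinLoop

theorem torLoop_run {H : Store} {K d a b : ℕ} (h2 : H.var 2 = d) (h6 : H.var 6 = K)
    (h23 : H.var 23 = a) (h24 : H.var 24 = b) (h25 : H.var 25 = 0) :
    (torLoop.run H).var 25 = torSq K d a b := by
  refine (Cmd.loop_spec (P := fun i G => G.var 23 = ((a / K ^ i : ℕ) : ℝ) ∧
    G.var 24 = ((b / K ^ i : ℕ) : ℝ) ∧ G.var 25 = torSq K i a b) h2 ?_ (by intro _ _ _ h; exact h)
    fun i _ G _ hF hG => ?_).2.2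
  · simp [h23, h24, h25, torSq]
  · obtain ⟨g1, g2, g3⟩ := hG
    have h6' : G.var 6 = K := (hF.var 6 (by decide) rfl).trans h6
    have e1 : ∀ x : ℕ, x / K ^ (i + 1) = x / K ^ i / K := fun x => by
      rw [pow_succ, Nat.div_div_eq_div_mul]
    simp only [Cmd.run, Expr.eval_floor, Expr.eval_div, Expr.eval_var, Store.setVar_var,
      Expr.eval_sub, Expr.eval_mul, Expr.eval_add, Expr.eval_one, Expr.eval_ofNat,
      Nat.reduceEqDiff, if_true, if_false]
    simp only [g1, g2, g3, h6', floor_natCast_div, natCast_mod, e1, true_and]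
    rw [torSq, torSq, Finset.sum_range_succ]
    simp only [digit, wrap, Int.cast_sub, Int.cast_mul, Int.cast_natCast]
    ring

end FilterLSF

/-! ### Tables of relations, and correctness of the greedy loop -/

namespace FilterLSF
open RealRAM

local prefix:max "§" => Expr.var

open Classical in
/-- The indicator of a proposition. -/
noncomputable def ind (p : Prop) : ℝ := if p then 1 else 0

theorem ind_of {p : Prop} (h : p) : ind p = 1 := if_pos h

theorem ind_of_not {p : Prop} (h : ¬ p) : ind p = 0 := if_neg h

theorem ind_and (p q : Prop) : ind (p ∧ q) = ind p * ind q := by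
  by_cases hp : p <;> by_cases hq : q <;> simp [ind, hp, hq]

theorem ind_not (p : Prop) : ind (¬ p) = 1 - ind p := by
  by_cases hp : p <;> simp [ind, hp]

theorem sum_ind {α : Type*} (s : Finset α) (p : α → Prop) [DecidablePred p] :
    ∑ x ∈ s, ind (p x) = ((s.filter p).card : ℝ) := by
  rw [Finset.card_filter, Nat.cast_sum]
  refine Finset.sum_congr rfl fun x _ => ?_
  by_cases h : p x
  · rw [ind_of h, if_pos h, Nat.cast_one]
  · rw [ind_of_not h, if_neg h, Nat.cast_zero]

/-- The table of a relation on the numbers below `n`. -/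
def IsTable (n : ℕ) (R : ℕ → ℕ → Prop) (f : ℕ → ℝ) : Prop :=
  ∀ p < n * n, f p = ind (R (p / n) (p % n))

theorem IsTable.apply {n : ℕ} {R : ℕ → ℕ → Prop} {f : ℕ → ℝ} (h : IsTable n R f) {a b : ℕ}
    (ha : a < n) (hb : b < n) : f (a * n + b) = ind (R a b) := by
  have h1 : a * n + b < n * n := by nlinarith
  have h2 : (a * n + b) / n = a := by
    rw [add_comm, Nat.add_mul_div_right _ _ (by omega), Nat.div_eq_of_lt hb, zero_add]
  have h3 : (a * n + b) % n = b := by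
    rw [add_comm, Nat.add_mul_mod_self_right, Nat.mod_eq_of_lt hb]
  rw [h _ h1, h2, h3]

theorem tables_run {H : Store} {K d n : ℕ} {w : ℝ} (h2 : H.var 2 = d) (h6 : H.var 6 = K)
    (h7 : H.var 7 = n) (h12 : H.var 12 = nearRadius K d w ^ 2)
    (h13 : H.var 13 = coverRadius K d ^ 2) (h16 : H.var 16 = (n * n : ℕ)) :
    IsTable n (Covers K d) ((tables.run H).arr 0) ∧
      IsTable n (IsNear K d w) ((tables.run H).arr 1) := by
  have key := Cmd.loop_spec (v := 21) (P := fun i G => ∀ p < i,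
    G.arr 0 p = ind (Covers K d (p / n) (p % n)) ∧
    G.arr 1 p = ind (IsNear K d w (p / n) (p % n))) h16 (by simp) (by intro _ _ _ h; exact h)
    (c := .set 23 (.floor (§21 / §7)) ;; .set 24 (§21 - §7 * §23) ;; .set 25 0 ;; torLoop ;;
      .ite §13 §25 (.put 0 §21 0) (.put 0 §21 1) ;; .ite §12 §25 (.put 1 §21 0) (.put 1 §21 1))
    fun i _ G hi hF hG => ?_
  · exact ⟨fun p hp => (key p hp).1, fun p hp => (key p hp).2⟩
  · set G₁ := (Cmd.set 23 (.floor (§21 / §7)) ;; .set 24 (§21 - §7 * §23) ;; .set 25 0).run G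
      with hG₁
    have h7' : G.var 7 = n := (hF.var 7 (by decide) rfl).trans h7
    have e23 : G₁.var 23 = ((i / n : ℕ) : ℝ) := by
      simp [hG₁, Cmd.run, h7', hi, floor_natCast_div]
    have e24 : G₁.var 24 = ((i % n : ℕ) : ℝ) := by
      simp [hG₁, Cmd.run, h7', hi, floor_natCast_div, natCast_mod]
    have e2 : G₁.var 2 = d := by
      simp [hG₁, Cmd.run, hF.var 2 (by decide) rfl, h2]
    have e6 : G₁.var 6 = K := by
      simp [hG₁, Cmd.run, hF.var 6 (by decide) rfl, h6]
    have e25 := torLoop_run e2 e6 e23 e24 (by simp [hG₁, Cmd.run])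
    set G₂ := torLoop.run G₁ with hG₂
    have f21 : G₂.var 21 = i := by
      rw [hG₂, Cmd.run_var rfl]; simp [hG₁, Cmd.run, hi]
    have f12 : G₂.var 12 = nearRadius K d w ^ 2 := by
      rw [hG₂, Cmd.run_var rfl]; simp [hG₁, Cmd.run, hF.var 12 (by decide) rfl, h12]
    have f13 : G₂.var 13 = coverRadius K d ^ 2 := by
      rw [hG₂, Cmd.run_var rfl]; simp [hG₁, Cmd.run, hF.var 13 (by decide) rfl, h13]
    have f0 : G₂.arr 0 = G.arr 0 := by rw [hG₂, Cmd.run_arr rfl]; rfl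
    have f1 : G₂.arr 1 = G.arr 1 := by rw [hG₂, Cmd.run_arr rfl]; rfl
    have g0 : ∀ (G : Store) (a : Fin 8) (t x : ℝ) (v : ℕ), G.var 21 = i → G.var v = t →
        G.var 25 = x → (Cmd.ite §v §25 (.put a §21 0) (.put a §21 1)).run G =
          G.setArr a i (ind (x ≤ t)) := by
      intro G a t x v h1 h2 h3
      simp only [Cmd.run, Expr.eval_var, h1, h2, h3, Nat.cast_nonneg, if_true, Nat.floor_natCast,
        Expr.eval_zero, Expr.eval_one]
      split_ifs with h
      · rw [ind_of_not (not_le.2 h)]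
      · rw [ind_of (not_lt.1 h)]
    change ∀ p < i + 1, ((Cmd.ite §12 §25 (.put 1 §21 0) (.put 1 §21 1)).run
      ((Cmd.ite §13 §25 (.put 0 §21 0) (.put 0 §21 1)).run G₂)).arr 0 p = _ ∧
      ((Cmd.ite §12 §25 (.put 1 §21 0) (.put 1 §21 1)).run
      ((Cmd.ite §13 §25 (.put 0 §21 0) (.put 0 §21 1)).run G₂)).arr 1 p = _
    rw [g0 G₂ 0 _ _ 13 f21 f13 e25, g0 _ 1 _ _ 12 (by exact f21) (by exact f12) (by exact e25)]
    intro p hp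
    simp only [Store.setArr_arr, Fin.reduceEq, if_true, if_false, f0, f1, Function.update_apply]
    by_cases hpi : p = i
    · subst hpi
      simp only [if_true]
      exact ⟨rfl, rfl⟩
    · simp only [hpi, if_false]
      exact hG p (by omega)

section Greedy

variable {n : ℕ} {near cov : ℕ → ℕ → Prop}

/-- Pairs (a, b) are stored at the position an + b, so that one loop over n² positions with products
of table entries counts the gain. -/
theorem gain_eq_sum {S : Finset (ℕ × ℕ)} (hS : ∀ p ∈ S, p.1 < n ∧ p.2 < n) (v : ℕ) :
    (gain cov S v : ℝ) = ∑ p ∈ Finset.range (n * n),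
      ind (cov v (p / n)) * ind (cov v (p % n)) * ind ((p / n, p % n) ∈ S) := by
  classical
  simp only [← ind_and]
  rw [sum_ind, gain]
  congr 1
  refine (Finset.card_bij (fun p _ => (p / n, p % n)) ?_ ?_ ?_).symm
  · intro p hp
    simp only [Finset.mem_filter, Finset.mem_range] at hp
    simp only [Finset.mem_filter]
    exact ⟨hp.2.2, hp.2.1⟩
  · intro p _ q _ h
    rw [← Nat.div_add_mod p n, ← Nat.div_add_mod q n, (Prod.mk.inj h).1, (Prod.mk.inj h).2]
  · rintro ⟨a, b⟩ hp
    simp only [Finset.mem_filter] at hp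
    obtain ⟨ha, hb⟩ := hS _ hp.1
    simp only at ha hb
    have h2 : (a * n + b) / n = a := by
      rw [add_comm, Nat.add_mul_div_right _ _ (by omega), Nat.div_eq_of_lt hb, zero_add]
    have h3 : (a * n + b) % n = b := by
      rw [add_comm, Nat.add_mul_mod_self_right, Nat.mod_eq_of_lt hb]
    refine ⟨a * n + b, ?_, by rw [h2, h3]⟩
    simp only [Finset.mem_filter, Finset.mem_range, h2, h3]
    exact ⟨by nlinarith, hp.2, hp.1⟩

theorem gainLoop_run {H : Store} {S : Finset (ℕ × ℕ)} {v : ℕ} (hv : v < n)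
    (hS : ∀ p ∈ S, p.1 < n ∧ p.2 < n) (h7 : H.var 7 = n) (h16 : H.var 16 = (n * n : ℕ))
    (h21 : H.var 21 = v) (h31 : H.var 31 = 0) (hc : IsTable n cov (H.arr 0))
    (ho : IsTable n (fun a b => (a, b) ∈ S) (H.arr 1)) :
    (gainLoop.run H).var 31 = gain cov S v := by
  rw [gain_eq_sum hS]
  refine Cmd.loop_spec (v := 22) (P := fun i G => G.var 31 = ∑ p ∈ Finset.range i,
    ind (cov v (p / n)) * ind (cov v (p % n)) * ind ((p / n, p % n) ∈ S)) h16 (by simpa using h31)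
    (by intro _ _ _ h; exact h) fun i hi G hGi hF hG => ?_
  have h7' : G.var 7 = n := (hF.var 7 (by decide) rfl).trans h7
  have h21' : G.var 21 = v := (hF.var 21 (by decide) rfl).trans h21
  have a0 : G.arr 0 = H.arr 0 := hF.arr 0 rfl
  have a1 : G.arr 1 = H.arr 1 := hF.arr 1 rfl
  set G₁ := (Cmd.set 23 (.floor (§22 / §7)) ;; .set 24 (§22 - §7 * §23)).run G with hG₁
  have hn : 0 < n := by omega
  have e1 : (Expr.get 0 (§21 * §7 + §23)).eval G₁ = ind (cov v (i / n)) := by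
    rw [Expr.eval_get (i := v * n + i / n) (by simp [hG₁, Cmd.run, h7', h21', hGi, floor_natCast_div])]
    change G.arr 0 _ = _
    rw [a0, hc.apply hv (Nat.div_lt_of_lt_mul hi)]
  have e2 : (Expr.get 0 (§21 * §7 + §24)).eval G₁ = ind (cov v (i % n)) := by
    rw [Expr.eval_get (i := v * n + i % n)
      (by simp [hG₁, Cmd.run, h7', h21', hGi, floor_natCast_div, natCast_mod])]
    change G.arr 0 _ = _
    rw [a0, hc.apply hv (Nat.mod_lt _ hn)]
  have e3 : (Expr.get 1 §22).eval G₁ = ind ((i / n, i % n) ∈ S) := by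
    rw [Expr.eval_get (i := i) (by simp [hG₁, Cmd.run, hGi])]
    change G.arr 1 _ = _
    rw [a1, ho i hi]
  have e4 : G₁.var 31 = G.var 31 := by simp [hG₁, Cmd.run]
  change ((Cmd.set 31 (§31 + .get 0 (§21 * §7 + §23) * .get 0 (§21 * §7 + §24) * .get 1 §22)).run
    G₁).var 31 = _
  simp only [Cmd.run, Store.setVar_var, if_true, Expr.eval_add, Expr.eval_mul, e1, e2, e3,
    Expr.eval_var, e4, hG, Finset.sum_range_succ]

theorem bestLoop_run {H : Store} {S : Finset (ℕ × ℕ)} (hS : ∀ p ∈ S, p.1 < n ∧ p.2 < n)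
    (h7 : H.var 7 = n) (h16 : H.var 16 = (n * n : ℕ))
    (h29 : H.var 29 = 0) (h30 : H.var 30 = 0) (hc : IsTable n cov (H.arr 0))
    (ho : IsTable n (fun a b => (a, b) ∈ S) (H.arr 1)) :
    ∃ g a : ℕ, (bestLoop.run H).var 29 = g ∧ (bestLoop.run H).var 30 = a ∧
      (∀ v < n, gain cov S v ≤ g) ∧ (0 < g → a < n ∧ gain cov S a = g) := by
  refine Cmd.loop_spec (v := 21) (P := fun i G => ∃ g a : ℕ, G.var 29 = g ∧ G.var 30 = a ∧
    (∀ v < i, gain cov S v ≤ g) ∧ (0 < g → a < i ∧ gain cov S a = g)) h7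
    ⟨0, 0, by simpa using h29, by simpa using h30, by simp, by simp⟩
    (by intro _ _ _ h; exact h) fun i hi G hGi hF hG => ?_
  obtain ⟨g, a, h1, h2, h3, h4⟩ := hG
  set G₁ := (Cmd.set 31 0).run G with hG₁
  have e := gainLoop_run (H := G₁) (cov := cov) hi hS
    (by simp [hG₁, Cmd.run, hF.var 7 (by decide) rfl, h7])
    (by simp only [hG₁, Cmd.run, Store.setVar_var]; exact (hF.var 16 (by decide) rfl).trans h16)
    (by simp [hG₁, Cmd.run, hGi]) (by simp [hG₁, Cmd.run])
    (by change IsTable n cov (G.arr 0); rw [hF.arr 0 rfl]; exact hc)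
    (by change IsTable n _ (G.arr 1); rw [hF.arr 1 rfl]; exact ho)
  set G₂ := gainLoop.run G₁ with hG₂
  have f29 : G₂.var 29 = g := by
    rw [hG₂, Cmd.run_var rfl]; simp [hG₁, Cmd.run, h1]
  have f30 : G₂.var 30 = a := by
    rw [hG₂, Cmd.run_var rfl]; simp [hG₁, Cmd.run, h2]
  have f21 : G₂.var 21 = i := by
    rw [hG₂, Cmd.run_var rfl]; simp [hG₁, Cmd.run, hGi]
  change ∃ g a : ℕ, ((Cmd.ite §29 §31 (.set 29 §31 ;; .set 30 §21) .skip).run G₂).var 29 = g ∧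
    ((Cmd.ite §29 §31 (.set 29 §31 ;; .set 30 §21) .skip).run G₂).var 30 = a ∧ _
  simp only [Cmd.run, Expr.eval_var, f29, e, Nat.cast_lt]
  by_cases hlt : g < gain cov S i
  · refine ⟨gain cov S i, i, by simp [hlt], by simp [hlt, f21], fun v hv => ?_,
      fun _ => ⟨by omega, rfl⟩⟩
    rcases Nat.lt_succ_iff_lt_or_eq.1 hv with h | rfl
    · exact (h3 v h).trans hlt.le
    · exact le_rfl
  · refine ⟨g, a, by simp [hlt, f29], by simp [hlt, f30], fun v hv => ?_,
      fun h => ⟨(h4 h).1.trans (Nat.lt_succ_self i), (h4 h).2⟩⟩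
    rcases Nat.lt_succ_iff_lt_or_eq.1 hv with h | rfl
    · exact h3 v h
    · exact not_lt.1 hlt

theorem updateLoop_run {H : Store} {R : ℕ → ℕ → Prop} {v : ℕ} (hv : v < n)
    (h7 : H.var 7 = n) (h16 : H.var 16 = (n * n : ℕ))
    (h30 : H.var 30 = v) (hc : IsTable n cov (H.arr 0)) (ho : IsTable n R (H.arr 1)) :
    IsTable n (fun a b => R a b ∧ ¬ (cov v a ∧ cov v b)) ((updateLoop.run H).arr 1) := by
  have key := Cmd.loop_spec (v := 22) (P := fun i G => ∀ p < n * n,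
    G.arr 1 p = if p < i then ind (R (p / n) (p % n) ∧ ¬ (cov v (p / n) ∧ cov v (p % n)))
      else H.arr 1 p) h16 (by simp) (by intro _ _ _ h; exact h)
    (c := .set 23 (.floor (§22 / §7)) ;; .set 24 (§22 - §7 * §23) ;;
      .put 1 §22 (.get 1 §22 * (1 - .get 0 (§30 * §7 + §23) * .get 0 (§30 * §7 + §24))))
    fun i hi G hGi hF hG => ?_
  · intro p hp
    exact (key p hp).trans (if_pos hp)
  have h7' : G.var 7 = n := (hF.var 7 (by decide) rfl).trans h7
  have h30' : G.var 30 = v := (hF.var 30 (by decide) rfl).trans h30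
  have a0 : G.arr 0 = H.arr 0 := hF.arr 0 rfl
  set G₁ := (Cmd.set 23 (.floor (§22 / §7)) ;; .set 24 (§22 - §7 * §23)).run G with hG₁
  have hn : 0 < n := by omega
  have e1 : (Expr.get 0 (§30 * §7 + §23)).eval G₁ = ind (cov v (i / n)) := by
    rw [Expr.eval_get (i := v * n + i / n) (by simp [hG₁, Cmd.run, h7', h30', hGi, floor_natCast_div])]
    change G.arr 0 _ = _
    rw [a0, hc.apply hv (Nat.div_lt_of_lt_mul hi)]
  have e2 : (Expr.get 0 (§30 * §7 + §24)).eval G₁ = ind (cov v (i % n)) := by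
    rw [Expr.eval_get (i := v * n + i % n)
      (by simp [hG₁, Cmd.run, h7', h30', hGi, floor_natCast_div, natCast_mod])]
    change G.arr 0 _ = _
    rw [a0, hc.apply hv (Nat.mod_lt _ hn)]
  have e3 : (Expr.get 1 §22).eval G₁ = ind (R (i / n) (i % n)) := by
    rw [Expr.eval_get (i := i) (by simp [hG₁, Cmd.run, hGi])]
    change G.arr 1 _ = _
    rw [hG i hi, if_neg (lt_irrefl i), ho i hi]
  have e5 : (§22).eval G₁ = i := by simp [hG₁, Cmd.run, hGi]
  have e6 : G₁.arr 1 = G.arr 1 := rfl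
  change ∀ p < n * n, ((Cmd.put 1 §22 (.get 1 §22 *
    (1 - .get 0 (§30 * §7 + §23) * .get 0 (§30 * §7 + §24)))).run G₁).arr 1 p = _
  rw [Cmd.run_put e5]
  intro p hp
  simp only [Store.setArr_arr, if_true, Function.update_apply, Expr.eval_mul, Expr.eval_sub,
    Expr.eval_one, e1, e2, e3, e6]
  by_cases hpi : p = i
  · subst hpi
    simp only [if_true, Nat.lt_succ_self, ind_and, ind_not]
  · rw [if_neg hpi, hG p hp]
    have : p < i + 1 ↔ p < i := by omega
    simp only [this]

theorem uncov_congr {u u' : ℕ → ℕ} {t : ℕ} (h : ∀ j < t, u j = u' j) :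
    uncov n near cov u t = uncov n near cov u' t := by
  ext p
  rw [mem_uncov, mem_uncov]
  refine and_congr_right fun _ => and_congr_right fun _ => forall₂_congr fun j hj => ?_
  rw [h j hj]

theorem IsGreedy.snoc {u u' : ℕ → ℕ} {N : ℕ} (h : IsGreedy n near cov u N)
    (hu : ∀ j < N, u j = u' j) (hlt : u' N < n)
    (hmax : ∀ v < n, gain cov (uncov n near cov u N) v ≤ gain cov (uncov n near cov u N) (u' N))
    (hpos : 0 < gain cov (uncov n near cov u N) (u' N)) : IsGreedy n near cov u' (N + 1) := by
  have hc : ∀ t ≤ N, uncov n near cov u t = uncov n near cov u' t := fun t ht =>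
    uncov_congr fun j hj => hu j (by omega)
  refine ⟨fun t ht => ?_, fun t ht => ?_, fun t ht => ?_⟩ <;>
  rcases Nat.lt_succ_iff_lt_or_eq.1 ht with h1 | rfl
  · rw [← hu t h1]; exact h.lt t h1
  · exact hlt
  · rw [← hc t h1.le, ← hu t h1]; exact h.max t h1
  · rw [← hc t le_rfl]; exact hmax
  · rw [← hc t h1.le, ← hu t h1]; exact h.pos t h1
  · rw [← hc t le_rfl]; exact hpos

/-- The data of a greedy cover in progress. -/
structure GreedyState (n : ℕ) (near cov : ℕ → ℕ → Prop) (G : Store) (u : ℕ → ℕ) (N : ℕ) :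
    Prop where
  var : G.var 14 = N
  arr : ∀ j < N, G.arr 2 j = u j
  table : IsTable n (fun a b => (a, b) ∈ uncov n near cov u N) (G.arr 1)
  greedy : IsGreedy n near cov u N

/-- The loop has a fixed number of rounds, so a step must also be harmless when nothing can be
gained; then the best gain is 0 and the data remain as they are. -/
theorem greedyStep_run {H : Store} {u : ℕ → ℕ} {N : ℕ} (h7 : H.var 7 = n)
    (h16 : H.var 16 = (n * n : ℕ)) (hc : IsTable n cov (H.arr 0))
    (hH : GreedyState n near cov H u N) :
    (GreedyState n near cov (greedyStep.run H) u N ∧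
      ∀ v < n, gain cov (uncov n near cov u N) v = 0) ∨
    (∃ v < n, 0 < gain cov (uncov n near cov u N) v) ∧
      ∃ u', GreedyState n near cov (greedyStep.run H) u' (N + 1) := by
  set G := (Cmd.set 29 0 ;; .set 30 0).run H with hG
  have hS : ∀ p ∈ uncov n near cov u N, p.1 < n ∧ p.2 < n := fun p hp => (mem_uncov.1 hp).1
  have b7 : G.var 7 = n := by simp [hG, Cmd.run, h7]
  have b16 : G.var 16 = (n * n : ℕ) := by
    simp only [hG, Cmd.run, Store.setVar_var]; exact h16
  obtain ⟨g, a, e29, e30, e3, e4⟩ := bestLoop_run (H := G) hS b7 b16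
    (by simp [hG, Cmd.run]) (by simp [hG, Cmd.run]) hc hH.table
  set G₁ := bestLoop.run G with hG₁
  have c0 : G₁.arr 0 = H.arr 0 := by rw [hG₁, Cmd.run_arr rfl]; rfl
  have c1 : G₁.arr 1 = H.arr 1 := by rw [hG₁, Cmd.run_arr rfl]; rfl
  have c2 : G₁.arr 2 = H.arr 2 := by rw [hG₁, Cmd.run_arr rfl]; rfl
  have c14 : G₁.var 14 = N := by
    rw [hG₁, Cmd.run_var rfl]; simp [hG, Cmd.run, hH.var]
  have c7 : G₁.var 7 = n := by rw [hG₁, Cmd.run_var rfl, b7]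
  have c16 : G₁.var 16 = (n * n : ℕ) := by rw [hG₁, Cmd.run_var rfl, b16]
  have hrun : greedyStep.run H = (Cmd.ite 0 §29 (.put 2 §14 §30 ;; .set 14 (§14 + 1) ;; updateLoop)
      .skip).run G₁ := rfl
  rcases Nat.eq_zero_or_pos g with rfl | hg
  · refine .inl ⟨?_, fun v hv => by simpa using e3 v hv⟩
    have : greedyStep.run H = G₁ := by
      rw [hrun]
      simp only [Cmd.run, Expr.eval_zero, Expr.eval_var, e29, Nat.cast_zero, lt_irrefl, if_false]
    rw [this]
    exact ⟨c14, fun j hj => by rw [c2, hH.arr j hj], by rw [c1]; exact hH.table, hH.greedy⟩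
  · right
    obtain ⟨han, hga⟩ := e4 hg
    set G₂ := (Cmd.put 2 §14 §30 ;; .set 14 (§14 + 1)).run G₁ with hG₂
    have e14 : (§14).eval G₁ = N := c14
    have hput : G₂ = (G₁.setArr 2 N a).setVar 14 (N + 1) := by
      rw [hG₂]
      change (Cmd.set 14 (§14 + 1)).run ((Cmd.put 2 §14 §30).run G₁) = _
      rw [Cmd.run_put e14]
      simp [Cmd.run, c14, e30]
    have hrun' : greedyStep.run H = updateLoop.run G₂ := by
      rw [hrun]
      have : (0 : ℝ) < g := by exact_mod_cast hg
      simp only [Cmd.run, Expr.eval_zero, Expr.eval_var, e29, this, if_true]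
      rfl
    rw [hrun']
    have d30 : G₂.var 30 = a := by simp [hput, e30]
    have htab := updateLoop_run (H := G₂) han (by simp [hput, c7])
      (by rw [hput, Store.setVar_var]; exact c16) d30 (cov := cov)
      (by rw [hput]; change IsTable n cov (G₁.arr 0); rw [c0]; exact hc)
      (R := fun a b => (a, b) ∈ uncov n near cov u N)
      (by rw [hput]; change IsTable n _ (G₁.arr 1); rw [c1]; exact hH.table)
    refine ⟨⟨a, han, by omega⟩, Function.update u N a, ?_, ?_, ?_, ?_⟩
    · rw [Cmd.run_var rfl, hput]; simp
    · intro j hj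
      rw [Cmd.run_arr rfl, hput]
      simp only [Store.setVar_arr, Store.setArr_arr, if_true, Function.update_apply]
      by_cases hjN : j = N
      · simp [hjN]
      · simp only [hjN, if_false, c2]
        exact hH.arr j (by omega)
    · intro p hp
      rw [htab p hp]
      congr 1
      change ((_, _) ∈ _ ∧ _) = ((_, _) ∈ _)
      rw [mem_uncov, mem_uncov]
      refine propext ⟨fun ⟨⟨h1, h2, h3⟩, h4⟩ => ⟨h1, h2, fun j hj => ?_⟩,
        fun ⟨h1, h2, h3⟩ => ⟨⟨h1, h2, fun j hj => ?_⟩, ?_⟩⟩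
      · rcases Nat.lt_succ_iff_lt_or_eq.1 hj with h | rfl
        · rw [Function.update_of_ne (by omega)]; exact h3 j h
        · rw [Function.update_self]; exact h4
      · have := h3 j (by omega)
        rwa [Function.update_of_ne (by omega)] at this
      · have := h3 N (by omega)
        rwa [Function.update_self] at this
    · refine hH.greedy.snoc (fun j hj => (Function.update_of_ne (by omega) _ _).symm) ?_ ?_ ?_
      · rwa [Function.update_self]
      · rw [Function.update_self, hga]; exact e3
      · rw [Function.update_self, hga]; exact hg

/-- Invariant: either every round so far has added a point, or nothing is left to gain. After `n`
rounds the first case leads to the second by `IsGreedy.gain_eq_zero`. -/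
theorem greedyLoop_run {H : Store} (h7 : H.var 7 = n) (h16 : H.var 16 = (n * n : ℕ))
    (h14 : H.var 14 = 0) (hc : IsTable n cov (H.arr 0)) (hn : IsTable n near (H.arr 1)) :
    ∃ u N, GreedyState n near cov (greedyLoop.run H) u N ∧
      ∀ v < n, gain cov (uncov n near cov u N) v = 0 := by
  obtain ⟨u, N, h1, h2⟩ := Cmd.loop_spec (v := 20) (c := greedyStep) (P := fun i G => ∃ u N,
    GreedyState n near cov G u N ∧ (N = i ∨ ∀ v < n, gain cov (uncov n near cov u N) v = 0)) h7
    ⟨fun _ => 0, 0, ⟨by simpa using h14, by simp, fun p hp => by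
      rw [hn p hp]
      congr 1
      change _ = ((_, _) ∈ _)
      rw [mem_uncov]
      have hn0 : 0 < n := by
        rcases Nat.eq_zero_or_pos n with rfl | h
        · simp at hp
        · exact h
      have := Nat.div_lt_of_lt_mul hp
      have := Nat.mod_lt p hn0
      simp [*], ⟨by simp, by simp, by simp⟩⟩, .inl rfl⟩
    (by
      rintro i G x ⟨u, N, h, h'⟩
      exact ⟨u, N, ⟨h.var, h.arr, h.table, h.greedy⟩, h'⟩)
    fun i hi G hGi hF ⟨u, N, hG, hN⟩ => by
      rcases greedyStep_run ((hF.var 7 (by decide) rfl).trans h7)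
        ((hF.var 16 (by decide) rfl).trans h16) (by rw [hF.arr 0 rfl]; exact hc) hG with
        ⟨h1, h2⟩ | ⟨⟨v, hv, hv'⟩, u', h1⟩
      · exact ⟨u, N, h1, .inr h2⟩
      · rcases hN with rfl | hN
        · exact ⟨u', N + 1, h1, .inl rfl⟩
        · exact absurd (hN v hv) hv'.ne'
  refine ⟨u, N, h1, ?_⟩
  rcases h2 with rfl | h2
  · exact fun v hv => h1.greedy.gain_eq_zero hv
  · exact h2

end Greedy

end FilterLSF

/-! ### Correctness and cost of the sampler -/

namespace FilterLSF
open RealRAM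

local prefix:max "§" => Expr.var

/-- The number of `i < d` with `i² < d`, that is, the square root of `d` rounded up. -/
def rootCount (d : ℕ) : ℕ := ((Finset.range d).filter fun i => i * i < d).card

/-- The number of grid points per period. -/
def gridSize (d : ℕ) : ℕ := d * d * d

/-- The number of grid points. -/
def gridCard (d : ℕ) : ℕ := gridSize d ^ d

/-- The number of decompositions. -/
def decompCount (D k : ℕ) : ℕ := (D * D) ^ (k - 1)

/-- The store contains the parameters of the family. -/
structure Params (D d k : ℕ) (w : ℝ) (H : Store) : Prop where
  v1 : H.var 1 = D
  v2 : H.var 2 = d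
  v3 : H.var 3 = w
  v4 : H.var 4 = k
  v5 : H.var 5 = (k - 1 : ℕ)
  v6 : H.var 6 = gridSize d
  v7 : H.var 7 = gridCard d
  v8 : H.var 8 = (D * D : ℕ)
  v9 : H.var 9 = decompCount D k
  v10 : H.var 10 = rootCount d
  v11 : H.var 11 = (decompCount D k * D : ℕ)
  v12 : H.var 12 = nearRadius (gridSize d) d w ^ 2
  v13 : H.var 13 = coverRadius (gridSize d) d ^ 2
  v15 : H.var 15 = (2 * D : ℕ)
  v16 : H.var 16 = (gridCard d * gridCard d : ℕ)

theorem Params.of_eq {D d k : ℕ} {w : ℝ} {G H : Store} (h : Params D d k w H)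
    (he : ∀ v ∈ [1, 2, 3, 4, 5, 6, 7, 8, 9, 10, 11, 12, 13, 15, 16], G.var v = H.var v) :
    Params D d k w G where
  v1 := (he 1 (by decide)).trans h.v1
  v2 := (he 2 (by decide)).trans h.v2
  v3 := (he 3 (by decide)).trans h.v3
  v4 := (he 4 (by decide)).trans h.v4
  v5 := (he 5 (by decide)).trans h.v5
  v6 := (he 6 (by decide)).trans h.v6
  v7 := (he 7 (by decide)).trans h.v7
  v8 := (he 8 (by decide)).trans h.v8
  v9 := (he 9 (by decide)).trans h.v9
  v10 := (he 10 (by decide)).trans h.v10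
  v11 := (he 11 (by decide)).trans h.v11
  v12 := (he 12 (by decide)).trans h.v12
  v13 := (he 13 (by decide)).trans h.v13
  v15 := (he 15 (by decide)).trans h.v15
  v16 := (he 16 (by decide)).trans h.v16

/-- The variables of the parameters. -/
def paramVars : List ℕ := [1, 2, 3, 4, 5, 6, 7, 8, 9, 10, 11, 12, 13, 15, 16]

theorem Params.run {D d k : ℕ} {w : ℝ} {H : Store} (h : Params D d k w H) {c : Cmd}
    (hc : (paramVars.all fun v => c.keepsVar v) = true) : Params D d k w (c.run H) :=
  h.of_eq fun v hv => Cmd.run_var (List.all_eq_true.1 hc v hv) H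

theorem rootLoop_run {H : Store} {d : ℕ} (h2 : H.var 2 = d) (h10 : H.var 10 = 0) :
    (rootLoop.run H).var 10 = rootCount d := by
  refine Cmd.loop_spec (v := 20) (P := fun i G => G.var 10 =
    (((Finset.range i).filter fun i => i * i < d).card : ℝ)) h2 (by simpa using h10)
    (by intro _ _ _ h; exact h) fun i hi G hGi hF hG => ?_
  have h2' : G.var 2 = d := (hF.var 2 (by decide) rfl).trans h2
  rw [Finset.range_add_one, Finset.filter_insert]
  have e : G.var 20 * G.var 20 < G.var 2 ↔ i * i < d := by
    rw [hGi, h2']; exact_mod_cast Iff.rfl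
  simp only [Cmd.run, Expr.eval_mul, Expr.eval_var, e]
  split_ifs with h
  · simp [hG]
  · exact hG

theorem powers_run {H : Store} {D d k : ℕ} (h2 : H.var 2 = d) (h5 : H.var 5 = (k - 1 : ℕ))
    (h6 : H.var 6 = gridSize d) (h7 : H.var 7 = 1) (h8 : H.var 8 = (D * D : ℕ)) (h9 : H.var 9 = 1)
    (h10 : H.var 10 = 0) :
    (powers.run H).var 7 = gridCard d ∧ (powers.run H).var 9 = decompCount D k ∧
      (powers.run H).var 10 = rootCount d := by
  have e1 := powerLoop_run (v := 7) (b := 6) (e := 2) (by decide) (by decide) (by decide) h2 h7 h6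
  set G₁ := (powerLoop 7 6 2).run H with hG₁
  have f : ∀ v, (powerLoop 7 6 2).keepsVar v = true → G₁.var v = H.var v :=
    fun v hv => Cmd.run_var hv H
  have e2 := powerLoop_run (H := G₁) (v := 9) (b := 8) (e := 5) (by decide) (by decide) (by decide)
    ((f 5 rfl).trans h5) ((f 9 rfl).trans h9) ((f 8 rfl).trans h8)
  set G₂ := (powerLoop 9 8 5).run G₁ with hG₂
  have f' : ∀ v, (powerLoop 9 8 5).keepsVar v = true → G₂.var v = G₁.var v :=
    fun v hv => Cmd.run_var hv G₁
  have e3 := rootLoop_run (H := G₂) ((f' 2 rfl).trans ((f 2 rfl).trans h2))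
    ((f' 10 rfl).trans ((f 10 rfl).trans h10))
  have hrun : powers.run H = rootLoop.run G₂ := rfl
  rw [hrun]
  refine ⟨?_, ?_, e3⟩
  · rw [Cmd.run_var rfl, f' 7 rfl, e1, gridCard]; push_cast; rfl
  · rw [Cmd.run_var rfl, e2, decompCount]; push_cast; rfl

theorem readParams_run {H : Store} {D d k : ℕ} {w : ℝ} (hd : 0 < d) (hk : 0 < k) (hD : k * d = D)
    (i1 : H.inp 1 = D) (i2 : H.inp 2 = d) (i3 : H.inp 3 = w) :
    Params D d k w ((readParams ;; powers ;; sizes).run H) ∧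
      ((readParams ;; powers ;; sizes).run H).var 14 = 0 := by
  set G₁ := readParams.run H with hG₁
  have hd' : (d : ℝ) ≠ 0 := by exact_mod_cast hd.ne'
  have hDk : (D : ℝ) / d = k := by
    rw [div_eq_iff hd', ← hD]; push_cast; rfl
  have h4 : G₁.var 4 = k := by
    simp [hG₁, readParams, Cmd.run, i1, i2, hDk]
  have h5 : G₁.var 5 = (k - 1 : ℕ) := by
    rw [Nat.cast_sub hk]
    simp [hG₁, readParams, Cmd.run, i1, i2, hDk]
  have h6 : G₁.var 6 = gridSize d := by
    simp [hG₁, readParams, Cmd.run, i2, gridSize]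
  have h8 : G₁.var 8 = (D * D : ℕ) := by
    simp [hG₁, readParams, Cmd.run, i1]
  have h12 : G₁.var 12 = nearRadius (gridSize d) d w ^ 2 := by
    simp [hG₁, readParams, Cmd.run, i2, i3, gridSize, nearRadius, pow_two]
  have h13 : G₁.var 13 = coverRadius (gridSize d) d ^ 2 := by
    simp [hG₁, readParams, Cmd.run, i2, gridSize, coverRadius, pow_two]
  have h2 : G₁.var 2 = d := by simp [hG₁, readParams, Cmd.run, i2]
  obtain ⟨p7, p9, p10⟩ := powers_run (H := G₁) (D := D) (k := k) h2 h5 h6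
    (by simp [hG₁, readParams, Cmd.run]) h8 (by simp [hG₁, readParams, Cmd.run])
    (by simp [hG₁, readParams, Cmd.run])
  set G₂ := powers.run G₁ with hG₂
  have f : ∀ v, powers.keepsVar v = true → G₂.var v = G₁.var v := fun v hv => Cmd.run_var hv G₁
  have h1 : G₁.var 1 = D := by simp [hG₁, readParams, Cmd.run, i1]
  have h3 : G₁.var 3 = w := by simp [hG₁, readParams, Cmd.run, i3]
  have h14 : G₁.var 14 = 0 := by simp [hG₁, readParams, Cmd.run]
  have h15 : G₁.var 15 = (2 * D : ℕ) := by simp [hG₁, readParams, Cmd.run, i1]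
  have hrun : (readParams ;; powers ;; sizes).run H = sizes.run G₂ := rfl
  rw [hrun]
  have f' : ∀ v, sizes.keepsVar v = true → (sizes.run G₂).var v = G₂.var v :=
    fun v hv => Cmd.run_var hv G₂
  refine ⟨⟨?_, ?_, ?_, ?_, ?_, ?_, ?_, ?_, ?_, ?_, ?_, ?_, ?_, ?_, ?_⟩, ?_⟩
  · rw [f' 1 rfl, f 1 rfl, h1]
  · rw [f' 2 rfl, f 2 rfl, h2]
  · rw [f' 3 rfl, f 3 rfl, h3]
  · rw [f' 4 rfl, f 4 rfl, h4]
  · rw [f' 5 rfl, f 5 rfl, h5]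
  · rw [f' 6 rfl, f 6 rfl, h6]
  · rw [f' 7 rfl, p7]
  · rw [f' 8 rfl, f 8 rfl, h8]
  · rw [f' 9 rfl, p9]
  · rw [f' 10 rfl, p10]
  · simp [sizes, Cmd.run, p9, f 1 rfl, h1]
  · rw [f' 12 rfl, f 12 rfl, h12]
  · rw [f' 13 rfl, f 13 rfl, h13]
  · rw [f' 15 rfl, f 15 rfl, h15]
  · simp [sizes, Cmd.run, p7]
  · rw [f' 14 rfl, f 14 rfl, h14]

/-- The store at the start of the sampler. -/
noncomputable def startStore (n D d : ℕ) (w : ℝ) (ω : Tape) : Store where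
  var := fun _ => 0
  arr := fun _ _ => 0
  inp := (sampleStart n D d w ω).inp
  out := []
  coins := ω

theorem rep_startStore (n D d : ℕ) (w : ℝ) (ω : Tape) :
    Rep (startStore n D d w ω) (sampleStart n D d w ω) :=
  ⟨fun _ => rfl, fun _ _ => rfl, rfl, rfl, rfl⟩

/-- The result of the sampler: the parameters, a greedy cover of the grid, and the coins. -/
structure Sampled (D d k : ℕ) (w : ℝ) (u : ℕ → ℕ) (N : ℕ) (ω : Tape) (G : Store) : Prop where
  params : Params D d k w G
  var : G.var 14 = N
  cover : ∀ j < N, G.arr 2 j = u j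
  coins : ∀ p < decompCount D k * D, G.arr 3 p = ω p

/-- A complete greedy cover of the grid. -/
structure IsCover (d : ℕ) (w : ℝ) (u : ℕ → ℕ) (N : ℕ) : Prop where
  greedy : IsGreedy (gridCard d) (IsNear (gridSize d) d w) (Covers (gridSize d) d) u N
  gain : ∀ v < gridCard d, gain (Covers (gridSize d) d)
    (uncov (gridCard d) (IsNear (gridSize d) d w) (Covers (gridSize d) d) u N) v = 0

theorem coinLoop_run {H : Store} {n : ℕ} (h : H.var 11 = n) :
    ∀ p < n, (coinLoop.run H).arr 3 p = H.coins p :=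
  (Cmd.loop_spec (v := 20) (c := .coin 21 ;; .put 3 §20 §21)
    (P := fun i G => (∀ m, G.coins m = H.coins (m + i)) ∧ ∀ p < i, G.arr 3 p = H.coins p) h
    (by simp) (by intro _ _ _ h; exact h) fun i _ G hGi _ hG => by
      obtain ⟨h1, h2⟩ := hG
      set G₁ := (Cmd.coin 21).run G with hG₁
      have e : (§20).eval G₁ = i := by
        change (G.setVar 21 (G.coins 0 : ℝ)).var 20 = i
        simp [hGi]
      have e' : (§21).eval G₁ = H.coins i := by
        change (G.setVar 21 (G.coins 0 : ℝ)).var 21 = _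
        simp [h1]
      change (∀ m, ((Cmd.put 3 §20 §21).run G₁).coins m = _) ∧
        ∀ p < i + 1, ((Cmd.put 3 §20 §21).run G₁).arr 3 p = _
      rw [Cmd.run_put e, e']
      refine ⟨fun m => ?_, fun p hp => ?_⟩
      · change G.coins (m + 1) = _
        rw [h1]; congr 1; omega
      · have e3 : G₁.arr 3 = G.arr 3 := rfl
        simp only [Store.setArr_arr, if_true, Function.update_apply, e3]
        by_cases hpi : p = i
        · simp [hpi]
        · simp only [hpi, if_false]
          exact h2 p (by omega)).2

/-- The cover is quantified before the tape: it is found by `prepare`, which uses no coins. -/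
theorem exists_sampled (n : ℕ) {D d k : ℕ} (w : ℝ) (hd : 0 < d) (hk : 0 < k) (hD : k * d = D) :
    ∃ u N, IsCover d w u N ∧ ∀ ω, Sampled D d k w u N ω (samplerCmd.run (startStore n D d w ω)) := by
  set H := startStore n D d w (fun _ => 0) with hH
  obtain ⟨hP, h14⟩ := readParams_run (H := H) (w := w) hd hk hD (by simp [hH, startStore, sampleStart])
    (by simp [hH, startStore, sampleStart]) (by simp [hH, startStore, sampleStart])
  set G₁ := (readParams ;; powers ;; sizes).run H with hG₁
  obtain ⟨t0, t1⟩ := tables_run hP.v2 hP.v6 hP.v7 hP.v12 hP.v13 hP.v16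
  have hP₂ := hP.run (c := tables) rfl
  have h14₂ : (tables.run G₁).var 14 = 0 := by rw [Cmd.run_var rfl, h14]
  set G₂ := tables.run G₁ with hG₂
  obtain ⟨u, N, hg, h0⟩ := greedyLoop_run hP₂.v7 hP₂.v16 h14₂ t0 t1
  have hP₃ := hP₂.run (c := greedyLoop) rfl
  set G₃ := greedyLoop.run G₂ with hG₃
  refine ⟨u, N, ⟨hg.greedy, h0⟩, fun ω => ?_⟩
  have hrun : samplerCmd.run (startStore n D d w ω) = coinLoop.run (G₃.withCoins ω) := by
    have := Cmd.run_withCoins (c := prepare) rfl H ω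
    change coinLoop.run (prepare.run (H.withCoins ω)) = _
    rw [this]
    rfl
  have hP₄ : Params D d k w (G₃.withCoins ω) := hP₃.of_eq fun _ _ => rfl
  rw [hrun]
  refine ⟨hP₄.run rfl, ?_, fun j hj => ?_, coinLoop_run hP₄.v11⟩
  · rw [Cmd.run_var rfl]; exact hg.var
  · rw [Cmd.run_arr rfl]; exact hg.arr j hj

/-- `Cmd.cost_le` needs loop bounds that do not change, so the program is cut at the places where
the bounds have just been computed. The exponent 3 is the depth of the greedy loop. -/
theorem cost_samplerCmd_le (n : ℕ) {D d k B : ℕ} (w : ℝ) (hd : 0 < d) (hk : 0 < k) (hD : k * d = D)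
    (b1 : d ≤ B) (b2 : k ≤ B) (b3 : gridCard d * gridCard d ≤ B) (b4 : decompCount D k * D ≤ B)
    (ω : Tape) : samplerCmd.cost (startStore n D d w ω) ≤ samplerCmd.size * (B + 1) ^ 3 := by
  set H := startStore n D d w ω with hH
  obtain ⟨hP, h14⟩ := readParams_run (H := H) (w := w) hd hk hD (by simp [hH, startStore, sampleStart])
    (by simp [hH, startStore, sampleStart]) (by simp [hH, startStore, sampleStart])
  have mono : ∀ {c : Cmd} {e : ℕ}, e ≤ 3 → ∀ {x : ℕ}, x ≤ c.size * (B + 1) ^ e →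
      x ≤ c.size * (B + 1) ^ 3 := fun he _ hx =>
    hx.trans (Nat.mul_le_mul_left _ (Nat.pow_le_pow_right (by omega) he))
  have c1 := mono (by decide) (readParams.cost_le (B := B) rfl H (by simp [Cmd.bounds, readParams]))
  set G₁ := readParams.run H with hG₁
  have c2 := mono (c := powers) (by decide) (powers.cost_le (B := B) rfl G₁ (by
    have e2 : G₁.var 2 = d := by
      simp [hG₁, readParams, Cmd.run, hH, startStore, sampleStart]
    have e5 : G₁.var 5 ≤ k := by
      have hd' : (d : ℝ) ≠ 0 := by exact_mod_cast hd.ne'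
      have hDk : (D : ℝ) / d = k := by
        rw [div_eq_iff hd', ← hD]; push_cast; rfl
      simp [hG₁, readParams, Cmd.run, hH, startStore, sampleStart, hDk]
    intro b hb
    simp only [powers, powerLoop, rootLoop, Cmd.bounds, List.append_nil, List.cons_append,
      List.nil_append, List.mem_cons, List.not_mem_nil, or_false] at hb
    rcases hb with rfl | rfl | rfl
    · rw [e2]; exact_mod_cast b1
    · exact e5.trans (by exact_mod_cast b2)
    · rw [e2]; exact_mod_cast b1))
  have c3 := mono (c := sizes) (by decide) (sizes.cost_le (B := B) rfl (powers.run G₁)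
    (by simp [Cmd.bounds, sizes]))
  change Params D d k w (sizes.run (powers.run G₁)) at hP
  set G₃ := sizes.run (powers.run G₁) with hG₃
  have c4 := (tables ;; greedyLoop ;; coinLoop).cost_le (B := B) rfl G₃ (by
    have n0 : gridCard d ≤ gridCard d * gridCard d := Nat.le_mul_self _
    have n1 : gridCard d ≤ B := n0.trans b3
    intro b hb
    have : b = 2 ∨ b = 7 ∨ b = 11 ∨ b = 16 := by
      simp only [tables, torLoop, greedyLoop, greedyStep, bestLoop, gainLoop, updateLoop, coinLoop,
        Cmd.bounds, List.append_nil, List.cons_append,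
        List.nil_append, List.mem_cons, List.not_mem_nil, or_false] at hb
      omega
    rcases this with rfl | rfl | rfl | rfl
    · rw [hP.v2]; exact_mod_cast b1
    · rw [hP.v7]; exact_mod_cast n1
    · rw [hP.v11]; exact_mod_cast b4
    · rw [hP.v16]; exact_mod_cast b3)
  have c4' := mono (c := tables ;; greedyLoop ;; coinLoop) (by decide) c4
  have hcost : samplerCmd.cost H = readParams.cost H + (powers.cost G₁ + (sizes.cost (powers.run G₁)
      + (tables.cost G₃ + greedyLoop.cost (tables.run G₃)))) +
      coinLoop.cost (greedyLoop.run (tables.run G₃)) := rfl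
  have hcost' : (tables ;; greedyLoop ;; coinLoop).cost G₃ = tables.cost G₃ +
      (greedyLoop.cost (tables.run G₃) + coinLoop.cost (greedyLoop.run (tables.run G₃))) := rfl
  have hsize : samplerCmd.size = readParams.size + (powers.size + (sizes.size +
      (tables ;; greedyLoop ;; coinLoop).size)) := rfl
  rw [hcost, hsize]
  rw [hcost'] at c4'
  simp only [Nat.add_mul]
  omega

end FilterLSF

namespace FilterLSF
open RealRAM

namespace Scheme

variable {D : ℕ} (s : Scheme D)

/-! #### Decoding -/

/-- The coordinates of the piece `i` of `x` relative to the grid point with number `j`. -/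
noncomputable def gap (ω : Tape) (x : E D) (m i j l : ℕ) : ℝ :=
  node (angle s.S m) (entries x) (s.k + i) l / ((1 + s.ε) * (3 * s.w)) -
    digit s.K (s.u j) l / s.K - ω (s.pos m i l)

/-- The lattice vector that is closest to the piece `i` of `x`. -/
noncomputable def closest (ω : Tape) (x : E D) (m i j l : ℕ) : ℤ := ⌊s.gap ω x m i j l + 1 / 2⌋

/-- Some ball of the lattice with number `j` contains the piece `i` of `x`. -/
def Test (ω : Tape) (x : E D) (m i j : ℕ) : Prop :=
  ∑ l ∈ Finset.range s.d, (s.gap ω x m i j l - s.closest ω x m i j l) ^ 2 ≤ 1 / 9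

/-- The contribution of the ball of the lattice with number `j` to the name of a filter. -/
noncomputable def term (ω : Tape) (x : E D) (m i j : ℕ) : ℝ :=
  ∑ l ∈ Finset.range s.d,
    ((digit s.K (s.u j) l : ℝ) + s.K * s.closest ω x m i j l) * ω (s.pos m i l)

/-- The possible contributions of the piece `i` to the names of the filters that contain `x`. -/
def terms (ω : Tape) (x : E D) (m i : ℕ) : Set ℝ :=
  {y | ∃ j < s.N, s.Test ω x m i j ∧ s.term ω x m i j = y}

open Classical in
/-- The number of balls that contain the piece `i` of `x`. -/
noncomputable def count (ω : Tape) (x : E D) (m i : ℕ) : ℕ :=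
  ((Finset.range s.N).filter fun j => s.Test ω x m i j).card

theorem norm_pt_sub_center_sq (ω : Tape) (x : E D) (m i j : ℕ) (z : Fin s.d → ℤ) :
    ‖s.pt m x i - s.center ω m i j z‖ ^ 2 = ∑ l : Fin s.d, (s.gap ω x m i j l - z l) ^ 2 := by
  rw [EuclideanSpace.norm_sq_eq]
  refine Finset.sum_congr rfl fun l _ => ?_
  rw [Real.norm_eq_abs, sq_abs]
  congr 1
  simp only [gap, pt, center, base, shift, intVec, leaf, PiLp.sub_apply, PiLp.add_apply,
    PiLp.smul_apply, smul_eq_mul]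
  ring

theorem sq_sub_floor_le (a : ℝ) (z : ℤ) : (a - ⌊a + 1 / 2⌋) ^ 2 ≤ (a - z) ^ 2 := by
  have h1 := Int.floor_le (a + 1 / 2)
  have h2 := Int.lt_floor_add_one (a + 1 / 2)
  set f := ⌊a + 1 / 2⌋ with hf
  rcases lt_trichotomy z f with h | h | h
  · have h3 : z + 1 ≤ f := h
    have h4 : (z : ℝ) + 1 ≤ f := by exact_mod_cast h3
    nlinarith
  · rw [h]
  · have h3 : f + 1 ≤ z := h
    have h4 : (f : ℝ) + 1 ≤ z := by exact_mod_cast h3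
    nlinarith

theorem norm_le_third_iff {d : ℕ} (v : E d) : ‖v‖ ≤ 1 / 3 ↔ ‖v‖ ^ 2 ≤ 1 / 9 := by
  rw [show (1 / 9 : ℝ) = (1 / 3) ^ 2 by norm_num, sq_le_sq₀ (norm_nonneg _) (by norm_num)]

theorem norm_closest_le_iff (ω : Tape) (x : E D) (m i j : ℕ) :
    ‖s.pt m x i - s.center ω m i j (fun l => s.closest ω x m i j l)‖ ≤ 1 / 3 ↔
      s.Test ω x m i j := by
  rw [norm_le_third_iff, norm_pt_sub_center_sq, Test, ← Fin.sum_univ_eq_sum_range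
    (fun l => (s.gap ω x m i j l - s.closest ω x m i j l) ^ 2)]

/-- Rounding each coordinate gives the nearest lattice vector, so if any ball of the lattice
contains the piece, then the rounded one does. By `center_unique` it is the only one. -/
theorem test_of_norm_le {ω : Tape} {x : E D} {m i j : ℕ} {z : Fin s.d → ℤ}
    (h : ‖s.pt m x i - s.center ω m i j z‖ ≤ 1 / 3) :
    s.Test ω x m i j ∧ z = fun l : Fin s.d => s.closest ω x m i j l := by
  have h1 : ‖s.pt m x i - s.center ω m i j (fun l => s.closest ω x m i j l)‖ ≤ 1 / 3 := by
    rw [norm_le_third_iff] at h ⊢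
    refine le_trans ?_ h
    rw [norm_pt_sub_center_sq, norm_pt_sub_center_sq]
    exact Finset.sum_le_sum fun l _ => sq_sub_floor_le _ _
  exact ⟨(s.norm_closest_le_iff ω x m i j).1 h1, s.center_unique h h1⟩

theorem card_hits_self (ω : Tape) (x : E D) (m i : ℕ) :
    (s.hits ω m i x x).card = s.count ω x m i := by
  classical
  have : ∀ j, s.Hit ω m i j x x ↔ s.Test ω x m i j := fun j =>
    ⟨fun ⟨z, h, _⟩ => (s.test_of_norm_le h).1, fun h =>
      ⟨_, (s.norm_closest_le_iff ω x m i j).2 h, (s.norm_closest_le_iff ω x m i j).2 h⟩⟩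
  rw [hits, count, Finset.card_filter, Finset.card_filter]
  simp only [this]
  exact Fin.sum_univ_eq_sum_range (fun j => if s.Test ω x m i j then 1 else 0) s.N

/-- The names of the filters of the decomposition `m` that contain `x`. -/
def names (ω : Tape) (x : E D) (m : ℕ) : Set ℝ :=
  {y | ∃ c : ℕ → ℝ, (∀ i < s.k, c i ∈ s.terms ω x m i) ∧ y = m + ∑ i ∈ Finset.range s.k, c i}

theorem name_eq {ω : Tape} {x : E D} {q : s.Idx} (hq : x ∈ s.filt ω q) :
    s.name ω q = (q.1 : ℕ) + ∑ i : Fin s.k, s.term ω x q.1 i (q.2 i).1 := by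
  rw [name]
  congr 1
  refine Finset.sum_congr rfl fun i _ => ?_
  have := (s.test_of_norm_le (hq i)).2
  rw [term, ← Fin.sum_univ_eq_sum_range (fun l => ((digit s.K (s.u (q.2 i).1) l : ℝ) +
    s.K * s.closest ω x q.1 i (q.2 i).1 l) * ω (s.pos q.1 i l))]
  refine Finset.sum_congr rfl fun l _ => ?_
  rw [this, code]
  push_cast
  rfl

theorem image_name (ω : Tape) (x : E D) :
    s.name ω '' {q | x ∈ s.filt ω q} = {y | ∃ m < s.M, y ∈ s.names ω x m} := by
  ext y
  constructor
  · rintro ⟨q, hq, rfl⟩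
    refine ⟨q.1, q.1.2, fun i => if h : i < s.k then s.term ω x q.1 i (q.2 ⟨i, h⟩).1 else 0,
      fun i hi => ?_, ?_⟩
    · simp only [hi, dif_pos]
      exact ⟨_, (q.2 ⟨i, hi⟩).1.2, (s.test_of_norm_le (hq ⟨i, hi⟩)).1, rfl⟩
    · rw [s.name_eq hq, ← Fin.sum_univ_eq_sum_range
        (fun i => if h : i < s.k then s.term ω x q.1 i (q.2 ⟨i, h⟩).1 else 0)]
      simp
  · rintro ⟨m, hm, c, hc, rfl⟩
    choose! j hj ht hterm using hc
    have hq : x ∈ s.filt ω (⟨m, hm⟩, fun i : Fin s.k => (⟨j i, hj i i.2⟩,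
        fun l => s.closest ω x m i (j i) l)) := fun i =>
      (s.norm_closest_le_iff ω x m i (j i)).2 (ht i i.2)
    refine ⟨_, hq, ?_⟩
    rw [s.name_eq hq, ← Fin.sum_univ_eq_sum_range c]
    congr 1
    exact Finset.sum_congr rfl fun i _ => hterm i i.2

theorem encard_filt (ω : Tape) (x : E D) : {q : s.Idx | x ∈ s.filt ω q}.encard =
    ((∑ m ∈ Finset.range s.M, ∏ i ∈ Finset.range s.k, s.count ω x m i : ℕ) : ℕ∞) := by
  have h := s.encard_index ω x x
  simp only [and_self] at h
  rw [h, ← Fin.sum_univ_eq_sum_range (fun m : ℕ => ∏ i ∈ Finset.range s.k, s.count ω x m i)]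
  refine congrArg (fun n : ℕ => (n : ℕ∞)) (Finset.sum_congr rfl fun m _ => ?_)
  rw [← Fin.prod_univ_eq_prod_range (fun i : ℕ => s.count ω x m i)]
  exact Finset.prod_congr rfl fun i _ => s.card_hits_self ω x m i

theorem at_eq (ω : Tape) (x : E D) : (s.fam ω).at x = s.filt ω '' {q | x ∈ s.filt ω q} := by
  have := s.at_inter_at ω x x
  simpa using this

/-- A list of the right length and with the right elements is a correct output. -/
theorem exists_name {ω : Tape} (hf : Function.Injective (s.filt ω))
    (hn : Function.Injective (s.name ω)) :
    ∃ name : Set (E D) → ℝ, Set.InjOn name (s.fam ω) ∧ ∀ (x : E D) (l : List ℝ),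
      l.length = ∑ m ∈ Finset.range s.M, ∏ i ∈ Finset.range s.k, s.count ω x m i →
      {a | a ∈ l} = {y | ∃ m < s.M, y ∈ s.names ω x m} →
      (l.Nodup ∧ {a | a ∈ l} = name '' (s.fam ω).at x) ∧
        (((s.fam ω).at x).encard : ℝ≥0∞) = (l.length : ℝ≥0∞) := by
  have hM : 0 < s.M := by have := s.S_pos; positivity
  -- A default index is needed to invert the map from indices to filters; there is none if `N = 0`,
  -- and then the family is empty.
  rcases isEmpty_or_nonempty s.Idx with hI | hI
  · refine ⟨fun _ => 0, ?_, fun x l h1 h2 => ?_⟩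
    · intro A hA
      obtain ⟨q, -⟩ := s.mem_fam.1 hA
      exact hI.elim q
    · rw [← image_name] at h2
      have h3 : l = [] := by
        rw [List.eq_nil_iff_forall_not_mem]
        intro a ha
        have : a ∈ s.name ω '' {q | x ∈ s.filt ω q} := by rw [← h2]; exact ha
        obtain ⟨q, -⟩ := this
        exact hI.elim q
      have h4 : (s.fam ω).at x = ∅ := by
        rw [at_eq]
        exact Set.eq_empty_of_forall_notMem fun _ ⟨q, _⟩ => hI.elim q
      rw [h3, h4]
      simp
  · refine ⟨fun A => s.name ω (Function.invFun (s.filt ω) A), ?_, fun x l h1 h2 => ?_⟩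
    · intro A hA B hB h
      obtain ⟨q, rfl⟩ := s.mem_fam.1 hA
      obtain ⟨q', rfl⟩ := s.mem_fam.1 hB
      simp only [Function.leftInverse_invFun hf _] at h
      rw [hn h]
    · have he := s.encard_filt ω x
      rw [← h1] at he
      rw [← image_name] at h2
      have himg : (fun A => s.name ω (Function.invFun (s.filt ω) A)) '' (s.fam ω).at x =
          s.name ω '' {q | x ∈ s.filt ω q} := by
        rw [at_eq, Set.image_image]
        simp only [Function.leftInverse_invFun hf _]
      refine ⟨⟨?_, by rw [himg, h2]⟩, ?_⟩
      · have h3 : (l.toFinset : Set ℝ).encard = (l.length : ℕ∞) := by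
          rw [List.coe_toFinset, h2, hn.encard_image, he]
        rw [Set.encard_coe_eq_coe_finsetCard] at h3
        have h4 : l.toFinset.card = l.length := by exact_mod_cast h3
        exact Multiset.coe_nodup.1 (Multiset.toFinset_card_eq_card_iff_nodup.1 h4)
      · rw [at_eq, hf.encard_image, he, ENat.toENNReal_coe]

end Scheme

end FilterLSF

namespace FilterLSF
open RealRAM

local prefix:max "§" => Expr.var

/-! ### The decoder -/

/-- Store the point at the root of the tree. -/
def loadInput : Cmd := .loop 22 15 (.put 4 (§15 + §22) (.inp §22))

/-- Compute the two children of the node `§23 + 1`. -/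
def splitNode : Cmd := .loop 22 15
  (.ite §22 §1
    (.put 4 ((2 * §23 + 2) * §15 + §22) (§26 * .get 4 ((§23 + 1) * §15 + 2 * §22) +
        §27 * .get 4 ((§23 + 1) * §15 + (2 * §22 + 1))) ;;
      .put 4 ((2 * §23 + 3) * §15 + §22) (§26 * .get 4 ((§23 + 1) * §15 + (2 * §22 + 1)) -
        §27 * .get 4 ((§23 + 1) * §15 + 2 * §22)))
    (.put 4 ((2 * §23 + 2) * §15 + §22) 0 ;; .put 4 ((2 * §23 + 3) * §15 + §22) 0))

/-- Compute the parameters of the node `§23 + 1` and split it. -/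
def treeStep : Cmd :=
  .set 24 (.floor (§21 / §8)) ;; .set 25 ((§21 - §8 * §24) / §8) ;; .set 21 §24 ;;
  .set 26 ((1 + 2 * §25 - §25 * §25) / (1 + §25 * §25)) ;;
  .set 27 ((§25 * §25 + 2 * §25 - 1) / (1 + §25 * §25)) ;; splitNode

/-- Compute all nodes of the tree. -/
def treeLoop : Cmd := .loop 23 5 treeStep

/-- Compare the piece `§21` with a grid point, one coordinate at a time. -/
def coordLoop : Cmd := .loop 26 2
  (.set 27 (.floor (§23 / §6)) ;; .set 31 (§23 - §6 * §27) ;; .set 23 §27 ;;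
   .set 32 (.get 3 (§20 * §1 + §21 * §2 + §26)) ;;
   .set 33 (.get 4 ((§4 + §21) * §15 + §26) / ((1 + 1 / §10) * (3 * §3)) - §31 / §6 - §32) ;;
   .set 34 (.floor (§33 + 1 / 2)) ;; .set 24 (§24 + (§33 - §34) * (§33 - §34)) ;;
   .set 25 (§25 + (§31 + §6 * §34) * §32))

/-- Test the grid point `§22`. -/
def pointStep : Cmd :=
  .set 23 (.get 2 §22) ;; .set 24 0 ;; .set 25 0 ;; coordLoop ;;
  .ite (1 / 9) §24 .skip (.put 5 (§21 * §14 + §30) §25 ;; .set 30 (§30 + 1))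

/-- List the balls that contain the piece `§21`. -/
def pointLoop : Cmd := .loop 22 14 pointStep

/-- Treat the piece `§21`. -/
def pieceStep : Cmd :=
  .set 30 0 ;; pointLoop ;; .put 6 §21 §30 ;; .ite §30 1 (.set 29 0) .skip ;;
  .set 28 (§28 + .get 5 (§21 * §14))

/-- Treat all pieces. -/
def pieceLoop : Cmd := .loop 21 4 pieceStep

/-- Find the balls that contain the pieces of the point, for the decomposition `§20`. -/
def findBalls : Cmd :=
  .set 21 §20 ;; loadInput ;; treeLoop ;; .set 28 §20 ;; .set 29 1 ;; pieceLoop ;; .put 7 0 §28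

variable {D : ℕ}

/-- The store contains the data of the family, and the input is `x`. -/
structure Ready (s : Scheme D) (ω : Tape) (x : E D) (H : Store) : Prop where
  v1 : H.var 1 = D
  v2 : H.var 2 = s.d
  v3 : H.var 3 = s.w
  v4 : H.var 4 = s.k
  v5 : H.var 5 = (s.k - 1 : ℕ)
  v6 : H.var 6 = s.K
  v8 : H.var 8 = s.S
  v9 : H.var 9 = s.M
  v10 : 1 / H.var 10 = s.ε
  v14 : H.var 14 = s.N
  v15 : H.var 15 = (2 * D : ℕ)
  a2 : ∀ j < s.N, H.arr 2 j = s.u j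
  a3 : ∀ p < s.M * D, H.arr 3 p = ω p
  inp : ∀ j, H.inp j = entries x j

/-- The variables that the decoder does not change. -/
def readyVars : List ℕ := [1, 2, 3, 4, 5, 6, 8, 9, 10, 14, 15]

theorem Ready.of_eq {s : Scheme D} {ω : Tape} {x : E D} {G H : Store} (h : Ready s ω x H)
    (he : ∀ v ∈ readyVars, G.var v = H.var v) (h2 : G.arr 2 = H.arr 2) (h3 : G.arr 3 = H.arr 3)
    (hi : G.inp = H.inp) : Ready s ω x G where
  v1 := (he 1 (by decide)).trans h.v1
  v2 := (he 2 (by decide)).trans h.v2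
  v3 := (he 3 (by decide)).trans h.v3
  v4 := (he 4 (by decide)).trans h.v4
  v5 := (he 5 (by decide)).trans h.v5
  v6 := (he 6 (by decide)).trans h.v6
  v8 := (he 8 (by decide)).trans h.v8
  v9 := (he 9 (by decide)).trans h.v9
  v10 := by rw [he 10 (by decide)]; exact h.v10
  v14 := (he 14 (by decide)).trans h.v14
  v15 := (he 15 (by decide)).trans h.v15
  a2 j hj := by rw [h2]; exact h.a2 j hj
  a3 p hp := by rw [h3]; exact h.a3 p hp
  inp j := by rw [hi]; exact h.inp j

theorem Ready.run {s : Scheme D} {ω : Tape} {x : E D} {H : Store} (h : Ready s ω x H) {c : Cmd}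
    (hc : (readyVars.all fun v => c.keepsVar v) = true) (h2 : c.keepsArr 2 = true)
    (h3 : c.keepsArr 3 = true) : Ready s ω x (c.run H) :=
  h.of_eq (fun v hv => Cmd.run_var (List.all_eq_true.1 hc v hv) H) (Cmd.run_arr h2 H)
    (Cmd.run_arr h3 H) (Cmd.run_inp c H)

theorem Ready.frame {s : Scheme D} {ω : Tape} {x : E D} {G H : Store} (h : Ready s ω x H) {v : ℕ}
    {c : Cmd} (hF : Frame v c H G)
    (hc : (readyVars.all fun u => u != v && c.keepsVar u) = true) (h2 : c.keepsArr 2 = true)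
    (h3 : c.keepsArr 3 = true) : Ready s ω x G :=
  h.of_eq (fun u hu => by
    have := List.all_eq_true.1 hc u hu
    simp only [Bool.and_eq_true, bne_iff_ne] at this
    exact hF.var u this.1 this.2) (hF.arr 2 h2) (hF.arr 3 h3) hF.inp

variable {s : Scheme D} {ω : Tape} {x : E D} {H : Store} {m : ℕ}

theorem index_inj {W p j p' j' : ℕ} (hj : j < W) (hj' : j' < W) (h : p * W + j = p' * W + j') :
    p = p' ∧ j = j' := by
  have h1 := congrArg (· / W) h
  have h2 := congrArg (· % W) h
  have hW : 0 < W := by omega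
  simp only [Nat.mul_comm _ W, Nat.mul_add_div hW, Nat.div_eq_of_lt hj, Nat.div_eq_of_lt hj',
    Nat.mul_add_mod, Nat.mod_eq_of_lt hj, Nat.mod_eq_of_lt hj', add_zero] at h1 h2
  exact ⟨h1, h2⟩

theorem loadInput_run (hH : Ready s ω x H) :
    ∀ j < 2 * D, (loadInput.run H).arr 4 (1 * (2 * D) + j) = entries x j :=
  Cmd.loop_spec (v := 22) (P := fun i G => ∀ j < i, G.arr 4 (1 * (2 * D) + j) = entries x j)
    (c := .put 4 (§15 + §22) (.inp §22)) hH.v15 (by simp) (by intro _ _ _ h; exact h)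
    fun i _ G hGi hF hG => by
      have hR := hH.frame hF rfl rfl rfl
      have e : (§15 + §22).eval G = (1 * (2 * D) + i : ℕ) := by
        simp [hR.v15, hGi]
      rw [Cmd.run_put e]
      intro j hj
      simp only [Store.setArr_arr, if_true, Function.update_apply, Expr.eval_inp, Expr.eval_var,
        hGi, Nat.floor_natCast, hR.inp, Nat.add_left_cancel_iff]
      split_ifs with hji
      · rw [hji]
      · exact hG j (by omega)

/-- The rows `1, …, q - 1` of the array `4` contain the nodes of the tree. -/
def HasNodes (s : Scheme D) (x : E D) (m q : ℕ) (f : ℕ → ℝ) : Prop :=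
  ∀ p, 1 ≤ p → p < q → ∀ j < 2 * D, f (p * (2 * D) + j) = node (angle s.S m) (entries x) p j

/-- Rows have 2D entries because the entry `i < D` of a child reads the entries 2i and 2i + 1 of its
parent. Beyond `D` all entries are zero, which the `else` branch writes. -/
theorem splitNode_run {q : ℕ} (hH : Ready s ω x H) (h23 : H.var 23 = q)
    (h26 : H.var 26 = cosPar (angle s.S m (q + 1))) (h27 : H.var 27 = sinPar (angle s.S m (q + 1)))
    (hn : HasNodes s x m (2 * q + 2) (H.arr 4)) :
    HasNodes s x m (2 * (q + 1) + 2) ((splitNode.run H).arr 4) := by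
  set W := 2 * D with hW
  have key := Cmd.loop_spec (v := 22) (P := fun i G => HasNodes s x m (2 * q + 2) (G.arr 4) ∧
    ∀ j < i, G.arr 4 ((2 * q + 2) * W + j) = node (angle s.S m) (entries x) (2 * (q + 1)) j ∧
      G.arr 4 ((2 * q + 3) * W + j) = node (angle s.S m) (entries x) (2 * (q + 1) + 1) j)
    (c := .ite §22 §1
      (.put 4 ((2 * §23 + 2) * §15 + §22) (§26 * .get 4 ((§23 + 1) * §15 + 2 * §22) +
          §27 * .get 4 ((§23 + 1) * §15 + (2 * §22 + 1))) ;;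
        .put 4 ((2 * §23 + 3) * §15 + §22) (§26 * .get 4 ((§23 + 1) * §15 + (2 * §22 + 1)) -
          §27 * .get 4 ((§23 + 1) * §15 + 2 * §22)))
      (.put 4 ((2 * §23 + 2) * §15 + §22) 0 ;; .put 4 ((2 * §23 + 3) * §15 + §22) 0))
    hH.v15 ⟨hn, by simp⟩ (by intro _ _ _ h; exact h) fun i hi G hGi hF hG => ?_
  · intro p hp hpq j hj
    rcases Nat.lt_or_ge p (2 * q + 2) with h | h
    · exact key.1 p hp h j hj
    · obtain rfl | rfl : p = 2 * q + 2 ∨ p = 2 * q + 3 := by omega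
      · exact (key.2 j hj).1
      · exact (key.2 j hj).2
  · have hR := hH.frame hF rfl rfl rfl
    obtain ⟨g1, g2⟩ := hG
    have g23 : G.var 23 = q := (hF.var 23 (by decide) rfl).trans h23
    have g26 := (hF.var 26 (by decide) rfl).trans h26
    have g27 := (hF.var 27 (by decide) rfl).trans h27
    have upd : ∀ y z : ℝ, y = node (angle s.S m) (entries x) (2 * (q + 1)) i →
        z = node (angle s.S m) (entries x) (2 * (q + 1) + 1) i → ∀ f : ℕ → ℝ,
        f = Function.update (Function.update (G.arr 4) ((2 * q + 2) * W + i) y)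
          ((2 * q + 3) * W + i) z → HasNodes s x m (2 * q + 2) f ∧
        ∀ j < i + 1, f ((2 * q + 2) * W + j) = node (angle s.S m) (entries x) (2 * (q + 1)) j ∧
          f ((2 * q + 3) * W + j) = node (angle s.S m) (entries x) (2 * (q + 1) + 1) j := by
      rintro y z hy hz f rfl
      constructor
      · intro p hp hpq j hj
        have n1 : p * W + j ≠ (2 * q + 3) * W + i := fun h => by
          have := (index_inj hj hi h).1; omega
        have n2 : p * W + j ≠ (2 * q + 2) * W + i := fun h => by
          have := (index_inj hj hi h).1; omega
        rw [Function.update_of_ne n1, Function.update_of_ne n2]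
        exact g1 p hp hpq j hj
      · intro j hj
        have hjW : j < W := by omega
        have n1 : (2 * q + 2) * W + j ≠ (2 * q + 3) * W + i := fun h => by
          have := (index_inj hjW hi h).1; omega
        have n2 : (2 * q + 3) * W + j ≠ (2 * q + 2) * W + i := fun h => by
          have := (index_inj hjW hi h).1; omega
        rw [Function.update_of_ne n1]
        by_cases hji : j = i
        · subst hji
          rw [Function.update_self, Function.update_self]
          exact ⟨hy, hz⟩
        · have n3 : (2 * q + 2) * W + j ≠ (2 * q + 2) * W + i := by omega
          have n4 : (2 * q + 3) * W + j ≠ (2 * q + 3) * W + i := by omega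
          rw [Function.update_of_ne n3, Function.update_of_ne n4, Function.update_of_ne n2]
          exact g2 j (by omega)
    have a1 : ∀ G' : Store, G'.var = G.var →
        ((2 * §23 + 2) * §15 + §22).eval G' = ((2 * q + 2) * W + i : ℕ) := by
      intro G' h
      simp [h, g23, hR.v15, hGi, hW]
    have a2 : ∀ G' : Store, G'.var = G.var →
        ((2 * §23 + 3) * §15 + §22).eval G' = ((2 * q + 3) * W + i : ℕ) := by
      intro G' h
      simp [h, g23, hR.v15, hGi, hW]
    have a3 : ∀ G' : Store, G'.var = G.var →
        ((§23 + 1) * §15 + 2 * §22).eval G' = ((q + 1) * W + 2 * i : ℕ) := by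
      intro G' h
      simp [h, g23, hR.v15, hGi, hW]
    have a4 : ∀ G' : Store, G'.var = G.var →
        ((§23 + 1) * §15 + (2 * §22 + 1)).eval G' = ((q + 1) * W + (2 * i + 1) : ℕ) := by
      intro G' h
      simp [h, g23, hR.v15, hGi, hW]
    by_cases hiD : i < D
    · have hlt : (§22).eval G < (§1).eval G := by
        simp only [Expr.eval_var, hGi, hR.v1]; exact_mod_cast hiD
      have r1 : G.arr 4 ((q + 1) * W + 2 * i) = _ := g1 (q + 1) (by omega) (by omega) (2 * i) (by omega)
      have r2 : G.arr 4 ((q + 1) * W + (2 * i + 1)) = _ := g1 (q + 1) (by omega) (by omega) (2 * i + 1) (by omega)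
      have n5 : (q + 1) * W + 2 * i ≠ (2 * q + 2) * W + i := fun h => by
        have := (index_inj (by omega) hi h).1; omega
      have n6 : (q + 1) * W + (2 * i + 1) ≠ (2 * q + 2) * W + i := fun h => by
        have := (index_inj (by omega) hi h).1; omega
      rw [Cmd.run_ite_pos hlt, Cmd.run_seq, Cmd.run_put (a1 G rfl), Cmd.run_put (a2 (G.setArr 4 _ _) rfl)]
      simp only [Expr.eval_add, Expr.eval_sub, Expr.eval_mul, Expr.eval_get (a3 G rfl),
        Expr.eval_get (a4 G rfl), Expr.eval_get (a3 (G.setArr 4 _ _) rfl),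
        Expr.eval_get (a4 (G.setArr 4 _ _) rfl), Store.setArr_arr, if_true,
        Function.update_of_ne n5, Function.update_of_ne n6, Expr.eval_var, Store.setArr_var,
        g26, g27, r1, r2]
      refine upd _ _ ?_ ?_ _ rfl
      · rw [node_even _ _ (by omega)]
      · rw [node_odd _ _ (by omega)]
    · have hlt : ¬ (§22).eval G < (§1).eval G := by
        simp only [Expr.eval_var, hGi, hR.v1]; exact_mod_cast hiD
      rw [Cmd.run_ite_neg hlt, Cmd.run_seq, Cmd.run_put (a1 G rfl), Cmd.run_put (a2 (G.setArr 4 _ _) rfl)]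
      simp only [Expr.eval_zero, Store.setArr_arr, if_true]
      have hz := fun (p : ℕ) (hp : 1 ≤ p) => node_eq_zero (σ := angle s.S m) hp
        (entries_eq_zero x) i (by omega)
      exact upd _ _ (hz _ (by omega)).symm (hz _ (by omega)).symm _ rfl

theorem treeLoop_run (hH : Ready s ω x H) (h21 : H.var 21 = m)
    (hn : ∀ j < 2 * D, H.arr 4 (1 * (2 * D) + j) = entries x j) :
    HasNodes s x m (2 * s.k) ((treeLoop.run H).arr 4) := by
  have key := Cmd.loop_spec (v := 23) (c := treeStep) (P := fun i G =>
    G.var 21 = ((m / s.S ^ i : ℕ) : ℝ) ∧ HasNodes s x m (2 * i + 2) (G.arr 4)) hH.v5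
    ⟨by simpa using h21, fun p hp hp2 j hj => by
      obtain rfl : p = 1 := by omega
      rw [hn j hj, node_one]⟩ (by intro _ _ _ h; exact h) fun i hi G hGi hF hG => ?_
  · have hk := s.k_pos
    have : 2 * (s.k - 1) + 2 = 2 * s.k := by omega
    rw [this] at key
    exact key.2
  · have hR := hH.frame hF rfl rfl rfl
    obtain ⟨g1, g2⟩ := hG
    set G₁ := (Cmd.set 24 (.floor (§21 / §8)) ;; .set 25 ((§21 - §8 * §24) / §8) ;; .set 21 §24 ;;
      .set 26 ((1 + 2 * §25 - §25 * §25) / (1 + §25 * §25)) ;;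
      .set 27 ((§25 * §25 + 2 * §25 - 1) / (1 + §25 * §25))).run G with hG₁
    have hang : angle s.S m (i + 1) = ((m / s.S ^ i % s.S : ℕ) : ℝ) / s.S := by
      rw [angle, Nat.add_sub_cancel]
    have h25 : G₁.var 25 = angle s.S m (i + 1) := by
      simp [hG₁, Cmd.run, g1, hR.v8, floor_natCast_div, natCast_mod, hang]
    have h21 : G₁.var 21 = ((m / s.S ^ (i + 1) : ℕ) : ℝ) := by
      rw [pow_succ, ← Nat.div_div_eq_div_mul]
      simp [hG₁, Cmd.run, g1, hR.v8, floor_natCast_div]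
    have hR₁ : Ready s ω x G₁ := hR.run rfl rfl rfl
    have e26 : G₁.var 26 = cosPar (angle s.S m (i + 1)) := by
      rw [← h25, cosPar]
      simp [hG₁, Cmd.run]
    have e27 : G₁.var 27 = sinPar (angle s.S m (i + 1)) := by
      rw [← h25, sinPar]
      simp [hG₁, Cmd.run]
    have h23 : G₁.var 23 = i := by simp [hG₁, Cmd.run, hGi]
    have := splitNode_run (H := G₁) hR₁ h23 e26 e27 g2
    have hrun : treeStep.run G = splitNode.run G₁ := rfl
    rw [hrun]
    exact ⟨by rw [Cmd.run_var rfl, h21], this⟩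

theorem pos_lt {i l : ℕ} (hm : m < s.M) (hi : i < s.k) (hl : l < s.d) : s.pos m i l < s.M * D := by
  have h1 : i * s.d + l < D := by
    have := s.hD
    calc i * s.d + l < i * s.d + s.d := by omega
      _ = (i + 1) * s.d := by ring
      _ ≤ s.k * s.d := Nat.mul_le_mul_right _ hi
      _ = D := s.hD
  calc s.pos m i l < m * D + D := by unfold Scheme.pos; omega
    _ = (m + 1) * D := by ring
    _ ≤ _ := Nat.mul_le_mul_right _ hm

theorem coordLoop_run {i j : ℕ} (hH : Ready s ω x H) (hm : m < s.M) (hi : i < s.k)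
    (hn : HasNodes s x m (2 * s.k) (H.arr 4)) (h20 : H.var 20 = m) (h21 : H.var 21 = i)
    (h23 : H.var 23 = s.u j) (h24 : H.var 24 = 0) (h25 : H.var 25 = 0) :
    (coordLoop.run H).var 24 = ∑ l ∈ Finset.range s.d,
        (s.gap ω x m i j l - s.closest ω x m i j l) ^ 2 ∧
      (coordLoop.run H).var 25 = s.term ω x m i j := by
  refine (Cmd.loop_spec (v := 26) (P := fun l G => G.var 23 = ((s.u j / s.K ^ l : ℕ) : ℝ) ∧
    G.var 24 = ∑ l ∈ Finset.range l, (s.gap ω x m i j l - s.closest ω x m i j l) ^ 2 ∧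
    G.var 25 = ∑ l ∈ Finset.range l,
      ((digit s.K (s.u j) l : ℝ) + s.K * s.closest ω x m i j l) * ω (s.pos m i l)) hH.v2
    (by simpa using ⟨h23, h24, h25⟩) (by intro _ _ _ h; exact h) fun l hl G hGl hF hG => ?_).2
  have hR := hH.frame hF rfl rfl rfl
  obtain ⟨g23, g24, g25⟩ := hG
  have g20 : G.var 20 = m := (hF.var 20 (by decide) rfl).trans h20
  have g21 : G.var 21 = i := (hF.var 21 (by decide) rfl).trans h21
  have b4 : G.arr 4 = H.arr 4 := hF.arr 4 rfl
  set G₁ := (Cmd.set 27 (.floor (§23 / §6)) ;; .set 31 (§23 - §6 * §27) ;; .set 23 §27).run G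
    with hG₁
  have c31 : G₁.var 31 = digit s.K (s.u j) l := by
    simp [hG₁, Cmd.run, g23, hR.v6, floor_natCast_div, natCast_mod, digit]
  have c23 : G₁.var 23 = ((s.u j / s.K ^ (l + 1) : ℕ) : ℝ) := by
    rw [pow_succ, ← Nat.div_div_eq_div_mul]
    simp [hG₁, Cmd.run, g23, hR.v6, floor_natCast_div]
  have c3 : (Expr.get 3 (§20 * §1 + §21 * §2 + §26)).eval G₁ = ω (s.pos m i l) := by
    rw [Expr.eval_get (i := s.pos m i l) (by
      simp [hG₁, Cmd.run, g20, g21, hGl, hR.v1, hR.v2, Scheme.pos])]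
    exact hR.a3 _ (pos_lt hm hi hl)
  set G₂ := (Cmd.set 32 (.get 3 (§20 * §1 + §21 * §2 + §26))).run G₁ with hG₂
  have d32 : G₂.var 32 = ω (s.pos m i l) := by
    rw [hG₂, Cmd.run, c3]; simp
  have hR₂ : Ready s ω x G₂ := (hR.run (c := Cmd.set 27 (.floor (§23 / §6)) ;;
    .set 31 (§23 - §6 * §27) ;; .set 23 §27) rfl rfl rfl).run rfl rfl rfl
  have hdD : s.d ≤ D := 
    (Nat.le_mul_of_pos_left _ s.k_pos).trans_eq s.hD
  have c4 : (Expr.get 4 ((§4 + §21) * §15 + §26)).eval G₂ =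
      node (angle s.S m) (entries x) (s.k + i) l := by
    rw [Expr.eval_get (i := (s.k + i) * (2 * D) + l) (by
      have e1 : G₂.var 21 = i := by simp [hG₂, hG₁, Cmd.run, g21]
      have e2 : G₂.var 26 = l := by simp [hG₂, hG₁, Cmd.run, hGl]
      simp [hR₂.v4, hR₂.v15, e1, e2])]
    have hk := s.k_pos
    change G.arr 4 _ = _
    rw [b4]
    exact hn (s.k + i) (by omega) (by omega) l (by omega)
  have e24 : G₂.var 24 = G.var 24 := by simp [hG₂, hG₁, Cmd.run]
  have e25 : G₂.var 25 = G.var 25 := by simp [hG₂, hG₁, Cmd.run]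
  have e31 : G₂.var 31 = G₁.var 31 := by simp [hG₂, Cmd.run]
  have e23 : G₂.var 23 = G₁.var 23 := by simp [hG₂, Cmd.run]
  set G₃ := (Cmd.set 33 (.get 4 ((§4 + §21) * §15 + §26) / ((1 + 1 / §10) * (3 * §3)) - §31 / §6 -
    §32)).run G₂ with hG₃
  have e33 : G₃.var 33 = s.gap ω x m i j l := by
    rw [hG₃, Cmd.run]
    simp only [Store.setVar_var, if_true, Expr.eval_sub, Expr.eval_div, c4, Expr.eval_mul,
      Expr.eval_add, Expr.eval_one, Expr.eval_ofNat, Expr.eval_var, hR₂.v10, hR₂.v3, hR₂.v6, e31,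
      c31, d32]
    rfl
  have f24 : G₃.var 24 = G.var 24 := by rw [← e24]; simp [hG₃, Cmd.run]
  have f25 : G₃.var 25 = G.var 25 := by rw [← e25]; simp [hG₃, Cmd.run]
  have f31 : G₃.var 31 = digit s.K (s.u j) l := by rw [← c31, ← e31]; simp [hG₃, Cmd.run]
  have f23 : G₃.var 23 = _ := (by simp [hG₃, Cmd.run] : G₃.var 23 = G₂.var 23).trans
    (e23.trans c23)
  have f32 : G₃.var 32 = ω (s.pos m i l) := by rw [← d32]; simp [hG₃, Cmd.run]
  have f6 : G₃.var 6 = s.K := by rw [← hR₂.v6]; simp [hG₃, Cmd.run]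
  have hrun : (Cmd.set 27 (.floor (§23 / §6)) ;; .set 31 (§23 - §6 * §27) ;; .set 23 §27 ;;
      .set 32 (.get 3 (§20 * §1 + §21 * §2 + §26)) ;;
      .set 33 (.get 4 ((§4 + §21) * §15 + §26) / ((1 + 1 / §10) * (3 * §3)) - §31 / §6 - §32) ;;
      .set 34 (.floor (§33 + 1 / 2)) ;; .set 24 (§24 + (§33 - §34) * (§33 - §34)) ;;
      .set 25 (§25 + (§31 + §6 * §34) * §32)).run G =
    (Cmd.set 34 (.floor (§33 + 1 / 2)) ;; .set 24 (§24 + (§33 - §34) * (§33 - §34)) ;;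
      .set 25 (§25 + (§31 + §6 * §34) * §32)).run G₃ := rfl
  rw [hrun, Finset.sum_range_succ, Finset.sum_range_succ]
  have e34 : ((⌊s.gap ω x m i j l + 1 / 2⌋ : ℤ) : ℝ) = s.closest ω x m i j l := rfl
  refine ⟨?_, ?_, ?_⟩
  · simp only [Cmd.run, Store.setVar_var, Nat.reduceEqDiff, if_false, f23]
  · simp only [Cmd.run, Store.setVar_var, Nat.reduceEqDiff, if_false, if_true, f24, g24, e33,
      Expr.eval_add, Expr.eval_sub, Expr.eval_mul, Expr.eval_var, Expr.eval_floor, Expr.eval_div,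
      Expr.eval_one, Expr.eval_ofNat, e34]
    ring
  · simp only [Cmd.run, Store.setVar_var, Nat.reduceEqDiff, if_false, if_true, f25, g25, e33,
      Expr.eval_add, Expr.eval_sub, Expr.eval_mul, Expr.eval_var, Expr.eval_floor, Expr.eval_div,
      Expr.eval_one, Expr.eval_ofNat, e34, f31, f32, f6]

end FilterLSF

/-! ### Listing the balls that contain the pieces of a point -/

namespace FilterLSF
open RealRAM

local prefix:max "§" => Expr.var

variable {D : ℕ} {s : Scheme D} {ω : Tape} {x : E D} {H : Store} {m : ℕ}

open Classical in
/-- The number of balls among the first `j` lattices that contain the piece `i` of `x`. -/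
noncomputable def Scheme.countBelow (s : Scheme D) (ω : Tape) (x : E D) (m i j : ℕ) : ℕ :=
  ((Finset.range j).filter fun j => s.Test ω x m i j).card

/-- The contributions are stored in row `i` of width `N`. The last clause says that other rows are
untouched, which the loop over the pieces needs. -/
theorem pointLoop_run {i : ℕ} (hH : Ready s ω x H) (hm : m < s.M) (hi : i < s.k)
    (hn : HasNodes s x m (2 * s.k) (H.arr 4)) (h20 : H.var 20 = m) (h21 : H.var 21 = i)
    (h30 : H.var 30 = 0) :
    (pointLoop.run H).var 30 = s.count ω x m i ∧
    (∀ y, (∃ t < s.count ω x m i, (pointLoop.run H).arr 5 (i * s.N + t) = y) ↔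
      y ∈ s.terms ω x m i) ∧
    ∀ p, p < i * s.N ∨ i * s.N + s.N ≤ p → (pointLoop.run H).arr 5 p = H.arr 5 p := by
  refine (Cmd.loop_spec (v := 22) (c := pointStep) (P := fun j G =>
    G.var 30 = s.countBelow ω x m i j ∧
    (∀ y, (∃ t < s.countBelow ω x m i j, G.arr 5 (i * s.N + t) = y) ↔
      ∃ j' < j, s.Test ω x m i j' ∧ s.term ω x m i j' = y) ∧
    ∀ p, p < i * s.N ∨ i * s.N + s.N ≤ p → G.arr 5 p = H.arr 5 p) hH.v14
    ⟨by simp [Scheme.countBelow, h30], by simp [Scheme.countBelow], fun _ _ => rfl⟩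
    (by intro _ _ _ h; exact h) fun j hj G hGj hF hG => ?_)
  have hR := hH.frame hF rfl rfl rfl
  obtain ⟨g30, gs, gp⟩ := hG
  have g20 : G.var 20 = m := (hF.var 20 (by decide) rfl).trans h20
  have g21 : G.var 21 = i := (hF.var 21 (by decide) rfl).trans h21
  have b4 : G.arr 4 = H.arr 4 := hF.arr 4 rfl
  set G₁ := (Cmd.set 23 (.get 2 §22) ;; .set 24 0 ;; .set 25 0).run G with hG₁
  have hR₁ : Ready s ω x G₁ := hR.run rfl rfl rfl
  have e23 : G₁.var 23 = s.u j := by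
    have : (Expr.get 2 §22).eval G = s.u j := by
      rw [Expr.eval_get (i := j) (by simpa using hGj)]; exact hR.a2 j hj
    simp [hG₁, Cmd.run, this]
  obtain ⟨k1, k2⟩ := coordLoop_run (j := j) hR₁ hm hi (b4 ▸ hn) (by simp [hG₁, Cmd.run, g20])
    (by simp [hG₁, Cmd.run, g21]) e23 (by simp [hG₁, Cmd.run]) (by simp [hG₁, Cmd.run])
  set G₂ := coordLoop.run G₁ with hG₂
  have hR₂ : Ready s ω x G₂ := hR₁.run rfl rfl rfl
  have f21 : G₂.var 21 = i := by rw [hG₂, Cmd.run_var rfl]; simp [hG₁, Cmd.run, g21]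
  have f30 : G₂.var 30 = s.countBelow ω x m i j := by
    rw [hG₂, Cmd.run_var rfl]; simp [hG₁, Cmd.run, g30]
  have f5 : G₂.arr 5 = G.arr 5 := by rw [hG₂, Cmd.run_arr rfl]; rfl
  have hrun : pointStep.run G =
    (Cmd.ite (1 / 9) §24 .skip (.put 5 (§21 * §14 + §30) §25 ;; .set 30 (§30 + 1))).run G₂ := rfl
  have hle : s.countBelow ω x m i j ≤ j := by
    classical
    exact (Finset.card_filter_le _ _).trans_eq (Finset.card_range j)
  rw [hrun]
  by_cases ht : s.Test ω x m i j
  · have hlt : ¬ (1 / 9 : Expr).eval G₂ < (§24).eval G₂ := by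
      simp only [Expr.eval_div, Expr.eval_one, Expr.eval_ofNat, Expr.eval_var, k1, not_lt]
      exact ht
    have hc : s.countBelow ω x m i (j + 1) = s.countBelow ω x m i j + 1 := by
      classical
      rw [Scheme.countBelow, Finset.range_add_one, Finset.filter_insert, if_pos ht,
        Finset.card_insert_of_notMem (by simp)]
      rfl
    have ea : (§21 * §14 + §30).eval G₂ = (i * s.N + s.countBelow ω x m i j : ℕ) := by
      simp [f21, f30, hR₂.v14]
    rw [Cmd.run_ite_neg hlt, Cmd.run_seq, Cmd.run_put ea, hc]
    simp only [Cmd.run, Store.setVar_var, if_true, Expr.eval_add, Expr.eval_var, Expr.eval_one,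
      Store.setArr_var, Store.setVar_arr, Store.setArr_arr, f5, f30, k2]
    refine ⟨by push_cast; rfl, fun y => ?_, fun p hp => ?_⟩
    · constructor
      · rintro ⟨t, ht', rfl⟩
        rcases Nat.lt_succ_iff_lt_or_eq.1 ht' with h | rfl
        · rw [Function.update_of_ne (by omega)]
          obtain ⟨j', hj', h1⟩ := (gs _).1 ⟨t, h, rfl⟩
          exact ⟨j', by omega, h1⟩
        · rw [Function.update_self]
          exact ⟨j, by omega, ht, rfl⟩
      · rintro ⟨j', hj', h1, h2⟩
        rcases Nat.lt_succ_iff_lt_or_eq.1 hj' with h | rfl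
        · obtain ⟨t, ht', h3⟩ := (gs y).2 ⟨j', h, h1, h2⟩
          exact ⟨t, by omega, by rw [Function.update_of_ne (by omega)]; exact h3⟩
        · exact ⟨_, Nat.lt_succ_self _, by rw [Function.update_self]; exact h2⟩
    · rw [Function.update_of_ne (by omega)]
      exact gp p hp
  · have hlt : (1 / 9 : Expr).eval G₂ < (§24).eval G₂ := by
      simp only [Expr.eval_div, Expr.eval_one, Expr.eval_ofNat, Expr.eval_var, k1]
      exact not_le.1 ht
    have hc : s.countBelow ω x m i (j + 1) = s.countBelow ω x m i j := by
      classical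
      rw [Scheme.countBelow, Finset.range_add_one, Finset.filter_insert, if_neg ht]
      rfl
    rw [Cmd.run_ite_pos hlt, hc]
    refine ⟨f30, fun y => ?_, fun p hp => ?_⟩
    · change (∃ t < _, G₂.arr 5 _ = y) ↔ _
      rw [f5, gs]
      constructor
      · rintro ⟨j', hj', h1⟩
        exact ⟨j', by omega, h1⟩
      · rintro ⟨j', hj', h1⟩
        rcases Nat.lt_succ_iff_lt_or_eq.1 hj' with h | rfl
        · exact ⟨j', h, h1⟩
        · exact absurd h1.1 ht
    · exact (congrFun f5 p).trans (gp p hp)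

/-- The first `q` rows of the array `5` list the balls that contain the pieces of `x`. -/
def HasRows (s : Scheme D) (ω : Tape) (x : E D) (m q : ℕ) (G : Store) : Prop :=
  ∀ i < q, G.arr 6 i = s.count ω x m i ∧
    ∀ y, (∃ t < s.count ω x m i, G.arr 5 (i * s.N + t) = y) ↔ y ∈ s.terms ω x m i

open Classical in
-- Variable 28 collects the name that belongs to the first ball of each piece, and variable 29
-- records whether each piece has a ball. If some piece has none, the first entry of its row is
-- meaningless, but then the flag is 0 and the sum is not used.
theorem pieceLoop_run (hH : Ready s ω x H) (hm : m < s.M)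
    (hn : HasNodes s x m (2 * s.k) (H.arr 4)) (h20 : H.var 20 = m) (h28 : H.var 28 = m)
    (h29 : H.var 29 = 1) :
    HasRows s ω x m s.k (pieceLoop.run H) ∧
    (pieceLoop.run H).var 28 =
      m + ∑ i ∈ Finset.range s.k, (pieceLoop.run H).arr 5 (i * s.N) ∧
    (pieceLoop.run H).var 29 = if ∀ i < s.k, 0 < s.count ω x m i then 1 else 0 := by
  refine (Cmd.loop_spec (v := 21) (c := pieceStep) (P := fun q G => HasRows s ω x m q G ∧
    G.var 28 = m + ∑ i ∈ Finset.range q, G.arr 5 (i * s.N) ∧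
    G.var 29 = if ∀ i < q, 0 < s.count ω x m i then 1 else 0) hH.v4
    ⟨by simp [HasRows], by simp [h28], by simp [h29]⟩ (by intro _ _ _ h; exact h)
    fun i hi G hGi hF hG => ?_)
  have hR := hH.frame hF rfl rfl rfl
  obtain ⟨g1, g28, g29⟩ := hG
  have g20 : G.var 20 = m := (hF.var 20 (by decide) rfl).trans h20
  have b4 : G.arr 4 = H.arr 4 := hF.arr 4 rfl
  set G₁ := (Cmd.set 30 0).run G with hG₁
  have hR₁ : Ready s ω x G₁ := hR.run rfl rfl rfl
  obtain ⟨k1, k2, k3⟩ := pointLoop_run hR₁ hm hi (b4 ▸ hn) (by simp [hG₁, Cmd.run, g20])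
    (by simp [hG₁, Cmd.run, hGi]) (by simp [hG₁, Cmd.run])
  set G₂ := pointLoop.run G₁ with hG₂
  have f21 : G₂.var 21 = i := by rw [hG₂, Cmd.run_var rfl]; simp [hG₁, Cmd.run, hGi]
  have f28 : G₂.var 28 = G.var 28 := by rw [hG₂, Cmd.run_var rfl]; simp [hG₁, Cmd.run]
  have f29 : G₂.var 29 = G.var 29 := by rw [hG₂, Cmd.run_var rfl]; simp [hG₁, Cmd.run]
  have f6 : G₂.arr 6 = G.arr 6 := by rw [hG₂, Cmd.run_arr rfl]; rfl
  have hR₂ : Ready s ω x G₂ := hR₁.run rfl rfl rfl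
  set G₃ := (Cmd.put 6 §21 §30).run G₂ with hG₃
  have hG₃' : G₃ = G₂.setArr 6 i (s.count ω x m i) := by
    rw [hG₃, Cmd.run_put (i := i) (by simpa using f21)]
    simp [k1]
  set G₄ := (Cmd.ite §30 1 (.set 29 0) .skip).run G₃ with hG₄
  have a5 : G₄.arr 5 = G₂.arr 5 := by rw [hG₄, Cmd.run_arr rfl, hG₃, Cmd.run_arr rfl]
  have a6 : G₄.arr 6 = Function.update (G.arr 6) i (s.count ω x m i) := by
    rw [hG₄, Cmd.run_arr rfl, hG₃', Store.setArr_arr, if_pos rfl, f6]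
  have v28 : G₄.var 28 = G.var 28 := by
    rw [hG₄, Cmd.run_var rfl, hG₃', Store.setArr_var, f28]
  have v21 : G₄.var 21 = i := by rw [hG₄, Cmd.run_var rfl, hG₃', Store.setArr_var, f21]
  have v14 : G₄.var 14 = s.N := by
    rw [hG₄, Cmd.run_var rfl, hG₃', Store.setArr_var, hR₂.v14]
  have v29 : G₄.var 29 = if ∀ i' < i + 1, 0 < s.count ω x m i' then 1 else 0 := by
    have e30 : G₃.var 30 = s.count ω x m i := by rw [hG₃', Store.setArr_var, k1]
    have e29 : G₃.var 29 = G.var 29 := by rw [hG₃', Store.setArr_var, f29]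
    simp only [Nat.forall_lt_succ_right]
    by_cases hc : 0 < s.count ω x m i
    · rw [hG₄, Cmd.run_ite_neg (by simp [e30]; omega)]
      simp only [hc, and_true]
      exact e29.trans g29
    · rw [hG₄, Cmd.run_ite_pos (by simp [e30]; omega)]
      simp [hc, Cmd.run]
  have hrun : pieceStep.run G = (Cmd.set 28 (§28 + .get 5 (§21 * §14))).run G₄ := rfl
  -- The case `t = 0` stands apart because the sum reads the first entry of each row even if `N =
  -- 0`.
  have old : ∀ p < i, ∀ t, t = 0 ∨ t < s.N → G₄.arr 5 (p * s.N + t) = G.arr 5 (p * s.N + t) := by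
    intro p hp t ht
    rw [a5]
    refine k3 _ ?_
    have : (p + 1) * s.N ≤ i * s.N := Nat.mul_le_mul_right _ hp
    rw [Nat.add_mul, one_mul] at this
    omega
  have cle : ∀ p, s.count ω x m p ≤ s.N := fun p =>
    (Finset.card_filter_le _ _).trans_eq (Finset.card_range _)
  rw [hrun]
  refine ⟨fun p hp => ?_, ?_, ?_⟩
  · change G₄.arr 6 p = _ ∧ ∀ y, (∃ t < _, G₄.arr 5 _ = y) ↔ _
    rw [a6]
    rcases Nat.lt_succ_iff_lt_or_eq.1 hp with h | rfl
    · rw [Function.update_of_ne h.ne]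
      refine ⟨(g1 p h).1, fun y => ?_⟩
      rw [← (g1 p h).2 y]
      constructor
      · rintro ⟨t, ht, h2⟩
        exact ⟨t, ht, by rw [← old p h t (.inr (ht.trans_le (cle p)))]; exact h2⟩
      · rintro ⟨t, ht, h2⟩
        exact ⟨t, ht, by rw [old p h t (.inr (ht.trans_le (cle p)))]; exact h2⟩
    · rw [Function.update_self, a5]
      exact ⟨rfl, k2⟩
  · have : (Expr.get 5 (§21 * §14)).eval G₄ = G₄.arr 5 (i * s.N) :=
      Expr.eval_get (by simp [v21, v14])
    simp only [Cmd.run, Store.setVar_var, if_true, Expr.eval_add, Expr.eval_var, this,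
      Store.setVar_arr, v28, g28, Finset.sum_range_succ]
    rw [add_assoc]
    congr 2
    exact Finset.sum_congr rfl fun p hp => (old p (Finset.mem_range.1 hp) 0 (.inl rfl)).symm
  · simp only [Cmd.run, Store.setVar_var, Nat.reduceEqDiff, if_false, v29]

/-- The store lists the balls that contain the pieces of `x`. -/
structure Found (s : Scheme D) (ω : Tape) (x : E D) (m : ℕ) (H : Store) : Prop where
  rows : HasRows s ω x m s.k H
  root : H.arr 7 0 = m + ∑ i ∈ Finset.range s.k, H.arr 5 (i * s.N)
  alive : (∀ i < s.k, 0 < s.count ω x m i) → H.var 29 = 1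
  dead : (¬ ∀ i < s.k, 0 < s.count ω x m i) → H.var 29 = 0

theorem findBalls_run (hH : Ready s ω x H) (hm : m < s.M) (h20 : H.var 20 = m) :
    Found s ω x m (findBalls.run H) := by
  classical
  set G₁ := (Cmd.set 21 §20).run H with hG₁
  have hR₁ : Ready s ω x G₁ := hH.run rfl rfl rfl
  set G₂ := loadInput.run G₁ with hG₂
  have hR₂ : Ready s ω x G₂ := hR₁.run rfl rfl rfl
  have k2 := loadInput_run hR₁
  have k3 := treeLoop_run (m := m) hR₂
    (by rw [hG₂, Cmd.run_var rfl]; simp [hG₁, Cmd.run, h20]) k2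
  set G₃ := treeLoop.run G₂ with hG₃
  have hR₃ : Ready s ω x G₃ := hR₂.run rfl rfl rfl
  have e20 : G₃.var 20 = m := by
    rw [hG₃, Cmd.run_var rfl, hG₂, Cmd.run_var rfl]; simp [hG₁, Cmd.run, h20]
  set G₄ := (Cmd.set 28 §20 ;; .set 29 1).run G₃ with hG₄
  have hR₄ : Ready s ω x G₄ := hR₃.run rfl rfl rfl
  obtain ⟨k4, k5, k6⟩ := pieceLoop_run hR₄ hm k3 (by simp [hG₄, Cmd.run, e20])
    (by simp [hG₄, Cmd.run, e20]) (by simp [hG₄, Cmd.run])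
  set G₅ := pieceLoop.run G₄ with hG₅
  have hrun : findBalls.run H = G₅.setArr 7 0 (G₅.var 28) := by
    change (Cmd.put 7 0 §28).run G₅ = _
    rw [Cmd.run_put (i := 0) (by simp)]
    simp
  rw [hrun]
  exact ⟨k4, by simpa using k5, fun h => by rw [Store.setArr_var, k6, if_pos h],
    fun h => by rw [Store.setArr_var, k6, if_neg h]⟩

end FilterLSF

/-! ### From lists of balls to names of filters; cost of the decoder -/

namespace FilterLSF
open RealRAM

local prefix:max "§" => Expr.var

/-- Append a translate of the first `§32` entries of the list. -/
def copyLoop : Cmd := .loop 23 32 (.put 7 (§29 + §23) (.get 7 §23 + §33))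

/-- Append a translate of the first `§32` entries for the ball `§22 + 1` of the piece `§21`. -/
def rowStep : Cmd :=
  .set 33 (.get 5 (§21 * §14 + (§22 + 1)) - .get 5 (§21 * §14)) ;; copyLoop ;; .set 29 (§29 + §32)

/-- Append translates of the list for all balls but the first of the piece `§21`. -/
def rowLoop : Cmd := .loop 22 31 rowStep

/-- Replace each entry of the list by one entry for each ball that contains the piece `§21`. -/
def expandStep : Cmd :=
  .set 31 (.get 6 §21) ;; .ite §31 1 (.set 31 0) (.set 31 (§31 - 1)) ;; .set 32 §29 ;; rowLoop

/-- Compute the names of all filters that contain the point. -/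
def expandLoop : Cmd := .loop 21 4 expandStep

/-- Output the list. -/
def emitLoop : Cmd := .loop 23 29 (.emit (.get 7 §23))

/-- Output the names of the filters of the decomposition `§20` that contain the point. -/
def decodeStep : Cmd := findBalls ;; expandLoop ;; emitLoop

/-- The decoder. -/
def decoderCmd : Cmd := .loop 20 9 decodeStep

variable {D : ℕ} {s : Scheme D} {ω : Tape} {x : E D} {H : Store} {m : ℕ}

theorem copyLoop_run {l n : ℕ} (h32 : H.var 32 = l) (h29 : H.var 29 = n) (hln : l ≤ n) :
    ((∀ r < l, (copyLoop.run H).arr 7 (n + r) = H.arr 7 r + H.var 33) ∧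
      ∀ p < n, (copyLoop.run H).arr 7 p = H.arr 7 p) ∧
      copyLoop.cost H ≤ 4 + l * 29 := by
  have key := Cmd.loop_cost (v := 23) (c := .put 7 (§29 + §23) (.get 7 §23 + §33)) (A := 24)
    (fun _ => 0) (P := fun i G => (∀ r < i, G.arr 7 (n + r) = H.arr 7 r + H.var 33) ∧
      ∀ p < n, G.arr 7 p = H.arr 7 p) h32 ⟨by simp, fun _ _ => rfl⟩ (by intro _ _ _ h; exact h)
    (by simp) fun i hi G hGi hF hG => ⟨?_, by simp [Cmd.cost, Expr.cost]⟩
  · have h := key.2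
    simp only [add_zero, Nat.reduceAdd] at h
    exact ⟨key.1, h⟩
  · obtain ⟨g1, g2⟩ := hG
    have g29 := (hF.var 29 (by decide) rfl).trans h29
    have g33 := hF.var 33 (by decide) rfl
    rw [Cmd.run_put (i := n + i) (by simp [g29, hGi])]
    have e : (Expr.get 7 §23).eval G = H.arr 7 i := by
      rw [Expr.eval_get (i := i) (by simpa using hGi), g2 i (by omega)]
    simp only [Store.setArr_arr, if_true, Expr.eval_add, Expr.eval_var, e, g33]
    constructor
    · intro r hr
      rcases Nat.lt_succ_iff_lt_or_eq.1 hr with h | rfl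
      · rw [Function.update_of_ne (by omega)]; exact g1 r h
      · rw [Function.update_self]
    · intro p hp
      rw [Function.update_of_ne (by omega)]; exact g2 p hp

/-- A measure of the length of the list. -/
noncomputable def listPotential (κ : ℕ) (H : Store) : ℕ := κ * ⌊H.var 29⌋₊

/-- The entries already contain the contribution of the first ball of the piece, so another ball
means adding the difference of the two contributions to a fresh copy. Copying one entry takes 29
steps, and it lengthens the list by one entry, which explains the potential. -/
theorem rowLoop_run {i l n : ℕ} (h21 : H.var 21 = i) (h14 : H.var 14 = s.N) (h31 : H.var 31 = n)
    (h32 : H.var 32 = l) (h29 : H.var 29 = l) :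
    ((rowLoop.run H).var 29 = (l * (n + 1) : ℕ) ∧
      ∀ t ≤ n, ∀ r < l, (rowLoop.run H).arr 7 (l * t + r) =
        H.arr 7 r + (H.arr 5 (i * s.N + t) - H.arr 5 (i * s.N))) ∧
      rowLoop.cost H + listPotential 29 H ≤ 4 + n * (47 + 5) +
        listPotential 29 (rowLoop.run H) := by
  refine (Cmd.loop_cost (v := 22) (c := rowStep) (A := 47) (listPotential 29)
    (P := fun q G => G.var 29 = (l * (q + 1) : ℕ) ∧ ∀ t ≤ q, ∀ r < l, G.arr 7 (l * t + r) =
        H.arr 7 r + (H.arr 5 (i * s.N + t) - H.arr 5 (i * s.N))) h31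
    ⟨by simpa using h29, by simp⟩ (by intro _ _ _ h; exact h)
    (by simp [listPotential]) fun q hq G hGq hF hG => ?_)
  obtain ⟨g29, ga⟩ := hG
  have g21 := (hF.var 21 (by decide) rfl).trans h21
  have g14 := (hF.var 14 (by decide) rfl).trans h14
  have g32 := (hF.var 32 (by decide) rfl).trans h32
  have b5 : G.arr 5 = H.arr 5 := hF.arr 5 rfl
  have e1 : (Expr.get 5 (§21 * §14 + (§22 + 1))).eval G = H.arr 5 (i * s.N + (q + 1)) := by
    rw [Expr.eval_get (i := i * s.N + (q + 1)) (by simp [g21, g14, hGq]), b5]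
  have e2 : (Expr.get 5 (§21 * §14)).eval G = H.arr 5 (i * s.N) := by
    rw [Expr.eval_get (i := i * s.N) (by simp [g21, g14]), b5]
  set G₁ := (Cmd.set 33 (.get 5 (§21 * §14 + (§22 + 1)) - .get 5 (§21 * §14))).run G with hG₁
  have c33 : G₁.var 33 = H.arr 5 (i * s.N + (q + 1)) - H.arr 5 (i * s.N) := by
    simp [hG₁, Cmd.run, e1, e2]
  have c29 : G₁.var 29 = (l * (q + 1) : ℕ) := by rw [← g29]; simp [hG₁, Cmd.run]
  have c32 : G₁.var 32 = l := by rw [← g32]; simp [hG₁, Cmd.run]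
  obtain ⟨⟨k1, k2⟩, k3⟩ := copyLoop_run c32 c29 (Nat.le_mul_of_pos_right _ (by omega))
  set G₂ := copyLoop.run G₁ with hG₂
  have d29 : G₂.var 29 = (l * (q + 1) : ℕ) := by rw [hG₂, Cmd.run_var rfl, c29]
  have d32 : G₂.var 32 = l := by rw [hG₂, Cmd.run_var rfl, c32]
  have hrun : rowStep.run G = G₂.setVar 29 (l * (q + 1 + 1) : ℕ) := by
    change G₂.setVar 29 ((§29 + §32).eval G₂) = _
    congr 1
    simp only [Expr.eval_add, Expr.eval_var, d29, d32]
    push_cast; ring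
  have hcost : rowStep.cost G = 30 + (copyLoop.cost G₁ + 7) := rfl
  rw [hrun, hcost]
  refine ⟨⟨by simp, fun t ht r hr => ?_⟩, ?_⟩
  · rw [Store.setVar_arr]
    rcases Nat.lt_or_ge t (q + 1) with h | h
    · rw [k2 _ (by
        calc l * t + r < l * t + l := by omega
          _ = l * (t + 1) := by ring
          _ ≤ _ := Nat.mul_le_mul_left _ h)]
      exact ga t (by omega) r hr
    · obtain rfl : t = q + 1 := by omega
      rw [k1 r hr, c33]
      have := ga 0 (by omega) r hr
      rw [show G₁.arr 7 = G.arr 7 from rfl, show r = l * 0 + r by omega, this]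
      simp
  · simp only [listPotential, Store.setVar_var, if_true, Nat.floor_natCast, g29]
    nlinarith

/-- The first `q` sums have been formed. -/
def Expanded (s : Scheme D) (ω : Tape) (x : E D) (m a q : ℕ) (b : ℝ) (e : ℕ → ℕ → ℝ) (G : Store) :
    Prop :=
  G.var 29 = (a * ∏ i ∈ Finset.range q, (s.count ω x m i - 1 + 1) : ℕ) ∧
  ∀ y, (∃ r < a * ∏ i ∈ Finset.range q, (s.count ω x m i - 1 + 1), G.arr 7 r = y) ↔
    0 < a ∧ ∃ τ : ℕ → ℕ, (∀ i < q, τ i < s.count ω x m i - 1 + 1) ∧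
      b + ∑ i ∈ Finset.range q, (e i (τ i) - e i 0) = y

/-- The factor `count - 1 + 1` is `count` except that 0 is read as 1. So the list never shrinks, and
all intermediate work is paid for by its final length. Pieces without balls are dealt with
beforehand: then `a = 0` and the list is empty from the start. -/
theorem expandLoop_run {a : ℕ} (hH : Ready s ω x H) (hF : HasRows s ω x m s.k H)
    (h29 : H.var 29 = a) (ha : a ≤ 1) :
    Expanded s ω x m a s.k (H.arr 7 0) (fun i t => H.arr 5 (i * s.N + t)) (expandLoop.run H) ∧
      expandLoop.cost H + listPotential 29 H ≤ 4 + s.k * (30 + s.N * 52 + 5) +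
        listPotential 29 (expandLoop.run H) := by
  set e : ℕ → ℕ → ℝ := fun i t => H.arr 5 (i * s.N + t) with he
  refine (Cmd.loop_cost (v := 21) (c := expandStep) (A := 30 + s.N * 52) (listPotential 29)
    (P := fun q G => Expanded s ω x m a q (H.arr 7 0) e G) hH.v4
    ⟨by simpa using h29, fun y => ?_⟩ (by intro _ _ _ h; exact h)
    (by simp [listPotential]) fun q hq G hGq hFr hG => ?_)
  · simp only [Finset.range_zero, Finset.prod_empty, mul_one, Finset.sum_empty, add_zero]
    constructor
    · rintro ⟨r, hr, h⟩
      obtain rfl : r = 0 := by omega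
      exact ⟨by omega, fun _ => 0, by simp, h⟩
    · rintro ⟨h1, -, -, h2⟩
      exact ⟨0, h1, h2⟩
  · obtain ⟨g29, ga⟩ := hG
    have hR := hH.frame hFr rfl rfl rfl
    have b5 : G.arr 5 = H.arr 5 := hFr.arr 5 rfl
    have b6 : G.arr 6 = H.arr 6 := hFr.arr 6 rfl
    set c := s.count ω x m q with hc
    set l := a * ∏ i ∈ Finset.range q, (s.count ω x m i - 1 + 1) with hl
    have cle : c ≤ s.N := by
      classical
      exact (Finset.card_filter_le _ _).trans_eq (Finset.card_range _)
    have e6 : (Expr.get 6 §21).eval G = c := by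
      rw [Expr.eval_get (i := q) (by simpa using hGq), b6, (hF q hq).1]
    set G₁ := (Cmd.set 31 (.get 6 §21)).run G with hG₁
    have c31 : G₁.var 31 = c := by simp [hG₁, Cmd.run, e6]
    set G₂ := (Cmd.ite §31 1 (.set 31 0) (.set 31 (§31 - 1))).run G₁ with hG₂
    have d31 : G₂.var 31 = (c - 1 : ℕ) := by
      rcases Nat.eq_zero_or_pos c with h | h
      · rw [hG₂, Cmd.run_ite_pos (by simp [c31, h])]
        simp [Cmd.run, h]
      · rw [hG₂, Cmd.run_ite_neg (by simp [c31]; omega)]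
        simp [Cmd.run, c31, Nat.cast_sub (show 1 ≤ c from h)]
    set G₃ := (Cmd.set 32 §29).run G₂ with hG₃
    have v29 : G₃.var 29 = l := by
      simp [hG₃, Cmd.run]
      rw [hG₂, Cmd.run_var rfl, hG₁, Cmd.run_var rfl, g29]
    have v32 : G₃.var 32 = l := by
      simp [hG₃, Cmd.run]
      rw [hG₂, Cmd.run_var rfl, hG₁, Cmd.run_var rfl, g29]
    have v31 : G₃.var 31 = (c - 1 : ℕ) := by rw [hG₃, Cmd.run_var rfl, d31]
    have v21 : G₃.var 21 = q := by
      rw [hG₃, Cmd.run_var rfl, hG₂, Cmd.run_var rfl, hG₁, Cmd.run_var rfl, hGq]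
    have v14 : G₃.var 14 = s.N := by
      rw [hG₃, Cmd.run_var rfl, hG₂, Cmd.run_var rfl, hG₁, Cmd.run_var rfl, hR.v14]
    have a5 : G₃.arr 5 = H.arr 5 := by
      rw [hG₃, Cmd.run_arr rfl, hG₂, Cmd.run_arr rfl, hG₁, Cmd.run_arr rfl, b5]
    have a7 : G₃.arr 7 = G.arr 7 := by
      rw [hG₃, Cmd.run_arr rfl, hG₂, Cmd.run_arr rfl, hG₁, Cmd.run_arr rfl]
    obtain ⟨⟨k1, k2⟩, k3⟩ := rowLoop_run v21 v14 v31 v32 v29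
    have hrun : expandStep.run G = rowLoop.run G₃ := rfl
    have hcost : expandStep.cost G =
        10 + ((Cmd.ite §31 1 (.set 31 0) (.set 31 (§31 - 1))).cost G₁ + (4 + rowLoop.cost G₃)) := rfl
    have hite : (Cmd.ite §31 1 (.set 31 0) (.set 31 (§31 - 1))).cost G₁ ≤ 10 := by
      simp only [Cmd.cost]
      split_ifs
      all_goals
        simp [Expr.cost]
        try decide
    have hP : listPotential 29 G₃ = listPotential 29 G := by
      simp only [listPotential, v29, g29]
    rw [hrun, hcost]
    refine ⟨⟨?_, fun y => ?_⟩, ?_⟩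
    · rw [k1, Finset.prod_range_succ, ← mul_assoc]
    · rw [Finset.prod_range_succ, ← mul_assoc, ← hl, ← hc]
      rw [a7, a5] at k2
      -- The position `p` of the new list is the entry `p % l` of the copy number `p / l`.
      have h1 : (∃ r < l * (c - 1 + 1), (rowLoop.run G₃).arr 7 r = y) ↔
          ∃ t < c - 1 + 1, ∃ r < l, G.arr 7 r = y - (e q t - e q 0) := by
        constructor
        · rintro ⟨p, hp, rfl⟩
          have hl0 : 0 < l := by
            rcases Nat.eq_zero_or_pos l with h | h
            · rw [h] at hp; omega
            · exact h
          have hd : p / l < c - 1 + 1 := Nat.div_lt_of_lt_mul hp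
          have := k2 (p / l) (by omega) (p % l) (Nat.mod_lt _ hl0)
          rw [Nat.div_add_mod] at this
          exact ⟨p / l, hd, p % l, Nat.mod_lt _ hl0, by rw [this]; simp [he]⟩
        · rintro ⟨t, ht, r, hr, h⟩
          refine ⟨l * t + r, ?_, ?_⟩
          · calc l * t + r < l * t + l := by omega
              _ = l * (t + 1) := by ring
              _ ≤ _ := Nat.mul_le_mul_left _ ht
          · rw [k2 t (by omega) r hr, h]
            simp [he]
      rw [h1]
      constructor
      · rintro ⟨t, ht, h2⟩
        obtain ⟨ha, τ, hτ, h3⟩ := (ga _).1 h2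
        refine ⟨ha, Function.update τ q t, fun i hi => ?_, ?_⟩
        · rcases Nat.lt_succ_iff_lt_or_eq.1 hi with h | rfl
          · rw [Function.update_of_ne h.ne]; exact hτ i h
          · rw [Function.update_self]; exact ht
        · rw [Finset.sum_range_succ, Function.update_self, ← add_assoc, ← eq_sub_iff_add_eq, ← h3]
          congr 1
          exact Finset.sum_congr rfl fun i hi => by
            rw [Function.update_of_ne (Finset.mem_range.1 hi).ne]
      · rintro ⟨ha, τ, hτ, h3⟩
        rw [Finset.sum_range_succ, ← add_assoc, ← eq_sub_iff_add_eq] at h3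
        exact ⟨τ q, hτ q (Nat.lt_succ_self q),
          (ga _).2 ⟨ha, τ, fun i hi => hτ i (by omega), h3⟩⟩
    · rw [← hP]
      have : (c - 1) * 52 ≤ s.N * 52 := Nat.mul_le_mul_right _ (by omega)
      omega

theorem emitLoop_run {l : ℕ} (h29 : H.var 29 = l) :
    ((emitLoop.run H).out.length = H.out.length + l ∧
      ∀ y, y ∈ (emitLoop.run H).out ↔ y ∈ H.out ∨ ∃ r < l, H.arr 7 r = y) ∧
    emitLoop.cost H ≤ 4 + l * 14 := by
  have key := Cmd.loop_cost (v := 23) (c := .emit (.get 7 §23)) (A := 9)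
    (fun _ => 0) (P := fun i G => G.out.length = H.out.length + i ∧
      ∀ y, y ∈ G.out ↔ y ∈ H.out ∨ ∃ r < i, H.arr 7 r = y) h29 ⟨by simp, by simp⟩
    (by intro _ _ _ h; exact h) (by simp)
    fun i hi G hGi hF hG => ⟨?_, by simp [Cmd.cost, Expr.cost]⟩
  · have h := key.2
    simp only [add_zero, Nat.reduceAdd] at h
    exact ⟨key.1, h⟩
  · obtain ⟨g1, g2⟩ := hG
    have e : (Expr.get 7 §23).eval G = H.arr 7 i := by
      rw [Expr.eval_get (i := i) (by simpa using hGi), hF.arr 7 rfl]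
    simp only [Cmd.run, e, List.length_cons, g1, List.mem_cons, g2, Nat.lt_succ_iff_lt_or_eq]
    refine ⟨by ring, fun y => ?_⟩
    constructor
    · rintro (rfl | h | ⟨r, hr, h⟩)
      · exact .inr ⟨i, .inr rfl, rfl⟩
      · exact .inl h
      · exact .inr ⟨r, .inl hr, h⟩
    · rintro (h | ⟨r, hr | rfl, h⟩)
      · exact .inr (.inl h)
      · exact .inr (.inr ⟨r, hr, h⟩)
      · exact .inl h.symm

/-- The differences turn the contributions of the first balls, which are contained in `b`, into
those of the chosen balls. -/
theorem mem_names_iff {b : ℝ} {e : ℕ → ℕ → ℝ}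
    (hr : ∀ i < s.k, ∀ y, (∃ t < s.count ω x m i, e i t = y) ↔ y ∈ s.terms ω x m i)
    (hb : b = m + ∑ i ∈ Finset.range s.k, e i 0) (h0 : ∀ i < s.k, 0 < s.count ω x m i) (y : ℝ) :
    (∃ τ : ℕ → ℕ, (∀ i < s.k, τ i < s.count ω x m i - 1 + 1) ∧
      b + ∑ i ∈ Finset.range s.k, (e i (τ i) - e i 0) = y) ↔ y ∈ s.names ω x m := by
  have hs : ∀ τ : ℕ → ℕ, b + ∑ i ∈ Finset.range s.k, (e i (τ i) - e i 0) =
      m + ∑ i ∈ Finset.range s.k, e i (τ i) := fun τ => by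
    rw [hb, Finset.sum_sub_distrib]; ring
  simp only [hs]
  constructor
  · rintro ⟨τ, hτ, rfl⟩
    exact ⟨fun i => e i (τ i), fun i hi => (hr i hi _).1
      ⟨_, by have := h0 i hi; have := hτ i hi; omega, rfl⟩, rfl⟩
  · rintro ⟨c, hc, rfl⟩
    have : ∀ i, ∃ t, i < s.k → t < s.count ω x m i ∧ e i t = c i := fun i => by
      by_cases hi : i < s.k
      · obtain ⟨t, ht⟩ := (hr i hi _).2 (hc i hi)
        exact ⟨t, fun _ => ht⟩
      · exact ⟨0, fun h => absurd h hi⟩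
    choose τ hτ using this
    refine ⟨τ, fun i hi => by have := (hτ i hi).1; omega, ?_⟩
    rw [Finset.sum_congr rfl fun i hi => (hτ i (Finset.mem_range.1 hi)).2]

/-- Each listed name is paid for with 43 = 29 + 14 steps, for copying and for output. Everything
else has a bound that does not depend on the point. -/
theorem decodeStep_run (hH : Ready s ω x H) (hm : m < s.M) (h20 : H.var 20 = m) {B : ℕ}
    (b1 : 2 * D ≤ B) (b2 : s.k ≤ B) (b3 : s.N ≤ B) :
    ((decodeStep.run H).out.length = H.out.length + ∏ i ∈ Finset.range s.k, s.count ω x m i ∧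
      ∀ y, y ∈ (decodeStep.run H).out ↔ y ∈ H.out ∨ y ∈ s.names ω x m) ∧
    decodeStep.cost H + 43 * H.out.length ≤
      (findBalls.size + 95) * (B + 1) ^ 3 + 43 * (decodeStep.run H).out.length := by
  have hd : s.d ≤ D := (Nat.le_mul_of_pos_left _ s.k_pos).trans_eq s.hD
  have hcost : findBalls.cost H ≤ findBalls.size * (B + 1) ^ 3 := by
    refine Cmd.cost_le findBalls rfl H fun b hb => ?_
    have hb' : b ∈ [15, 5, 4, 14, 2] := by
      revert b; decide
    simp only [List.mem_cons, List.not_mem_nil, or_false] at hb'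
    rcases hb' with rfl | rfl | rfl | rfl | rfl
    · rw [hH.v15]; exact_mod_cast b1
    · rw [hH.v5]; exact_mod_cast (by omega : s.k - 1 ≤ B)
    · rw [hH.v4]; exact_mod_cast b2
    · rw [hH.v14]; exact_mod_cast b3
    · rw [hH.v2]; exact_mod_cast (by omega : s.d ≤ B)
  have hF := findBalls_run hH hm h20
  set G₁ := findBalls.run H with hG₁
  have hR₁ : Ready s ω x G₁ := hH.run rfl rfl rfl
  have o1 : G₁.out = H.out := Cmd.run_out rfl H
  obtain ⟨a, ha1, h29, halive⟩ : ∃ a : ℕ, a ≤ 1 ∧ G₁.var 29 = a ∧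
      (0 < a ↔ ∀ i < s.k, 0 < s.count ω x m i) := by
    by_cases h : ∀ i < s.k, 0 < s.count ω x m i
    · exact ⟨1, le_rfl, by simpa using hF.alive h, by simpa using h⟩
    · exact ⟨0, by omega, by simpa using hF.dead h, by simpa using h⟩
  obtain ⟨⟨k1, k2⟩, k3⟩ := expandLoop_run hR₁ hF.rows h29 ha1
  set G₂ := expandLoop.run G₁ with hG₂
  have o2 : G₂.out = H.out := (Cmd.run_out rfl G₁).trans o1
  obtain ⟨⟨k4, k5⟩, k6⟩ := emitLoop_run k1
  have hlen : a * ∏ i ∈ Finset.range s.k, (s.count ω x m i - 1 + 1) =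
      ∏ i ∈ Finset.range s.k, s.count ω x m i := by
    by_cases h : 0 < a
    · obtain rfl : a = 1 := by omega
      rw [one_mul]
      exact Finset.prod_congr rfl fun i hi => by
        have := halive.1 h i (Finset.mem_range.1 hi); omega
    · have h' := h
      rw [halive] at h'
      push Not at h'
      obtain ⟨i, hi, h0⟩ := h'
      rw [show a = 0 by omega, zero_mul,
        Finset.prod_eq_zero (Finset.mem_range.2 hi) (Nat.le_zero.1 h0)]
  have hrun : decodeStep.run H = emitLoop.run G₂ := rfl
  have hdc : decodeStep.cost H = findBalls.cost H + (expandLoop.cost G₁ + emitLoop.cost G₂) := rfl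
  rw [hrun, hdc]
  refine ⟨⟨by rw [k4, o2, hlen], fun y => ?_⟩, ?_⟩
  · rw [k5, o2, k2 y]
    refine or_congr_right ?_
    by_cases h : 0 < a
    · have := mem_names_iff (e := fun i t => G₁.arr 5 (i * s.N + t))
        (fun i hi => (hF.rows i hi).2) hF.root (halive.1 h) y
      rw [← this]
      exact and_iff_right h
    · refine iff_of_false (fun h' => h h'.1) ?_
      rintro ⟨c, hc, -⟩
      refine h (halive.2 fun i hi => ?_)
      obtain ⟨t, ht, -⟩ := ((hF.rows i hi).2 _).2 (hc i hi)
      omega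
  · have hp : listPotential 29 G₂ =
        29 * (a * ∏ i ∈ Finset.range s.k, (s.count ω x m i - 1 + 1)) := by
      rw [listPotential, k1, Nat.floor_natCast]
    rw [hp] at k3
    rw [k4, o2]
    have hB : 8 + s.k * (30 + s.N * 52 + 5) ≤ 95 * (B + 1) ^ 3 := by
      calc 8 + s.k * (30 + s.N * 52 + 5) ≤ 8 + B * (30 + B * 52 + 5) := by gcongr
        _ ≤ 95 * (B + 1) ^ 3 := by ring_nf; nlinarith [sq_nonneg B]
    rw [Nat.add_mul]
    omega

theorem decoderCmd_run (hH : Ready s ω x H) (ho : H.out = []) {B : ℕ}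
    (b1 : 2 * D ≤ B) (b2 : s.k ≤ B) (b3 : s.N ≤ B) (b4 : s.M ≤ B) :
    ((decoderCmd.run H).out.length =
        ∑ m ∈ Finset.range s.M, ∏ i ∈ Finset.range s.k, s.count ω x m i ∧
      ∀ y, y ∈ (decoderCmd.run H).out ↔ ∃ m < s.M, y ∈ s.names ω x m) ∧
    decoderCmd.cost H ≤
      (findBalls.size + 104) * (B + 1) ^ 4 + 43 * (decoderCmd.run H).out.length := by
  have key := Cmd.loop_cost (v := 20) (c := decodeStep) (A := (findBalls.size + 95) * (B + 1) ^ 3)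
    (fun G => 43 * G.out.length) (P := fun m G => G.out.length =
        ∑ m ∈ Finset.range m, ∏ i ∈ Finset.range s.k, s.count ω x m i ∧
      ∀ y, y ∈ G.out ↔ ∃ m' < m, y ∈ s.names ω x m') hH.v9 ⟨by simp [ho], by simp [ho]⟩
    (by intro _ _ _ h; exact h) (by simp) fun m hm G hGm hF hG => ?_
  · refine ⟨key.1, ?_⟩
    have := key.2
    simp only [ho, List.length_nil, mul_zero, add_zero] at this
    refine this.trans (Nat.add_le_add_right ?_ _)
    have h1 : 1 ≤ (B + 1) ^ 3 := Nat.one_le_pow _ _ (by omega)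
    calc 4 + s.M * ((findBalls.size + 95) * (B + 1) ^ 3 + 5)
        ≤ 4 * (B + 1) ^ 3 + B * ((findBalls.size + 95) * (B + 1) ^ 3 + 5 * (B + 1) ^ 3) := by
          gcongr <;> omega
      _ ≤ (findBalls.size + 104) * ((B + 1) * (B + 1) ^ 3) := by
          ring_nf; nlinarith
      _ = _ := by ring
  · have hR := hH.frame hF rfl rfl rfl
    obtain ⟨g1, g2⟩ := hG
    obtain ⟨⟨k1, k2⟩, k3⟩ := decodeStep_run hR hm hGm b1 b2 b3
    refine ⟨⟨by rw [k1, g1, Finset.sum_range_succ], fun y => ?_⟩, k3⟩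
    rw [k2, g2]
    constructor
    · rintro (⟨m', hm', h⟩ | h)
      · exact ⟨m', by omega, h⟩
      · exact ⟨m, by omega, h⟩
    · rintro ⟨m', hm', h⟩
      rcases Nat.lt_succ_iff_lt_or_eq.1 hm' with h' | rfl
      · exact .inl ⟨m', h', h⟩
      · exact .inr h

end FilterLSF

namespace FilterLSF
open RealRAM

/-! ### The scheme for given parameters -/

theorem rootCount_pos {d : ℕ} (hd : 0 < d) : 0 < rootCount d :=
  Finset.card_pos.2 ⟨0, Finset.mem_filter.2 ⟨Finset.mem_range.2 hd, by simpa using hd⟩⟩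

/-- The parameters are admissible. -/
structure Valid (D d : ℕ) (w : ℝ) : Prop where
  d_pos : 0 < d
  hD : 2 ^ Nat.log 2 (D / d) * d = D
  one_lt : 1 < w
  le_gridSize : 6 * d * w ≤ gridSize d
  ratio_pos : 0 < ratioSq (gridSize d) d w
  lt_eps : 64 * 2 ^ Nat.log 2 (D / d) / (D * D : ℕ) < 1 / (rootCount d : ℝ)

namespace Valid

variable {D d : ℕ} {w : ℝ} (h : Valid D d w) (n : ℕ)
include h

theorem pow_log : 2 ^ Nat.log 2 (D / d) = D / d :=
  (Nat.div_eq_of_eq_mul_left h.d_pos h.hD.symm).symm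

theorem D_pos : 0 < D := by
  have := h.d_pos
  have h1 := h.hD
  have : 0 < 2 ^ Nat.log 2 (D / d) * d := by positivity
  omega

theorem gridSize_pos : 0 < gridSize d := by
  have := h.d_pos
  unfold gridSize
  positivity

/-- With w > 1 and K = d³, the condition 6dw ≤ K forces d² > 6. -/
theorem three_le : 3 ≤ d := by
  by_contra hlt
  have h1 := h.le_gridSize
  have h2 := h.one_lt
  have h3 := h.d_pos
  have h4 : d = 1 ∨ d = 2 := by omega
  rcases h4 with rfl | rfl
  all_goals norm_num [gridSize] at h1; linarith

theorem exists_cover : ∃ u N, IsCover d w u N ∧ ∀ ω, Sampled D d (2 ^ Nat.log 2 (D / d)) w u N ω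
    (samplerCmd.run (startStore n D d w ω)) :=
  exists_sampled n w h.d_pos (by positivity) h.hD

omit h in
/-- The scheme that the sampler computes. -/
noncomputable def scheme (h : Valid D d w) (n : ℕ) : Scheme D where
  S := D * D
  r := Nat.log 2 (D / d)
  d := d
  K := gridSize d
  N := (h.exists_cover n).choose_spec.choose
  u := (h.exists_cover n).choose
  w := w
  ε := 1 / rootCount d
  hD := h.hD
  d_pos := h.d_pos
  K_pos := h.gridSize_pos
  S_pos := Nat.mul_pos h.D_pos h.D_pos
  w_pos := one_pos.trans h.one_lt
  ε_pos := one_div_pos.2 (by exact_mod_cast rootCount_pos h.d_pos)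
  u_lt := (h.exists_cover n).choose_spec.choose_spec.1.greedy.lt
  u_inj := fun i hi j hj hij => (h.exists_cover n).choose_spec.choose_spec.1.greedy.injOn
    (by simpa using hi) (by simpa using hj) hij

theorem isCover : IsCover d w (h.scheme n).u (h.scheme n).N :=
  (h.exists_cover n).choose_spec.choose_spec.1

theorem sampled (ω : Tape) : Sampled D d (2 ^ Nat.log 2 (D / d)) w (h.scheme n).u (h.scheme n).N ω
    (samplerCmd.run (startStore n D d w ω)) :=
  (h.exists_cover n).choose_spec.choose_spec.2 ω

theorem N_le : (h.scheme n).N ≤ gridCard d := (h.isCover n).greedy.le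

omit h in
theorem exec_sampler (ω : Tape) : ∃ s, Exec (samplerCmd.code 0) (sampleStart n D d w ω)
    (samplerCmd.cost (startStore n D d w ω)) s ∧
    Rep (samplerCmd.run (startStore n D d w ω)) s := by
  obtain ⟨s, h1, h2, -⟩ := samplerCmd.exec_code 0 _ _ (rep_startStore n D d w ω)
  exact ⟨s, h1, h2⟩

/-- A bound for all loops. -/
theorem bounds : ∃ B : ℕ, 2 * D ≤ B ∧ d ≤ B ∧ 2 ^ Nat.log 2 (D / d) ≤ B ∧
    gridCard d * gridCard d ≤ B ∧ decompCount D (2 ^ Nat.log 2 (D / d)) * D ≤ B ∧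
    ((B : ℝ) + 1) ≤ 3 * ((D : ℝ) ^ (D / d) * (d : ℝ) ^ d) ^ 6 := by
  rw [h.pow_log]
  have hD := h.D_pos
  have hd := h.d_pos
  set k := D / d with hk
  have hk1 : 1 ≤ k := by
    rw [hk, ← h.pow_log]; exact Nat.one_le_two_pow
  set X := D ^ k * d ^ d with hX
  have p1 : 1 ≤ D ^ k := Nat.one_le_pow _ _ hD
  have p2 : 1 ≤ d ^ d := Nat.one_le_pow _ _ hd
  have hX1 : 1 ≤ X := Nat.mul_le_mul p1 p2
  have x1 : D ^ k ≤ X := Nat.le_mul_of_pos_right _ p2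
  have x2 : d ^ d ≤ X := Nat.le_mul_of_pos_left _ p1
  have e1 : D ≤ X := (Nat.le_self_pow (by omega) D).trans x1
  have e2 : X ≤ X ^ 6 := Nat.le_self_pow (by norm_num) X
  have e3 : X ^ 2 ≤ X ^ 6 := Nat.pow_le_pow_right hX1 (by norm_num)
  have hkD : k ≤ D := Nat.div_le_self _ _
  have hdD : d ≤ D := by
    have h1 := h.hD
    rw [h.pow_log] at h1
    calc d ≤ k * d := Nat.le_mul_of_pos_left _ hk1
      _ = D := h1
  refine ⟨2 * X ^ 6, by omega, by omega, by omega, ?_, ?_, ?_⟩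
  -- The grid has (d³)^d points, so the tables of pairs have size d^(6d).
  · have : gridCard d * gridCard d = (d ^ d) ^ 6 := by
      rw [gridCard, gridSize, ← pow_mul]; ring
    rw [this]
    have : (d ^ d) ^ 6 ≤ X ^ 6 := Nat.pow_le_pow_left x2 6
    omega
  · have : decompCount D k * D ≤ (D ^ k) ^ 2 := by
      rw [decompCount, ← pow_two, ← pow_mul, ← pow_succ, ← pow_mul]
      exact Nat.pow_le_pow_right hD (by omega)
    have : (D ^ k) ^ 2 ≤ X ^ 2 := Nat.pow_le_pow_left x1 2
    omega
  · have h1 : (1 : ℝ) ≤ ((D : ℝ) ^ k * (d : ℝ) ^ d) ^ 6 := by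
      have : 1 ≤ X ^ 6 := Nat.one_le_pow _ _ hX1
      have : (1 : ℝ) ≤ (X ^ 6 : ℕ) := by exact_mod_cast this
      rw [hX] at this
      push_cast at this
      exact this
    rw [hX]
    push_cast
    linarith

theorem one_le_pow : (1 : ℝ) ≤ (D : ℝ) ^ (D / d) * (d : ℝ) ^ d := by
  have h1 : (1 : ℝ) ≤ D := by exact_mod_cast h.D_pos
  have h2 : (1 : ℝ) ≤ d := by exact_mod_cast h.d_pos
  exact one_le_mul_of_one_le_of_one_le (one_le_pow₀ h1) (one_le_pow₀ h2)

omit h in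
/-- The constant in the bounds for the running times. -/
noncomputable def timeConst : ℝ := 27 * samplerCmd.size + 81 * (findBalls.size + 104)

omit h in
theorem le_timeConst : (43 : ℝ) ≤ timeConst := by
  unfold timeConst
  have := Nat.cast_nonneg (α := ℝ) samplerCmd.size
  have := Nat.cast_nonneg (α := ℝ) findBalls.size
  linarith

theorem expectedTime_sampler_le : expectedTime (samplerCmd.code 0) (sampleStart n D d w) ≤
    ENNReal.ofReal (timeConst * ((D : ℝ) ^ (D / d) * (d : ℝ) ^ d) ^ 24) := by
  obtain ⟨B, b1, b2, b3, b4, b5, hB⟩ := h.bounds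
  set X : ℝ := (D : ℝ) ^ (D / d) * (d : ℝ) ^ d with hX
  have hX1 : 1 ≤ X := h.one_le_pow
  have key : ∀ ω, runTime (samplerCmd.code 0) (sampleStart n D d w ω) ≤
      ENNReal.ofReal (timeConst * X ^ 24) := fun ω => by
    obtain ⟨s, h1, -⟩ := exec_sampler n ω
    refine (runTime_le h1).trans ?_
    rw [← ENNReal.ofReal_natCast]
    refine ENNReal.ofReal_le_ofReal ?_
    have h2 := cost_samplerCmd_le n w h.d_pos (by positivity) h.hD b2 b3 b4 b5 ω
    have h3 : (samplerCmd.cost (startStore n D d w ω) : ℝ) ≤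
        samplerCmd.size * ((B : ℝ) + 1) ^ 3 := by exact_mod_cast h2
    have h4 : ((B : ℝ) + 1) ^ 3 ≤ 27 * X ^ 24 := by
      calc ((B : ℝ) + 1) ^ 3 ≤ (3 * X ^ 6) ^ 3 := by gcongr
        _ = 27 * X ^ 18 := by ring
        _ ≤ 27 * X ^ 24 := by
          gcongr
          norm_num
    have h5 := Nat.cast_nonneg (α := ℝ) samplerCmd.size
    have h6 := Nat.cast_nonneg (α := ℝ) findBalls.size
    have h7 : 0 ≤ X ^ 24 := by positivity
    unfold timeConst
    nlinarith [mul_nonneg h6 h7, mul_le_mul_of_nonneg_left h4 h5]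
  calc expectedTime (samplerCmd.code 0) (sampleStart n D d w)
      ≤ ∫⁻ _, ENNReal.ofReal (timeConst * X ^ 24) ∂coinMeasure := lintegral_mono key
    _ = _ := by
      rw [lintegral_const]
      simp [coinMeasure]

/-- The decoder inherits the memory of the sampler and gets a new input, an empty output and fresh
coins. What temporaries and counters contain does not matter, as `Rep` ignores them. -/
theorem ready {ω : Tape} {s : State} (hr : Rep (samplerCmd.run (startStore n D d w ω)) s)
    (x : E D) (ω' : Tape) : ∃ H : Store, Rep H (decodeStart s.mem x ω') ∧ H.out = [] ∧
      Ready (h.scheme n) ω x H := by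
  have hs := h.sampled n ω
  set G := samplerCmd.run (startStore n D d w ω) with hG
  refine ⟨{ G with inp := (decodeStart s.mem x ω').inp, out := [], coins := ω' },
    ⟨hr.var, hr.arr, rfl, rfl, rfl⟩, rfl, ?_⟩
  exact {
    v1 := hs.params.v1
    v2 := hs.params.v2
    v3 := hs.params.v3
    v4 := hs.params.v4
    v5 := hs.params.v5
    v6 := hs.params.v6
    v8 := hs.params.v8
    v9 := hs.params.v9
    v10 := congrArg (1 / ·) hs.params.v10
    v14 := hs.var
    v15 := hs.params.v15
    a2 := hs.cover
    a3 := hs.coins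
    inp := fun j => rfl }

theorem decodes {ω : Tape} {s : State} (hr : Rep (samplerCmd.run (startStore n D d w ω)) s)
    (hf : Function.Injective ((h.scheme n).filt ω)) (hn : Function.Injective ((h.scheme n).name ω)) :
    Decodes (decoderCmd.code 0) s.mem ((h.scheme n).fam ω) timeConst
      (((D : ℝ) ^ (D / d) * (d : ℝ) ^ d) ^ 24) := by
  obtain ⟨B, b1, b2, b3, b4, b5, hB⟩ := h.bounds
  obtain ⟨name, hname, key⟩ := (h.scheme n).exists_name hf hn
  have run : ∀ (x : E D) (ω' : Tape), ∃ (t : ℕ) (s' : State),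
      Exec (decoderCmd.code 0) (decodeStart s.mem x ω') t s' ∧
      (s'.out.Nodup ∧ {a | a ∈ s'.out} = name '' ((h.scheme n).fam ω).at x) ∧
      (((h.scheme n).fam ω).at x).encard = (s'.out.length : ℝ≥0∞) ∧
      t ≤ (findBalls.size + 104) * (B + 1) ^ 4 + 43 * s'.out.length := by
    intro x ω'
    obtain ⟨H, hH, ho, hR⟩ := h.ready n hr x ω'
    obtain ⟨s', h1, h2, -⟩ := decoderCmd.exec_code 0 _ _ hH
    have hG : 1 ≤ gridCard d := Nat.one_le_pow _ _ h.gridSize_pos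
    obtain ⟨⟨k1, k2⟩, k3⟩ := decoderCmd_run hR ho b1 b3
      ((h.N_le n).trans ((Nat.le_mul_of_pos_left _ hG).trans b4))
      ((Nat.le_mul_of_pos_right _ h.D_pos).trans b5)
    rw [← h2.out] at k1 k2 k3
    obtain ⟨k4, k5⟩ := key x s'.out k1 (Set.ext k2)
    exact ⟨_, s', h1, k4, k5, k3⟩
  refine ⟨name, hname, fun x => ⟨fun ω' t s' he => ?_, ?_⟩⟩
  · obtain ⟨t₁, s₁, h1, h2, -⟩ := run x ω'
    obtain ⟨-, rfl⟩ := h1.det he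
    exact h2
  · set X : ℝ := (D : ℝ) ^ (D / d) * (d : ℝ) ^ d with hX
    have hX1 : 1 ≤ X := h.one_le_pow
    set e : ℝ≥0∞ := ((((h.scheme n).fam ω).at x).encard : ℝ≥0∞) with he
    have hC := le_timeConst
    have bound : ∀ ω', runTime (decoderCmd.code 0) (decodeStart s.mem x ω') ≤
        ENNReal.ofReal timeConst * (ENNReal.ofReal (X ^ 24) + e) := fun ω' => by
      obtain ⟨t, s', h1, -, h3, h4⟩ := run x ω'
      refine (runTime_le h1).trans ?_
      rw [he, h3, ← ENNReal.ofReal_natCast s'.out.length,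
        ← ENNReal.ofReal_add (by positivity) (by positivity),
        ← ENNReal.ofReal_mul (by linarith), ← ENNReal.ofReal_natCast]
      refine ENNReal.ofReal_le_ofReal ?_
      have h5 : (t : ℝ) ≤ (findBalls.size + 104) * ((B : ℝ) + 1) ^ 4 + 43 * s'.out.length := by
        exact_mod_cast h4
      -- The loops of the decoder are nested four deep and `B + 1 ≤ 3 * X ^ 6`; this is the source
      -- of the exponent 24.
      have h6 : ((B : ℝ) + 1) ^ 4 ≤ 81 * X ^ 24 := by
        calc ((B : ℝ) + 1) ^ 4 ≤ (3 * X ^ 6) ^ 4 := by gcongr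
          _ = 81 * X ^ 24 := by ring
      have h7 := Nat.cast_nonneg (α := ℝ) s'.out.length
      have h8 := Nat.cast_nonneg (α := ℝ) findBalls.size
      have h9 := Nat.cast_nonneg (α := ℝ) samplerCmd.size
      have h10 : 0 ≤ X ^ 24 := by positivity
      rw [mul_add]
      refine h5.trans (add_le_add ?_ (mul_le_mul_of_nonneg_right hC h7))
      calc (findBalls.size + 104 : ℝ) * ((B : ℝ) + 1) ^ 4
          ≤ (findBalls.size + 104) * (81 * X ^ 24) := by gcongr
        _ = 81 * (findBalls.size + 104) * X ^ 24 := by ring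
        _ ≤ timeConst * X ^ 24 := by
          unfold timeConst
          gcongr
          linarith
    calc expectedTime (decoderCmd.code 0) (decodeStart s.mem x)
        ≤ ∫⁻ _, ENNReal.ofReal timeConst * (ENNReal.ofReal (X ^ 24) + e) ∂coinMeasure :=
          lintegral_mono bound
      _ = _ := by
        rw [lintegral_const]
        simp [coinMeasure]

/-- Every near pair has some common cover (`exists_cover_of_near`). If the greedy choice had left
the pair open, that cover would still have a positive gain. -/
theorem nonempty (ω : Tape) {x y : E D} (hxy : dist x y ≤ 1) :
    (((h.scheme n).fam ω).at x ∩ ((h.scheme n).fam ω).at y).Nonempty := by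
  refine (h.scheme n).nonempty_common_filter ?_ h.one_lt ?_ ?_ ω hxy
  · exact_mod_cast h.lt_eps
  · have := h.three_le
    change 3 * d ≤ d * d * d
    nlinarith
  · intro a ha b hb hab
    obtain ⟨u, hu, hua, hub⟩ := exists_cover_of_near h.gridSize_pos h.d_pos h.one_lt
      h.le_gridSize h.ratio_pos hab
    by_contra hcon
    push Not at hcon
    have h0 := (h.isCover n).gain u hu
    refine absurd (gain_pos_iff.2 ⟨(a, b), ?_, hua, hub⟩) (by rw [h0]; exact lt_irrefl 0)
    exact mem_uncov.2 ⟨⟨ha, hb⟩, hab, fun j hj hc => hcon j hj hc.1 hc.2⟩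

theorem M_le : ((h.scheme n).M : ℝ) ≤ ((D : ℝ) ^ (D / d)) ^ 2 := by
  have h1 : (1 : ℝ) ≤ D := by exact_mod_cast h.D_pos
  have e : (h.scheme n).M = (D * D) ^ (2 ^ Nat.log 2 (D / d) - 1) := rfl
  rw [e, h.pow_log]
  push_cast
  rw [← pow_two, ← pow_mul, ← pow_mul]
  exact pow_le_pow_right₀ h1 (by omega)

theorem lintegral_shared_le {t : ℝ} (ht : 0 ≤ t) {x y : E D} (hxy : t ≤ dist x y) :
    ∫⁻ ω, shared ((h.scheme n).fam ω) x y ∂coinMeasure ≤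
      ENNReal.ofReal (((D : ℝ) ^ (D / d)) ^ 8 * Real.exp (-(D / 2 *
        (((t / (1 + 1 / (rootCount d : ℝ))) ^ 2 - 4 * w ^ 2 * (1 - ratioSq (gridSize d) d w)) /
          ratioSq (gridSize d) d w / (4 * w ^ 2))))) := by
  have hK : (1 : ℝ) ≤ gridSize d := by exact_mod_cast h.gridSize_pos
  have hlog : 0 ≤ Real.log (gridSize d) := Real.log_nonneg hK
  refine ((h.scheme n).lintegral_shared_le_exp (q := ratioSq (gridSize d) d w)
    (A := 2 * (1 + 2 * (d * Real.log (gridSize d)))) h.ratio_pos (by positivity)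
    (greedy_card_mul_le h.gridSize_pos h.d_pos h.one_lt h.le_gridSize h.ratio_pos
      (h.isCover n).greedy) ht hxy).trans ?_
  refine ENNReal.ofReal_le_ofReal (mul_le_mul_of_nonneg_right ?_ (Real.exp_pos _).le)
  have hd3 : (3 : ℝ) ≤ d := by exact_mod_cast h.three_le
  have hdD : (d : ℝ) ≤ D := by
    have h1 := h.hD
    have : d ≤ 2 ^ Nat.log 2 (D / d) * d := Nat.le_mul_of_pos_left _ (by positivity)
    exact_mod_cast this.trans_eq h1
  have hlog2 : Real.log (gridSize d) ≤ 3 * d := by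
    have e : ((gridSize d : ℕ) : ℝ) = (d : ℝ) ^ 3 := by
      unfold gridSize; push_cast; ring
    rw [e, Real.log_pow]
    have := Real.log_le_self (show (0 : ℝ) ≤ d by linarith)
    push_cast
    linarith
  -- The logarithmic loss of the greedy cover is at most D⁶ per piece, as d ≥ 3. With M ≤ D^(2k)
  -- this gives the power 8 in the statement.
  have hA : 2 * (1 + 2 * (d * Real.log (gridSize d))) ≤ (D : ℝ) ^ 6 := by
    calc 2 * (1 + 2 * (d * Real.log (gridSize d))) ≤ 2 * (1 + 2 * (d * (3 * d))) := by gcongr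
      _ ≤ (d : ℝ) ^ 2 * 3 ^ 4 := by nlinarith
      _ ≤ (d : ℝ) ^ 2 * (d : ℝ) ^ 4 := by gcongr
      _ = (d : ℝ) ^ 6 := by ring
      _ ≤ _ := by gcongr
  have hk : (h.scheme n).k = D / d := h.pow_log
  calc ((h.scheme n).M : ℝ) * (2 * (1 + 2 * (d * Real.log (gridSize d)))) ^ (h.scheme n).k
      ≤ ((D : ℝ) ^ (D / d)) ^ 2 * ((D : ℝ) ^ 6) ^ (D / d) := by
        rw [hk]
        gcongr
        exact h.M_le n
    _ = _ := by ring

omit h in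
-- The number of pieces is D / d in the theorem and a power of two in the scheme. These agree, but
-- not by definition, and the types depend on them; a variable `k` removes the need for casts.
theorem _root_.FilterLSF.Scheme.fam_eq {D : ℕ} (s : Scheme D) (ω : Tape) {k : ℕ} (hk : k = s.k) :
    s.fam ω = rescale (1 + s.ε) (⋃ m : Fin s.M, tensor (decomp s.S k s.d D m)
      (fun i : Fin k => ballLattices s.w (fun j : Fin s.N => s.offset ω m i j))) := by
  subst hk
  rfl

end Valid

end FilterLSF

/-! ### The shape of the family, and the asymptotics of its parameters -/

namespace FilterLSF
open RealRAM

namespace Valid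

variable {D d : ℕ} {w : ℝ}

theorem isSplitting (h : Valid D d w) :
    IsSplitting (fun m : Fin ((D * D) ^ (D / d - 1)) => decomp (D * D) (D / d) d D m)
      (1 / (rootCount d : ℝ)) := by
  have := isSplitting_decomp (S := D * D) (r := Nat.log 2 (D / d)) (Nat.mul_pos h.D_pos h.D_pos)
    h.d_pos h.hD h.lt_eps
  rwa [h.pow_log] at this

theorem fam_shape (h : Valid D d w) (n : ℕ) {N : ℕ} (hN : N = (h.scheme n).N) (ω : Tape) :
    ∃ v : Fin ((D * D) ^ (D / d - 1)) → Fin (D / d) → Fin N → E d,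
      (∀ m i j l, v m i j l ∈ Set.Icc 0 (3 * w)) ∧
      (h.scheme n).fam ω = rescale (1 + 1 / (rootCount d : ℝ))
        (⋃ m : Fin ((D * D) ^ (D / d - 1)), tensor (decomp (D * D) (D / d) d D m)
          (fun i => ballLattices w (v m i))) := by
  subst hN
  refine ⟨fun m i j => (h.scheme n).offset ω m i j, fun m i j l =>
    (h.scheme n).offset_mem ω m i j l, ?_⟩
  rw [(h.scheme n).fam_eq ω h.pow_log.symm]
  have hM : (h.scheme n).M = (D * D) ^ (D / d - 1) := by
    rw [← h.pow_log]; rfl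
  congr 1
  ext A
  simp only [Set.mem_iUnion]
  constructor
  · rintro ⟨m, hm⟩
    exact ⟨Fin.cast hM m, hm⟩
  · rintro ⟨m, hm⟩
    exact ⟨Fin.cast hM.symm m, hm⟩

end Valid

/-! ### Asymptotics -/

theorem tendsto_log_natCast_atTop : Tendsto (fun n : ℕ => Real.log n) atTop atTop :=
  Real.tendsto_log_atTop.comp tendsto_natCast_atTop_atTop

theorem isLittleO_log_rpow {a b : ℝ} (hab : a < b) :
    (fun n : ℕ => Real.log n ^ a) =o[atTop] fun n : ℕ => Real.log n ^ b := by
  have h1 : ∀ᶠ n : ℕ in atTop, 0 < Real.log n := tendsto_log_natCast_atTop.eventually_gt_atTop 0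
  rw [isLittleO_iff_tendsto']
  · have h2 := (tendsto_rpow_neg_atTop (sub_pos.2 hab)).comp tendsto_log_natCast_atTop
    refine h2.congr' ?_
    filter_upwards [h1] with n hn
    rw [Function.comp_apply, neg_sub, Real.rpow_sub hn]
  · filter_upwards [h1] with n hn h0
    exact absurd h0 (Real.rpow_pos_of_pos hn b).ne'

theorem isTheta_log_rpow_mul {f g : ℕ → ℝ} {a b : ℝ}
    (hf : f =Θ[atTop] fun n : ℕ => Real.log n ^ a) (hg : g =Θ[atTop] fun n : ℕ => Real.log n ^ b) :
    (fun n => f n * g n) =Θ[atTop] fun n : ℕ => Real.log n ^ (a + b) := by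
  refine (hf.mul hg).trans_eventuallyEq ?_
  filter_upwards [tendsto_log_natCast_atTop.eventually_gt_atTop 0] with n hn
  rw [Real.rpow_add hn]

theorem isLittleO_of_isTheta {f g : ℕ → ℝ} {a b : ℝ}
    (hf : f =Θ[atTop] fun n : ℕ => Real.log n ^ a) (hg : g =Θ[atTop] fun n : ℕ => Real.log n ^ b)
    (hab : a < b) : f =o[atTop] g :=
  hf.trans_isLittleO ((isLittleO_log_rpow hab).trans_isTheta hg.symm)

theorem tendsto_atTop_of_isTheta {f : ℕ → ℝ} {a : ℝ} (h0 : ∀ n, 0 ≤ f n)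
    (hf : f =Θ[atTop] fun n : ℕ => Real.log n ^ a) (ha : 0 < a) : Tendsto f atTop atTop := by
  have h1 : Tendsto (norm ∘ fun n : ℕ => Real.log n ^ a) atTop atTop :=
    tendsto_norm_atTop_atTop.comp ((tendsto_rpow_atTop ha).comp tendsto_log_natCast_atTop)
  refine (hf.tendsto_norm_atTop_iff.2 h1).congr fun n => ?_
  rw [Function.comp_apply, Real.norm_of_nonneg (h0 n)]

/-- The numbers counted are 0, …, ⌊√(d - 1)⌋, so `rootCount d` is √d rounded up. It supplies ε of
order d^(-1/2) without a root instruction. -/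
theorem rootCount_eq (d : ℕ) (hd : 0 < d) :
    (rootCount d - 1) * (rootCount d - 1) < d ∧ d ≤ rootCount d * rootCount d := by
  have h : (Finset.range d).filter (fun i => i * i < d) = Finset.range (Nat.sqrt (d - 1) + 1) := by
    ext i
    simp only [Finset.mem_filter, Finset.mem_range, Nat.lt_succ_iff, Nat.le_sqrt]
    constructor
    · rintro ⟨-, h⟩; omega
    · intro h
      have := Nat.le_mul_self i
      omega
  rw [rootCount, h, Finset.card_range]
  have h1 := Nat.sqrt_le (d - 1)
  have h2 := Nat.lt_succ_sqrt (d - 1)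
  simp only [Nat.succ_eq_add_one] at h2
  rw [Nat.add_sub_cancel]
  omega

theorem sqrt_le_rootCount {d : ℕ} (hd : 0 < d) : √(d : ℝ) ≤ rootCount d := by
  refine Real.sqrt_le_iff.2 ⟨by positivity, ?_⟩
  rw [pow_two]
  exact_mod_cast (rootCount_eq d hd).2

theorem rootCount_le {d : ℕ} (hd : 0 < d) : (rootCount d : ℝ) ≤ √(d : ℝ) + 1 := by
  have h1 := (rootCount_eq d hd).1
  have h2 : ((rootCount d - 1 : ℕ) : ℝ) ≤ √(d : ℝ) := by
    refine Real.le_sqrt_of_sq_le ?_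
    rw [pow_two]
    exact_mod_cast h1.le
  rw [Nat.cast_sub (rootCount_pos hd)] at h2
  push_cast at h2
  linarith

theorem isTheta_eps {dC : ℕ → ℕ} {γ : ℝ} (hd : ∀ n, 0 < dC n)
    (hC : (fun n => (dC n : ℝ)) =Θ[atTop] fun n : ℕ => Real.log n ^ γ) :
    (fun n => 1 / (rootCount (dC n) : ℝ)) =Θ[atTop] fun n : ℕ => Real.log n ^ (-γ / 2) := by
  have hlog := tendsto_log_natCast_atTop.eventually_gt_atTop 0
  have h1 : (fun n => √(dC n : ℝ)) =Θ[atTop] fun n : ℕ => Real.log n ^ (γ / 2) := by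
    have e : (fun n : ℕ => √(Real.log n ^ γ)) =ᶠ[atTop] fun n : ℕ => Real.log n ^ (γ / 2) := by
      filter_upwards [hlog] with n hn
      rw [Real.sqrt_eq_rpow, ← Real.rpow_mul hn.le]
      congr 1
      ring
    refine IsTheta.trans_eventuallyEq ⟨hC.1.sqrt ?_, hC.2.sqrt ?_⟩ e
    · filter_upwards [hlog] with n hn using (Real.rpow_pos_of_pos hn γ).le
    · exact Eventually.of_forall fun n => Nat.cast_nonneg _
  have h2 : (fun n => (rootCount (dC n) : ℝ)) =Θ[atTop] fun n => √(dC n : ℝ) := by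
    constructor
    · refine IsBigO.of_bound 2 (Eventually.of_forall fun n => ?_)
      rw [Real.norm_of_nonneg (by positivity), Real.norm_of_nonneg (by positivity)]
      have := rootCount_le (hd n)
      have : (1 : ℝ) ≤ √(dC n : ℝ) := Real.one_le_sqrt.2 (by exact_mod_cast hd n)
      linarith
    · refine IsBigO.of_bound 1 (Eventually.of_forall fun n => ?_)
      rw [Real.norm_of_nonneg (by positivity), Real.norm_of_nonneg (by positivity), one_mul]
      exact sqrt_le_rootCount (hd n)
  simp only [one_div]
  refine (h2.trans h1).inv.trans_eventuallyEq ?_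
  filter_upwards [hlog] with n hn
  rw [← Real.rpow_neg hn.le]
  congr 1
  ring

/-- As K = d³, the rounding terms 6d/K are 6/d². In 4w²(1 - q) the term (1/w)²/4 of `ratioSq`
contributes exactly 1, the Chebyshev slack contributes 16w/√d, and the rest involves powers of w/d
and 1/d. The limit 1 becomes the 1 in t² - 1. -/
theorem tendsto_ratioSq {dC : ℕ → ℕ} {w : ℕ → ℝ} (hd : ∀ n, 0 < dC n) (hw0 : ∀ n, 0 < w n)
    (h1 : Tendsto (fun n => (dC n : ℝ)) atTop atTop) (h2 : Tendsto w atTop atTop)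
    (h3 : Tendsto (fun n => w n / √(dC n)) atTop (𝓝 0)) :
    Tendsto (fun n => ratioSq (gridSize (dC n)) (dC n) (w n)) atTop (𝓝 1) ∧
    Tendsto (fun n => 4 * w n ^ 2 * (1 - ratioSq (gridSize (dC n)) (dC n) (w n))) atTop (𝓝 1) := by
  have hi : Tendsto (fun n => (dC n : ℝ)⁻¹) atTop (𝓝 0) := h1.inv_tendsto_atTop
  have hv : Tendsto (fun n => (w n)⁻¹) atTop (𝓝 0) := h2.inv_tendsto_atTop
  have hr : Tendsto (fun n => w n / (dC n : ℝ)) atTop (𝓝 0) := by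
    refine squeeze_zero (fun n => div_nonneg (hw0 n).le (by positivity)) (fun n => ?_) h3
    have h1 : (1 : ℝ) ≤ dC n := by exact_mod_cast hd n
    have h2 : (0 : ℝ) < √(dC n : ℝ) := Real.sqrt_pos.2 (by linarith)
    refine div_le_div_of_nonneg_left (hw0 n).le h2 ?_
    rw [Real.sqrt_le_left (by linarith)]
    nlinarith
  have ha : ∀ n, 6 * (dC n : ℝ) / (gridSize (dC n) : ℕ) = 6 * (dC n : ℝ)⁻¹ ^ 2 := fun n => by
    have : (dC n : ℝ) ≠ 0 := by exact_mod_cast (hd n).ne'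
    unfold gridSize
    push_cast
    field_simp
  have hs : ∀ n, (√(dC n : ℝ)) ≠ 0 := fun n =>
    (Real.sqrt_pos.2 (by exact_mod_cast hd n)).ne'
  have hq : ∀ n, ratioSq (gridSize (dC n)) (dC n) (w n) = (1 - 6 * (dC n : ℝ)⁻¹ ^ 2) ^ 2 -
      ((w n)⁻¹ + 6 * (dC n : ℝ)⁻¹ ^ 2) ^ 2 / 4 - 4 * (w n / √(dC n)) * (w n)⁻¹ ^ 2 := fun n => by
    rw [ratioSq, ha, one_div]
    have := (hw0 n).ne'
    have := hs n
    congr 1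
    field_simp
  constructor
  · simp only [hq]
    have := ((((hi.pow 2).const_mul 6).const_sub 1).pow 2).sub
      (((hv.add ((hi.pow 2).const_mul 6)).pow 2).div_const 4) |>.sub
      ((h3.const_mul 4).mul (hv.pow 2))
    simpa using this
  · have e : ∀ n, 4 * w n ^ 2 * (1 - ratioSq (gridSize (dC n)) (dC n) (w n)) =
        48 * (w n / dC n) ^ 2 - 4 * (6 * (w n / dC n) * (dC n : ℝ)⁻¹) ^ 2 +
        (1 + 6 * (w n / dC n) * (dC n : ℝ)⁻¹) ^ 2 + 16 * (w n / √(dC n)) := fun n => by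
      rw [hq]
      have := (hw0 n).ne'
      have : (dC n : ℝ) ≠ 0 := by exact_mod_cast (hd n).ne'
      generalize w n / √(dC n : ℝ) = τ
      field_simp
      ring
    simp only [e]
    have hrs := (hr.const_mul 6).mul hi
    have := ((((hr.pow 2).const_mul 48).sub ((hrs.pow 2).const_mul 4)).add
      ((hrs.const_add 1).pow 2)).add (h3.const_mul 16)
    simpa using this

theorem tendsto_error {e q θ : ℕ → ℝ} (he : Tendsto e atTop (𝓝 0)) (hq : Tendsto q atTop (𝓝 1))
    (hθ : Tendsto θ atTop (𝓝 1)) (t : ℝ) :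
    Tendsto (fun n => t ^ 2 - 1 - ((t / (1 + e n)) ^ 2 - θ n) / q n) atTop (𝓝 0) := by
  have h1 : Tendsto (fun n => t / (1 + e n)) atTop (𝓝 t) := by
    have := (tendsto_const_nhds (x := t) (f := (atTop : Filter ℕ))).div (he.const_add 1) (by simp)
    rw [add_zero, div_one] at this
    exact this
  have := (((h1.pow 2).sub hθ).div hq one_ne_zero).const_sub (t ^ 2 - 1)
  simpa using this

theorem eventually_valid {β γ : ℝ} (hβ : 0 < β) (hβγ : β < γ) (hγ : γ < 1)
    {dC dB : ℕ → ℕ} {w : ℕ → ℝ}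
    (hC2 : ∀ n, ∃ k : ℕ, dC n = 2 ^ k) (hB2 : ∀ n, ∃ k : ℕ, dB n = 2 ^ k)
    (hC : (fun n => (dC n : ℝ)) =Θ[atTop] fun n : ℕ => Real.log n ^ γ)
    (hB : (fun n => (dB n : ℝ)) =Θ[atTop] fun n : ℕ => Real.log n ^ (1 + β))
    (hw0 : ∀ n, 0 < w n) (hw : w =Θ[atTop] fun n : ℕ => Real.log n ^ (β / 2))
    (hq : Tendsto (fun n => ratioSq (gridSize (dC n)) (dC n) (w n)) atTop (𝓝 1)) :
    ∀ᶠ n in atTop, Valid (dB n) (dC n) (w n) := by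
  have hd : ∀ n, 0 < dC n := fun n => by
    obtain ⟨k, hk⟩ := hC2 n
    rw [hk]; positivity
  have w1 := (tendsto_atTop_of_isTheta (fun n => (hw0 n).le) hw (by linarith)).eventually_gt_atTop 1
  have wd := (isLittleO_of_isTheta hw hC (by linarith)).bound one_pos
  have d6 := (tendsto_atTop_of_isTheta (fun n => Nat.cast_nonneg _) hC
    (by linarith)).eventually_ge_atTop 6
  -- With 65 in place of 64 the inequality `64 * dC n < dB n` is strict. It implies `lt_eps`, since
  -- `rootCount d ≤ d` and k ≤ D.
  have dB' := (isLittleO_of_isTheta hC hB (by linarith)).bound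
    (show (0 : ℝ) < 1 / 65 by norm_num)
  filter_upwards [w1, wd, d6, dB', hq.eventually (eventually_gt_nhds one_pos)] with n w1 wd d6 dB' hq
  rw [Real.norm_of_nonneg (by positivity), Real.norm_of_nonneg (by positivity)] at dB'
  rw [Real.norm_of_nonneg (hw0 n).le, Real.norm_of_nonneg (by positivity), one_mul] at wd
  have hlt : 64 * dC n < dB n := by
    have h1 : (0 : ℝ) < dC n := by exact_mod_cast hd n
    have : (64 * dC n : ℝ) < dB n := by linarith
    exact_mod_cast this
  have hpow : 2 ^ Nat.log 2 (dB n / dC n) * dC n = dB n := by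
    obtain ⟨a, ha⟩ := hC2 n
    obtain ⟨b, hb⟩ := hB2 n
    have hab : a ≤ b := by
      refine (Nat.pow_le_pow_iff_right one_lt_two).1 ?_
      rw [← ha, ← hb]; omega
    rw [ha, hb, Nat.pow_div hab two_pos, Nat.log_pow one_lt_two, ← pow_add, Nat.sub_add_cancel hab]
  have hr : (0 : ℝ) < rootCount (dC n) := by exact_mod_cast rootCount_pos (hd n)
  refine ⟨hd n, hpow, w1, ?_, hq, ?_⟩
  · unfold gridSize
    push_cast
    have h1 : (6 : ℝ) * w n ≤ dC n * dC n := mul_le_mul d6 wd (hw0 n).le (by linarith)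
    calc 6 * (dC n : ℝ) * w n = dC n * (6 * w n) := by ring
      _ ≤ dC n * (dC n * dC n) := by gcongr
      _ = _ := by ring
  · have hk : 2 ^ Nat.log 2 (dB n / dC n) ≤ dB n := by
      conv_rhs => rw [← hpow]
      exact Nat.le_mul_of_pos_right _ (hd n)
    have hk' : (2 : ℝ) ^ Nat.log 2 (dB n / dC n) ≤ dB n := by exact_mod_cast hk
    have hrd : rootCount (dC n) ≤ dC n :=
      (Finset.card_filter_le _ _).trans_eq (Finset.card_range _)
    have hrd' : (64 * rootCount (dC n) : ℝ) < dB n := by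
      have : 64 * rootCount (dC n) < dB n := by omega
      exact_mod_cast this
    have hB0 : (0 : ℝ) < dB n := by linarith
    push_cast
    rw [div_lt_div_iff₀ (by positivity) hr]
    calc 64 * (2 : ℝ) ^ Nat.log 2 (dB n / dC n) * rootCount (dC n)
        = 64 * rootCount (dC n) * (2 : ℝ) ^ Nat.log 2 (dB n / dC n) := by ring
      _ ≤ 64 * rootCount (dC n) * dB n := by gcongr
      _ < dB n * dB n := by gcongr
      _ = _ := by ring

end FilterLSF

/-! ### The family for each n, and the main theorem -/

namespace FilterLSF
open RealRAM

open Classical in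
/-- The family for `n`. -/
noncomputable def family (dC dB : ℕ → ℕ) (w : ℕ → ℝ) (n : ℕ) (ω : Tape) :
    FilterFamily (E (dB n)) :=
  if h : Valid (dB n) (dC n) (w n) then (h.scheme n).fam ω else ∅

open Classical in
/-- The number of lattices of balls for `n`. -/
noncomputable def latticeCount (dC dB : ℕ → ℕ) (w : ℕ → ℝ) (n : ℕ) : ℕ :=
  if h : Valid (dB n) (dC n) (w n) then (h.scheme n).N else 0

section

variable {dC dB : ℕ → ℕ} {w : ℕ → ℝ} {n : ℕ} (h : Valid (dB n) (dC n) (w n))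
include h

theorem family_eq (ω : Tape) : family dC dB w n ω = (h.scheme n).fam ω := dif_pos h

theorem lintegral_shared_family_le {t : ℝ} (ht : 0 ≤ t) {x y : E (dB n)} (hxy : t ≤ dist x y) :
    ∫⁻ ω, shared (family dC dB w n ω) x y ∂coinMeasure ≤
      ENNReal.ofReal (Valid.timeConst * ((dB n : ℝ) ^ (dB n / dC n)) ^ 24 *
        Real.exp (-((dB n : ℝ) / 2 *
          (((t / (1 + 1 / (rootCount (dC n) : ℝ))) ^ 2 - 4 * w n ^ 2 *
            (1 - ratioSq (gridSize (dC n)) (dC n) (w n))) /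
              ratioSq (gridSize (dC n)) (dC n) (w n) / (4 * w n ^ 2))))) := by
  simp only [family_eq h]
  refine (h.lintegral_shared_le n ht hxy).trans (ENNReal.ofReal_le_ofReal ?_)
  refine mul_le_mul_of_nonneg_right ?_ (Real.exp_pos _).le
  have h1 : (1 : ℝ) ≤ (dB n : ℝ) ^ (dB n / dC n) := one_le_pow₀ (by exact_mod_cast h.D_pos)
  calc ((dB n : ℝ) ^ (dB n / dC n)) ^ 8 ≤ ((dB n : ℝ) ^ (dB n / dC n)) ^ 24 :=
        pow_le_pow_right₀ h1 (by norm_num)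
    _ ≤ _ := le_mul_of_one_le_left (by positivity) (by linarith [Valid.le_timeConst])

end

end FilterLSF

open RealRAM FilterLSF

theorem mainTheorem5 (β γ : ℝ) (hβ : 0 < β) (hβγ : β < γ) (hγ : γ < 1)
    (dC dB : ℕ → ℕ) (w : ℕ → ℝ)
    (hC2 : ∀ n, ∃ k : ℕ, dC n = 2 ^ k) (hB2 : ∀ n, ∃ k : ℕ, dB n = 2 ^ k)
    (hC : (fun n => (dC n : ℝ)) =Θ[atTop] fun n : ℕ => Real.log n ^ γ)
    (hB : (fun n => (dB n : ℝ)) =Θ[atTop] fun n : ℕ => Real.log n ^ (1 + β))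
    (hw0 : ∀ n, 0 < w n)
    (hw : w =Θ[atTop] fun n : ℕ => Real.log n ^ (β / 2)) :
    ∃ (sampler decoder : Program) (C : ℝ) (c : ℕ)
      (G : (n : ℕ) → Tape → FilterFamily (E (dB n))),
      -- sampling, decoding, and the guarantee for close pairs
      (∀ᶠ n : ℕ in atTop,
        (∀ᵐ ω ∂coinMeasure, ∃ (τ : ℕ) (s : State),
          Exec sampler (sampleStart n (dB n) (dC n) (w n) ω) τ s) ∧
        expectedTime sampler (sampleStart n (dB n) (dC n) (w n)) ≤
          ENNReal.ofReal (C * ((dB n : ℝ) ^ (dB n / dC n) * (dC n : ℝ) ^ dC n) ^ c) ∧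
        (∀ᵐ ω ∂coinMeasure, ∀ (τ : ℕ) (s : State),
          Exec sampler (sampleStart n (dB n) (dC n) (w n) ω) τ s →
          Decodes decoder s.mem (G n ω) C
            (((dB n : ℝ) ^ (dB n / dC n) * (dC n : ℝ) ^ dC n) ^ c)) ∧
        (∀ (ω : Tape) (τ : ℕ) (s : State),
          Exec sampler (sampleStart n (dB n) (dC n) (w n) ω) τ s →
          ∀ x y : E (dB n), dist x y ≤ 1 → ((G n ω).at x ∩ (G n ω).at y).Nonempty) ∧
        (∀ x y : E (dB n), AEMeasurable (fun ω => shared (G n ω) x y) coinMeasure)) ∧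
      -- the expected number of shared filters for distant pairs
      (∀ t : ℝ, 0 ≤ t → ∃ o : ℕ → ℝ, Tendsto o atTop (𝓝 0) ∧
        ∀ᶠ n : ℕ in atTop, ∀ x y : E (dB n), t ≤ dist x y →
          ∫⁻ ω, shared (G n ω) x y ∂coinMeasure ≤
            ENNReal.ofReal (C * ((dB n : ℝ) ^ (dB n / dC n)) ^ c *
              Real.exp (-((dB n : ℝ) / 2 * ((t ^ 2 - 1 - o n) / (4 * w n ^ 2)))))) ∧
      -- the expected number of filters that contain a given point
      (∃ o : ℕ → ℝ, Tendsto o atTop (𝓝 0) ∧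
        ∀ᶠ n : ℕ in atTop, ∀ x : E (dB n),
          ∫⁻ ω, (((G n ω).at x).encard : ℝ≥0∞) ∂coinMeasure ≤
            ENNReal.ofReal (C * ((dB n : ℝ) ^ (dB n / dC n)) ^ c *
              Real.exp ((dB n : ℝ) / 2 * ((1 + o n) / (4 * w n ^ 2))))) ∧
      -- the shape of the family
      (∃ (ε : ℕ → ℝ) (N M : ℕ → ℕ)
        (Q : (n : ℕ) → Fin (M n) → Fin (dB n / dC n) → Matrix (Fin (dC n)) (Fin (dB n)) ℝ),
        (ε =Θ[atTop] fun n : ℕ => Real.log n ^ (-γ / 2)) ∧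
        ∀ᶠ n : ℕ in atTop,
          IsSplitting (Q n) (ε n) ∧
          (M n : ℝ) ≤ C * ((dB n : ℝ) ^ (dB n / dC n)) ^ c ∧
          (N n : ℝ) ≤ C * ((dC n : ℝ) ^ dC n) ^ c ∧
          ∀ (ω : Tape) (τ : ℕ) (s : State),
            Exec sampler (sampleStart n (dB n) (dC n) (w n) ω) τ s →
            ∃ v : Fin (M n) → Fin (dB n / dC n) → Fin (N n) → E (dC n),
              (∀ m i j l, v m i j l ∈ Set.Icc 0 (3 * w n)) ∧
              G n ω = rescale (1 + ε n)
                (⋃ m, tensor (Q n m) (fun i => ballLattices (w n) (v m i)))) := by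
  have hd : ∀ n, 0 < dC n := fun n => by
    obtain ⟨k, hk⟩ := hC2 n
    rw [hk]; positivity
  have hd' : Tendsto (fun n => (dC n : ℝ)) atTop atTop :=
    tendsto_atTop_of_isTheta (fun n => Nat.cast_nonneg _) hC (by linarith)
  have hw' : Tendsto w atTop atTop :=
    tendsto_atTop_of_isTheta (fun n => (hw0 n).le) hw (by linarith)
  -- Here w² = Θ(log^β n) is o(log^γ n).
  have hwd : Tendsto (fun n => w n / √(dC n)) atTop (𝓝 0) := by
    have h1 : (fun n => w n * w n) =Θ[atTop] fun n : ℕ => Real.log n ^ (β / 2 + β / 2) :=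
      isTheta_log_rpow_mul hw hw
    have h2 := (isLittleO_of_isTheta h1 hC (by linarith)).tendsto_div_nhds_zero.sqrt
    rw [Real.sqrt_zero] at h2
    refine h2.congr fun n => ?_
    rw [Real.sqrt_div (mul_self_nonneg _), Real.sqrt_mul_self (hw0 n).le]
  obtain ⟨hq, hθ⟩ := tendsto_ratioSq hd hw0 hd' hw' hwd
  have hvalid := eventually_valid hβ hβγ hγ hC2 hB2 hC hB hw0 hw hq
  have heΘ := isTheta_eps hd hC
  have he : Tendsto (fun n => 1 / (rootCount (dC n) : ℝ)) atTop (𝓝 0) := by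
    refine heΘ.isBigO.trans_tendsto ?_
    have := (tendsto_rpow_neg_atTop (show 0 < γ / 2 by linarith)).comp tendsto_log_natCast_atTop
    simpa only [Function.comp_def, neg_div] using this
  -- The error is defined so that t² - 1 - o is exactly the numerator in
  -- `lintegral_shared_family_le`; it depends on t and n but not on the points.
  set o : ℝ → ℕ → ℝ := fun t n => t ^ 2 - 1 - ((t / (1 + 1 / (rootCount (dC n) : ℝ))) ^ 2 -
    4 * w n ^ 2 * (1 - ratioSq (gridSize (dC n)) (dC n) (w n))) /
      ratioSq (gridSize (dC n)) (dC n) (w n) with ho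
  have ho' : ∀ t, Tendsto (o t) atTop (𝓝 0) := tendsto_error he hq hθ
  have hsh : ∀ t : ℝ, 0 ≤ t → ∀ n, Valid (dB n) (dC n) (w n) → ∀ x y : E (dB n), t ≤ dist x y →
      ∫⁻ ω, shared (family dC dB w n ω) x y ∂coinMeasure ≤
        ENNReal.ofReal (Valid.timeConst * ((dB n : ℝ) ^ (dB n / dC n)) ^ 24 *
          Real.exp (-((dB n : ℝ) / 2 * ((t ^ 2 - 1 - o t n) / (4 * w n ^ 2))))) := by
    intro t ht n h x y hxy
    have := lintegral_shared_family_le h ht hxy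
    rwa [ho, sub_sub_cancel]
  refine ⟨samplerCmd.code 0, decoderCmd.code 0, Valid.timeConst, 24, family dC dB w,
    ?_, fun t ht => ⟨o t, ho' t, ?_⟩, ⟨o 0, ho' 0, ?_⟩, fun n => 1 / (rootCount (dC n) : ℝ),
    latticeCount dC dB w, fun n => (dB n * dB n) ^ (dB n / dC n - 1),
    fun n m => decomp (dB n * dB n) (dB n / dC n) (dC n) (dB n) m, heΘ, ?_⟩
  · filter_upwards [hvalid] with n h
    simp only [family_eq h]
    refine ⟨Eventually.of_forall fun ω => ?_, h.expectedTime_sampler_le n, ?_,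
      fun ω _ _ _ x y => h.nonempty n ω, (h.scheme n).aemeasurable_shared⟩
    · obtain ⟨s, hs, -⟩ := Valid.exec_sampler n ω
      exact ⟨_, s, hs⟩
    · filter_upwards [(h.scheme n).ae_injective_filt, (h.scheme n).ae_injective_name]
        with ω hf hn τ s hs
      obtain ⟨s', hs', hr⟩ := Valid.exec_sampler n ω
      obtain ⟨-, rfl⟩ := hs'.det hs
      exact h.decodes n hr hf hn
  · filter_upwards [hvalid] with n h
    exact hsh t ht n h
  · filter_upwards [hvalid] with n h x
    simp only [Scheme.encard_at_eq_shared]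
    -- A point shares all its filters with itself, and for t = 0 the exponent is D/2 · (1 +
    -- o)/(4w²).
    refine (hsh 0 le_rfl n h x x dist_nonneg).trans_eq ?_
    congr 3
    ring
  · filter_upwards [hvalid] with n h
    have h1 : (1 : ℝ) ≤ (dB n : ℝ) ^ (dB n / dC n) := one_le_pow₀ (by exact_mod_cast h.D_pos)
    have h2 : (1 : ℝ) ≤ (dC n : ℝ) ^ dC n := one_le_pow₀ (by exact_mod_cast h.d_pos)
    have hc : (1 : ℝ) ≤ Valid.timeConst := by linarith [Valid.le_timeConst]
    have hN : latticeCount dC dB w n = (h.scheme n).N := dif_pos h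
    refine ⟨h.isSplitting, ?_, ?_, fun ω _ _ _ => ?_⟩
    · have hM := h.M_le n
      have e : (h.scheme n).M = (dB n * dB n) ^ (dB n / dC n - 1) := by
        rw [← h.pow_log]; rfl
      rw [e] at hM
      calc _ ≤ _ := hM
        _ ≤ ((dB n : ℝ) ^ (dB n / dC n)) ^ 24 := pow_le_pow_right₀ h1 (by norm_num)
        _ ≤ _ := le_mul_of_one_le_left (by positivity) hc
    · have hg : (gridCard (dC n) : ℝ) = ((dC n : ℝ) ^ dC n) ^ 3 := by
        rw [gridCard, gridSize]
        push_cast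
        ring
      calc (latticeCount dC dB w n : ℝ) ≤ gridCard (dC n) := by
            rw [hN]; exact_mod_cast h.N_le n
        _ = ((dC n : ℝ) ^ dC n) ^ 3 := hg
        _ ≤ ((dC n : ℝ) ^ dC n) ^ 24 := pow_le_pow_right₀ h2 (by norm_num)
        _ ≤ _ := le_mul_of_one_le_left (by positivity) hc
    · rw [family_eq h]
      exact h.fam_shape n hN ω
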